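/- **Setting.** Let $q^{1/2}$ be an indeterminate and $\mathbb K=\mathbb Q(q^{1/2})$. Let $U_q(\mathfrak g)$ be the quantized enveloping algebra of type $A_1^{(1)}$ (Cartan matrix $\begin{pmatrix}2&-2\\-2&2\end{pmatrix}$; generators $E_i,F_i,K_i^{\pm1}$, $i=1,2$), with scalars extended to $\mathbb K$, and let $T_1,T_2$ be Lusztig's automorphisms $T'_{i,-1}$. Put $v_0=E_1$, $v_1=T_1(E_2)$, $v_2=T_1T_2(E_1)$, $v_3=T_1T_2T_1(E_2)$, and let $U_q^+(w)$, $w=s_1s_2s_1s_2$, be the $\mathbb K$-subalgebra generated by $v_0,\dots,v_3$. Let $u_i=(1-q^{-2})^{-2i}v_i$ and, for ${\bf a}=(a_3,a_2,a_1,a_0)\in\mathbb N^4$, $u[{\bf a}]=u_3^{a_3}u_2^{a_2}u_1^{a_1}u_0^{a_0}$ and $E[{\bf a}]=q^{\sum_i\binom{a_i}{2}}u[{\bf a}]$. The dual canonical basis element $B[{\bf a}]$ is the unique element such that $B[{\bf a}]-E[{\bf a}]$ is a $q\mathbb Z[q]$-linear combination of elements $E[{\bf b}]$ with ${\bf b}\ne{\bf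 a}$ and ${\bf b}-{\bf a}\in\mathbb N(-1,2,-1,0)+\mathbb N(0,-1,2,-1)$, and $\sigma(B[{\bf a}])=q^{-N({\bf a})}B[{\bf a}]$; here $\sigma$ is the ring anti-automorphism of $U_q^+(w)$ with $\sigma(q^{1/2})=q^{-1/2}$, $\sigma(u_i)=q^{2i}u_i$, and $N({\bf a})=(a_3+a_2+a_1+a_0)^2-7a_3-5a_2-3a_1-a_0$. Put $$X_n=q^{-\frac12(2n-5)^2}B[n-2,0,0,n-3]\ (n\ge3),\qquad X_n=q^{-\frac12}u_n\ (n=0,1,2),\qquad X_n=q^{-\frac12(2n-1)^2}B[-n,0,0,1-n]\ (n<0),$$ $$Y_0=q^{-2}(u_2u_0-q^2u_1^2),\qquad Y_1=q^{-2}(u_3u_1-q^2u_2^2).$$ Quantum seeds, the elements $M(c)$, mutations and compatible pairs are those of Berenstein–Zelevinsky; $(\Lambda,\tilde B)$ is compatible if $\Lambda$ is skew-symmetric and $\tilde B^T\Lambda=(D\,|\,0)$ with $D$ diagonal with positive integer entries. The quantum cluster algebra of a quantum seed is the $\mathbb Z[q^{\pm1/2}]$-algebra generated by all cluster variables of all mutation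 equivalent seeds and by the frozen variables (which are not inverted). **Theorem.** The monomials $u[{\bf a}]$, ${\bf a}\in\mathbb N^4$, form a $\mathbb K$-basis of $U_q^+(w)$, and $$\mathcal A=\bigoplus_{{\bf a}\in\mathbb N^4}\mathbb Z[q^{\pm1/2}]\,u[{\bf a}]$$ is a $\mathbb Z[q^{\pm1/2}]$-subalgebra. The elements $B[{\bf a}]$ used above exist and are unique, so that the $X_n$ $(n\in\mathbb Z)$ are well defined. As a $\mathbb Z[q^{\pm1/2}]$-algebra $\mathcal A$ is generated by $X_0,X_1,X_2,X_3$, and also by all $X_n$, $n\in\mathbb Z$. The algebra $U_q^+(w)$ has a skew field of fractions $F$, and for every $n\ge3$: 1. The cluster $(X_n,X_{n+1},Y_0,Y_1)$, with $Y_0,Y_1$ frozen, together with the matrices $L$ and $-B$, where $$L=\begin{pmatrix}0&2&2n-2&-2n+8\\-2&0&2n&-2n+6\\-2n+2&-2n&0&-4\\2n-8&2n-6&4&0\end{pmatrix},\qquad B=\begin{pmatrix}0&2\\-2&0\\n-3&-n+4\\n&-n+1\end{pmatrix},$$ is a quantum seed in $F$: the pair $(L,-B)$ is compatible, the variables quasi-commute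 with exponents $L$ (that is, $xy=q^{L_{xy}}yx$), and they generate a quantum torus with skew field of fractions $F$. 2. With $M(a_1,a_2,a_3,a_4)=q^{\frac12\sum_{i>j}a_ia_jL_{ij}}X_n^{a_1}X_{n+1}^{a_2}Y_0^{a_3}Y_1^{a_4}$ the exchange relation $X_{n+2}=M(-1,2,0,0)+M(-1,0,n-3,n)$ holds. 3. Every seed that is mutation equivalent to this one is a quantum seed with cluster $\{X_j,X_{j+1}\}$ and frozen variables $Y_0,Y_1$ for some $j\in\mathbb Z$, and every $j\in\mathbb Z$ occurs. In the seed with cluster $\{X_j,X_{j+1}\}$ the exchange relation at $X_j$ gives $X_{j+2}$, and the one at $X_{j+1}$ gives $X_{j-1}$. 4. The quantum cluster algebra of this seed is equal to $\mathcal A$. Consequently the version in which $Y_0,Y_1$ are inverted is the $\mathbb Z[q^{\pm1/2}]$-subalgebra of $F$ generated by $\mathcal A$, $Y_0^{-1}$ and $Y_1^{-1}$. -/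

import Mathlib

/-!
# The quantum cluster algebra structure on `U_q^+(s₁s₂s₁s₂)` in type `A₁⁽¹⁾`
-/

noncomputable section

namespace QuantumKronecker

/-! ## Ground field and ground ring -/

/-- The field `ℚ(q^{1/2})`. -/
abbrev 𝕂 : Type := RatFunc ℚ

/-- The square root `v = q^{1/2}` of the deformation parameter. -/
def v : 𝕂 := RatFunc.X

/-- The deformation parameter `q`. -/
def q : 𝕂 := v ^ 2

/-- The ring `ℤ[q^{±1/2}]`, as a subring of `ℚ(q^{1/2})`. -/
abbrev Zv : Subalgebra ℤ 𝕂 := Algebra.adjoin ℤ {v, v⁻¹}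

/-- The quantum integer `[k]`. -/
def qInt (k : ℕ) : 𝕂 := (q ^ k - (q⁻¹) ^ k) / (q - q⁻¹)

/-- The quantum factorial `[k]!`. -/
def qFact (k : ℕ) : 𝕂 := ∏ i ∈ Finset.range k, qInt (i + 1)

/-! ## The quantized enveloping algebra `U_q(𝔤)` of type `A₁⁽¹⁾` -/

/-- The Cartan matrix. -/
def cartan : Matrix (Fin 2) (Fin 2) ℤ := !![2, -2; -2, 2]

/-- The generators `E_i`, `F_i`, `K_i`, `K_i⁻¹`; the indices `1, 2` are represented by
`0, 1 : Fin 2`. -/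
inductive Gen : Type
  | e (i : Fin 2)
  | f (i : Fin 2)
  | k (i : Fin 2)
  | kinv (i : Fin 2)

/-- The free algebra on the generators. -/
abbrev Free : Type := FreeAlgebra 𝕂 Gen

/-- A generator as an element of the free algebra. -/
abbrev gen (x : Gen) : Free := FreeAlgebra.ι 𝕂 x

/-- The quantum Serre expression `x³y - [3] x²yx + [3] xyx² - yx³`. -/
def serre (x y : Free) : Free :=
  x ^ 3 * y - qInt 3 • (x ^ 2 * y * x) + qInt 3 • (x * y * x ^ 2) - y * x ^ 3

/-- The defining relations of `U_q(𝔤)`. -/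
inductive Rel : Free → Free → Prop
  | k_comm (i j : Fin 2) : Rel (gen (.k i) * gen (.k j)) (gen (.k j) * gen (.k i))
  | k_kinv (i : Fin 2) : Rel (gen (.k i) * gen (.kinv i)) 1
  | kinv_k (i : Fin 2) : Rel (gen (.kinv i) * gen (.k i)) 1
  | k_e (i j : Fin 2) :
      Rel (gen (.k i) * gen (.e j) * gen (.kinv i)) (q ^ cartan i j • gen (.e j))
  | k_f (i j : Fin 2) :
      Rel (gen (.k i) * gen (.f j) * gen (.kinv i)) (q ^ (-cartan i j) • gen (.f j))
  | e_f (i j : Fin 2) :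
      Rel (gen (.e i) * gen (.f j) - gen (.f j) * gen (.e i))
        (if i = j then (q - q⁻¹)⁻¹ • (gen (.k i) - gen (.kinv i)) else 0)
  | serre_e (i j : Fin 2) (h : i ≠ j) : Rel (serre (gen (.e i)) (gen (.e j))) 0
  | serre_f (i j : Fin 2) (h : i ≠ j) : Rel (serre (gen (.f i)) (gen (.f j))) 0

/-- The quantized enveloping algebra `U_q(𝔤)`, with scalars extended to `ℚ(q^{1/2})`. -/
abbrev Uq : Type := RingQuot Rel

/-- The projection from the free algebra onto `U_q(𝔤)`. -/
def proj : Free →ₐ[𝕂] Uq := RingQuot.mkAlgHom 𝕂 Rel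

/-- The divided power `x^{(r)} = x^r / [r]!`. -/
def dpow (x : Free) (r : ℕ) : Free := (qFact r)⁻¹ • x ^ r

/-- The values of Lusztig's automorphism `T_i` on the generators:
`T_i(E_i) = -K_i⁻¹F_i`, `T_i(F_i) = -E_iK_i`, `T_i(K_j) = K_j K_i^{-a_{ij}}` and, for `j ≠ i`,
`T_i(E_j) = ∑_{r+s=2} (-1)^r q^{-r} E_i^{(r)} E_j E_i^{(s)}`,
`T_i(F_j) = ∑_{r+s=2} (-1)^r q^r F_i^{(s)} F_j F_i^{(r)}`.
Here `K_i K_i^{-2}` is written `K_i⁻¹`. -/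
def braidGen (i : Fin 2) : Gen → Free
  | .e j => if j = i then -(gen (.kinv i) * gen (.f i)) else
      ∑ p ∈ Finset.HasAntidiagonal.antidiagonal 2,
        ((-1) ^ p.1 * (q⁻¹) ^ p.1 : 𝕂) •
          (dpow (gen (.e i)) p.1 * gen (.e j) * dpow (gen (.e i)) p.2)
  | .f j => if j = i then -(gen (.e i) * gen (.k i)) else
      ∑ p ∈ Finset.HasAntidiagonal.antidiagonal 2,
        ((-1) ^ p.1 * q ^ p.1 : 𝕂) •
          (dpow (gen (.f i)) p.2 * gen (.f j) * dpow (gen (.f i)) p.1)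
  | .k j => if j = i then gen (.kinv i) else gen (.k j) * gen (.k i) ^ 2
  | .kinv j => if j = i then gen (.k i) else gen (.kinv j) * gen (.kinv i) ^ 2

/-- The lift of `T_i` to the free algebra. Since `T_i` is the algebra endomorphism of `U_q(𝔤)`
with the values above on the generators, `proj ∘ braid i = T_i ∘ proj`. -/
def braid (i : Fin 2) : Free →ₐ[𝕂] Free := FreeAlgebra.lift 𝕂 (braidGen i)

/-- `v₀ = E₁`, `v₁ = T₁(E₂)`, `v₂ = T₁T₂(E₁)`, `v₃ = T₁T₂T₁(E₂)`. -/
def rootVector : Fin 4 → Uq :=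
  ![proj (gen (.e 0)),
    proj (braid 0 (gen (.e 1))),
    proj (braid 0 (braid 1 (gen (.e 0)))),
    proj (braid 0 (braid 1 (braid 0 (gen (.e 1)))))]

/-- The algebra `U_q^+(w)`, `w = s₁s₂s₁s₂`, with scalars extended to `ℚ(q^{1/2})`. -/
abbrev Uplus : Type := ↥(Algebra.adjoin 𝕂 (Set.range rootVector))

/-! ## The dual PBW basis and the dual canonical basis

A vector `(a₃, a₂, a₁, a₀) ∈ ℕ⁴` is stored as `a : Fin 4 → ℕ` with `a i = a_i`. -/

/-- The vector `(a₃, a₂, a₁, a₀)`. -/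
def vec (a₃ a₂ a₁ a₀ : ℕ) : Fin 4 → ℕ := ![a₀, a₁, a₂, a₃]

/-- `u_i = v_i / (1 - q^{-2})^{2i}`. -/
def u (i : Fin 4) : Uplus :=
  ((1 - (q⁻¹) ^ 2) ^ (2 * (i : ℕ)))⁻¹ •
    (⟨rootVector i, Algebra.subset_adjoin (Set.mem_range_self i)⟩ : Uplus)

/-- The ordered monomial `u[a] = u₃^{a₃} u₂^{a₂} u₁^{a₁} u₀^{a₀}`. -/
def uMon (a : Fin 4 → ℕ) : Uplus := u 3 ^ a 3 * u 2 ^ a 2 * u 1 ^ a 1 * u 0 ^ a 0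

/-- The `ℤ[q^{±1/2}]`-span of the monomials `u[a]`. -/
def integralForm : Submodule Zv Uplus := Submodule.span Zv (Set.range uMon)

/-- The dual PBW basis element `E[a] = q^{b(a)} u[a]`, `b(a) = ∑ a_i (a_i - 1) / 2`. -/
def dualPBW (a : Fin 4 → ℕ) : Uplus := q ^ (∑ i, (a i).choose 2) • uMon a

/-- The norm `N(a) = (a₃ + a₂ + a₁ + a₀)² - 7a₃ - 5a₂ - 3a₁ - a₀`. -/
def normN (a : Fin 4 → ℕ) : ℤ :=
  ((a 3 : ℤ) + a 2 + a 1 + a 0) ^ 2 - 7 * a 3 - 5 * a 2 - 3 * a 1 - a 0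

/-- The partial order: `b - a ∈ ℕ(-1, 2, -1, 0) + ℕ(0, -1, 2, -1)` in the order `3, 2, 1, 0`. -/
def Below (a b : Fin 4 → ℕ) : Prop :=
  ∃ s r : ℕ, (b 3 : ℤ) = a 3 - s ∧ (b 2 : ℤ) = a 2 + 2 * s - r ∧
    (b 1 : ℤ) = a 1 - s + 2 * r ∧ (b 0 : ℤ) = a 0 - r

/-- `σ` is a ring anti-automorphism of `U_q^+(w)` with `σ(q^{1/2}) = q^{-1/2}` and
`σ(u_i) = q^{2i} u_i`. -/
def IsSigma (σ : Uplus ≃+* Uplusᵐᵒᵖ) : Prop :=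
  σ (algebraMap 𝕂 Uplus v) = MulOpposite.op (algebraMap 𝕂 Uplus v⁻¹) ∧
    ∀ i : Fin 4, σ (u i) = MulOpposite.op (q ^ (2 * (i : ℕ)) • u i)

/-- `x` is the dual canonical basis element `B[a]`: `x - E[a]` is a combination of the `E[b]`,
`a ◁ b`, `b ≠ a`, with coefficients in `qℤ[q]`, and `σ(x) = q^{-N(a)} x`. -/
def IsDualCanonical (a : Fin 4 → ℕ) (x : Uplus) : Prop :=
  x - dualPBW a ∈ AddSubgroup.closure
      {y : Uplus | ∃ b : Fin 4 → ℕ, Below a b ∧ b ≠ a ∧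
        ∃ k : ℕ, 1 ≤ k ∧ y = q ^ k • dualPBW b} ∧
    ∃ σ : Uplus ≃+* Uplusᵐᵒᵖ, IsSigma σ ∧
      σ x = MulOpposite.op (q ^ (-normN a) • x)

/-! ## The rescaled quantized cluster variables -/

/-- `x` is the element `X_n`: `X_n = q^{-(2n-5)²/2} B[n-2, 0, 0, n-3]` for `n ≥ 3`,
`X_n = q^{-1/2} u_n` for `n = 0, 1, 2`, and `X_n = q^{-(2n-1)²/2} B[-n, 0, 0, 1-n]` for `n < 0`. -/
def IsX (n : ℤ) (x : Uplus) : Prop :=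
  if 3 ≤ n then
    ∃ b, IsDualCanonical (vec (n - 2).toNat 0 0 (n - 3).toNat) b ∧
      x = v ^ (-(2 * n - 5) ^ 2) • b
  else if n < 0 then
    ∃ b, IsDualCanonical (vec (-n).toNat 0 0 (1 - n).toNat) b ∧
      x = v ^ (-(2 * n - 1) ^ 2) • b
  else x = v⁻¹ • u (Fin.ofNat 4 n.toNat)

/-- `Y₀ = q^{-2} p₀` with `p₀ = u₂u₀ - q²u₁²`. -/
def Y₀ : Uplus := (q⁻¹) ^ 2 • (u 2 * u 0 - q ^ 2 • u 1 ^ 2)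

/-- `Y₁ = q^{-2} p₁` with `p₁ = u₃u₁ - q²u₂²`. -/
def Y₁ : Uplus := (q⁻¹) ^ 2 • (u 3 * u 1 - q ^ 2 • u 2 ^ 2)

/-! ## Quantum seeds and quantum cluster algebras

Cluster variables are indexed by `Fin (r + s)`; the first `r` are exchangeable, the last `s` are
frozen. The ambient skew field `F` is an algebra over `ℚ(q^{1/2})`. -/

/-- The data of a quantum seed: variables, commutation matrix `Λ`, exchange matrix `B̃`. -/
@[ext]
structure SeedData (F : Type) (r s : ℕ) where
  x : Fin (r + s) → F
  Λ : Matrix (Fin (r + s)) (Fin (r + s)) ℤ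
  B : Matrix (Fin (r + s)) (Fin r) ℤ

namespace SeedData

variable {F : Type} [DivisionRing F] [Algebra 𝕂 F] {r s : ℕ}

/-- The toric frame `M(c) = q^{½ ∑_{i>j} c_i c_j Λ_{ij}} x_1^{c_1} ⋯ x_m^{c_m}`. -/
def frame (S : SeedData F r s) (c : Fin (r + s) → ℤ) : F :=
  v ^ (∑ i, ∑ j, if j < i then c i * c j * S.Λ i j else 0) •
    (List.ofFn fun i => S.x i ^ c i).prod

/-- `(Λ, B̃)` is a compatible pair: `Λ` is skew-symmetric and `∑_k b_{kj} λ_{ki} = δ_{ij} d_j`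
with positive integers `d_j`. -/
def IsCompatible (S : SeedData F r s) : Prop :=
  S.Λ.transpose = -S.Λ ∧
    ∃ d : Fin r → ℤ, (∀ j, 0 < d j) ∧
      ∀ (j : Fin r) (i : Fin (r + s)),
        ∑ k, S.B k j * S.Λ k i = if i = Fin.castAdd s j then d j else 0

/-- `S` is a quantum seed in `F`: the pair `(Λ, B̃)` is compatible, the variables quasi-commute
according to `Λ`, and the `M(c)` form a basis of a quantum torus of which `F` is the skew field of
fractions. -/
structure IsQuantumSeed (S : SeedData F r s) : Prop where
  compatible : S.IsCompatible
  quasiComm : ∀ i j, S.x i * S.x j = q ^ S.Λ i j • (S.x j * S.x i)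
  linearIndependent : LinearIndependent 𝕂 S.frame
  fractions : ∀ f : F, ∃ g ∈ Submodule.span 𝕂 (Set.range S.frame),
    ∃ h ∈ Submodule.span 𝕂 (Set.range S.frame), h ≠ 0 ∧ f = g * h⁻¹

/-- The right-hand side `M(-e_k + [b^k]_+) + M(-e_k + [-b^k]_+)` of the exchange relation. -/
def exchange (S : SeedData F r s) (k : Fin r) : F :=
  S.frame (fun i => -(Pi.single (Fin.castAdd s k) 1 : Fin (r + s) → ℤ) i + max (S.B i k) 0) +
    S.frame (fun i => -(Pi.single (Fin.castAdd s k) 1 : Fin (r + s) → ℤ) i + max (-S.B i k) 0)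

/-- The matrix `E` of the mutation in direction `k`. -/
def mutE (S : SeedData F r s) (k : Fin r) : Matrix (Fin (r + s)) (Fin (r + s)) ℤ :=
  fun i j => if j = Fin.castAdd s k then
      (if i = Fin.castAdd s k then -1 else max (-S.B i k) 0)
    else if i = j then 1 else 0

/-- The mutation of a quantum seed in the exchangeable direction `k`. -/
def mutate (S : SeedData F r s) (k : Fin r) : SeedData F r s where
  x := Function.update S.x (Fin.castAdd s k) (S.exchange k)
  Λ := (S.mutE k).transpose * S.Λ * S.mutE k
  B := fun i j => if i = Fin.castAdd s k ∨ j = k then -S.B i j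
    else S.B i j + max (S.B i k) 0 * max (S.B (Fin.castAdd s k) j) 0
      - max (-S.B i k) 0 * max (-S.B (Fin.castAdd s k) j) 0

/-- `T` is obtained from `S` by a finite sequence of mutations. -/
def Reaches (S T : SeedData F r s) : Prop :=
  Relation.ReflTransGen (fun S₁ S₂ => ∃ k : Fin r, S₂ = S₁.mutate k) S T

/-- The quantum cluster algebra of `S`: the `ℤ[q^{±1/2}]`-subalgebra of `F` generated by all
variables, exchangeable and frozen, of all seeds that are mutation equivalent to `S`. -/
def quantumClusterAlgebra (S : SeedData F r s) : Subalgebra Zv F :=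
  Algebra.adjoin Zv {y : F | ∃ T : SeedData F r s, S.Reaches T ∧ ∃ i, y = T.x i}

/-- The variant of the quantum cluster algebra in which the frozen variables are inverted. -/
def localizedQuantumClusterAlgebra (S : SeedData F r s) : Subalgebra Zv F :=
  Algebra.adjoin Zv ({y : F | ∃ T : SeedData F r s, S.Reaches T ∧ ∃ i, y = T.x i} ∪
    {y : F | ∃ i : Fin s, y = (S.x (Fin.natAdd r i))⁻¹})

end SeedData

/-! ## The seeds of the theorem -/

/-- The matrix `L` of the cluster `(X_n, X_{n+1}, Y₀, Y₁)`, `n ≥ 3`. -/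
def L (n : ℤ) : Matrix (Fin 4) (Fin 4) ℤ :=
  !![0, 2, 2 * n - 2, -2 * n + 8;
     -2, 0, 2 * n, -2 * n + 6;
     -2 * n + 2, -2 * n, 0, -4;
     2 * n - 8, 2 * n - 6, 4, 0]

/-- The matrix `B` of the cluster `(X_n, X_{n+1}, Y₀, Y₁)`, `n ≥ 3`. -/
def exchangeMatrix (n : ℤ) : Matrix (Fin 4) (Fin 2) ℤ :=
  !![0, 2;
     -2, 0;
     n - 3, -n + 4;
     n, -n + 1]

/-- The seed with cluster `(X_n, X_{n+1}, Y₀, Y₁)`, commutation matrix `L` and exchange matrix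
`-B`. The sign makes the pair compatible with positive `d_j`; it does not affect the exchange
relations. -/
def seed {F : Type} [DivisionRing F] [Algebra 𝕂 F] (ι : Uplus →ₐ[𝕂] F) (X : ℤ → Uplus)
    (n : ℤ) : SeedData F 2 2 where
  x := ![ι (X n), ι (X (n + 1)), ι Y₀, ι Y₁]
  Λ := L n
  B := -exchangeMatrix n

end QuantumKronecker

end

open QuantumKronecker

noncomputable section

namespace QuantumKronecker

/-! ## Straightening relations and ordered monomials -/

section Straightening

variable {A k R : Type*} [CommRing A] [Field k] [Ring R] [Algebra A k] [Algebra k R]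

/-! Everything rests on six straightening relations between u₀, …, u₃ (`Straightening`). Up to
powers of 1/[2], the root vectors form the string E₁, [ψ,E₁], [ψ,[ψ,E₁]], … generated by the
imaginary root vector ψ = E₂E₁ - q⁻²E₁E₂ (`rootVector_eq`). The first q-commutation in the string is
a Serre relation. A second imaginary element η, which commutes with ψ and shifts the string by two,
propagates it along the string (`commutation_step`), and bracketing with ψ gives the remaining
relations.

For the independence of the monomials u[a] an explicit representation on functions on ℤ × ℤ is used:
E₁ acts as a sum of two weighted shifts and ψ acts diagonally. In it u₀, u₁, Y₀, Y₁ act injectively.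
These four elements quasi-commute with a nondegenerate exponent matrix, so their monomials are
independent, as in Dedekind's argument for characters. Since Y₀ and Y₁ have leading terms u₂u₀ and
u₃u₁, a dimension count transfers independence to the u[a] (`mon_linearIndepOn_cone`,
`mon_linearIndependent`). Leading terms then show that there are no zero divisors, polynomial growth
gives the Ore conditions, and the basis shows that the straightening relations are a presentation.
The presentation yields σ.

The cluster variables are controlled by one element z (`zz`): each product of z with X_n is a
combination of X_{n+1} and X_{n-1} with frozen coefficients. From this linear recursion follow the
quasi-commutation of neighbours, the exchange relations (by the argument for a Casoratian,
`exchange_pos`), integrality, and the fact that the X_n are eigenvectors of σ. Chebyshev-type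
polynomials in z give closed formulas from which the unitriangularity over qℤ[q] is proved by a
joint induction (`pos_sub_mem_aux`). A polynomial in vℚ[v] fixed by v ↦ v⁻¹ vanishes, so dual
canonical elements are unique, and the rescaled recursion elements are the required B[a]. The
opposite algebra with the reversed family satisfies the same relations, so the indices at most 1
follow from those at least 2 by the reflection j ↦ 3 - j.

All seeds are written down at once: the exponents of X_j with Y₀ and Y₁ are 2pⱼ and 2rⱼ with pⱼ =
|j| - 1 and rⱼ = 1 - |j - 3|, and these piecewise linear sequences satisfy the tropical form of the
exchange recursion. Mutation therefore shifts j by one and interchanges the two positions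
(`mutate_zero`, `mutate_one`). The Laurent property needed for the fraction field comes from z: it
lies in every quantum torus, and one moves along the sequence by dividing by frozen variables only
(`mem_torus_all`). Hence the cluster variables are exactly the X_j. They all lie in 𝒜, as do Y₀ and
Y₁, and already X₀, …, X₃ generate 𝒜, which gives the equality of the algebras. -/

/-- The straightening relations between the dual root vectors. -/
structure Straightening (q : k) (u : Fin 4 → R) : Prop where
  q_ne : q ≠ 0
  rel10 : u 1 * u 0 = q ^ 2 • (u 0 * u 1)
  rel21 : u 2 * u 1 = q ^ 2 • (u 1 * u 2)
  rel32 : u 3 * u 2 = q ^ 2 • (u 2 * u 3)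
  rel20 : u 2 * u 0 = q ^ 2 • (u 0 * u 2) + (q ^ 2 - 1) • (u 1 * u 1)
  rel31 : u 3 * u 1 = q ^ 2 • (u 1 * u 3) + (q ^ 2 - 1) • (u 2 * u 2)
  rel30 : u 3 * u 0 = q ^ 2 • (u 0 * u 3) + (q ^ 2 - (q ^ 2)⁻¹) • (u 2 * u 1)

/-- The family `u₃, u₂, u₁, u₀` in the opposite algebra. -/
def opFamily (u : Fin 4 → R) : Fin 4 → Rᵐᵒᵖ :=
  ![MulOpposite.op (u 3), MulOpposite.op (u 2), MulOpposite.op (u 1), MulOpposite.op (u 0)]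

/-- The ordered monomial `u₃^{a₃} u₂^{a₂} u₁^{a₁} u₀^{a₀}`. -/
def mon (u : Fin 4 → R) (a : Fin 4 → ℕ) : R := u 3 ^ a 3 * u 2 ^ a 2 * u 1 ^ a 1 * u 0 ^ a 0

theorem mon_vec (u : Fin 4 → R) (a b c d : ℕ) :
    mon u (vec a b c d) = u 3 ^ a * u 2 ^ b * u 1 ^ c * u 0 ^ d := rfl

theorem vec_eta (a : Fin 4 → ℕ) : vec (a 3) (a 2) (a 1) (a 0) = a := by
  ext i; fin_cases i <;> rfl

theorem vec_inj {a b c d a' b' c' d' : ℕ} :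
    vec a b c d = vec a' b' c' d' ↔ a = a' ∧ b = b' ∧ c = c' ∧ d = d' := by
  constructor
  · intro h
    exact ⟨congrFun h 3, congrFun h 2, congrFun h 1, congrFun h 0⟩
  · rintro ⟨rfl, rfl, rfl, rfl⟩; rfl

theorem below_vec {a b c d a' b' c' d' : ℕ} :
    Below (vec a b c d) (vec a' b' c' d') ↔ ∃ s r : ℕ, (a' : ℤ) = a - s ∧
      (b' : ℤ) = b + 2 * s - r ∧ (c' : ℤ) = c - s + 2 * r ∧ (d' : ℤ) = d - r := Iff.rfl

theorem Below.refl (a : Fin 4 → ℕ) : Below a a := ⟨0, 0, by simp⟩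

theorem Below.trans {a b c : Fin 4 → ℕ} (h : Below a b) (h' : Below b c) : Below a c := by
  obtain ⟨s, r, h1, h2, h3, h4⟩ := h
  obtain ⟨s', r', h1', h2', h3', h4'⟩ := h'
  refine ⟨s + s', r + r', ?_, ?_, ?_, ?_⟩ <;> push_cast <;> omega

theorem Below.antisymm {a b : Fin 4 → ℕ} (h : Below a b) (h' : Below b a) : a = b := by
  obtain ⟨s, r, h1, h2, h3, h4⟩ := h
  obtain ⟨s', r', h1', h2', h3', h4'⟩ := h'
  rw [← vec_eta a, ← vec_eta b, vec_inj]
  omega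

theorem Below.add_right {a b : Fin 4 → ℕ} (h : Below a b) (c : Fin 4 → ℕ) :
    Below (a + c) (b + c) := by
  obtain ⟨s, r, h1, h2, h3, h4⟩ := h
  refine ⟨s, r, ?_, ?_, ?_, ?_⟩ <;> simp only [Pi.add_apply] <;> push_cast <;> omega

theorem Below.sum_eq {a b : Fin 4 → ℕ} (h : Below a b) : ∑ i, b i = ∑ i, a i := by
  obtain ⟨s, r, h1, h2, h3, h4⟩ := h
  simp only [Fin.sum_univ_four]; omega

theorem pow_mul_of_mul_eq_smul {x y : R} {c : k} (h : x * y = c • (y * x)) (n : ℕ) :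
    x ^ n * y = c ^ n • (y * x ^ n) := by
  induction n with
  | zero => simp
  | succ n ih =>
    rw [pow_succ, mul_assoc, h, mul_smul_comm, ← mul_assoc, ih, smul_mul_assoc, smul_smul,
      mul_assoc, pow_succ']

theorem pow_mul_pow_of_mul_eq_smul {x y : R} {c : k} (h : x * y = c • (y * x)) (n m : ℕ) :
    x ^ n * y ^ m = c ^ (n * m) • (y ^ m * x ^ n) := by
  induction m with
  | zero => simp
  | succ m ih =>
    rw [pow_succ, ← mul_assoc, ih, smul_mul_assoc, mul_assoc, pow_mul_of_mul_eq_smul h n,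
      mul_smul_comm, smul_smul, ← mul_assoc, ← pow_add, Nat.mul_succ]

theorem mul_comm_of_eq_smul {x y : R} {c : k} (hc : c ≠ 0) (h : x * y = c • (y * x)) :
    y * x = c⁻¹ • (x * y) := by
  rw [h, smul_smul, inv_mul_cancel₀ hc, one_smul]

namespace Straightening

variable {q : k} {u : Fin 4 → R} (h : Straightening q u)
include h

theorem op : Straightening q (opFamily u) where
  q_ne := h.q_ne
  rel10 := congrArg MulOpposite.op h.rel32
  rel21 := congrArg MulOpposite.op h.rel21
  rel32 := congrArg MulOpposite.op h.rel10
  rel20 := congrArg MulOpposite.op h.rel31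
  rel31 := congrArg MulOpposite.op h.rel20
  rel30 := congrArg MulOpposite.op h.rel30

theorem swap01 : u 0 * u 1 = (q ^ 2)⁻¹ • (u 1 * u 0) := by
  rw [h.rel10, smul_smul, inv_mul_cancel₀ (pow_ne_zero _ h.q_ne), one_smul]

theorem swap12 : u 1 * u 2 = (q ^ 2)⁻¹ • (u 2 * u 1) := by
  rw [h.rel21, smul_smul, inv_mul_cancel₀ (pow_ne_zero _ h.q_ne), one_smul]

theorem swap23 : u 2 * u 3 = (q ^ 2)⁻¹ • (u 3 * u 2) := by
  rw [h.rel32, smul_smul, inv_mul_cancel₀ (pow_ne_zero _ h.q_ne), one_smul]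

theorem swap02 : u 0 * u 2 = (q ^ 2)⁻¹ • (u 2 * u 0) + ((q ^ 2)⁻¹ - 1) • (u 1 * u 1) := by
  have := h.q_ne
  rw [h.rel20]; match_scalars <;> field_simp; ring

theorem swap13 : u 1 * u 3 = (q ^ 2)⁻¹ • (u 3 * u 1) + ((q ^ 2)⁻¹ - 1) • (u 2 * u 2) := by
  have := h.q_ne
  rw [h.rel31]; match_scalars <;> field_simp; ring

theorem swap03 : u 0 * u 3 = (q ^ 2)⁻¹ • (u 3 * u 0) + ((q ^ 4)⁻¹ - 1) • (u 2 * u 1) := by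
  have := h.q_ne
  rw [h.rel30]; match_scalars <;> field_simp; ring

theorem swap01_assoc (x : R) : u 0 * (u 1 * x) = (q ^ 2)⁻¹ • (u 1 * (u 0 * x)) := by
  rw [← mul_assoc, h.swap01, smul_mul_assoc, mul_assoc]

theorem swap12_assoc (x : R) : u 1 * (u 2 * x) = (q ^ 2)⁻¹ • (u 2 * (u 1 * x)) := by
  rw [← mul_assoc, h.swap12, smul_mul_assoc, mul_assoc]

theorem swap23_assoc (x : R) : u 2 * (u 3 * x) = (q ^ 2)⁻¹ • (u 3 * (u 2 * x)) := by
  rw [← mul_assoc, h.swap23, smul_mul_assoc, mul_assoc]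

theorem swap02_assoc (x : R) : u 0 * (u 2 * x) =
    (q ^ 2)⁻¹ • (u 2 * (u 0 * x)) + ((q ^ 2)⁻¹ - 1) • (u 1 * (u 1 * x)) := by
  rw [← mul_assoc, h.swap02, add_mul, smul_mul_assoc, smul_mul_assoc, mul_assoc, mul_assoc]

theorem swap13_assoc (x : R) : u 1 * (u 3 * x) =
    (q ^ 2)⁻¹ • (u 3 * (u 1 * x)) + ((q ^ 2)⁻¹ - 1) • (u 2 * (u 2 * x)) := by
  rw [← mul_assoc, h.swap13, add_mul, smul_mul_assoc, smul_mul_assoc, mul_assoc, mul_assoc]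

theorem swap03_assoc (x : R) : u 0 * (u 3 * x) =
    (q ^ 2)⁻¹ • (u 3 * (u 0 * x)) + ((q ^ 4)⁻¹ - 1) • (u 2 * (u 1 * x)) := by
  rw [← mul_assoc, h.swap03, add_mul, smul_mul_assoc, smul_mul_assoc, mul_assoc, mul_assoc]

/-- Since u₀ quasi-commutes with u₁, moving u₀^d past u₂ creates a single type of correction. The
clause `c = 0 ∨ 1 ≤ d` ensures that the truncated exponent `d - 1` matters only where it is a true
difference. Coefficients are tracked in a subring containing q⁻², so that the same computation
serves the field and the integral form. -/
theorem pow_mul_02 {S : Subalgebra A k} (hS : (q ^ 2)⁻¹ ∈ S) (d : ℕ) :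
    ∃ c ∈ S, (c = 0 ∨ 1 ≤ d) ∧ u 0 ^ d * u 2 =
      ((q ^ 2)⁻¹) ^ d • (u 2 * u 0 ^ d) + c • (u 1 * (u 1 * u 0 ^ (d - 1))) := by
  induction d with
  | zero => exact ⟨0, S.zero_mem, Or.inl rfl, by simp⟩
  | succ d ih =>
    obtain ⟨c, hc, hd, e⟩ := ih
    refine ⟨((q ^ 2)⁻¹) ^ d * ((q ^ 2)⁻¹ - 1) + c * (q ^ 2)⁻¹ * (q ^ 2)⁻¹, ?_, Or.inr (by omega), ?_⟩
    · exact add_mem (mul_mem (pow_mem hS _) (sub_mem hS S.one_mem)) (mul_mem (mul_mem hc hS) hS)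
    · rw [pow_succ', mul_assoc, e]
      simp only [mul_add, mul_smul_comm, h.swap02_assoc, h.swap01_assoc, smul_add, smul_smul,
        Nat.add_sub_cancel]
      rcases hd with rfl | hd
      · simp only [zero_smul, zero_mul, add_zero, ← pow_succ', ← pow_succ]
      · rw [← pow_succ' (u 0) (d - 1), Nat.sub_add_cancel hd, ← pow_succ', ← pow_succ,
          add_assoc, ← add_smul, mul_assoc c]

theorem pow_mul_13 {S : Subalgebra A k} (hS : (q ^ 2)⁻¹ ∈ S) (d : ℕ) :
    ∃ c ∈ S, (c = 0 ∨ 1 ≤ d) ∧ u 1 ^ d * u 3 =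
      ((q ^ 2)⁻¹) ^ d • (u 3 * u 1 ^ d) + c • (u 2 * (u 2 * u 1 ^ (d - 1))) := by
  induction d with
  | zero => exact ⟨0, S.zero_mem, Or.inl rfl, by simp⟩
  | succ d ih =>
    obtain ⟨c, hc, hd, e⟩ := ih
    refine ⟨((q ^ 2)⁻¹) ^ d * ((q ^ 2)⁻¹ - 1) + c * (q ^ 2)⁻¹ * (q ^ 2)⁻¹, ?_, Or.inr (by omega), ?_⟩
    · exact add_mem (mul_mem (pow_mem hS _) (sub_mem hS S.one_mem)) (mul_mem (mul_mem hc hS) hS)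
    · rw [pow_succ', mul_assoc, e]
      simp only [mul_add, mul_smul_comm, h.swap13_assoc, h.swap12_assoc, smul_add, smul_smul,
        Nat.add_sub_cancel]
      rcases hd with rfl | hd
      · simp only [zero_smul, zero_mul, add_zero, ← pow_succ', ← pow_succ]
      · rw [← pow_succ' (u 1) (d - 1), Nat.sub_add_cancel hd, ← pow_succ', ← pow_succ,
          add_assoc, ← add_smul, mul_assoc c]

/-- The cubic correction arises when another u₀ crosses the u₂ of a correction term u₂u₁; it is
therefore present only from d = 2 on. -/
theorem pow_mul_03 {S : Subalgebra A k} (hS : (q ^ 2)⁻¹ ∈ S) (d : ℕ) :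
    ∃ c ∈ S, ∃ c' ∈ S, (c = 0 ∨ 1 ≤ d) ∧ (c' = 0 ∨ 2 ≤ d) ∧ u 0 ^ d * u 3 =
      ((q ^ 2)⁻¹) ^ d • (u 3 * u 0 ^ d) + c • (u 2 * (u 1 * u 0 ^ (d - 1))) +
        c' • (u 1 * (u 1 * (u 1 * u 0 ^ (d - 2)))) := by
  induction d with
  | zero => exact ⟨0, S.zero_mem, 0, S.zero_mem, Or.inl rfl, Or.inl rfl, by simp⟩
  | succ d ih =>
    obtain ⟨c, hc, c', hc', hd, hd', e⟩ := ih
    have h4 : (q ^ 4)⁻¹ ∈ S := by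
      have : (q ^ 4)⁻¹ = (q ^ 2)⁻¹ * (q ^ 2)⁻¹ := by rw [← mul_inv]; ring
      rw [this]; exact mul_mem hS hS
    refine ⟨((q ^ 2)⁻¹) ^ d * ((q ^ 4)⁻¹ - 1) + c * (q ^ 2)⁻¹ * (q ^ 2)⁻¹, ?_,
      c * ((q ^ 2)⁻¹ - 1) + c' * (q ^ 2)⁻¹ * (q ^ 2)⁻¹ * (q ^ 2)⁻¹, ?_,
      Or.inr (by omega), ?_, ?_⟩
    · exact add_mem (mul_mem (pow_mem hS _) (sub_mem h4 S.one_mem)) (mul_mem (mul_mem hc hS) hS)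
    · exact add_mem (mul_mem hc (sub_mem hS S.one_mem))
        (mul_mem (mul_mem (mul_mem hc' hS) hS) hS)
    · rcases hd with rfl | hd
      · rcases hd' with rfl | hd'
        · left; ring
        · right; omega
      · right; omega
    · rw [pow_succ', mul_assoc, e]
      simp only [mul_add, mul_smul_comm, h.swap03_assoc, h.swap02_assoc, h.swap01_assoc, smul_add,
        smul_smul, Nat.add_sub_cancel]
      have e1 : c • (u 2 * (u 1 * (u 0 * u 0 ^ (d - 1)))) = c • (u 2 * (u 1 * u 0 ^ d)) := by
        rcases hd with rfl | hd
        · simp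
        · rw [← pow_succ', Nat.sub_add_cancel hd]
      have e2 : c' • (u 1 * (u 1 * (u 1 * (u 0 * u 0 ^ (d - 2))))) =
          c' • (u 1 * (u 1 * (u 1 * u 0 ^ (d - 1)))) := by
        rcases hd' with rfl | hd'
        · simp
        · rw [← pow_succ', show d - 2 + 1 = d - 1 by omega]
      rw [show d + 1 - 2 = d - 1 by omega, mul_assoc c, mul_comm c, mul_smul _ c, e1,
        mul_assoc, mul_assoc c', mul_comm c', mul_smul _ c', e2, ← pow_succ']
      module

end Straightening

end Straightening

/-! ### Leading terms of products of ordered monomials. -/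

section Leading

variable {A k R : Type*} [CommRing A] [Field k] [Ring R] [Algebra A k] [Algebra k R]

/-- The `S`-span of the ordered monomials strictly below `a`. -/
def lowerSpan (S : Subalgebra A k) (u : Fin 4 → R) (a : Fin 4 → ℕ) : Submodule S R :=
  Submodule.span S {x | ∃ b, Below a b ∧ b ≠ a ∧ x = mon u b}

theorem smul_mem_of_mem {S : Subalgebra A k} {c : k} (hc : c ∈ S) {M : Submodule S R} {x : R}
    (hx : x ∈ M) : c • x ∈ M := M.smul_mem (⟨c, hc⟩ : S) hx

theorem mon_mem_lowerSpan (S : Subalgebra A k) (u : Fin 4 → R) {a b : Fin 4 → ℕ}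
    (h : Below a b) (hne : b ≠ a) : mon u b ∈ lowerSpan S u a :=
  Submodule.subset_span ⟨b, h, hne, rfl⟩

theorem lowerSpan_mono (S : Subalgebra A k) (u : Fin 4 → R) {a b : Fin 4 → ℕ}
    (h : Below a b) : lowerSpan S u b ≤ lowerSpan S u a := by
  refine Submodule.span_le.2 ?_
  rintro _ ⟨c, hc, hne, rfl⟩
  refine mon_mem_lowerSpan S u (h.trans hc) ?_
  rintro rfl
  exact hne (h.antisymm hc)

theorem mon_mul_zero (u : Fin 4 → R) (a b c d : ℕ) :
    mon u (vec a b c d) * u 0 = mon u (vec a b c (d + 1)) := by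
  simp only [mon_vec, mul_assoc, pow_succ]

namespace Straightening

variable {q : k} {u : Fin 4 → R} (h : Straightening q u)
include h

theorem mon_mul_one (a b c d : ℕ) :
    mon u (vec a b c d) * u 1 = ((q ^ 2)⁻¹) ^ d • mon u (vec a b (c + 1) d) := by
  simp only [mon_vec, mul_assoc]
  rw [pow_mul_of_mul_eq_smul h.swap01]
  simp only [mul_smul_comm, pow_succ, mul_assoc]

theorem mon_mul_two {S : Subalgebra A k} (hS : (q ^ 2)⁻¹ ∈ S) (a b c d : ℕ) :
    mon u (vec a b c d) * u 2 - ((q ^ 2)⁻¹) ^ (d + c) • mon u (vec a (b + 1) c d) ∈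
      lowerSpan S u (vec a (b + 1) c d) := by
  obtain ⟨γ, hγ, hd, e⟩ := h.pow_mul_02 hS d
  have e2 := pow_mul_of_mul_eq_smul h.swap12 c
  have : mon u (vec a b c d) * u 2 = ((q ^ 2)⁻¹) ^ (d + c) • mon u (vec a (b + 1) c d) +
      γ • mon u (vec a b (c + 2) (d - 1)) := by
    simp only [mon_vec, mul_assoc, e, mul_add, mul_smul_comm]
    congr 1
    · rw [← mul_assoc (u 1 ^ c) (u 2), e2]
      simp only [smul_mul_assoc, mul_smul_comm, smul_smul, pow_succ, mul_assoc, pow_add]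
    · simp only [pow_succ, mul_assoc]
  rw [this, add_sub_cancel_left]
  rcases hd with rfl | hd
  · simp
  · refine smul_mem_of_mem hγ (mon_mem_lowerSpan S u ?_ ?_)
    · exact below_vec.2 ⟨0, 1, by omega, by omega, by omega, by omega⟩
    · rw [ne_eq, vec_inj]; omega

theorem mon_mul_three {S : Subalgebra A k} (hS : (q ^ 2)⁻¹ ∈ S) (a b c d : ℕ) :
    mon u (vec a b c d) * u 3 - ((q ^ 2)⁻¹) ^ (d + c + b) • mon u (vec (a + 1) b c d) ∈
      lowerSpan S u (vec (a + 1) b c d) := by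
  obtain ⟨γ, hγ, γ', hγ', hd, hd', e⟩ := h.pow_mul_03 hS d
  obtain ⟨δ, hδ, hc, e1⟩ := h.pow_mul_13 hS c
  have e2 := pow_mul_of_mul_eq_smul h.swap23 b
  have e3 := pow_mul_of_mul_eq_smul h.swap12 c
  have : mon u (vec a b c d) * u 3 = ((q ^ 2)⁻¹) ^ (d + c + b) • mon u (vec (a + 1) b c d) +
      (((q ^ 2)⁻¹) ^ d * δ) • mon u (vec a (b + 2) (c - 1) d) +
      (γ * ((q ^ 2)⁻¹) ^ c) • mon u (vec a (b + 1) (c + 1) (d - 1)) +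
      γ' • mon u (vec a b (c + 3) (d - 2)) := by
    simp only [mon_vec, mul_assoc, e, mul_add, mul_smul_comm]
    rw [← mul_assoc (u 1 ^ c) (u 3), e1, ← mul_assoc (u 1 ^ c) (u 2), e3]
    simp only [add_mul, mul_add, smul_add, smul_mul_assoc, mul_smul_comm, mul_assoc, smul_smul]
    rw [← mul_assoc (u 2 ^ b) (u 3), e2]
    simp only [smul_mul_assoc, mul_smul_comm, smul_smul, pow_succ, mul_assoc, pow_add, pow_zero,
      one_mul, add_assoc]
  rw [this, add_assoc, add_assoc, add_sub_cancel_left, ← add_assoc]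
  refine add_mem (add_mem ?_ ?_) ?_
  · rcases hc with rfl | hc
    · simp
    · refine smul_mem_of_mem (mul_mem (pow_mem hS _) hδ) (mon_mem_lowerSpan S u ?_ ?_)
      · exact below_vec.2 ⟨1, 0, by omega, by omega, by omega, by omega⟩
      · rw [ne_eq, vec_inj]; omega
  · rcases hd with rfl | hd
    · simp
    · refine smul_mem_of_mem (mul_mem hγ (pow_mem hS _)) (mon_mem_lowerSpan S u ?_ ?_)
      · exact below_vec.2 ⟨1, 1, by omega, by omega, by omega, by omega⟩
      · rw [ne_eq, vec_inj]; omega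
  · rcases hd' with rfl | hd'
    · simp
    · refine smul_mem_of_mem hγ' (mon_mem_lowerSpan S u ?_ ?_)
      · exact below_vec.2 ⟨1, 2, by omega, by omega, by omega, by omega⟩
      · rw [ne_eq, vec_inj]; omega

/-- Moving u_i to its place past the generators of smaller index costs q⁻² for each of them; every
correction replaces exponents by strictly lower ones for the order `Below`. -/
theorem mon_mul_gen {S : Subalgebra A k} (hS : (q ^ 2)⁻¹ ∈ S) (a : Fin 4 → ℕ) (i : Fin 4) :
    mon u a * u i - ((q ^ 2)⁻¹) ^ (∑ j with j < i, a j) • mon u (a + Pi.single i 1) ∈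
      lowerSpan S u (a + Pi.single i 1) := by
  have key : ∀ x y z w : ℕ, ∀ b : Fin 4 → ℕ, (b 3 = x) → (b 2 = y) → b 1 = z → b 0 = w →
      b = vec x y z w := by
    rintro x y z w b rfl rfl rfl rfl; exact (vec_eta b).symm
  fin_cases i
  · have e : a + Pi.single 0 1 = vec (a 3) (a 2) (a 1) (a 0 + 1) := by
      apply key <;> simp
    have e' : ∑ j : Fin 4 with j < 0, a j = 0 := by simp [Finset.filter]
    have := mon_mul_zero u (a 3) (a 2) (a 1) (a 0)
    rw [vec_eta] at this
    simp only [Fin.zero_eta, Fin.isValue, e, e', this, pow_zero, one_smul, sub_self, zero_mem]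
  · have e : a + Pi.single 1 1 = vec (a 3) (a 2) (a 1 + 1) (a 0) := by
      apply key <;> simp
    have e' : ∑ j : Fin 4 with j < 1, a j = a 0 := by
      rw [show (Finset.univ.filter fun j : Fin 4 => j < 1) = {0} by decide]; simp
    have := h.mon_mul_one (a 3) (a 2) (a 1) (a 0)
    rw [vec_eta] at this
    simp only [Fin.mk_one, Fin.isValue, e, e', this, sub_self, zero_mem]
  · have e : a + Pi.single 2 1 = vec (a 3) (a 2 + 1) (a 1) (a 0) := by
      apply key <;> simp
    have e' : ∑ j : Fin 4 with j < 2, a j = a 0 + a 1 := by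
      rw [show (Finset.univ.filter fun j : Fin 4 => j < 2) = {0, 1} by decide]; simp
    have := h.mon_mul_two hS (a 3) (a 2) (a 1) (a 0)
    rw [vec_eta] at this
    simpa only [Fin.reduceFinMk, Fin.isValue, e, e'] using this
  · have e : a + Pi.single 3 1 = vec (a 3 + 1) (a 2) (a 1) (a 0) := by
      apply key <;> simp
    have e' : ∑ j : Fin 4 with j < 3, a j = a 0 + a 1 + a 2 := by
      rw [show (Finset.univ.filter fun j : Fin 4 => j < 3) = {0, 1, 2} by decide]
      simp [add_assoc]
    have := h.mon_mul_three hS (a 3) (a 2) (a 1) (a 0)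
    rw [vec_eta] at this
    simpa only [Fin.reduceFinMk, Fin.isValue, e, e'] using this

theorem lowerSpan_mul_gen {S : Subalgebra A k} (hS : (q ^ 2)⁻¹ ∈ S) {a : Fin 4 → ℕ} (i : Fin 4)
    {x : R} (hx : x ∈ lowerSpan S u a) : x * u i ∈ lowerSpan S u (a + Pi.single i 1) := by
  induction hx using Submodule.span_induction with
  | mem x hx =>
    obtain ⟨b, hb, hne, rfl⟩ := hx
    have hB : Below (a + Pi.single i 1) (b + Pi.single i 1) := hb.add_right _
    rw [← sub_add_cancel (mon u b * u i)
      (((q ^ 2)⁻¹) ^ (∑ j with j < i, b j) • mon u (b + Pi.single i 1))]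
    refine add_mem (lowerSpan_mono S u hB (h.mon_mul_gen hS b i))
      (smul_mem_of_mem (pow_mem hS _) (mon_mem_lowerSpan S u hB ?_))
    simpa using hne
  | zero => simp
  | add x y _ _ hx hy => rw [add_mul]; exact add_mem hx hy
  | smul c x _ hx => rw [smul_mul_assoc]; exact Submodule.smul_mem _ c hx

theorem lead_mul_gen {S : Subalgebra A k} (hS : (q ^ 2)⁻¹ ∈ S) {a : Fin 4 → ℕ} (i : Fin 4)
    {x : R} {c : k} (hc : c ∈ S) (hx : x - c • mon u a ∈ lowerSpan S u a) :
    x * u i - (c * ((q ^ 2)⁻¹) ^ (∑ j with j < i, a j)) • mon u (a + Pi.single i 1) ∈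
      lowerSpan S u (a + Pi.single i 1) := by
  have h1 := h.lowerSpan_mul_gen hS i hx
  have h2 := smul_mem_of_mem hc (h.mon_mul_gen hS a i)
  have := add_mem h1 h2
  rwa [sub_mul, smul_sub, smul_smul, smul_mul_assoc, sub_add_sub_cancel] at this

theorem lead_mul_pow {S : Subalgebra A k} (hS : (q ^ 2)⁻¹ ∈ S) {a : Fin 4 → ℕ} (i : Fin 4)
    {x : R} {c : k} (hc : c ∈ S) (hx : x - c • mon u a ∈ lowerSpan S u a) (n : ℕ) :
    x * u i ^ n - (c * ((q ^ 2)⁻¹) ^ (n * ∑ j with j < i, a j)) • mon u (a + Pi.single i n) ∈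
      lowerSpan S u (a + Pi.single i n) := by
  induction n with
  | zero => simpa using hx
  | succ n ih =>
    have := h.lead_mul_gen hS i (mul_mem hc (pow_mem hS _)) ih
    have e : ∑ j with j < i, (a + Pi.single i n : Fin 4 → ℕ) j = ∑ j with j < i, a j := by
      refine Finset.sum_congr rfl fun j hj => ?_
      have : j ≠ i := (Finset.mem_filter.1 hj).2.ne
      simp [this]
    rwa [e, add_assoc, ← Pi.single_add, mul_assoc c, ← pow_add, mul_assoc x, ← pow_succ,
      ← Nat.succ_mul] at this

/-- The factors of the second monomial are absorbed one power at a time, in the order u₃, u₂, u₁,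
u₀; each absorption keeps the leading term up to a power of q⁻². -/
theorem mon_mul_mon {S : Subalgebra A k} (hS : (q ^ 2)⁻¹ ∈ S) (a b : Fin 4 → ℕ) :
    ∃ n : ℕ, mon u a * mon u b - ((q ^ 2)⁻¹) ^ n • mon u (a + b) ∈ lowerSpan S u (a + b) := by
  have h0 : mon u a - (1 : k) • mon u a ∈ lowerSpan S u a := by simp
  have h1 := h.lead_mul_pow hS 3 S.one_mem h0 (b 3)
  have h2 := h.lead_mul_pow hS 2 (mul_mem S.one_mem (pow_mem hS _)) h1 (b 2)
  have h3 := h.lead_mul_pow hS 1 (mul_mem (mul_mem S.one_mem (pow_mem hS _)) (pow_mem hS _)) h2 (b 1)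
  have h4 := h.lead_mul_pow hS 0 (mul_mem (mul_mem (mul_mem S.one_mem (pow_mem hS _))
    (pow_mem hS _)) (pow_mem hS _)) h3 (b 0)
  have e : a + Pi.single 3 (b 3) + Pi.single 2 (b 2) + Pi.single 1 (b 1) + Pi.single 0 (b 0) =
      a + b := by
    ext i; fin_cases i <;> simp
  rw [e, one_mul, ← pow_add, ← pow_add, ← pow_add] at h4
  exact ⟨_, by simpa only [mon, mul_assoc] using h4⟩

/-- The product of the generators in the opposite order. -/
theorem reversed_mon {S : Subalgebra A k} (hS : (q ^ 2)⁻¹ ∈ S) (a : Fin 4 → ℕ) :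
    u 0 ^ a 0 * u 1 ^ a 1 * u 2 ^ a 2 * u 3 ^ a 3 -
      ((q ^ 2)⁻¹) ^ (a 1 * a 0 + a 2 * (a 0 + a 1) + a 3 * (a 0 + a 1 + a 2)) • mon u a ∈
        lowerSpan S u a := by
  have h0 : (1 : R) - (1 : k) • mon u 0 ∈ lowerSpan S u 0 := by simp [mon]
  have h1 := h.lead_mul_pow hS 0 S.one_mem h0 (a 0)
  have h2 := h.lead_mul_pow hS 1 (mul_mem S.one_mem (pow_mem hS _)) h1 (a 1)
  have h3 := h.lead_mul_pow hS 2 (mul_mem (mul_mem S.one_mem (pow_mem hS _)) (pow_mem hS _)) h2 (a 2)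
  have h4 := h.lead_mul_pow hS 3 (mul_mem (mul_mem (mul_mem S.one_mem (pow_mem hS _))
    (pow_mem hS _)) (pow_mem hS _)) h3 (a 3)
  have e : (0 : Fin 4 → ℕ) + Pi.single 0 (a 0) + Pi.single 1 (a 1) + Pi.single 2 (a 2) +
      Pi.single 3 (a 3) = a := by
    ext i; fin_cases i <;> simp
  have f2 : (Finset.univ.filter fun j : Fin 4 => j < 2) = {0, 1} := by decide
  have f3 : (Finset.univ.filter fun j : Fin 4 => j < 3) = {0, 1, 2} := by decide
  rw [e] at h4
  simp only [one_mul, ← pow_add] at h4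
  convert h4 using 4
  simp [f2, f3, add_assoc]

/-- The `S`-span of the ordered monomials is a subalgebra. -/
theorem span_mul_mem {S : Subalgebra A k} (hS : (q ^ 2)⁻¹ ∈ S) {x y : R}
    (hx : x ∈ Submodule.span S (Set.range (mon u))) (hy : y ∈ Submodule.span S (Set.range (mon u))) :
    x * y ∈ Submodule.span S (Set.range (mon u)) := by
  induction hx using Submodule.span_induction with
  | zero => simp
  | add x x' _ _ hx hx' => rw [add_mul]; exact add_mem hx hx'
  | smul c x _ hx => rw [smul_mul_assoc]; exact Submodule.smul_mem _ c hx
  | mem x hx =>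
    obtain ⟨a, rfl⟩ := hx
    induction hy using Submodule.span_induction with
    | zero => simp
    | add y y' _ _ hy hy' => rw [mul_add]; exact add_mem hy hy'
    | smul c y _ hy => rw [mul_smul_comm]; exact Submodule.smul_mem _ c hy
    | mem y hy =>
      obtain ⟨b, rfl⟩ := hy
      obtain ⟨n, hn⟩ := h.mon_mul_mon hS a b
      rw [← sub_add_cancel (mon u a * mon u b) (((q ^ 2)⁻¹) ^ n • mon u (a + b))]
      refine add_mem (Submodule.span_mono ?_ hn)
        (smul_mem_of_mem (pow_mem hS _) (Submodule.subset_span ⟨_, rfl⟩))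
      rintro _ ⟨c, -, -, rfl⟩
      exact ⟨c, rfl⟩

end Straightening

end Leading

/-! ### Frozen elements, the recursion element and the exchange relations. -/

section Elements

variable {k R : Type*} [Field k] [Ring R] [Algebra k R]

/-- The first frozen element. -/
def y0 (q : k) (u : Fin 4 → R) : R := (q ^ 2)⁻¹ • (u 2 * u 0 - q ^ 2 • (u 1 * u 1))

/-- The second frozen element. -/
def y1 (q : k) (u : Fin 4 → R) : R := (q ^ 2)⁻¹ • (u 3 * u 1 - q ^ 2 • (u 2 * u 2))

/-- The element by which the three term recursion multiplies. -/
def zz (q : k) (u : Fin 4 → R) : R := (q ^ 2)⁻¹ • (u 3 * u 0 - q ^ 2 • (u 2 * u 1))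

/-- The cluster variables with index at least two, up to a common scalar. -/
def pos (q : k) (u : Fin 4 → R) : ℕ → R
  | 0 => u 2
  | 1 => u 3
  | 2 => q • (zz q u * u 3) - q⁻¹ • (y1 q u * u 2)
  | n + 3 => q • (zz q u * pos q u (n + 2)) - q ^ 4 • (y0 q u * (y1 q u * pos q u (n + 1)))

theorem commute_smul_mul {a x y : R} {c d : k} (hx : x * a = c • (a * x))
    (hy : y * a = d • (a * y)) : x * y * a = (c * d) • (a * (x * y)) := by
  rw [mul_assoc, hy, mul_smul_comm, ← mul_assoc, hx, smul_mul_assoc, smul_smul, mul_assoc,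
    mul_comm d]

theorem commute_smul_sub {a x y : R} {c : k} (hx : x * a = c • (a * x))
    (hy : y * a = c • (a * y)) (d e : k) :
    (d • x - e • y) * a = c • (a * (d • x - e • y)) := by
  rw [sub_mul, smul_mul_assoc, smul_mul_assoc, hx, hy, mul_sub, mul_smul_comm, mul_smul_comm,
    smul_sub, smul_comm d, smul_comm e]

namespace Straightening

variable {q : k} {u : Fin 4 → R} (h : Straightening q u)
include h

/-- This and its companions say that Y₀ and Y₁ quasi-commute with all generators. Both sides are
brought to the same normal order, larger indices first, and coefficients are compared. -/
theorem u0_y0 : u 0 * y0 q u = (q ^ 2)⁻¹ • (y0 q u * u 0) := by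
  have := h.q_ne
  simp only [y0, mul_sub, sub_mul, smul_sub, smul_mul_assoc, mul_smul_comm, mul_assoc, h.swap01,
    h.swap01_assoc, h.swap02_assoc, smul_add]
  match_scalars <;> field_simp <;> ring

theorem u1_y0 : u 1 * y0 q u = (1 : k) • (y0 q u * u 1) := by
  have := h.q_ne
  simp only [y0, mul_sub, sub_mul, smul_sub, smul_mul_assoc, mul_smul_comm, mul_assoc, h.swap01,
    h.swap12_assoc]
  match_scalars <;> field_simp

theorem u2_y0 : u 2 * y0 q u = q ^ 2 • (y0 q u * u 2) := by
  have := h.q_ne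
  simp only [y0, mul_sub, sub_mul, smul_sub, smul_mul_assoc, mul_smul_comm, mul_assoc, h.swap12,
    h.swap02, h.swap12_assoc,
    mul_add, smul_add]
  match_scalars <;> field_simp <;> ring

theorem u3_y0 : u 3 * y0 q u = q ^ 4 • (y0 q u * u 3) := by
  have := h.q_ne
  simp only [y0, mul_sub, sub_mul, smul_sub, smul_mul_assoc, mul_smul_comm, mul_assoc, h.swap12,
    h.swap13, h.swap03, h.swap12_assoc,
    h.swap23_assoc, h.swap13_assoc, mul_add, smul_add]
  match_scalars <;> field_simp <;> ring

theorem u0_y1 : u 0 * y1 q u = (q ^ 4)⁻¹ • (y1 q u * u 0) := by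
  have := h.q_ne
  simp only [y1, mul_sub, sub_mul, smul_sub, smul_mul_assoc, mul_smul_comm, mul_assoc, h.swap01,
    h.swap12, h.swap02, h.swap12_assoc,
    h.swap02_assoc, h.swap03_assoc, mul_add, smul_add]
  match_scalars <;> field_simp <;> ring

theorem u1_y1 : u 1 * y1 q u = (q ^ 2)⁻¹ • (y1 q u * u 1) := by
  have := h.q_ne
  simp only [y1, mul_sub, sub_mul, smul_sub, smul_mul_assoc, mul_smul_comm, mul_assoc, h.swap12,
    h.swap12_assoc,
    h.swap13_assoc, smul_add]
  match_scalars <;> field_simp <;> ring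

theorem u2_y1 : u 2 * y1 q u = (1 : k) • (y1 q u * u 2) := by
  have := h.q_ne
  simp only [y1, mul_sub, sub_mul, smul_sub, smul_mul_assoc, mul_smul_comm, mul_assoc, h.swap12,
    h.swap23_assoc]
  match_scalars <;> field_simp

theorem u3_y1 : u 3 * y1 q u = q ^ 2 • (y1 q u * u 3) := by
  have := h.q_ne
  simp only [y1, mul_sub, sub_mul, smul_sub, smul_mul_assoc, mul_smul_comm, mul_assoc, h.swap23,
    h.swap13, h.swap23_assoc, mul_add, smul_add]
  match_scalars <;> field_simp <;> ring

/-- The two summands u₃u₁ and u₂² of Y₁ have the same quasi-commutation weight with Y₀. -/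
theorem y1_y0 : y1 q u * y0 q u = q ^ 4 • (y0 q u * y1 q u) := by
  have e1 := commute_smul_mul h.u3_y0 h.u1_y0
  have e2 := commute_smul_mul h.u2_y0 h.u2_y0
  rw [mul_one] at e1
  rw [← pow_add] at e2
  have := commute_smul_sub e1 e2 ((q ^ 2)⁻¹) ((q ^ 2)⁻¹ * q ^ 2)
  simpa only [y1, smul_sub, smul_smul] using this

theorem zz_y0 : zz q u * y0 q u = q ^ 2 • (y0 q u * zz q u) := by
  have hq := h.q_ne
  have e1 := commute_smul_mul h.u3_y0 h.u0_y0
  have e2 := commute_smul_mul h.u2_y0 h.u1_y0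
  rw [mul_one] at e2
  rw [show q ^ 4 * (q ^ 2)⁻¹ = q ^ 2 by field_simp] at e1
  have := commute_smul_sub e1 e2 ((q ^ 2)⁻¹) ((q ^ 2)⁻¹ * q ^ 2)
  simpa only [zz, smul_sub, smul_smul] using this

theorem zz_y1 : zz q u * y1 q u = (q ^ 2)⁻¹ • (y1 q u * zz q u) := by
  have hq := h.q_ne
  have e1 := commute_smul_mul h.u3_y1 h.u0_y1
  have e2 := commute_smul_mul h.u2_y1 h.u1_y1
  rw [one_mul] at e2
  rw [show q ^ 2 * (q ^ 4)⁻¹ = (q ^ 2)⁻¹ by field_simp] at e1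
  have := commute_smul_sub e1 e2 ((q ^ 2)⁻¹) ((q ^ 2)⁻¹ * q ^ 2)
  simpa only [zz, smul_sub, smul_smul] using this

/-- The linear recursion at the index 1. Near the indices 1 and 2 both frozen elements enter, one
with each neighbour; this is why the recursion in `pos` takes its uniform shape only later. -/
theorem zz_u1 : zz q u * u 1 = q ^ 2 • (y0 q u * u 2) + (q ^ 2)⁻¹ • (y1 q u * u 0) := by
  have := h.q_ne
  simp only [y0, y1, zz, sub_mul, smul_sub, smul_mul_assoc, mul_smul_comm, mul_assoc,
    h.swap01, h.swap12, h.swap02, h.swap12_assoc,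
    mul_add, smul_add]
  match_scalars <;> field_simp <;> ring

theorem zz_u2 : zz q u * u 2 = q ^ 2 • (y0 q u * u 3) + (q ^ 2)⁻¹ • (y1 q u * u 1) := by
  have := h.q_ne
  simp only [y0, y1, zz, sub_mul, smul_sub, smul_mul_assoc, mul_smul_comm, mul_assoc,
    h.swap12, h.swap02, h.swap13, h.swap03, h.swap12_assoc,
    h.swap23_assoc, h.swap13_assoc, mul_add, smul_add]
  match_scalars <;> field_simp <;> ring

theorem u2_zz : u 2 * zz q u = q ^ 2 • (y0 q u * u 3) + y1 q u * u 1 := by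
  have := h.q_ne
  simp only [y0, y1, zz, mul_sub, sub_mul, smul_sub, smul_mul_assoc, mul_smul_comm, mul_assoc,
    h.swap12, h.swap13, h.swap03, h.swap12_assoc,
    h.swap23_assoc, h.swap13_assoc, mul_add, smul_add]
  match_scalars <;> field_simp <;> ring

theorem pos_two : pos q u 2 = q • (zz q u * u 3) - q⁻¹ • (y1 q u * u 2) := by rw [pos]

theorem pos_succ (n : ℕ) : pos q u (n + 3) = q • (zz q u * pos q u (n + 2)) -
    q ^ 4 • (y0 q u * (y1 q u * pos q u (n + 1))) := by rw [pos]

theorem u3_zz : u 3 * zz q u = q • pos q u 2 + q ^ 2 • (y1 q u * u 2) := by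
  have := h.q_ne
  simp only [pos, y1, zz, mul_sub, sub_mul, smul_sub, smul_mul_assoc, mul_smul_comm, mul_assoc,
    h.swap12, h.swap13, h.swap03, h.swap23_assoc, mul_add, smul_add]
  match_scalars <;> field_simp <;> ring

theorem u1_u3 : u 1 * u 3 = y1 q u + (q ^ 2)⁻¹ • (u 2 * u 2) := by
  have := h.q_ne
  rw [h.swap13, y1]
  match_scalars <;> field_simp <;> ring

/-- `Y₀Y₁` commutes with the recursion element. -/
theorem zz_y0_y1 (x : R) : zz q u * (y0 q u * (y1 q u * x)) = y0 q u * (y1 q u * (zz q u * x)) := by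
  have hq := h.q_ne
  rw [← mul_assoc, h.zz_y0, smul_mul_assoc, mul_assoc, ← mul_assoc (zz q u), h.zz_y1,
    smul_mul_assoc, mul_smul_comm, smul_smul, mul_inv_cancel₀ (pow_ne_zero _ hq), one_smul, mul_assoc]

theorem pos_two_zz : pos q u 2 * zz q u = q • pos q u 3 +
    q ^ 7 • (y0 q u * (y1 q u * pos q u 1)) := by
  have hq := h.q_ne
  have e1 : pos q u 2 * zz q u = q • (zz q u * (u 3 * zz q u)) -
      q⁻¹ • (y1 q u * (u 2 * zz q u)) := by
    rw [pos, sub_mul, smul_mul_assoc, smul_mul_assoc, mul_assoc, mul_assoc]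
  have e2 : zz q u * (y1 q u * u 2) = (q ^ 2)⁻¹ • (y1 q u * (zz q u * u 2)) := by
    rw [← mul_assoc, h.zz_y1, smul_mul_assoc, mul_assoc]
  have e3 : y1 q u * (y0 q u * u 3) = q ^ 4 • (y0 q u * (y1 q u * u 3)) := by
    rw [← mul_assoc, h.y1_y0, smul_mul_assoc, mul_assoc]
  rw [e1, h.u3_zz, h.u2_zz, h.pos_succ 0]
  simp only [mul_add, mul_smul_comm, e2, h.zz_u2, e3, smul_add, zero_add]
  rw [show pos q u 1 = u 3 by rw [pos]]
  match_scalars <;> field_simp <;> ring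

/-- The recursion with z on the right. In the induction the variable is expanded by the left
recursion and the hypothesis is applied to the remaining products with z, using that z commutes with
Y₀Y₁. Two initial cases are separate because `pos q u 2` has its own formula. -/
theorem pos_zz (n : ℕ) : pos q u (n + 2) * zz q u = q • pos q u (n + 3) +
    q ^ 7 • (y0 q u * (y1 q u * pos q u (n + 1))) := by
  have hq := h.q_ne
  induction n using Nat.strong_induction_on with
  | _ n ih =>
    match n with
    | 0 => exact h.pos_two_zz
    | 1 =>
      have e1 : pos q u 3 * zz q u = q • (zz q u * (pos q u 2 * zz q u)) -
          q ^ 4 • (y0 q u * (y1 q u * (pos q u 1 * zz q u))) := by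
        rw [h.pos_succ 0]
        simp only [sub_mul, smul_mul_assoc, mul_assoc, zero_add]
      have e2 := h.pos_succ 1
      have e3 := h.pos_two
      simp only [Nat.reduceAdd] at e2 ⊢
      rw [e1, h.pos_two_zz, show pos q u 1 = u 3 by rw [pos], h.u3_zz, e2]
      simp only [mul_add, mul_smul_comm, h.zz_y0_y1, smul_add]
      have e4 : zz q u * u 3 = q⁻¹ • pos q u 2 + (q ^ 2)⁻¹ • (y1 q u * u 2) := by
        rw [e3]; match_scalars <;> field_simp <;> ring
      rw [e4]
      simp only [mul_add, mul_smul_comm]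
      match_scalars <;> field_simp <;> ring
    | m + 2 =>
      have i1 := ih (m + 1) (by omega)
      have i2 := ih m (by omega)
      have e1 : pos q u (m + 4) * zz q u = q • (zz q u * (pos q u (m + 3) * zz q u)) -
          q ^ 4 • (y0 q u * (y1 q u * (pos q u (m + 2) * zz q u))) := by
        rw [h.pos_succ (m + 1)]
        simp only [sub_mul, smul_mul_assoc, mul_assoc, add_assoc, Nat.reduceAdd]
      have e2 := h.pos_succ (m + 2)
      have e3 : zz q u * pos q u (m + 2) = q⁻¹ • pos q u (m + 3) +
          q ^ 3 • (y0 q u * (y1 q u * pos q u (m + 1))) := by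
        rw [h.pos_succ m]
        match_scalars <;> field_simp <;> ring
      simp only [add_assoc, Nat.reduceAdd] at i1 i2 e1 e2 ⊢
      rw [e1, i1, i2, e2]
      simp only [mul_add, mul_smul_comm, h.zz_y0_y1, smul_add, e3]
      match_scalars <;> field_simp <;> ring

theorem pos_y0 (n : ℕ) : pos q u n * y0 q u = q ^ (2 * n + 2) • (y0 q u * pos q u n) := by
  have hq := h.q_ne
  induction n using Nat.strong_induction_on with
  | _ n ih =>
    match n with
    | 0 => exact h.u2_y0
    | 1 => exact h.u3_y0
    | 2 =>
      have e1 := commute_smul_mul h.zz_y0 h.u3_y0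
      have e2 := commute_smul_mul h.y1_y0 h.u2_y0
      rw [← pow_add] at e1 e2
      exact commute_smul_sub e1 e2 _ _
    | m + 3 =>
      have e1 := commute_smul_mul h.zz_y0 (ih (m + 2) (by omega))
      have e0 : y0 q u * y0 q u = (1 : k) • (y0 q u * y0 q u) := (one_smul _ _).symm
      have e2 := commute_smul_mul e0 (commute_smul_mul h.y1_y0 (ih (m + 1) (by omega)))
      rw [one_mul, ← pow_add] at e2
      rw [← pow_add] at e1
      have e3 : 2 + (2 * (m + 2) + 2) = 2 * (m + 3) + 2 := by ring
      have e4 : 4 + (2 * (m + 1) + 2) = 2 * (m + 3) + 2 := by ring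
      rw [e3] at e1
      rw [e4] at e2
      rw [h.pos_succ]
      exact commute_smul_sub e1 e2 _ _

theorem pos_y1 (n : ℕ) : pos q u (n + 1) * y1 q u =
    (q ^ 2 * ((q ^ 2)⁻¹) ^ n) • (y1 q u * pos q u (n + 1)) := by
  have hq := h.q_ne
  induction n using Nat.strong_induction_on with
  | _ n ih =>
    match n with
    | 0 => rw [pow_zero, mul_one]; exact h.u3_y1
    | 1 =>
      have e0 : y1 q u * y1 q u = (1 : k) • (y1 q u * y1 q u) := (one_smul _ _).symm
      have e1 := commute_smul_mul h.zz_y1 h.u3_y1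
      have e2 := commute_smul_mul e0 h.u2_y1
      rw [inv_mul_cancel₀ (pow_ne_zero _ hq)] at e1
      rw [mul_one] at e2
      rw [pow_one, mul_inv_cancel₀ (pow_ne_zero _ hq)]
      exact commute_smul_sub e1 e2 _ _
    | m + 2 =>
      have e1 := commute_smul_mul h.zz_y1 (ih (m + 1) (by omega))
      have e0 : y1 q u * y1 q u = (1 : k) • (y1 q u * y1 q u) := (one_smul _ _).symm
      have e00 : y0 q u * y1 q u = (q ^ 4)⁻¹ • (y1 q u * y0 q u) := by
        rw [h.y1_y0, smul_smul, inv_mul_cancel₀ (pow_ne_zero _ hq), one_smul]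
      have e2 := commute_smul_mul e00 (commute_smul_mul e0 (ih m (by omega)))
      have e3 : (q ^ 2)⁻¹ * (q ^ 2 * ((q ^ 2)⁻¹) ^ (m + 1)) = q ^ 2 * ((q ^ 2)⁻¹) ^ (m + 2) := by
        ring
      have e4 : (q ^ 4)⁻¹ * (1 * (q ^ 2 * ((q ^ 2)⁻¹) ^ m)) = q ^ 2 * ((q ^ 2)⁻¹) ^ (m + 2) := by
        ring
      rw [e3] at e1
      rw [e4] at e2
      rw [h.pos_succ]
      exact commute_smul_sub e1 e2 _ _

/-- The product `Y₀Y₁` moved through a cluster variable. -/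
theorem pos_y0_y1 (n : ℕ) (x : R) : pos q u (n + 1) * (y0 q u * (y1 q u * x)) =
    q ^ 6 • (y0 q u * (y1 q u * (pos q u (n + 1) * x))) := by
  have hq := h.q_ne
  rw [← mul_assoc, h.pos_y0, smul_mul_assoc, mul_assoc, ← mul_assoc (pos q u (n + 1)), h.pos_y1,
    smul_mul_assoc, mul_smul_comm, smul_smul, mul_assoc]
  congr 1
  rw [inv_pow, ← pow_mul, show 2 * (n + 1) + 2 = 4 + 2 * n by ring, pow_add]
  field_simp

/-- Expand the later variable by the left recursion, move z to the other side by `pos_zz`, and use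
the relation for the preceding pair. -/
theorem pos_comm (n : ℕ) : pos q u (n + 1) * pos q u (n + 2) =
    q ^ 2 • (pos q u (n + 2) * pos q u (n + 1)) := by
  have hq := h.q_ne
  induction n with
  | zero =>
    have e1 : u 3 * (y1 q u * u 2) = q ^ 4 • (y1 q u * (u 2 * u 3)) := by
      rw [← mul_assoc, h.u3_y1, smul_mul_assoc, mul_assoc, h.rel32, mul_smul_comm, smul_smul,
        ← pow_add]
    have e2 : u 3 * pos q u 2 = q • (u 3 * zz q u * u 3) - q⁻¹ • (u 3 * (y1 q u * u 2)) := by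
      rw [pos, mul_sub, mul_smul_comm, mul_smul_comm, mul_assoc]
    rw [show pos q u (0 + 1) = u 3 by rw [zero_add, pos], zero_add, e2, h.u3_zz, e1]
    simp only [add_mul, smul_mul_assoc, smul_add, mul_assoc]
    match_scalars <;> field_simp <;> ring
  | succ n ih =>
    simp only [add_assoc, Nat.reduceAdd]
    have e1 : pos q u (n + 2) * pos q u (n + 3) = q • (pos q u (n + 2) * zz q u * pos q u (n + 2)) -
        q ^ 4 • (pos q u (n + 2) * (y0 q u * (y1 q u * pos q u (n + 1)))) := by
      rw [h.pos_succ, mul_sub, mul_smul_comm, mul_smul_comm, mul_assoc]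
    rw [e1, h.pos_zz, h.pos_y0_y1 (n + 1)]
    simp only [add_mul, smul_mul_assoc, smul_add, mul_assoc, ih, mul_smul_comm]
    match_scalars <;> field_simp <;> ring

/-- The boundary exchange relation, for X₂X₄: here the square of X₃ still carries a factor Y₀, which
disappears from X₃X₅ on. -/
theorem exchange_two : u 2 * pos q u 2 = q ^ 3 • (y0 q u * (u 3 * u 3)) +
    q • (y1 q u * y1 q u) := by
  have hq := h.q_ne
  have e1 : u 2 * pos q u 2 = q • (u 2 * zz q u * u 3) - q⁻¹ • (u 2 * y1 q u * u 2) := by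
    rw [pos, mul_sub, mul_smul_comm, mul_smul_comm, mul_assoc, mul_assoc]
  rw [e1, h.u2_zz, h.u2_y1]
  simp only [add_mul, smul_mul_assoc, smul_add, mul_assoc, h.u1_u3, mul_add, mul_smul_comm]
  match_scalars <;> field_simp <;> ring

/-- As for the Casoratian of a second order recurrence: by the two forms of the recursion, the
defect of the relation at n + 1 is q⁸Y₀Y₁ times the defect at n, where the defect is the product of
the outer variables minus q² times the square of the middle one. The start is `exchange_two`. -/
theorem exchange_pos (n : ℕ) : pos q u (n + 1) * pos q u (n + 3) =
    q ^ 2 • (pos q u (n + 2) * pos q u (n + 2)) +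
      q ^ (2 * ((n + 1) * (n + 2))) • (y0 q u ^ n * y1 q u ^ (n + 3)) := by
  have hq := h.q_ne
  have e1 : ∀ n, pos q u (n + 1) * pos q u (n + 3) =
      q • (pos q u (n + 1) * zz q u * pos q u (n + 2)) -
        q ^ 4 • (pos q u (n + 1) * (y0 q u * (y1 q u * pos q u (n + 1)))) := by
    intro n
    rw [h.pos_succ, mul_sub, mul_smul_comm, mul_smul_comm, mul_assoc]
  induction n with
  | zero =>
    have e3 : y1 q u * (y0 q u * (u 3 * u 3)) = q ^ 4 • (y0 q u * (y1 q u * (u 3 * u 3))) := by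
      rw [← mul_assoc, h.y1_y0, smul_mul_assoc, mul_assoc]
    have e2 := e1 0
    rw [h.pos_y0_y1 0] at e2
    rw [e2]
    rw [show pos q u (0 + 1) = u 3 by rw [zero_add, pos], zero_add, h.u3_zz]
    simp only [add_mul, smul_mul_assoc, mul_assoc, h.exchange_two, mul_add, mul_smul_comm, e3,
      smul_add, pow_zero, one_mul, pow_succ]
    match_scalars <;> field_simp <;> ring
  | succ n ih =>
    simp only [add_assoc, Nat.reduceAdd] at ih ⊢
    have e2 := e1 (n + 1)
    rw [h.pos_y0_y1 (n + 1)] at e2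
    have e3 : y1 q u * (y0 q u ^ n * y1 q u ^ (n + 3)) =
        q ^ (4 * n) • (y0 q u ^ n * y1 q u ^ (n + 4)) := by
      have := pow_mul_pow_of_mul_eq_smul h.y1_y0 1 n
      rw [pow_one, one_mul] at this
      rw [← mul_assoc, this, smul_mul_assoc, mul_assoc, ← pow_succ', ← pow_mul]
    have e4 : y0 q u * (y0 q u ^ n * y1 q u ^ (n + 4)) = y0 q u ^ (n + 1) * y1 q u ^ (n + 4) := by
      rw [← mul_assoc, ← pow_succ']
    simp only [add_assoc, Nat.reduceAdd] at e2
    rw [e2, h.pos_zz]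
    simp only [add_mul, smul_mul_assoc, mul_assoc, ih, mul_add, mul_smul_comm, smul_add, e3, e4]
    match_scalars <;> field_simp <;> ring

end Straightening

end Elements

/-! ## Root vectors in the quantized enveloping algebra -/

section Enveloping

variable {k U : Type*} [Field k] [Ring U] [Algebra k U]

/-- Relations of Chevalley generators `a = E₁`, `y = E₂`, `f = F₁`, `g = F₂`, `K = K₁`, `L = K₂`
with inverses `K'`, `L'`, solved for normal ordering. -/
structure ChevalleyRelations (q : k) (a y f g K L K' L' : U) : Prop where
  q_ne : q ≠ 0
  q_sq_ne : q ^ 2 ≠ 1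
  two_ne : q ^ 2 + 1 ≠ 0
  KK' : K * K' = 1
  K'K : K' * K = 1
  LL' : L * L' = 1
  L'L : L' * L = 1
  LK : L * K = K * L
  Ka : K * a = q ^ 2 • (a * K)
  Ky : K * y = (q ^ 2)⁻¹ • (y * K)
  La : L * a = (q ^ 2)⁻¹ • (a * L)
  Ly : L * y = q ^ 2 • (y * L)
  Kf : K * f = (q ^ 2)⁻¹ • (f * K)
  Kg : K * g = q ^ 2 • (g * K)
  Lf : L * f = q ^ 2 • (f * L)
  Lg : L * g = (q ^ 2)⁻¹ • (g * L)
  fa : f * a = a * f - (q - q⁻¹)⁻¹ • (K - K')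
  fy : f * y = y * f
  ga : g * a = a * g
  gy : g * y = y * g - (q - q⁻¹)⁻¹ • (L - L')
  serre_ay : a ^ 3 * y - (q ^ 2 + 1 + (q ^ 2)⁻¹) • (a ^ 2 * y * a) +
    (q ^ 2 + 1 + (q ^ 2)⁻¹) • (a * y * a ^ 2) - y * a ^ 3 = 0
  serre_ya : y ^ 3 * a - (q ^ 2 + 1 + (q ^ 2)⁻¹) • (y ^ 2 * a * y) +
    (q ^ 2 + 1 + (q ^ 2)⁻¹) • (y * a * y ^ 2) - a * y ^ 3 = 0
  serre_fg : f ^ 3 * g - (q ^ 2 + 1 + (q ^ 2)⁻¹) • (f ^ 2 * g * f) +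
    (q ^ 2 + 1 + (q ^ 2)⁻¹) • (f * g * f ^ 2) - g * f ^ 3 = 0

theorem inv_mul_of_mul_eq_smul {K K' x : U} {c : k} (hc : c ≠ 0) (h1 : K * K' = 1)
    (h2 : K' * K = 1) (h : K * x = c • (x * K)) : K' * x = c⁻¹ • (x * K') := by
  have : K' * (K * x) * K' = K' * (c • (x * K)) * K' := by rw [h]
  rw [← mul_assoc, h2, one_mul, mul_smul_comm, smul_mul_assoc, mul_assoc, mul_assoc, h1,
    mul_one] at this
  rw [this, smul_smul, inv_mul_cancel₀ hc, one_smul]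

theorem assoc_of_mul_eq_smul {A B : U} {c : k} (h : A * B = c • (B * A)) (x : U) :
    A * (B * x) = c • (B * (A * x)) := by
  rw [← mul_assoc, h, smul_mul_assoc, mul_assoc]

namespace ChevalleyRelations

variable {q : k} {a y f g K L K' L' : U} (h : ChevalleyRelations q a y f g K L K' L')
include h

theorem sq_sub_one_ne : q ^ 2 - 1 ≠ 0 := sub_ne_zero.2 h.q_sq_ne

theorem K'a : K' * a = (q ^ 2)⁻¹ • (a * K') :=
  inv_mul_of_mul_eq_smul (pow_ne_zero _ h.q_ne) h.KK' h.K'K h.Ka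
theorem K'y : K' * y = q ^ 2 • (y * K') := by
  simpa using inv_mul_of_mul_eq_smul (inv_ne_zero (pow_ne_zero _ h.q_ne)) h.KK' h.K'K h.Ky
theorem L'a : L' * a = q ^ 2 • (a * L') := by
  simpa using inv_mul_of_mul_eq_smul (inv_ne_zero (pow_ne_zero _ h.q_ne)) h.LL' h.L'L h.La
theorem L'y : L' * y = (q ^ 2)⁻¹ • (y * L') :=
  inv_mul_of_mul_eq_smul (pow_ne_zero _ h.q_ne) h.LL' h.L'L h.Ly
theorem K'f : K' * f = q ^ 2 • (f * K') := by
  simpa using inv_mul_of_mul_eq_smul (inv_ne_zero (pow_ne_zero _ h.q_ne)) h.KK' h.K'K h.Kf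
theorem K'g : K' * g = (q ^ 2)⁻¹ • (g * K') :=
  inv_mul_of_mul_eq_smul (pow_ne_zero _ h.q_ne) h.KK' h.K'K h.Kg
theorem L'f : L' * f = (q ^ 2)⁻¹ • (f * L') :=
  inv_mul_of_mul_eq_smul (pow_ne_zero _ h.q_ne) h.LL' h.L'L h.Lf
theorem LK' : L * K' = K' * L := by
  have : K * L = (1 : k) • (L * K) := by rw [one_smul, h.LK]
  simpa using (inv_mul_of_mul_eq_smul one_ne_zero h.KK' h.K'K this).symm
theorem L'K : L' * K = K * L' := by
  have : L * K = (1 : k) • (K * L) := by rw [one_smul, h.LK]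
  simpa using inv_mul_of_mul_eq_smul one_ne_zero h.LL' h.L'L this
theorem L'K' : L' * K' = K' * L' := by
  have : L * K' = (1 : k) • (K' * L) := by rw [one_smul, h.LK']
  simpa using inv_mul_of_mul_eq_smul one_ne_zero h.LL' h.L'L this

theorem fa_assoc (x : U) : f * (a * x) = a * (f * x) - (q - q⁻¹)⁻¹ • (K * x - K' * x) := by
  rw [← mul_assoc, h.fa, sub_mul, mul_assoc, smul_mul_assoc, sub_mul]
theorem fy_assoc (x : U) : f * (y * x) = y * (f * x) := by
  rw [← mul_assoc, h.fy, mul_assoc]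
theorem ga_assoc (x : U) : g * (a * x) = a * (g * x) := by
  rw [← mul_assoc, h.ga, mul_assoc]
theorem gy_assoc (x : U) : g * (y * x) = y * (g * x) - (q - q⁻¹)⁻¹ • (L * x - L' * x) := by
  rw [← mul_assoc, h.gy, sub_mul, mul_assoc, smul_mul_assoc, sub_mul]

/-- `ψ = ya - q⁻²ay` and its commutator with `f`. -/
theorem psi_f {ψ : U} (hψ : ψ = y * a - (q ^ 2)⁻¹ • (a * y)) :
    ψ * f = f * ψ + ((q ^ 2)⁻¹ * (q + q⁻¹)) • (y * K) := by
  have := h.q_ne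
  have := h.sq_sub_one_ne
  subst hψ
  simp only [mul_sub, sub_mul, mul_add, mul_smul_comm, smul_mul_assoc, mul_assoc,
    h.fa, h.fy, h.fa_assoc, h.fy_assoc, h.Ky, h.K'y, smul_sub, smul_smul]
  match_scalars <;> field_simp <;> ring

theorem psi_g {ψ : U} (hψ : ψ = y * a - (q ^ 2)⁻¹ • (a * y)) :
    ψ * g = g * ψ - (q + q⁻¹) • (a * L') := by
  have := h.q_ne
  have := h.sq_sub_one_ne
  subst hψ
  simp only [mul_sub, sub_mul, mul_smul_comm, smul_mul_assoc, mul_assoc,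
    h.ga, h.gy, h.ga_assoc, h.gy_assoc, h.La, h.L'a, smul_sub, smul_smul]
  match_scalars <;> field_simp <;> ring

theorem K_psi {ψ : U} (hψ : ψ = y * a - (q ^ 2)⁻¹ • (a * y)) : K * ψ = ψ * K := by
  have := h.q_ne
  subst hψ
  simp only [mul_sub, sub_mul, mul_smul_comm, smul_mul_assoc, mul_assoc, h.Ka, h.Ky,
    assoc_of_mul_eq_smul h.Ka, assoc_of_mul_eq_smul h.Ky, smul_smul]
  match_scalars <;> field_simp

theorem K'_psi {ψ : U} (hψ : ψ = y * a - (q ^ 2)⁻¹ • (a * y)) : K' * ψ = ψ * K' := by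
  have := h.q_ne
  subst hψ
  simp only [mul_sub, sub_mul, mul_smul_comm, smul_mul_assoc, mul_assoc, h.K'a, h.K'y,
    assoc_of_mul_eq_smul h.K'a, assoc_of_mul_eq_smul h.K'y, smul_smul]
  match_scalars <;> field_simp

theorem L_psi {ψ : U} (hψ : ψ = y * a - (q ^ 2)⁻¹ • (a * y)) : L * ψ = ψ * L := by
  have := h.q_ne
  subst hψ
  simp only [mul_sub, sub_mul, mul_smul_comm, smul_mul_assoc, mul_assoc, h.La, h.Ly,
    assoc_of_mul_eq_smul h.La, assoc_of_mul_eq_smul h.Ly, smul_smul]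
  match_scalars <;> field_simp

theorem L'_psi {ψ : U} (hψ : ψ = y * a - (q ^ 2)⁻¹ • (a * y)) : L' * ψ = ψ * L' := by
  have := h.q_ne
  subst hψ
  simp only [mul_sub, sub_mul, mul_smul_comm, smul_mul_assoc, mul_assoc, h.L'a, h.L'y,
    assoc_of_mul_eq_smul h.L'a, assoc_of_mul_eq_smul h.L'y, smul_smul]
  match_scalars <;> field_simp

/-- The commutator with f lowers the string: a single term of the weight of ψ survives. Together
with the commutator with g it determines the commutators with the negative root vectors. -/
theorem w1_f {ψ w₁ : U} (hψ : ψ = y * a - (q ^ 2)⁻¹ • (a * y)) (hw : w₁ = ψ * a - a * ψ) :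
    w₁ * f = f * w₁ + (q + q⁻¹) • (ψ * K) := by
  have := h.q_ne
  have := h.sq_sub_one_ne
  have e1 := h.psi_f hψ
  have e2 := h.K_psi hψ
  have e3 := h.K'_psi hψ
  have e4 : a * f = f * a + (q - q⁻¹)⁻¹ • (K - K') := by rw [h.fa]; abel
  have e5 : a * (f * ψ) = f * (a * ψ) + (q - q⁻¹)⁻¹ • (ψ * K - ψ * K') := by
    rw [← mul_assoc, e4, add_mul, mul_assoc, smul_mul_assoc, sub_mul, e2, e3]
  have e6 : ψ * (f * a) = f * (ψ * a) + ((q ^ 2)⁻¹ * (q + q⁻¹)) • (y * (K * a)) := by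
    rw [← mul_assoc, e1, add_mul, mul_assoc, smul_mul_assoc, mul_assoc]
  subst hw
  simp only [sub_mul, mul_sub, mul_assoc, e1, e4, mul_add, mul_smul_comm, e5, e6, h.Ka]
  rw [show (q + q⁻¹) • (ψ * K) = (q + q⁻¹) • (y * (a * K)) -
    ((q + q⁻¹) * (q ^ 2)⁻¹) • (a * (y * K)) by
      rw [hψ, sub_mul, smul_mul_assoc, mul_assoc, mul_assoc]; module]
  match_scalars <;> field_simp <;> ring

theorem w1_g {ψ w₁ : U} (hψ : ψ = y * a - (q ^ 2)⁻¹ • (a * y)) (hw : w₁ = ψ * a - a * ψ) :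
    w₁ * g = g * w₁ - ((q + q⁻¹) * (q ^ 2 - 1)) • (a * (a * L')) := by
  have e1 := h.psi_g hψ
  have e4 : a * g = g * a := h.ga.symm
  have e5 : a * (g * ψ) = g * (a * ψ) := by rw [← mul_assoc, e4, mul_assoc]
  have e6 : ψ * (g * a) = g * (ψ * a) - (q + q⁻¹) • (a * (L' * a)) := by
    rw [← mul_assoc, e1, sub_mul, mul_assoc, smul_mul_assoc, mul_assoc]
  subst hw
  simp only [sub_mul, mul_sub, mul_assoc, e1, e4, mul_smul_comm, e5, e6, h.L'a]
  module

theorem w1_phi {ψ w₁ φ : U} (hψ : ψ = y * a - (q ^ 2)⁻¹ • (a * y)) (hw : w₁ = ψ * a - a * ψ)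
    (hφ : φ = f * g - q ^ 2 • (g * f)) :
    w₁ * φ = φ * w₁ - ((q + q⁻¹) ^ 2) • (a * (K' * L')) := by
  have := h.q_ne
  have := h.sq_sub_one_ne
  have e1 := h.w1_f hψ hw
  have e2 := h.w1_g hψ hw
  have e1' (x : U) : w₁ * (f * x) = f * (w₁ * x) + (q + q⁻¹) • (ψ * (K * x)) := by
    rw [← mul_assoc, e1, add_mul, smul_mul_assoc, mul_assoc, mul_assoc]
  have e2' (x : U) : w₁ * (g * x) = g * (w₁ * x) -
      ((q + q⁻¹) * (q ^ 2 - 1)) • (a * (a * (L' * x))) := by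
    rw [← mul_assoc, e2, sub_mul, smul_mul_assoc, mul_assoc, mul_assoc, mul_assoc]
  have e3 : ψ * (g * K) = g * (ψ * K) - (q + q⁻¹) • (a * (L' * K)) := by
    rw [← mul_assoc, h.psi_g hψ, sub_mul, mul_assoc, smul_mul_assoc, mul_assoc]
  subst hφ
  simp only [sub_mul, mul_sub, mul_smul_comm, smul_mul_assoc, mul_assoc, e1, e2, e1', e2', h.Kg,
    mul_add, e3, h.fa_assoc, h.L'f, smul_sub, smul_add, smul_smul, h.L'K,
    assoc_of_mul_eq_smul h.Ka, assoc_of_mul_eq_smul h.K'a]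
  match_scalars <;> field_simp <;> ring

theorem psi_phi {ψ φ : U} (hψ : ψ = y * a - (q ^ 2)⁻¹ • (a * y))
    (hφ : φ = f * g - q ^ 2 • (g * f)) :
    ψ * φ = φ * ψ + ((q + q⁻¹) * (q - q⁻¹)⁻¹) • (K * L - K' * L') := by
  have := h.q_ne
  have := h.sq_sub_one_ne
  have e1 := h.psi_f hψ
  have e2 := h.psi_g hψ
  have e1' (x : U) : ψ * (f * x) = f * (ψ * x) + ((q ^ 2)⁻¹ * (q + q⁻¹)) • (y * (K * x)) := by
    rw [← mul_assoc, e1, add_mul, smul_mul_assoc, mul_assoc, mul_assoc]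
  have e2' (x : U) : ψ * (g * x) = g * (ψ * x) - (q + q⁻¹) • (a * (L' * x)) := by
    rw [← mul_assoc, e2, sub_mul, smul_mul_assoc, mul_assoc, mul_assoc]
  subst hφ
  simp only [sub_mul, mul_sub, mul_smul_comm, smul_mul_assoc, mul_assoc, e1, e2, e1', e2', h.Kg,
    mul_add, h.fa_assoc, h.gy_assoc, h.L'f, smul_sub, smul_add, smul_smul, h.L'K, h.LK]
  match_scalars <;> field_simp <;> ring

/-- The commutator of the second root vector with its negative. -/
theorem w1_G {ψ w₁ φ G : U} (hψ : ψ = y * a - (q ^ 2)⁻¹ • (a * y)) (hw : w₁ = ψ * a - a * ψ)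
    (hφ : φ = f * g - q ^ 2 • (g * f)) (hG : G = f * φ - φ * f) :
    w₁ * G = G * w₁ +
      ((q + q⁻¹) ^ 2 * (q - q⁻¹)⁻¹) • (K * (K * L) - K' * (K' * L')) := by
  have := h.q_ne
  have := h.sq_sub_one_ne
  have e1 := h.w1_f hψ hw
  have e2 := h.w1_phi hψ hw hφ
  have e1' (x : U) : w₁ * (f * x) = f * (w₁ * x) + (q + q⁻¹) • (ψ * (K * x)) := by
    rw [← mul_assoc, e1, add_mul, smul_mul_assoc, mul_assoc, mul_assoc]
  have e2' (x : U) : w₁ * (φ * x) = φ * (w₁ * x) - ((q + q⁻¹) ^ 2) • (a * (K' * (L' * x))) := by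
    rw [← mul_assoc, e2, sub_mul, smul_mul_assoc, mul_assoc, mul_assoc, mul_assoc]
  have e3 : K * φ = φ * K := by
    subst hφ
    simp only [mul_sub, sub_mul, mul_smul_comm, smul_mul_assoc, mul_assoc, h.Kf, h.Kg,
      assoc_of_mul_eq_smul h.Kf, assoc_of_mul_eq_smul h.Kg, smul_smul]
    match_scalars <;> field_simp
  have e4 : ψ * (φ * K) = φ * (ψ * K) +
      ((q + q⁻¹) * (q - q⁻¹)⁻¹) • (K * (L * K) - K' * (L' * K)) := by
    rw [← mul_assoc, h.psi_phi hψ hφ, add_mul, mul_assoc, smul_mul_assoc, sub_mul, mul_assoc,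
      mul_assoc]
  subst hG
  have c1 : K' * (L' * K) = L' := by rw [h.L'K, ← mul_assoc, h.K'K, one_mul]
  have c2 : K * (K' * L') = L' := by rw [← mul_assoc, h.KK', one_mul]
  simp only [sub_mul, mul_sub, mul_assoc, e1, e2, e1', e2', e3, mul_add, e4, mul_smul_comm,
    h.L'f, h.fa_assoc, assoc_of_mul_eq_smul h.K'f, smul_smul, smul_sub, smul_add,
    h.LK, c1, c2]
  match_scalars <;> field_simp <;> ring

/-- G is an iterated q-commutator of f and g, so this is the Serre relation written as a
q-commutation. -/
theorem f_G {φ G : U} (hφ : φ = f * g - q ^ 2 • (g * f)) (hG : G = f * φ - φ * f) :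
    f * G = (q ^ 2)⁻¹ • (G * f) := by
  have := h.q_ne
  have e := h.serre_fg
  rw [← sub_eq_zero]
  refine Eq.trans ?_ e
  subst hG; subst hφ
  simp only [sub_mul, mul_sub, mul_smul_comm, smul_mul_assoc, mul_assoc, smul_sub, smul_smul,
    pow_succ, pow_zero, one_mul]
  match_scalars <;> field_simp <;> ring

end ChevalleyRelations

end Enveloping

/-! ### From the string generated by ψ to the straightening relations. -/

section RootVectors

variable {k U : Type*} [Field k] [Ring U] [Algebra k U]

/-- A `q`-commutation relation propagates along the string `w₀, w₁ = [ψ, w₀], …`. -/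
theorem commutation_step {q c : k} (hc : c ≠ 0) (h2 : (2 : k) ≠ 0) {ψ η w₀ w₁ w₂ w₃ : U}
    (h1 : ψ * w₀ = w₀ * ψ + w₁) (h12 : ψ * w₁ = w₁ * ψ + w₂) (h23 : ψ * w₂ = w₂ * ψ + w₃)
    (e0 : η * w₀ = w₀ * η + c • w₂) (e1 : η * w₁ = w₁ * η + c • w₃)
    (h : w₁ * w₀ = q ^ 2 • (w₀ * w₁)) : w₂ * w₁ = q ^ 2 • (w₁ * w₂) := by
  -- The commutator with η, which shifts by two, applied to the known relation `h`.
  have A : c • (w₃ * w₀ + w₁ * w₂) = c • (q ^ 2 • (w₂ * w₁ + w₀ * w₃)) := by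
    have f1 : η * (w₁ * w₀) = w₁ * w₀ * η + (c • (w₁ * w₂) + c • (w₃ * w₀)) := by
      rw [← mul_assoc, e1, add_mul, mul_assoc, e0, mul_add, mul_smul_comm, smul_mul_assoc,
        ← mul_assoc, add_assoc]
    have f2 : η * (w₀ * w₁) = w₀ * w₁ * η + (c • (w₀ * w₃) + c • (w₂ * w₁)) := by
      rw [← mul_assoc, e0, add_mul, mul_assoc, e1, mul_add, mul_smul_comm, smul_mul_assoc,
        ← mul_assoc, add_assoc]
    have f3 : η * (w₁ * w₀) = q ^ 2 • (η * (w₀ * w₁)) := by rw [h, mul_smul_comm]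
    have f4 : w₁ * w₀ * η = q ^ 2 • (w₀ * w₁ * η) := by rw [h, smul_mul_assoc]
    linear_combination (norm := module) f3 - f1 + q ^ 2 • f2 - f4
  have B1 : w₂ * w₀ + w₁ * w₁ = q ^ 2 • (w₁ * w₁ + w₀ * w₂) := by
    have : ψ * (w₁ * w₀) = ψ * (q ^ 2 • (w₀ * w₁)) := by rw [h]
    rw [← mul_assoc, h12, add_mul, mul_assoc, h1, mul_add, mul_smul_comm, ← mul_assoc ψ, h1,
      add_mul, mul_assoc w₀, h12, mul_add, ← mul_assoc w₁, h, ← mul_assoc w₀] at this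
    simp only [smul_add, smul_mul_assoc] at this ⊢
    rw [← sub_eq_zero] at this ⊢
    rw [← this]
    module
  -- The commutator with ψ applied once more to `B1`, hence twice to `h`. It involves w₃w₀ and w₀w₃
  -- exactly as in `A`.
  have B : w₃ * w₀ + w₂ * w₁ + (w₂ * w₁ + w₁ * w₂) =
      q ^ 2 • (w₂ * w₁ + w₁ * w₂ + (w₁ * w₂ + w₀ * w₃)) := by
    have : ψ * (w₂ * w₀ + w₁ * w₁) = ψ * (q ^ 2 • (w₁ * w₁ + w₀ * w₂)) := by rw [B1]
    have f1 : ψ * (w₂ * w₀) = w₂ * w₀ * ψ + (w₃ * w₀ + w₂ * w₁) := by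
      rw [← mul_assoc, h23, add_mul, mul_assoc, h1, mul_add, ← mul_assoc]; abel
    have f2 : ψ * (w₁ * w₁) = w₁ * w₁ * ψ + (w₂ * w₁ + w₁ * w₂) := by
      rw [← mul_assoc, h12, add_mul, mul_assoc, h12, mul_add, ← mul_assoc]; abel
    have f3 : ψ * (w₀ * w₂) = w₀ * w₂ * ψ + (w₁ * w₂ + w₀ * w₃) := by
      rw [← mul_assoc, h1, add_mul, mul_assoc, h23, mul_add, ← mul_assoc]; abel
    have f4 : w₂ * w₀ * ψ + w₁ * w₁ * ψ = q ^ 2 • (w₁ * w₁ * ψ + w₀ * w₂ * ψ) := by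
      rw [← add_mul, B1, smul_mul_assoc, add_mul]
    rw [mul_smul_comm, mul_add, mul_add] at this
    linear_combination (norm := module) this - f1 - f2 + q ^ 2 • f2 + q ^ 2 • f3 - f4
  have A' : w₃ * w₀ + w₁ * w₂ = q ^ 2 • (w₂ * w₁ + w₀ * w₃) := smul_right_injective U hc A
  -- Subtracting the η-identity from the twofold ψ-identity cancels all products of w₀ and w₃.
  have : (2 : k) • (w₂ * w₁) = (2 : k) • (q ^ 2 • (w₁ * w₂)) := by
    linear_combination (norm := module) B - A'
  exact smul_right_injective U h2 this

/-- The straightening relations of four consecutive elements of a string. -/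
theorem straightening_of_string {q : k} (hq : q ≠ 0) {ψ : U} {w : Fin 4 → U}
    (h1 : ψ * w 0 = w 0 * ψ + w 1) (h12 : ψ * w 1 = w 1 * ψ + w 2)
    (h23 : ψ * w 2 = w 2 * ψ + w 3) (r0 : w 1 * w 0 = q ^ 2 • (w 0 * w 1))
    (r1 : w 2 * w 1 = q ^ 2 • (w 1 * w 2)) (r2 : w 3 * w 2 = q ^ 2 • (w 2 * w 3)) :
    Straightening q w := by
  -- Bracketing the q-commutation of neighbours with ψ gives the relation at distance two.
  have step : ∀ {w₀ w₁ w₂ : U}, ψ * w₀ = w₀ * ψ + w₁ → ψ * w₁ = w₁ * ψ + w₂ →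
      w₁ * w₀ = q ^ 2 • (w₀ * w₁) →
      w₂ * w₀ = q ^ 2 • (w₀ * w₂) + (q ^ 2 - 1) • (w₁ * w₁) := by
    intro w₀ w₁ w₂ h1 h12 h
    have : ψ * (w₁ * w₀) = ψ * (q ^ 2 • (w₀ * w₁)) := by rw [h]
    rw [← mul_assoc, h12, add_mul, mul_assoc, h1, mul_add, mul_smul_comm, ← mul_assoc ψ, h1,
      add_mul, mul_assoc w₀, h12, mul_add, ← mul_assoc w₁, h, ← mul_assoc w₀] at this
    simp only [smul_add, smul_mul_assoc] at this ⊢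
    rw [← sub_eq_zero] at this ⊢
    rw [← this]
    module
  have r20 := step h1 h12 r0
  refine ⟨hq, r0, r1, r2, r20, step h12 h23 r1, ?_⟩
  -- Bracketing the relation at distance two with ψ gives the one at distance three.
  have : ψ * (w 2 * w 0) = ψ * (q ^ 2 • (w 0 * w 2) + (q ^ 2 - 1) • (w 1 * w 1)) := by rw [r20]
  have f1 : ψ * (w 2 * w 0) = w 2 * w 0 * ψ + (w 3 * w 0 + w 2 * w 1) := by
    rw [← mul_assoc, h23, add_mul, mul_assoc, h1, mul_add, ← mul_assoc]; abel
  have f2 : ψ * (w 1 * w 1) = w 1 * w 1 * ψ + (w 2 * w 1 + w 1 * w 2) := by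
    rw [← mul_assoc, h12, add_mul, mul_assoc, h12, mul_add, ← mul_assoc]; abel
  have f3 : ψ * (w 0 * w 2) = w 0 * w 2 * ψ + (w 1 * w 2 + w 0 * w 3) := by
    rw [← mul_assoc, h1, add_mul, mul_assoc, h23, mul_add, ← mul_assoc]; abel
  have f5 : w 1 * w 2 = (q ^ 2)⁻¹ • (w 2 * w 1) := by
    rw [r1, smul_smul, inv_mul_cancel₀ (pow_ne_zero _ hq), one_smul]
  rw [mul_add, mul_smul_comm, mul_smul_comm, f1, f2, f3, r20, f5] at this
  simp only [add_mul, smul_mul_assoc, smul_add, smul_smul] at this ⊢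
  rw [← sub_eq_zero] at this ⊢
  rw [← this]
  match_scalars <;> field_simp <;> ring

/-- Each relation is homogeneous in the sum of the indices, so rescaling u_i by cⁱ is harmless. -/
theorem Straightening.smul {q : k} {u : Fin 4 → U} (h : Straightening q u) (c : k) :
    Straightening q (fun i => c ^ (i : ℕ) • u i) := by
  obtain ⟨hq, r10, r21, r32, r20, r31, r30⟩ := h
  refine ⟨hq, ?_, ?_, ?_, ?_, ?_, ?_⟩ <;>
  simp only [smul_mul_assoc, mul_smul_comm, r10, r21, r32, r20, r31, r30, smul_add, smul_smul,
    Fin.isValue, Fin.coe_ofNat_eq_mod, Nat.reduceMod] <;>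
  module

namespace ChevalleyRelations

variable {q : k} {a y f g K L K' L' : U} (h : ChevalleyRelations q a y f g K L K' L')
include h

/-- After expansion this is the Serre relation of a and y, up to sign. -/
theorem w1_a {ψ w₁ : U} (hψ : ψ = y * a - (q ^ 2)⁻¹ • (a * y)) (hw : w₁ = ψ * a - a * ψ) :
    w₁ * a = q ^ 2 • (a * w₁) := by
  have := h.q_ne
  have e := h.serre_ay
  rw [← sub_eq_zero, ← neg_eq_zero]
  refine Eq.trans ?_ e
  subst hw; subst hψ
  simp only [sub_mul, mul_sub, mul_smul_comm, smul_mul_assoc, mul_assoc, smul_sub, smul_smul,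
    pow_succ, pow_zero, one_mul]
  match_scalars <;> field_simp <;> ring

theorem y_z1 {ψ z₁ : U} (hψ : ψ = y * a - (q ^ 2)⁻¹ • (a * y)) (hz : z₁ = y * ψ - ψ * y) :
    y * z₁ = q ^ 2 • (z₁ * y) := by
  have := h.q_ne
  have e := h.serre_ya
  rw [← sub_eq_zero]
  refine Eq.trans ?_ e
  subst hz; subst hψ
  simp only [sub_mul, mul_sub, mul_smul_comm, smul_mul_assoc, mul_assoc, smul_sub, smul_smul,
    pow_succ, pow_zero, one_mul]
  match_scalars <;> field_simp <;> ring

theorem psi2_a {ψ w₁ ψ₂ : U} (hψ : ψ = y * a - (q ^ 2)⁻¹ • (a * y)) (hw : w₁ = ψ * a - a * ψ)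
    (hψ₂ : ψ₂ = y * w₁ - (q ^ 2)⁻¹ • (w₁ * y)) :
    ψ₂ * a - a * ψ₂ = q ^ 2 • (ψ * w₁) - (q ^ 2)⁻¹ • (w₁ * ψ) := by
  have hq := h.q_ne
  have r := h.w1_a hψ hw
  have r' (x : U) : w₁ * (a * x) = q ^ 2 • (a * (w₁ * x)) := assoc_of_mul_eq_smul r x
  subst hψ₂
  rw [hψ]
  simp only [sub_mul, mul_sub, mul_smul_comm, smul_mul_assoc, mul_assoc, smul_sub, smul_smul, r, r']
  match_scalars <;> field_simp

/-- Apply the derivation [ψ, ·] to ψ = ya - q⁻²ay: the left side vanishes, and the Leibniz rule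
equates the two ways of building an imaginary element of degree two. -/
theorem psi2_eq {ψ w₁ z₁ ψ₂ : U} (hψ : ψ = y * a - (q ^ 2)⁻¹ • (a * y)) (hw : w₁ = ψ * a - a * ψ)
    (hz : z₁ = y * ψ - ψ * y)
    (hψ₂ : ψ₂ = y * w₁ - (q ^ 2)⁻¹ • (w₁ * y)) : ψ₂ = z₁ * a - (q ^ 2)⁻¹ • (a * z₁) := by
  have e : ψ * (y * a - (q ^ 2)⁻¹ • (a * y)) = (y * a - (q ^ 2)⁻¹ • (a * y)) * ψ := by rw [← hψ]
  rw [← sub_eq_zero] at e ⊢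
  rw [← e]
  subst hψ₂; subst hz; subst hw
  simp only [sub_mul, mul_sub, mul_smul_comm, smul_mul_assoc, mul_assoc, smul_sub]
  module

theorem psi2_y {ψ w₁ z₁ ψ₂ : U} (hψ : ψ = y * a - (q ^ 2)⁻¹ • (a * y)) (hw : w₁ = ψ * a - a * ψ)
    (hz : z₁ = y * ψ - ψ * y) (hψ₂ : ψ₂ = y * w₁ - (q ^ 2)⁻¹ • (w₁ * y)) :
    ψ₂ * y - y * ψ₂ = (q ^ 2)⁻¹ • (ψ * z₁) - q ^ 2 • (z₁ * ψ) := by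
  have hq := h.q_ne
  have r := h.y_z1 hψ hz
  have r' (x : U) : y * (z₁ * x) = q ^ 2 • (z₁ * (y * x)) := assoc_of_mul_eq_smul r x
  rw [h.psi2_eq hψ hw hz hψ₂, hψ]
  simp only [sub_mul, mul_sub, mul_smul_comm, smul_mul_assoc, mul_assoc, smul_sub, smul_smul, r, r']
  match_scalars <;> field_simp

/-- The Leibniz rule computes the commutator of ψ₂ and ψ from those of ψ₂ with a and y. Rewriting
the result with both expressions of ψ₂ returns the same commutator with a different factor, which
forces it to vanish. -/
theorem psi2_psi (h3 : q ^ 4 + q ^ 2 + 1 ≠ 0) {ψ w₁ ψ₂ : U}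
    (hψ : ψ = y * a - (q ^ 2)⁻¹ • (a * y)) (hw : w₁ = ψ * a - a * ψ)
    (hψ₂ : ψ₂ = y * w₁ - (q ^ 2)⁻¹ • (w₁ * y)) : ψ₂ * ψ = ψ * ψ₂ := by
  have hq := h.q_ne
  obtain ⟨z₁, hz⟩ : ∃ z₁, z₁ = y * ψ - ψ * y := ⟨_, rfl⟩
  have e1 := h.psi2_a hψ hw hψ₂
  have e2 := h.psi2_y hψ hw hz hψ₂
  have e3 := h.psi2_eq hψ hw hz hψ₂
  have e1' : ψ₂ * a = a * ψ₂ + (q ^ 2 • (ψ * w₁) - (q ^ 2)⁻¹ • (w₁ * ψ)) := by rw [← e1]; abel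
  have e2' : ψ₂ * y = y * ψ₂ + ((q ^ 2)⁻¹ • (ψ * z₁) - q ^ 2 • (z₁ * ψ)) := by rw [← e2]; abel
  have c1 : y * ψ = ψ * y + z₁ := by rw [hz]; abel
  have c2 : ψ * a = a * ψ + w₁ := by rw [hw]; abel
  have c3 (x : U) : y * (ψ * x) = ψ * (y * x) + z₁ * x := by
    rw [← mul_assoc, c1, add_mul, mul_assoc]
  have c4 (x : U) : a * (ψ * x) = ψ * (a * x) - w₁ * x := by
    rw [← mul_assoc, ← mul_assoc ψ, c2, add_mul]; abel
  have c5 : a * ψ = ψ * a - w₁ := by rw [c2]; abel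
  have p1 : ψ₂ * (y * a) = y * (ψ₂ * a) + ((q ^ 2)⁻¹ • (ψ * (z₁ * a)) - q ^ 2 • (z₁ * (ψ * a))) := by
    rw [← mul_assoc, e2', add_mul, sub_mul, smul_mul_assoc, smul_mul_assoc, mul_assoc, mul_assoc,
      mul_assoc]
  have p2 : ψ₂ * (a * y) = a * (ψ₂ * y) + (q ^ 2 • (ψ * (w₁ * y)) - (q ^ 2)⁻¹ • (w₁ * (ψ * y))) := by
    rw [← mul_assoc, e1', add_mul, sub_mul, smul_mul_assoc, smul_mul_assoc, mul_assoc, mul_assoc,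
      mul_assoc]
  have d1 : ψ₂ * ψ - ψ * ψ₂ =
      y * (q ^ 2 • (ψ * w₁) - (q ^ 2)⁻¹ • (w₁ * ψ))
      + ((q ^ 2)⁻¹ • (ψ * (z₁ * a)) - q ^ 2 • (z₁ * (ψ * a)))
      - (q ^ 2)⁻¹ • (a * ((q ^ 2)⁻¹ • (ψ * z₁) - q ^ 2 • (z₁ * ψ)))
      - (q ^ 2)⁻¹ • (q ^ 2 • (ψ * (w₁ * y)) - (q ^ 2)⁻¹ • (w₁ * (ψ * y))) := by
    have : ψ₂ * (y * a - (q ^ 2)⁻¹ • (a * y)) - (y * a - (q ^ 2)⁻¹ • (a * y)) * ψ₂ =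
        y * (q ^ 2 • (ψ * w₁) - (q ^ 2)⁻¹ • (w₁ * ψ))
        + ((q ^ 2)⁻¹ • (ψ * (z₁ * a)) - q ^ 2 • (z₁ * (ψ * a)))
        - (q ^ 2)⁻¹ • (a * ((q ^ 2)⁻¹ • (ψ * z₁) - q ^ 2 • (z₁ * ψ)))
        - (q ^ 2)⁻¹ • (q ^ 2 • (ψ * (w₁ * y)) - (q ^ 2)⁻¹ • (w₁ * (ψ * y))) := by
      rw [mul_sub, mul_smul_comm, p1, p2, e1', e2']
      simp only [mul_add, mul_sub, sub_mul, smul_mul_assoc, mul_smul_comm, mul_assoc, smul_add,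
        smul_sub]
      module
    rwa [← hψ] at this
  -- The Leibniz expansion equals -(q² + q⁻²) times the commutator itself.
  have key : (q ^ 2 + 1 + (q ^ 2)⁻¹) • (ψ₂ * ψ - ψ * ψ₂) = 0 := by
    have g1 : ψ * ψ₂ = ψ * (y * w₁) - (q ^ 2)⁻¹ • (ψ * (w₁ * y)) := by
      rw [hψ₂, mul_sub, mul_smul_comm]
    have g2 : ψ₂ * ψ = y * (w₁ * ψ) - (q ^ 2)⁻¹ • (w₁ * (ψ * y)) - (q ^ 2)⁻¹ • (w₁ * z₁) := by
      rw [hψ₂, sub_mul, smul_mul_assoc, mul_assoc, mul_assoc, c1, mul_add, smul_add, sub_sub]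
    have g3 : ψ * ψ₂ = ψ * (z₁ * a) - (q ^ 2)⁻¹ • (ψ * (a * z₁)) := by
      rw [e3, mul_sub, mul_smul_comm]
    have g4 : ψ₂ * ψ = z₁ * (ψ * a) - z₁ * w₁ - (q ^ 2)⁻¹ • (a * (z₁ * ψ)) := by
      rw [e3, sub_mul, smul_mul_assoc, mul_assoc, mul_assoc, c5, mul_sub]
    simp only [mul_sub, mul_smul_comm, c3, c4, smul_sub, smul_add, smul_smul] at d1
    have d2 : ψ₂ * ψ - ψ * ψ₂ = q ^ 2 • (ψ * ψ₂) - (q ^ 2)⁻¹ • (ψ₂ * ψ)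
        + ((q ^ 2)⁻¹ • (ψ * ψ₂) - q ^ 2 • (ψ₂ * ψ)) := by
      rw [d1]
      nth_rewrite 1 [g1]
      nth_rewrite 1 [g2]
      rw [g3, g4]
      simp only [smul_sub, smul_smul]
      match_scalars <;> field_simp
    rw [← sub_eq_zero] at d2
    rw [← d2]
    module
  have h3' : q ^ 2 + 1 + (q ^ 2)⁻¹ ≠ 0 := by
    intro h0; apply h3; field_simp at h0; linear_combination h0
  exact sub_eq_zero.1 ((smul_eq_zero.1 key).resolve_left h3')

/-- The string `a, [ψ, a], [ψ, [ψ, a]], …` satisfies the straightening relations. -/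
theorem straightening (h2 : (2 : k) ≠ 0) (h3 : q ^ 4 + q ^ 2 + 1 ≠ 0) (h4 : q ^ 4 + 1 ≠ 0)
    {ψ w₁ w₂ w₃ : U}
    (hψ : ψ = y * a - (q ^ 2)⁻¹ • (a * y)) (hw₁ : w₁ = ψ * a - a * ψ)
    (hw₂ : w₂ = ψ * w₁ - w₁ * ψ) (hw₃ : w₃ = ψ * w₂ - w₂ * ψ) :
    Straightening q ![a, w₁, w₂, w₃] := by
  have hq := h.q_ne
  obtain ⟨w₄, hw₄⟩ : ∃ w₄, w₄ = ψ * w₃ - w₃ * ψ := ⟨_, rfl⟩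
  obtain ⟨ψ₂, hψ₂⟩ : ∃ ψ₂, ψ₂ = y * w₁ - (q ^ 2)⁻¹ • (w₁ * y) := ⟨_, rfl⟩
  -- The coefficients are chosen so that the products ψw₁ and w₁ψ in [η, a] get opposite
  -- coefficients and combine to (q² + q⁻²)[ψ, w₁].
  obtain ⟨η, hη⟩ : ∃ η, η = (2 : k) • ψ₂ - (q ^ 2 - (q ^ 2)⁻¹) • (ψ * ψ) := ⟨_, rfl⟩
  have d0 : ψ * a = a * ψ + w₁ := by rw [hw₁]; abel
  have d1 : ψ * w₁ = w₁ * ψ + w₂ := by rw [hw₂]; abel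
  have d2 : ψ * w₂ = w₂ * ψ + w₃ := by rw [hw₃]; abel
  have d3 : ψ * w₃ = w₃ * ψ + w₄ := by rw [hw₄]; abel
  have hη' : η * ψ = ψ * η := by
    rw [hη, sub_mul, mul_sub, smul_mul_assoc, h.psi2_psi h3 hψ hw₁ hψ₂, mul_smul_comm,
      smul_mul_assoc, mul_smul_comm, mul_assoc]
  have e0 : η * a = a * η + (q ^ 2 + (q ^ 2)⁻¹) • w₂ := by
    have p1 : ψ₂ * a = a * ψ₂ + (q ^ 2 • (ψ * w₁) - (q ^ 2)⁻¹ • (w₁ * ψ)) := by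
      rw [← h.psi2_a hψ hw₁ hψ₂]; abel
    have p2 : ψ * ψ * a = a * (ψ * ψ) + (w₁ * ψ + ψ * w₁) := by
      rw [mul_assoc, d0, mul_add, ← mul_assoc, d0, add_mul, mul_assoc, add_assoc]
    rw [hη, sub_mul, mul_sub, smul_mul_assoc, smul_mul_assoc, p1, p2, d1]
    simp only [mul_smul_comm]
    module
  -- As η commutes with ψ, a shift by two under η at one place of the string passes to the next
  -- place.
  have comm_step : ∀ {x x' x'' x''' : U} (c : k), ψ * x = x * ψ + x' → ψ * x'' = x'' * ψ + x''' →
      η * x = x * η + c • x'' → η * x' = x' * η + c • x''' := by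
    intro x x' x'' x''' c h1 h2 h3
    have hx' : x' = ψ * x - x * ψ := by rw [h1]; abel
    have hx''' : x''' = ψ * x'' - x'' * ψ := by rw [h2]; abel
    have f1 : η * (ψ * x) = ψ * (x * η) + c • (ψ * x'') := by
      rw [← mul_assoc, hη', mul_assoc, h3, mul_add, mul_smul_comm]
    have f2 : η * (x * ψ) = x * ψ * η + c • (x'' * ψ) := by
      rw [← mul_assoc, h3, add_mul, mul_assoc, hη', smul_mul_assoc, ← mul_assoc]
    rw [hx', mul_sub, f1, f2, hx''', sub_mul, mul_assoc ψ]
    module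
  have e1 := comm_step _ d0 d2 e0
  have e2 := comm_step _ d1 d3 e1
  have hc : q ^ 2 + (q ^ 2)⁻¹ ≠ 0 := by
    intro h0; apply h4; field_simp at h0; linear_combination h0
  have r0 := h.w1_a hψ hw₁
  have r1 := commutation_step hc h2 d0 d1 d2 e0 e1 r0
  have r2 := commutation_step hc h2 d1 d2 d3 e1 e2 r1
  exact straightening_of_string hq d0 d1 d2 r0 r1 r2

/-- The value of `T₁T₂` on `E₁` is obtained from `ψ` and the second root vector. -/
theorem lower_w1 {ψ w₁ : U} (hψ : ψ = y * a - (q ^ 2)⁻¹ • (a * y)) (hw : w₁ = ψ * a - a * ψ) :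
    (-(K' * f)) * w₁ - (q ^ 2)⁻¹ • (w₁ * (-(K' * f))) = (q + q⁻¹) • ψ := by
  have hq := h.q_ne
  have e1 := h.w1_f hψ hw
  have e2 : K' * w₁ = (q ^ 2)⁻¹ • (w₁ * K') := by
    rw [hw]
    simp only [mul_sub, sub_mul, mul_assoc, h.K'a, ← mul_assoc K', h.K'_psi hψ, smul_mul_assoc,
      mul_smul_comm, smul_sub]
  have e3 : w₁ * (K' * f) = q ^ 2 • (K' * (w₁ * f)) := by
    rw [← mul_assoc K', e2, smul_mul_assoc, smul_smul, mul_inv_cancel₀ (pow_ne_zero _ hq), one_smul,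
      mul_assoc]
  rw [neg_mul, mul_neg, e3, e1, mul_assoc, mul_add, mul_smul_comm, ← mul_assoc K' ψ,
    h.K'_psi hψ, mul_assoc, h.K'K, mul_one]
  match_scalars <;> field_simp <;> ring

/-- The analogue of `lower_w1` one step further: up to a scalar, the lowering element is T₁T₂(E₂) =
-T₁(K₂⁻¹)T₁(F₂), with T₁(K₂⁻¹) = K'K'L' and T₁(F₂) proportional to G. -/
theorem lower_w2 {ψ w₁ w₂ φ G : U} (hψ : ψ = y * a - (q ^ 2)⁻¹ • (a * y))
    (hw₁ : w₁ = ψ * a - a * ψ) (hw₂ : w₂ = ψ * w₁ - w₁ * ψ)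
    (hφ : φ = f * g - q ^ 2 • (g * f)) (hG : G = f * φ - φ * f) :
    (-(K' * (K' * L') * G)) * w₂ - (q ^ 2)⁻¹ • (w₂ * (-(K' * (K' * L') * G))) =
      (q + q⁻¹) ^ 3 • ψ := by
  have hq := h.q_ne
  have hd := h.sq_sub_one_ne
  have h2 := h.two_ne
  have h2' : q + q⁻¹ ≠ 0 := by
    intro h0; apply h2; field_simp at h0; linear_combination h0
  obtain ⟨κ, hκ⟩ : ∃ κ, κ = K * (K * L) := ⟨_, rfl⟩
  obtain ⟨κ', hκ'⟩ : ∃ κ', κ' = K' * (K' * L') := ⟨_, rfl⟩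
  obtain ⟨y', hy'⟩ : ∃ y', y' = -(K' * f) := ⟨_, rfl⟩
  have e1 : w₁ * G = G * w₁ + ((q + q⁻¹) ^ 2 * (q - q⁻¹)⁻¹) • (κ - κ') := by
    rw [hκ, hκ']; exact h.w1_G hψ hw₁ hφ hG
  have κκ : κ' * κ = 1 := by
    have c1 : L' * (K * (K * L)) = K * K := by
      rw [← mul_assoc, h.L'K, mul_assoc, ← mul_assoc L', h.L'K, mul_assoc, h.L'L, mul_one]
    have c2 : K' * (K * K) = K := by rw [← mul_assoc, h.K'K, one_mul]
    rw [hκ, hκ', mul_assoc, mul_assoc, c1, c2, h.K'K]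
  have κf : κ * f = (q ^ 2)⁻¹ • (f * κ) := by
    rw [hκ]
    simp only [mul_assoc, h.Lf, mul_smul_comm, assoc_of_mul_eq_smul h.Kf, smul_smul]
    match_scalars; field_simp
  have κ'f : κ' * f = q ^ 2 • (f * κ') := by
    rw [hκ']
    simp only [mul_assoc, h.L'f, mul_smul_comm, assoc_of_mul_eq_smul h.K'f, smul_smul]
    match_scalars; field_simp
  have κK' : κ * K' = K' * κ := by
    rw [hκ]; simp only [mul_assoc, h.LK']
    simp only [← mul_assoc, h.KK', h.K'K]
    simp only [one_mul, mul_one]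
  have κ'K' : κ' * K' = K' * κ' := by
    rw [hκ']; simp only [mul_assoc, h.L'K']
  have κy : κ * y' = (q ^ 2)⁻¹ • (y' * κ) := by
    rw [hy', mul_neg, neg_mul, ← mul_assoc, κK', mul_assoc, κf, mul_smul_comm, mul_assoc, smul_neg]
  have κ'y : κ' * y' = q ^ 2 • (y' * κ') := by
    rw [hy', mul_neg, neg_mul, ← mul_assoc, κ'K', mul_assoc, κ'f, mul_smul_comm, mul_assoc,
      smul_neg]
  have κψ : κ * ψ = ψ * κ := by
    rw [hκ, mul_assoc, mul_assoc, h.L_psi hψ, ← mul_assoc K ψ, h.K_psi hψ, mul_assoc ψ,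
      ← mul_assoc K ψ, h.K_psi hψ, mul_assoc]
  have κ'ψ : κ' * ψ = ψ * κ' := by
    rw [hκ', mul_assoc, mul_assoc, h.L'_psi hψ, ← mul_assoc K' ψ, h.K'_psi hψ, mul_assoc ψ,
      ← mul_assoc K' ψ, h.K'_psi hψ, mul_assoc]
  have κa : κ * a = q ^ 2 • (a * κ) := by
    rw [hκ]
    simp only [mul_assoc, h.La, mul_smul_comm, assoc_of_mul_eq_smul h.Ka, smul_smul]
    match_scalars; field_simp
  have κ'a : κ' * a = (q ^ 2)⁻¹ • (a * κ') := by
    rw [hκ']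
    simp only [mul_assoc, h.L'a, mul_smul_comm, assoc_of_mul_eq_smul h.K'a, smul_smul]
    match_scalars; field_simp
  have κw₁ : κ * w₁ = q ^ 2 • (w₁ * κ) := by
    rw [hw₁]
    simp only [mul_sub, sub_mul, ← mul_assoc, κψ, κa, smul_mul_assoc]
    simp only [mul_assoc, κψ, κa, mul_smul_comm, smul_sub]
  have κ'w₁ : κ' * w₁ = (q ^ 2)⁻¹ • (w₁ * κ') := by
    rw [hw₁]
    simp only [mul_sub, sub_mul, ← mul_assoc, κ'ψ, κ'a, smul_mul_assoc]
    simp only [mul_assoc, κ'ψ, κ'a, mul_smul_comm, smul_sub]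
  have κ'w₂ : κ' * w₂ = (q ^ 2)⁻¹ • (w₂ * κ') := by
    rw [hw₂]
    simp only [mul_sub, sub_mul, ← mul_assoc, κ'ψ, κ'w₁, smul_mul_assoc]
    simp only [mul_assoc, κ'ψ, κ'w₁, mul_smul_comm, smul_sub]
  have K'φ : K' * φ = φ * K' := by
    rw [hφ]
    simp only [mul_sub, sub_mul, mul_smul_comm, smul_mul_assoc, mul_assoc, h.K'f, h.K'g,
      assoc_of_mul_eq_smul h.K'f, assoc_of_mul_eq_smul h.K'g, smul_smul]
    match_scalars <;> field_simp
  have K'G : K' * G = q ^ 2 • (G * K') := by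
    rw [hG]
    simp only [mul_sub, sub_mul, ← mul_assoc, K'φ, h.K'f, smul_mul_assoc]
    simp only [mul_assoc, K'φ, h.K'f, mul_smul_comm, smul_sub]
  have y'G : y' * G = G * y' := by
    rw [hy', neg_mul, mul_neg, mul_assoc, h.f_G hφ hG, mul_smul_comm, ← mul_assoc, K'G,
      smul_mul_assoc, smul_smul, inv_mul_cancel₀ (pow_ne_zero _ hq), one_smul, mul_assoc]
  have hψ' : (q + q⁻¹) • ψ = y' * w₁ - (q ^ 2)⁻¹ • (w₁ * y') := by
    rw [hy']; exact (h.lower_w1 hψ hw₁).symm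
  -- Up to a scalar ψ is the q-commutator of y' and w₁, and y' commutes with G; thus the commutator
  -- of w₁ with G suffices. That of w₂ = [ψ, w₁] then follows by the Leibniz rule.
  have ψG : ψ * G = G * ψ + ((q ^ 2)⁻¹ * (q + q⁻¹) ^ 2) • (y' * κ) := by
    apply smul_right_injective U h2'
    simp only
    rw [← smul_mul_assoc, smul_add, ← mul_smul_comm, hψ', sub_mul, mul_sub, smul_mul_assoc,
      mul_smul_comm, mul_assoc, mul_assoc, y'G, e1, mul_add, mul_smul_comm, ← mul_assoc w₁ G y',
      e1, add_mul, smul_mul_assoc, sub_mul, mul_sub, κy, κ'y, ← mul_assoc y' G w₁, y'G]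
    simp only [mul_assoc]
    match_scalars <;> field_simp <;> ring
  have w₂G : w₂ * G = G * w₂ + (q + q⁻¹) ^ 3 • (ψ * κ) := by
    have t1 : ψ * (w₁ * G) = G * (ψ * w₁) + ((q ^ 2)⁻¹ * (q + q⁻¹) ^ 2) • (y' * (κ * w₁)) +
        ((q + q⁻¹) ^ 2 * (q - q⁻¹)⁻¹) • (ψ * κ - ψ * κ') := by
      rw [e1, mul_add, ← mul_assoc, ψG, add_mul, mul_assoc, smul_mul_assoc, mul_assoc,
        mul_smul_comm, mul_sub]
    have t2 : w₁ * (ψ * G) = G * (w₁ * ψ) + ((q + q⁻¹) ^ 2 * (q - q⁻¹)⁻¹) • (ψ * κ - ψ * κ') +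
        ((q ^ 2)⁻¹ * (q + q⁻¹) ^ 2) • (w₁ * (y' * κ)) := by
      rw [ψG, mul_add, ← mul_assoc, e1, add_mul, mul_assoc, smul_mul_assoc, sub_mul, κψ, κ'ψ,
        mul_smul_comm]
    have t3 : (q + q⁻¹) • (ψ * κ) = y' * (w₁ * κ) - (q ^ 2)⁻¹ • (w₁ * (y' * κ)) := by
      rw [← smul_mul_assoc, hψ', sub_mul, smul_mul_assoc, mul_assoc, mul_assoc]
    rw [pow_succ, mul_smul, t3, hw₂, sub_mul, mul_sub, mul_assoc, mul_assoc, t1, t2, κw₁,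
      mul_smul_comm]
    match_scalars <;> field_simp <;> ring
  rw [← hκ']
  have e3 : w₂ * (κ' * G) = q ^ 2 • (κ' * (w₂ * G)) := by
    rw [← mul_assoc κ', κ'w₂, smul_mul_assoc, smul_smul, mul_inv_cancel₀ (pow_ne_zero _ hq),
      one_smul, mul_assoc]
  rw [neg_mul, mul_neg, e3, w₂G, mul_assoc, mul_add, mul_smul_comm, ← mul_assoc κ' ψ, κ'ψ,
    mul_assoc, κκ, mul_one]
  match_scalars <;> field_simp <;> ring

end ChevalleyRelations

end RootVectors

/-! ### Scalars -/

theorem v_ne_zero : v ≠ 0 := RatFunc.X_ne_zero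

theorem q_ne_zero : q ≠ 0 := pow_ne_zero _ v_ne_zero

theorem v_zpow_injective : Function.Injective fun n : ℤ => v ^ n := by
  have key : ∀ n : ℕ, v ^ n = 1 → n = 0 := by
    intro n hn
    have : (algebraMap (Polynomial ℚ) 𝕂) (Polynomial.X ^ n) = algebraMap (Polynomial ℚ) 𝕂 1 := by
      rw [map_pow, map_one, RatFunc.algebraMap_X]; exact hn
    have := congrArg Polynomial.natDegree (RatFunc.algebraMap_injective ℚ this)
    simpa using this
  intro m n hmn
  have hmn : v ^ m = v ^ n := hmn
  have h1 : v ^ (m - n) = 1 := by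
    rw [zpow_sub₀ v_ne_zero, hmn, div_self (zpow_ne_zero _ v_ne_zero)]
  obtain ⟨d, hd⟩ := Int.eq_nat_or_neg (m - n)
  rcases hd with hd | hd
  · rw [hd, zpow_natCast] at h1
    have := key d h1; omega
  · rw [hd, zpow_neg, zpow_natCast, inv_eq_one] at h1
    have := key d h1; omega

theorem q_zpow (n : ℤ) : q ^ n = v ^ (2 * n) := by
  rw [q, ← zpow_natCast, ← zpow_mul]; rfl

theorem q_zpow_injective : Function.Injective fun n : ℤ => q ^ n := by
  intro m n h
  simp only [q_zpow] at h
  have := v_zpow_injective h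
  omega

theorem q_pow_ne_one {n : ℕ} (hn : n ≠ 0) : q ^ n ≠ 1 := by
  intro h
  have : (n : ℤ) = 0 := q_zpow_injective (by simpa using h)
  omega

theorem q_sq_add_one_ne : q ^ 2 + 1 ≠ 0 := by
  intro h
  apply q_pow_ne_one (n := 4) (by norm_num)
  linear_combination (q ^ 2 - 1) * h

theorem q_four_add_one_ne : q ^ 4 + 1 ≠ 0 := by
  intro h
  apply q_pow_ne_one (n := 8) (by norm_num)
  linear_combination (q ^ 4 - 1) * h

theorem q_four_add_sq_add_one_ne : q ^ 4 + q ^ 2 + 1 ≠ 0 := by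
  intro h
  apply q_pow_ne_one (n := 6) (by norm_num)
  linear_combination (q ^ 2 - 1) * h

theorem q_add_inv_ne : q + q⁻¹ ≠ 0 := by
  have := q_ne_zero
  intro h; apply q_sq_add_one_ne; field_simp at h; linear_combination h

theorem q_sub_inv_ne : q - q⁻¹ ≠ 0 := by
  have := q_ne_zero
  intro h
  apply q_pow_ne_one (n := 2) (by norm_num)
  field_simp at h; linear_combination h

theorem qInt_one : qInt 1 = 1 := by
  simp [qInt, div_self q_sub_inv_ne]

theorem qInt_two : qInt 2 = q + q⁻¹ := by
  rw [qInt, div_eq_iff q_sub_inv_ne]; ring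

theorem qInt_three : qInt 3 = q ^ 2 + 1 + (q ^ 2)⁻¹ := by
  have := q_ne_zero
  rw [qInt, div_eq_iff q_sub_inv_ne]; field_simp; ring

theorem qFact_zero : qFact 0 = 1 := by simp [qFact]
theorem qFact_one : qFact 1 = 1 := by simp [qFact, qInt_one]
theorem qFact_two : qFact 2 = q + q⁻¹ := by simp [qFact, Finset.prod_range_succ, qInt_one, qInt_two]

/-! ### The Chevalley generators -/

theorem proj_rel {x y : Free} (h : Rel x y) : proj x = proj y := RingQuot.mkAlgHom_rel 𝕂 h

theorem mul_of_conj {U : Type*} [Ring U] [Algebra 𝕂 U] {K K' x : U} {c : 𝕂} (h : K' * K = 1)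
    (e : K * x * K' = c • x) : K * x = c • (x * K) := by
  rw [← smul_mul_assoc, ← e, mul_assoc, h, mul_one]

theorem serre_proj {A : Type*} [Ring A] [Algebra 𝕂 A] (φ : Free →ₐ[𝕂] A) (x y : Free) :
    φ (serre x y) = φ x ^ 3 * φ y - (q ^ 2 + 1 + (q ^ 2)⁻¹) • (φ x ^ 2 * φ y * φ x) +
      (q ^ 2 + 1 + (q ^ 2)⁻¹) • (φ x * φ y * φ x ^ 2) - φ y * φ x ^ 3 := by
  simp [serre, qInt_three]

theorem chevalleyRelations : ChevalleyRelations q (proj (gen (.e 0))) (proj (gen (.e 1)))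
    (proj (gen (.f 0))) (proj (gen (.f 1))) (proj (gen (.k 0))) (proj (gen (.k 1)))
    (proj (gen (.kinv 0))) (proj (gen (.kinv 1))) := by
  have kk' : ∀ i, proj (gen (.k i)) * proj (gen (.kinv i)) = 1 := fun i => by
    simpa using proj_rel (.k_kinv i)
  have k'k : ∀ i, proj (gen (.kinv i)) * proj (gen (.k i)) = 1 := fun i => by
    simpa using proj_rel (.kinv_k i)
  have ke : ∀ i j, proj (gen (.k i)) * proj (gen (.e j)) =
      q ^ cartan i j • (proj (gen (.e j)) * proj (gen (.k i))) := fun i j =>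
    mul_of_conj (k'k i) (by simpa using proj_rel (.k_e i j))
  have kf : ∀ i j, proj (gen (.k i)) * proj (gen (.f j)) =
      q ^ (-cartan i j) • (proj (gen (.f j)) * proj (gen (.k i))) := fun i j =>
    mul_of_conj (k'k i) (by simpa only [map_mul, map_smul] using proj_rel (.k_f i j))
  have ef : ∀ i j, proj (gen (.f j)) * proj (gen (.e i)) = proj (gen (.e i)) * proj (gen (.f j)) -
      (if i = j then (q - q⁻¹)⁻¹ • (proj (gen (.k i)) - proj (gen (.kinv i))) else 0) := by
    intro i j
    have := proj_rel (.e_f i j)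
    rw [map_sub, map_mul, map_mul] at this
    split_ifs at this ⊢ with hij
    · rw [map_smul, map_sub] at this
      rw [← this]; abel
    · rw [map_zero] at this
      rw [sub_zero, sub_eq_zero.1 this]
  have se := fun i j hij => proj_rel (.serre_e i j hij)
  have sf := fun i j hij => proj_rel (.serre_f i j hij)
  simp only [serre_proj, map_zero] at se sf
  have n1 : q ^ (-2 : ℤ) = (q ^ 2)⁻¹ := by rw [zpow_neg]; rfl
  have n2 : q ^ (2 : ℤ) = q ^ 2 := rfl
  exact {
    q_ne := q_ne_zero
    q_sq_ne := q_pow_ne_one (by norm_num)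
    two_ne := q_sq_add_one_ne
    KK' := kk' 0
    K'K := k'k 0
    LL' := kk' 1
    L'L := k'k 1
    LK := by simpa using proj_rel (.k_comm 1 0)
    Ka := by simpa [cartan, n1, n2] using ke 0 0
    Ky := by simpa [cartan, n1, n2] using ke 0 1
    La := by simpa [cartan, n1, n2] using ke 1 0
    Ly := by simpa [cartan, n1, n2] using ke 1 1
    Kf := by simpa [cartan, n1, n2] using kf 0 0
    Kg := by simpa [cartan, n1, n2] using kf 0 1
    Lf := by simpa [cartan, n1, n2] using kf 1 0
    Lg := by simpa [cartan, n1, n2] using kf 1 1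
    fa := by simpa using ef 0 0
    fy := by simpa using ef 1 0
    ga := by simpa using ef 0 1
    gy := by simpa using ef 1 1
    serre_ay := se 0 1 (by decide)
    serre_ya := se 1 0 (by decide)
    serre_fg := sf 0 1 (by decide) }

/-! ### The root vectors -/

/-- The element `ψ = E₂E₁ - q⁻²E₁E₂`. -/
def psi : Uq := proj (gen (.e 1)) * proj (gen (.e 0)) -
  (q ^ 2)⁻¹ • (proj (gen (.e 0)) * proj (gen (.e 1)))

/-- The string `E₁, [ψ, E₁], [ψ, [ψ, E₁]], …`. -/
def stringElt : ℕ → Uq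
  | 0 => proj (gen (.e 0))
  | n + 1 => psi * stringElt n - stringElt n * psi

/-- The defining sum of T_i(E_j) is 1/[2] times an iterated commutator whose inner bracket has the
form of ψ. The left side keeps the exact terms of the sum over the antidiagonal. -/
theorem braid_sum_e {k A : Type*} [Field k] [Ring A] [Algebra k A] {q : k} (hq : q ≠ 0)
    (h2 : q ^ 2 + 1 ≠ 0) (y a : A) :
    ((-1) ^ 0 * (q⁻¹) ^ 0 : k) • (((1 : k)⁻¹ • a ^ 0) * y * ((q + q⁻¹)⁻¹ • a ^ 2)) +
    (((-1) ^ 1 * (q⁻¹) ^ 1 : k) • (((1 : k)⁻¹ • a ^ 1) * y * ((1 : k)⁻¹ • a ^ 1)) +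
    ((-1) ^ 2 * (q⁻¹) ^ 2 : k) • (((q + q⁻¹)⁻¹ • a ^ 2) * y * ((1 : k)⁻¹ • a ^ 0))) =
    (q + q⁻¹)⁻¹ • ((y * a - (q ^ 2)⁻¹ • (a * y)) * a - a * (y * a - (q ^ 2)⁻¹ • (a * y))) := by
  simp only [pow_succ, pow_zero, one_mul, mul_one, smul_mul_assoc, mul_smul_comm, mul_sub, sub_mul,
    mul_assoc, smul_sub, smul_smul, inv_one, one_smul]
  match_scalars <;> field_simp
  all_goals ring

theorem braid_sum_f {k A : Type*} [Field k] [Ring A] [Algebra k A] {q : k} (hq : q ≠ 0)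
    (h2 : q ^ 2 + 1 ≠ 0) (y a : A) :
    ((-1) ^ 0 * q ^ 0 : k) • (((q + q⁻¹)⁻¹ • a ^ 2) * y * ((1 : k)⁻¹ • a ^ 0)) +
    (((-1) ^ 1 * q ^ 1 : k) • (((1 : k)⁻¹ • a ^ 1) * y * ((1 : k)⁻¹ • a ^ 1)) +
    ((-1) ^ 2 * q ^ 2 : k) • (((1 : k)⁻¹ • a ^ 0) * y * ((q + q⁻¹)⁻¹ • a ^ 2))) =
    (q + q⁻¹)⁻¹ • (a * (a * y - q ^ 2 • (y * a)) - (a * y - q ^ 2 • (y * a)) * a) := by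
  simp only [pow_succ, pow_zero, one_mul, mul_one, smul_mul_assoc, mul_smul_comm, mul_sub, sub_mul,
    mul_assoc, smul_sub, smul_smul, inv_one, one_smul]
  match_scalars <;> field_simp
  all_goals ring

/-- The homomorphism φ is arbitrary so that it can be `proj` composed with lifts of braid operators.
Iterated values are then computed without proving that the lifts descend to `Uq`. -/
theorem braid_e_of_ne {A : Type*} [Ring A] [Algebra 𝕂 A] (φ : Free →ₐ[𝕂] A) {i j : Fin 2}
    (h : j ≠ i) : φ (braid i (gen (.e j))) = (q + q⁻¹)⁻¹ •
      ((φ (gen (.e j)) * φ (gen (.e i)) - (q ^ 2)⁻¹ • (φ (gen (.e i)) * φ (gen (.e j)))) *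
        φ (gen (.e i)) - φ (gen (.e i)) *
        (φ (gen (.e j)) * φ (gen (.e i)) - (q ^ 2)⁻¹ • (φ (gen (.e i)) * φ (gen (.e j))))) := by
  simp only [braid, gen, FreeAlgebra.lift_ι_apply, braidGen, if_neg h,
    Finset.Nat.antidiagonal_succ, Finset.Nat.antidiagonal_zero, dpow, map_add, map_mul, map_smul,
    map_pow, Finset.sum_cons, Finset.map_singleton, Finset.sum_singleton,
    Finset.map_cons, Function.Embedding.prodMap, Function.Embedding.coeFn_mk, Prod.map,
    qFact_zero, qFact_one, qFact_two, Function.Embedding.refl_apply]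
  have e := braid_sum_e q_ne_zero q_sq_add_one_ne (φ (gen (.e j))) (φ (gen (.e i)))
  simp only [pow_succ, pow_zero, one_mul, mul_one, smul_mul_assoc, mul_smul_comm, mul_sub, sub_mul,
    mul_assoc, smul_sub, smul_smul, inv_one, one_smul, Nat.succ_eq_add_one, Nat.reduceAdd, zero_add,
    qFact_one, qFact_two] at e ⊢
  exact e

theorem braid_f_of_ne {A : Type*} [Ring A] [Algebra 𝕂 A] (φ : Free →ₐ[𝕂] A) {i j : Fin 2}
    (h : j ≠ i) : φ (braid i (gen (.f j))) = (q + q⁻¹)⁻¹ •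
      (φ (gen (.f i)) *
        (φ (gen (.f i)) * φ (gen (.f j)) - q ^ 2 • (φ (gen (.f j)) * φ (gen (.f i)))) -
        (φ (gen (.f i)) * φ (gen (.f j)) - q ^ 2 • (φ (gen (.f j)) * φ (gen (.f i)))) *
        φ (gen (.f i))) := by
  simp only [braid, gen, FreeAlgebra.lift_ι_apply, braidGen, if_neg h,
    Finset.Nat.antidiagonal_succ, Finset.Nat.antidiagonal_zero, dpow, map_add, map_mul, map_smul,
    map_pow, Finset.sum_cons, Finset.map_singleton, Finset.sum_singleton,
    Finset.map_cons, Function.Embedding.prodMap, Function.Embedding.coeFn_mk, Prod.map,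
    qFact_zero, qFact_one, qFact_two, Function.Embedding.refl_apply]
  have e := braid_sum_f q_ne_zero q_sq_add_one_ne (φ (gen (.f j))) (φ (gen (.f i)))
  simp only [pow_succ, pow_zero, one_mul, mul_one, smul_mul_assoc, mul_smul_comm, mul_sub, sub_mul,
    mul_assoc, smul_sub, smul_smul, inv_one, one_smul, Nat.succ_eq_add_one, Nat.reduceAdd, zero_add,
    qFact_one, qFact_two] at e ⊢
  exact e

theorem braid_e_self {A : Type*} [Ring A] [Algebra 𝕂 A] (φ : Free →ₐ[𝕂] A) (i : Fin 2) :
    φ (braid i (gen (.e i))) = -(φ (gen (.kinv i)) * φ (gen (.f i))) := by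
  simp [braid, braidGen]

/-- Replaces the inner bracket of the braid formula by a multiple of ψ and collects the scalars;
this turns each application of a braid operator into one more bracket with ψ. -/
theorem double_bracket {k U : Type*} [Field k] [Ring U] [Algebra k U] {t s c γ δ : k}
    {Y X ψ : U} (h : Y * X - t • (X * Y) = s • ψ) :
    c • (((δ • Y) * (γ • X) - t • ((γ • X) * (δ • Y))) * (γ • X) -
      (γ • X) * ((δ • Y) * (γ • X) - t • ((γ • X) * (δ • Y)))) =
      (c * δ * γ * γ * s) • (ψ * X - X * ψ) := by
  have e : (δ • Y) * (γ • X) - t • ((γ • X) * (δ • Y)) = (δ * γ * s) • ψ := by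
    rw [mul_smul, ← h]
    simp only [smul_mul_assoc, mul_smul_comm]
    module
  rw [e]
  simp only [smul_mul_assoc, mul_smul_comm]
  module

theorem neg_mul_smul' {k U : Type*} [Field k] [Ring U] [Algebra k U] (c : k) (x y : U) :
    -(x * c • y) = c • -(x * y) := by
  rw [mul_smul_comm, smul_neg]

/-- In the double bracket for a root vector the inner bracket, between the previous root vector and
a lowered element, is a multiple of ψ by `lower_w1` and `lower_w2`. After collecting scalars each
step contributes one factor 1/[2]. -/
theorem rootVector_eq (i : Fin 4) : rootVector i = ((q + q⁻¹)⁻¹) ^ (i : ℕ) • stringElt i := by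
  have h := chevalleyRelations
  have h2 := q_add_inv_ne
  have t0 : proj (gen (.e 0)) = stringElt 0 := rfl
  have hψ : psi = proj (gen (.e 1)) * proj (gen (.e 0)) -
    (q ^ 2)⁻¹ • (proj (gen (.e 0)) * proj (gen (.e 1))) := rfl
  have h1 : stringElt 1 = psi * proj (gen (.e 0)) - proj (gen (.e 0)) * psi := rfl
  have h12 : stringElt 2 = psi * stringElt 1 - stringElt 1 * psi := rfl
  have h23 : stringElt 3 = psi * stringElt 2 - stringElt 2 * psi := rfl
  have v1 : proj (braid 0 (gen (.e 1))) = (q + q⁻¹)⁻¹ • stringElt 1 := by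
    rw [braid_e_of_ne proj (by decide), h1, psi]
  have v2 : proj (braid 0 (braid 1 (gen (.e 0)))) = ((q + q⁻¹)⁻¹) ^ 2 • stringElt 2 := by
    have e := braid_e_of_ne (proj.comp (braid 0)) (i := 1) (j := 0) (by decide)
    simp only [AlgHom.comp_apply] at e
    rw [e, v1, braid_e_self proj 0]
    have e2 := double_bracket (c := (q + q⁻¹)⁻¹) (γ := (q + q⁻¹)⁻¹) (δ := 1) (h.lower_w1 hψ h1)
    rw [one_smul] at e2
    rw [e2, h12]
    congr 1
    field_simp
  have v3 : proj (braid 0 (braid 1 (braid 0 (gen (.e 1))))) = ((q + q⁻¹)⁻¹) ^ 3 • stringElt 3 := by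
    have e := braid_e_of_ne ((proj.comp (braid 0)).comp (braid 1)) (i := 0) (j := 1) (by decide)
    simp only [AlgHom.comp_apply] at e
    rw [e, v2]
    have e1 := braid_e_self (proj.comp (braid 0)) 1
    simp only [AlgHom.comp_apply] at e1
    rw [e1, braid_f_of_ne proj (by decide)]
    have e3 : proj (braid 0 (gen (.kinv 1))) = proj (gen (.kinv 0)) *
        (proj (gen (.kinv 0)) * proj (gen (.kinv 1))) := by
      have : braid 0 (gen (.kinv 1)) = gen (.kinv 1) * gen (.kinv 0) ^ 2 := by
        simp [braid, braidGen]
      rw [this, map_mul, map_pow, sq, ← mul_assoc, h.L'K', mul_assoc, h.L'K']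
    rw [e3]
    have e2 := double_bracket (c := (q + q⁻¹)⁻¹) (γ := (q + q⁻¹)⁻¹ ^ 2) (δ := (q + q⁻¹)⁻¹)
      (h.lower_w2 hψ h1 h12 rfl rfl)
    rw [neg_mul_smul', e2, h23]
    congr 1
    field_simp
  fin_cases i
  · simp [rootVector, t0]
  · simpa [rootVector] using v1
  · simpa [rootVector] using v2
  · simpa [rootVector] using v3

/-- The scalar `c` with `u_i = c^i w_i`, `w_i` the `i`-th element of the string. -/
def stringScale : 𝕂 := ((1 - (q⁻¹) ^ 2) ^ 2)⁻¹ * (q + q⁻¹)⁻¹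

theorem stringScale_ne : stringScale ≠ 0 := by
  have h : 1 - (q⁻¹) ^ 2 ≠ 0 := by
    have := q_ne_zero
    intro h0
    apply q_pow_ne_one (n := 2) (by norm_num)
    field_simp at h0; linear_combination h0
  exact mul_ne_zero (inv_ne_zero (pow_ne_zero _ h)) (inv_ne_zero q_add_inv_ne)

theorem coe_u (i : Fin 4) : (u i : Uq) = stringScale ^ (i : ℕ) • stringElt i := by
  have : (u i : Uq) = ((1 - (q⁻¹) ^ 2) ^ (2 * (i : ℕ)))⁻¹ • rootVector i := rfl
  rw [this, rootVector_eq, smul_smul, stringScale, mul_pow, pow_mul, ← inv_pow]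

theorem straightening_u : Straightening q u := by
  have h := (chevalleyRelations.straightening two_ne_zero q_four_add_sq_add_one_ne
    q_four_add_one_ne (ψ := psi) (w₁ := stringElt 1) (w₂ := stringElt 2) (w₃ := stringElt 3)
    rfl rfl rfl rfl).smul stringScale
  have e : ∀ i : Fin 4, (u i : Uq) = stringScale ^ (i : ℕ) • (![proj (gen (.e 0)), stringElt 1,
      stringElt 2, stringElt 3] : Fin 4 → Uq) i := by
    intro i; rw [coe_u]; fin_cases i <;> rfl
  obtain ⟨hq, r10, r21, r32, r20, r31, r30⟩ := h
  simp only [← e] at r10 r21 r32 r20 r31 r30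
  refine ⟨hq, ?_, ?_, ?_, ?_, ?_, ?_⟩ <;> apply Subtype.ext
  · exact r10
  · exact r21
  · exact r32
  · exact r20
  · exact r31
  · exact r30

/-! ### Weighted shift operators -/

section Shift

variable {k : Type*} [Field k]

/-- The functions on `ℤ × ℤ` that vanish far to the right. -/
def boundedFunctions (k : Type*) [Field k] : Submodule k (ℤ → ℤ → k) where
  carrier := {f | ∃ N : ℤ, ∀ i j, N < i → f i j = 0}
  zero_mem' := ⟨0, fun _ _ _ => rfl⟩
  add_mem' := by
    rintro f g ⟨N, hN⟩ ⟨M, hM⟩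
    refine ⟨max N M, fun i j hi => ?_⟩
    simp [hN i j (lt_of_le_of_lt (le_max_left _ _) hi),
      hM i j (lt_of_le_of_lt (le_max_right _ _) hi)]
  smul_mem' := by
    rintro c f ⟨N, hN⟩
    exact ⟨N, fun i j hi => by simp [hN i j hi]⟩

/-- The operator that moves functions by `(m, n)` after multiplying them by `c`. -/
def wshift (m n : ℤ) (c : ℤ → ℤ → k) : Module.End k (boundedFunctions k) where
  toFun f := ⟨fun i j => c (i - m) (j - n) * f.1 (i - m) (j - n), by
    obtain ⟨N, hN⟩ := f.2
    exact ⟨N + m, fun i j hi => by simp [hN (i - m) (j - n) (by omega)]⟩⟩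
  map_add' f g := by ext i j; simp [mul_add]
  map_smul' a f := by ext i j; simp [mul_left_comm]

theorem wshift_apply (m n : ℤ) (c : ℤ → ℤ → k) (f : boundedFunctions k) (i j : ℤ) :
    (wshift m n c f).1 i j = c (i - m) (j - n) * f.1 (i - m) (j - n) := rfl

theorem end_ext {S T : Module.End k (boundedFunctions k)}
    (h : ∀ f i j, (S f).1 i j = (T f).1 i j) : S = T := by
  ext f i j; exact h f i j

theorem wshift_mul (m n m' n' : ℤ) (c c' : ℤ → ℤ → k) : wshift m n c * wshift m' n' c' =
    wshift (m + m') (n + n') fun i j => c (i + m') (j + n') * c' i j := by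
  refine end_ext fun f i j => ?_
  rw [Module.End.mul_apply, wshift_apply, wshift_apply, wshift_apply]
  rw [show i - m = i - (m + m') + m' by ring, show j - n = j - (n + n') + n' by ring]
  simp only [add_sub_cancel_right, mul_assoc]

theorem wshift_add (m n : ℤ) (c c' : ℤ → ℤ → k) : wshift m n c + wshift m n c' =
    wshift m n fun i j => c i j + c' i j := by
  refine end_ext fun f i j => ?_
  simp [wshift_apply, add_mul]

theorem wshift_sub (m n : ℤ) (c c' : ℤ → ℤ → k) : wshift m n c - wshift m n c' =
    wshift m n fun i j => c i j - c' i j := by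
  refine end_ext fun f i j => ?_
  simp [wshift_apply, sub_mul]

theorem smul_wshift (m n : ℤ) (a : k) (c : ℤ → ℤ → k) : a • wshift m n c =
    wshift m n fun i j => a * c i j := by
  refine end_ext fun f i j => ?_
  simp [wshift_apply, mul_assoc]

theorem wshift_congr {m n : ℤ} {c c' : ℤ → ℤ → k} (h : ∀ i j, c i j = c' i j) :
    wshift m n c = wshift m n c' := by
  congr; funext i j; exact h i j

theorem wshift_one : wshift 0 0 (fun _ _ => (1 : k)) = 1 := by
  refine end_ext fun f i j => ?_
  simp [wshift_apply]

/-- Raising operators. -/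
def raise (a b : ℤ → ℤ → k) : Module.End k (boundedFunctions k) := wshift 1 0 a + wshift 0 1 b

/-- Lowering operators. -/
def lower (a b : ℤ → ℤ → k) : Module.End k (boundedFunctions k) :=
  wshift (-1) 0 a + wshift 0 (-1) b

/-- Diagonal operators. -/
def diag (h : ℤ → ℤ → k) : Module.End k (boundedFunctions k) := wshift 0 0 h

theorem diag_mul_diag (g h : ℤ → ℤ → k) : diag g * diag h = diag fun i j => g i j * h i j := by
  simp [diag, wshift_mul]

theorem diag_mul_raise (h a b : ℤ → ℤ → k) :
    diag h * raise a b = raise (fun i j => h (i + 1) j * a i j) fun i j => h i (j + 1) * b i j := by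
  simp [diag, raise, mul_add, wshift_mul]

theorem raise_mul_diag (h a b : ℤ → ℤ → k) :
    raise a b * diag h = raise (fun i j => a i j * h i j) fun i j => b i j * h i j := by
  simp [diag, raise, add_mul, wshift_mul]

theorem diag_mul_lower (h a b : ℤ → ℤ → k) :
    diag h * lower a b =
      lower (fun i j => h (i - 1) j * a i j) fun i j => h i (j - 1) * b i j := by
  simp [diag, lower, mul_add, wshift_mul, sub_eq_add_neg]

theorem lower_mul_diag (h a b : ℤ → ℤ → k) :
    lower a b * diag h = lower (fun i j => a i j * h i j) fun i j => b i j * h i j := by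
  simp [diag, lower, add_mul, wshift_mul]

theorem raise_mul_raise (a b c d : ℤ → ℤ → k) : raise a b * raise c d =
    wshift 2 0 (fun i j => a (i + 1) j * c i j) +
    wshift 1 1 (fun i j => a i (j + 1) * d i j + b (i + 1) j * c i j) +
    wshift 0 2 (fun i j => b i (j + 1) * d i j) := by
  simp only [raise, add_mul, mul_add, wshift_mul, ← wshift_add]
  norm_num
  abel

theorem lower_mul_lower (a b c d : ℤ → ℤ → k) : lower a b * lower c d =
    wshift (-2) 0 (fun i j => a (i - 1) j * c i j) +
    wshift (-1) (-1) (fun i j => a i (j - 1) * d i j + b (i - 1) j * c i j) +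
    wshift 0 (-2) (fun i j => b i (j - 1) * d i j) := by
  simp only [lower, add_mul, mul_add, wshift_mul, ← wshift_add]
  norm_num [← sub_eq_add_neg]
  abel

theorem raise_mul_lower (a b c d : ℤ → ℤ → k) : raise a b * lower c d =
    diag (fun i j => a (i - 1) j * c i j + b i (j - 1) * d i j) +
    wshift 1 (-1) (fun i j => a i (j - 1) * d i j) +
    wshift (-1) 1 (fun i j => b (i - 1) j * c i j) := by
  simp only [raise, lower, diag, add_mul, mul_add, wshift_mul, ← wshift_add]
  norm_num [← sub_eq_add_neg]
  abel

theorem lower_mul_raise (a b c d : ℤ → ℤ → k) : lower c d * raise a b =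
    diag (fun i j => c (i + 1) j * a i j + d i (j + 1) * b i j) +
    wshift 1 (-1) (fun i j => d (i + 1) j * a i j) +
    wshift (-1) 1 (fun i j => c i (j + 1) * b i j) := by
  simp only [raise, lower, diag, add_mul, mul_add, wshift_mul, ← wshift_add]
  norm_num [← sub_eq_add_neg]
  abel

theorem smul_raise (c : k) (a b : ℤ → ℤ → k) :
    c • raise a b = raise (fun i j => c * a i j) fun i j => c * b i j := by
  simp [raise, smul_wshift]

theorem smul_lower (c : k) (a b : ℤ → ℤ → k) :
    c • lower a b = lower (fun i j => c * a i j) fun i j => c * b i j := by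
  simp [lower, smul_wshift]

theorem raise_congr {a b a' b' : ℤ → ℤ → k} (h : ∀ i j, a i j = a' i j)
    (h' : ∀ i j, b i j = b' i j) : raise a b = raise a' b' := by
  rw [raise, wshift_congr h, wshift_congr h', raise]

theorem lower_congr {a b a' b' : ℤ → ℤ → k} (h : ∀ i j, a i j = a' i j)
    (h' : ∀ i j, b i j = b' i j) : lower a b = lower a' b' := by
  rw [lower, wshift_congr h, wshift_congr h', lower]

theorem raise_sub (a b c d : ℤ → ℤ → k) : raise a b - raise c d =
    raise (fun i j => a i j - c i j) fun i j => b i j - d i j := by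
  simp only [raise, ← wshift_sub]; abel

theorem lower_sub (a b c d : ℤ → ℤ → k) : lower a b - lower c d =
    lower (fun i j => a i j - c i j) fun i j => b i j - d i j := by
  simp only [lower, ← wshift_sub]; abel

/-- Both products consist of a diagonal part and shifts by (1,-1) and (-1,1), so an identity of
operators reduces to three scalar identities. -/
theorem raise_mul_lower_eq {a b c d r : ℤ → ℤ → k} {t : k}
    (h : ∀ i j, a (i - 1) j * c i j + b i (j - 1) * d i j =
      t * (c (i + 1) j * a i j + d i (j + 1) * b i j) + r i j)
    (h₁ : ∀ i j, a i (j - 1) * d i j = t * (d (i + 1) j * a i j))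
    (h₂ : ∀ i j, b (i - 1) j * c i j = t * (c i (j + 1) * b i j)) :
    raise a b * lower c d = t • (lower c d * raise a b) + diag r := by
  rw [raise_mul_lower, lower_mul_raise, wshift_congr h₁, wshift_congr h₂, ← smul_wshift,
    ← smul_wshift, diag, wshift_congr h, ← wshift_add, ← smul_wshift, smul_add, smul_add, diag, diag]
  abel

theorem raise_mul_raise_eq {a b c d : ℤ → ℤ → k} {t : k}
    (h : ∀ i j, a i (j + 1) * d i j + b (i + 1) j * c i j =
      t * (c i (j + 1) * b i j + d (i + 1) j * a i j))
    (h₁ : ∀ i j, a (i + 1) j * c i j = t * (c (i + 1) j * a i j))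
    (h₂ : ∀ i j, b i (j + 1) * d i j = t * (d i (j + 1) * b i j)) :
    raise a b * raise c d = t • (raise c d * raise a b) := by
  rw [raise_mul_raise, raise_mul_raise, wshift_congr h₁, wshift_congr h₂, wshift_congr h,
    smul_add, smul_add, smul_wshift, smul_wshift, smul_wshift]

theorem lower_mul_lower_eq {a b c d : ℤ → ℤ → k} {t : k}
    (h : ∀ i j, a i (j - 1) * d i j + b (i - 1) j * c i j =
      t * (c i (j - 1) * b i j + d (i - 1) j * a i j))
    (h₁ : ∀ i j, a (i - 1) j * c i j = t * (c (i - 1) j * a i j))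
    (h₂ : ∀ i j, b i (j - 1) * d i j = t * (d i (j - 1) * b i j)) :
    lower a b * lower c d = t • (lower c d * lower a b) := by
  rw [lower_mul_lower, lower_mul_lower, wshift_congr h₁, wshift_congr h₂, wshift_congr h,
    smul_add, smul_add, smul_wshift, smul_wshift, smul_wshift]

theorem raise_injective {a b : ℤ → ℤ → k} (ha : ∀ i j, a i j ≠ 0) (hb : ∀ i j, b i j ≠ 0)
    {f : boundedFunctions k} (h : raise a b f = 0) : f = 0 := by
  obtain ⟨N, hN⟩ := f.2
  -- Downward induction on the first coordinate: the value of the image at (i + 1, j) involves f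
  -- only at (i, j) and at (i + 1, j - 1), where it already vanishes.
  have key : ∀ n : ℕ, ∀ i j, N - n < i → f.1 i j = 0 := by
    intro n
    induction n with
    | zero => intro i j hi; exact hN i j (by simpa using hi)
    | succ n ih =>
      intro i j hi
      have e : a i j * f.1 i j + b (i + 1) (j - 1) * f.1 (i + 1) (j - 1) = 0 := by
        have := congrFun (congrFun (congrArg Subtype.val h) (i + 1)) j
        simpa [raise, wshift_apply] using this
      rw [ih (i + 1) (j - 1) (by push_cast at hi; omega), mul_zero, add_zero] at e
      exact (mul_eq_zero.1 e).resolve_left (ha i j)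
  ext i j
  refine key (N - i + 1).toNat i j ?_
  have := Int.self_le_toNat (N - i + 1)
  omega

theorem wshift_injective {m n : ℤ} {c : ℤ → ℤ → k} (hc : ∀ i j, c i j ≠ 0)
    {f : boundedFunctions k} (h : wshift m n c f = 0) : f = 0 := by
  ext i j
  have := congrFun (congrFun (congrArg Subtype.val h) (i + m)) (j + n)
  simp only [wshift_apply, add_sub_cancel_right] at this
  exact (mul_eq_zero.1 this).resolve_left (hc i j)

end Shift

/-- Quantum Serre relations from a commutation relation. -/
theorem serre_of_bracket {k R : Type*} [Field k] [Ring R] [Algebra k R] {q : k} (hq : q ≠ 0)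
    {a y ψ : R} (hψ : y * a - (q ^ 2)⁻¹ • (a * y) = ψ)
    (h : (ψ * a - a * ψ) * a = q ^ 2 • (a * (ψ * a - a * ψ)))
    (h' : y * (y * ψ - ψ * y) = q ^ 2 • ((y * ψ - ψ * y) * y)) :
    a ^ 3 * y - (q ^ 2 + 1 + (q ^ 2)⁻¹) • (a ^ 2 * y * a) +
      (q ^ 2 + 1 + (q ^ 2)⁻¹) • (a * y * a ^ 2) - y * a ^ 3 = 0 ∧
    y ^ 3 * a - (q ^ 2 + 1 + (q ^ 2)⁻¹) • (y ^ 2 * a * y) +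
      (q ^ 2 + 1 + (q ^ 2)⁻¹) • (y * a * y ^ 2) - a * y ^ 3 = 0 := by
  subst hψ
  rw [← sub_eq_zero] at h h'
  constructor
  · rw [← neg_eq_zero, ← h]
    simp only [pow_succ, pow_zero, one_mul, mul_sub, sub_mul, smul_mul_assoc, mul_smul_comm,
      mul_assoc]
    match_scalars <;> field_simp <;> ring
  · rw [← h']
    simp only [pow_succ, pow_zero, one_mul, mul_sub, sub_mul, smul_mul_assoc, mul_smul_comm,
      mul_assoc]
    match_scalars <;> field_simp <;> ring

/-- Two geometric progressions of ratio `q²` without common terms. -/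
structure Progressions {k : Type*} [Field k] (q : k) (x y : ℤ → k) : Prop where
  q_ne : q ≠ 0
  q_sub_ne : q ^ 2 - 1 ≠ 0
  x_ne (i : ℤ) : x i ≠ 0
  y_ne (j : ℤ) : y j ≠ 0
  ne (i j : ℤ) : x i - y j ≠ 0
  x_succ (i : ℤ) : x (i + 1) = q ^ 2 * x i
  y_succ (j : ℤ) : y (j + 1) = q ^ 2 * y j

/-! ### Operators satisfying the relations of the quantized enveloping algebra. -/

section Rep

variable {k : Type*} [Field k]

/-- The coefficient of the lowering operators. -/
def lowerCoeff (q x y : k) : k :=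
  ((q ^ 3 * (x / q ^ 2) ^ 3 + q⁻¹ * (x / q ^ 2)⁻¹) / (q - q⁻¹) ^ 2) * y / (y - x)

variable (q : k) (x y : ℤ → k)

/-- The action of `E₁`. -/
def eOp : Module.End k (boundedFunctions k) :=
  raise (fun i j => (x i - y j)⁻¹) fun i j => -(x i - y j)⁻¹

/-- The action of `F₁`. -/
def fOp : Module.End k (boundedFunctions k) :=
  lower (fun i j => lowerCoeff q (x i) (y j)) fun i j => lowerCoeff q (y j) (x i)

/-- The action of `E₂`. -/
def e'Op : Module.End k (boundedFunctions k) :=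
  lower (fun i j => lowerCoeff q (x i) (y j) / (q ^ 2 * y j))
    fun i j => lowerCoeff q (y j) (x i) / (q ^ 2 * x i)

/-- The action of `F₂`. -/
def f'Op : Module.End k (boundedFunctions k) :=
  raise (fun i j => q ^ 2 * y j * (x i - y j)⁻¹) fun i j => -(q ^ 2 * x i * (x i - y j)⁻¹)

variable {q x y} (h : Progressions q x y)
include h

namespace Progressions

theorem x_pred (i : ℤ) : x (i - 1) = x i / q ^ 2 := by
  have := h.x_succ (i - 1)
  rw [sub_add_cancel] at this
  rw [this, mul_div_cancel_left₀ _ (pow_ne_zero _ h.q_ne)]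

theorem y_pred (i : ℤ) : y (i - 1) = y i / q ^ 2 := by
  have := h.y_succ (i - 1)
  rw [sub_add_cancel] at this
  rw [this, mul_div_cancel_left₀ _ (pow_ne_zero _ h.q_ne)]

theorem ne1 (i j : ℤ) : q ^ 2 * x i - y j ≠ 0 := by
  rw [← h.x_succ]; exact h.ne _ _

theorem ne2 (i j : ℤ) : x i - q ^ 2 * y j ≠ 0 := by
  rw [← h.y_succ]; exact h.ne _ _

theorem ne3 (i j : ℤ) : y j - x i ≠ 0 := by
  rw [← neg_sub]; exact neg_ne_zero.2 (h.ne _ _)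

theorem ne4 (i j : ℤ) : y j - q ^ 2 * x i ≠ 0 := by
  rw [← neg_sub]; exact neg_ne_zero.2 (h.ne1 _ _)

theorem ne5 (i j : ℤ) : q ^ 2 * y j - x i ≠ 0 := by
  rw [← neg_sub]; exact neg_ne_zero.2 (h.ne2 _ _)


theorem ne6 (i j : ℤ) : x i * q ^ 2 - y j ≠ 0 := mul_comm (x i) _ ▸ h.ne1 i j

theorem ne7 (i j : ℤ) : x i - y j * q ^ 2 ≠ 0 := mul_comm (y j) _ ▸ h.ne2 i j

theorem ne8 (i j : ℤ) : y j - x i * q ^ 2 ≠ 0 := mul_comm (x i) _ ▸ h.ne4 i j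

theorem ne9 (i j : ℤ) : y j * q ^ 2 - x i ≠ 0 := mul_comm (y j) _ ▸ h.ne5 i j

/-- The off-diagonal parts commute. The diagonal part is a partial fraction identity which explains
the shape of `lowerCoeff`: by homogeneity, its cubic term produces the product xy and its inverse
term produces -(xy)⁻¹. -/
theorem e_mul_f : eOp x y * fOp q x y = (1 : k) • (fOp q x y * eOp x y) +
    diag fun i j => (q - q⁻¹)⁻¹ * (x i * y j - (x i * y j)⁻¹) := by
  have hq := h.q_ne
  have hq' := h.q_sub_ne
  refine raise_mul_lower_eq ?_ ?_ ?_
  · intro i j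
    simp only [h.x_pred, h.y_pred, h.x_succ, h.y_succ, lowerCoeff]
    have := h.x_ne i; have := h.y_ne j; have := h.ne i j; have := h.ne1 i j; have := h.ne2 i j
    have := h.ne3 i j; have := h.ne4 i j; have := h.ne5 i j
    have := h.ne6 i j; have := h.ne7 i j; have := h.ne8 i j; have := h.ne9 i j
    field_simp <;> ring
  · intro i j
    simp only [h.y_pred, h.x_succ, lowerCoeff]
    have := h.x_ne i; have := h.y_ne j; have := h.ne i j; have := h.ne1 i j; have := h.ne2 i j
    have := h.ne3 i j; have := h.ne4 i j; have := h.ne5 i j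
    have := h.ne6 i j; have := h.ne7 i j; have := h.ne8 i j; have := h.ne9 i j
    field_simp
  · intro i j
    simp only [h.x_pred, h.y_succ, lowerCoeff]
    have := h.x_ne i; have := h.y_ne j; have := h.ne i j; have := h.ne1 i j; have := h.ne2 i j
    have := h.ne3 i j; have := h.ne4 i j; have := h.ne5 i j
    have := h.ne6 i j; have := h.ne7 i j; have := h.ne8 i j; have := h.ne9 i j
    field_simp <;> ring

theorem f'_mul_e' : f'Op q x y * e'Op q x y = (1 : k) • (e'Op q x y * f'Op q x y) +
    diag fun i j => (q - q⁻¹)⁻¹ * (x i * y j - (x i * y j)⁻¹) := by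
  have hq := h.q_ne
  have hq' := h.q_sub_ne
  refine raise_mul_lower_eq ?_ ?_ ?_
  · intro i j
    simp only [h.x_pred, h.y_pred, h.x_succ, h.y_succ, lowerCoeff]
    have := h.x_ne i; have := h.y_ne j; have := h.ne i j; have := h.ne1 i j; have := h.ne2 i j
    have := h.ne3 i j; have := h.ne4 i j; have := h.ne5 i j
    have := h.ne6 i j; have := h.ne7 i j; have := h.ne8 i j; have := h.ne9 i j
    field_simp <;> ring
  · intro i j
    simp only [h.y_pred, h.x_succ, lowerCoeff]
    have := h.x_ne i; have := h.y_ne j; have := h.ne i j; have := h.ne1 i j; have := h.ne2 i j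
    have := h.ne3 i j; have := h.ne4 i j; have := h.ne5 i j
    have := h.ne6 i j; have := h.ne7 i j; have := h.ne8 i j; have := h.ne9 i j
    field_simp
  · intro i j
    simp only [h.x_pred, h.y_succ, lowerCoeff]
    have := h.x_ne i; have := h.y_ne j; have := h.ne i j; have := h.ne1 i j; have := h.ne2 i j
    have := h.ne3 i j; have := h.ne4 i j; have := h.ne5 i j
    have := h.ne6 i j; have := h.ne7 i j; have := h.ne8 i j; have := h.ne9 i j
    field_simp <;> ring

theorem e_mul_f' : eOp x y * f'Op q x y = (1 : k) • (f'Op q x y * eOp x y) := by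
  have hq := h.q_ne
  have hq' := h.q_sub_ne
  refine raise_mul_raise_eq ?_ ?_ ?_
  · intro i j
    simp only [h.x_succ, h.y_succ]
    have := h.x_ne i; have := h.y_ne j; have := h.ne i j; have := h.ne1 i j; have := h.ne2 i j
    have := h.ne3 i j; have := h.ne4 i j; have := h.ne5 i j
    have := h.ne6 i j; have := h.ne7 i j; have := h.ne8 i j; have := h.ne9 i j
    field_simp <;> ring
  · intro i j
    simp only [h.x_succ]
    have := h.x_ne i; have := h.y_ne j; have := h.ne i j; have := h.ne1 i j; have := h.ne2 i j
    have := h.ne3 i j; have := h.ne4 i j; have := h.ne5 i j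
    have := h.ne6 i j; have := h.ne7 i j; have := h.ne8 i j; have := h.ne9 i j
    field_simp
  · intro i j
    simp only [h.y_succ]
    have := h.x_ne i; have := h.y_ne j; have := h.ne i j; have := h.ne1 i j; have := h.ne2 i j
    have := h.ne3 i j; have := h.ne4 i j; have := h.ne5 i j
    have := h.ne6 i j; have := h.ne7 i j; have := h.ne8 i j; have := h.ne9 i j
    field_simp

theorem e'_mul_f : e'Op q x y * fOp q x y = (1 : k) • (fOp q x y * e'Op q x y) := by
  have hq := h.q_ne
  have hq' := h.q_sub_ne
  refine lower_mul_lower_eq ?_ ?_ ?_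
  · intro i j
    simp only [h.x_pred, h.y_pred, lowerCoeff]
    have := h.x_ne i; have := h.y_ne j; have := h.ne i j; have := h.ne1 i j; have := h.ne2 i j
    have := h.ne3 i j; have := h.ne4 i j; have := h.ne5 i j
    have := h.ne6 i j; have := h.ne7 i j; have := h.ne8 i j; have := h.ne9 i j
    field_simp <;> ring
  · intro i j
    simp only [h.x_pred, lowerCoeff]
    have := h.x_ne i; have := h.y_ne j; have := h.ne i j; have := h.ne1 i j; have := h.ne2 i j
    have := h.ne3 i j; have := h.ne4 i j; have := h.ne5 i j
    have := h.ne6 i j; have := h.ne7 i j; have := h.ne8 i j; have := h.ne9 i j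
    field_simp
  · intro i j
    simp only [h.y_pred, lowerCoeff]
    have := h.x_ne i; have := h.y_ne j; have := h.ne i j; have := h.ne1 i j; have := h.ne2 i j
    have := h.ne3 i j; have := h.ne4 i j; have := h.ne5 i j
    have := h.ne6 i j; have := h.ne7 i j; have := h.ne8 i j; have := h.ne9 i j
    field_simp

theorem e_mul_e' : eOp x y * e'Op q x y = q ^ 2 • (e'Op q x y * eOp x y) +
    diag fun i j => (q + q⁻¹) / (q * (q - q⁻¹)) * (x i + y j) := by
  have hq := h.q_ne
  have hq' := h.q_sub_ne
  refine raise_mul_lower_eq ?_ ?_ ?_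
  · intro i j
    simp only [h.x_pred, h.y_pred, h.x_succ, h.y_succ, lowerCoeff]
    have := h.x_ne i; have := h.y_ne j; have := h.ne i j; have := h.ne1 i j; have := h.ne2 i j
    have := h.ne3 i j; have := h.ne4 i j; have := h.ne5 i j
    have := h.ne6 i j; have := h.ne7 i j; have := h.ne8 i j; have := h.ne9 i j
    field_simp <;> ring
  · intro i j
    simp only [h.y_pred, h.x_succ, lowerCoeff]
    have := h.x_ne i; have := h.y_ne j; have := h.ne i j; have := h.ne1 i j; have := h.ne2 i j
    have := h.ne3 i j; have := h.ne4 i j; have := h.ne5 i j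
    have := h.ne6 i j; have := h.ne7 i j; have := h.ne8 i j; have := h.ne9 i j
    field_simp
  · intro i j
    simp only [h.x_pred, h.y_succ, lowerCoeff]
    have := h.x_ne i; have := h.y_ne j; have := h.ne i j; have := h.ne1 i j; have := h.ne2 i j
    have := h.ne3 i j; have := h.ne4 i j; have := h.ne5 i j
    have := h.ne6 i j; have := h.ne7 i j; have := h.ne8 i j; have := h.ne9 i j
    field_simp <;> ring

theorem f'_mul_f : f'Op q x y * fOp q x y = (q ^ 2)⁻¹ • (fOp q x y * f'Op q x y) +
    diag fun i j => -((q + q⁻¹) * q / (q - q⁻¹)) * ((x i)⁻¹ + (y j)⁻¹) := by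
  have hq := h.q_ne
  have hq' := h.q_sub_ne
  refine raise_mul_lower_eq ?_ ?_ ?_
  · intro i j
    simp only [h.x_pred, h.y_pred, h.x_succ, h.y_succ, lowerCoeff]
    have := h.x_ne i; have := h.y_ne j; have := h.ne i j; have := h.ne1 i j; have := h.ne2 i j
    have := h.ne3 i j; have := h.ne4 i j; have := h.ne5 i j
    have := h.ne6 i j; have := h.ne7 i j; have := h.ne8 i j; have := h.ne9 i j
    field_simp <;> ring
  · intro i j
    simp only [h.y_pred, h.x_succ, lowerCoeff]
    have := h.x_ne i; have := h.y_ne j; have := h.ne i j; have := h.ne1 i j; have := h.ne2 i j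
    have := h.ne3 i j; have := h.ne4 i j; have := h.ne5 i j
    have := h.ne6 i j; have := h.ne7 i j; have := h.ne8 i j; have := h.ne9 i j
    field_simp
  · intro i j
    simp only [h.x_pred, h.y_succ, lowerCoeff]
    have := h.x_ne i; have := h.y_ne j; have := h.ne i j; have := h.ne1 i j; have := h.ne2 i j
    have := h.ne3 i j; have := h.ne4 i j; have := h.ne5 i j
    have := h.ne6 i j; have := h.ne7 i j; have := h.ne8 i j; have := h.ne9 i j
    field_simp <;> ring

end Progressions

end Rep

theorem diag_congr {k : Type*} [Field k] {a b : ℤ → ℤ → k} (h : ∀ i j, a i j = b i j) :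
    diag a = diag b := wshift_congr h

namespace Progressions

variable {k : Type*} [Field k] {q : k} {x y : ℤ → k} (h : Progressions q x y)
include h

/-- This is the action of ψ. That it is diagonal, a multiple of xᵢ + yⱼ, makes all brackets with ψ
computable. -/
theorem e'_mul_e : e'Op q x y * eOp x y - (q ^ 2)⁻¹ • (eOp x y * e'Op q x y) =
    diag fun i j => -((q + q⁻¹) / (q ^ 3 * (q - q⁻¹))) * (x i + y j) := by
  have hq := h.q_ne
  have hq' := h.q_sub_ne
  rw [h.e_mul_e', smul_add, smul_smul, inv_mul_cancel₀ (pow_ne_zero _ hq), one_smul]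
  refine (sub_add_cancel_left (e'Op q x y * eOp x y) _).trans ?_
  have e : ∀ r : ℤ → ℤ → k, -((q ^ 2)⁻¹ • diag r) = diag fun i j => -(q ^ 2)⁻¹ * r i j := by
    intro r
    refine (neg_smul ((q ^ 2)⁻¹) (diag r)).symm.trans ?_
    rw [diag, smul_wshift]; rfl
  rw [e]
  refine diag_congr fun i j => ?_
  field_simp

theorem f'_mul_f_sub : f'Op q x y * fOp q x y - (q ^ 2)⁻¹ • (fOp q x y * f'Op q x y) =
    diag fun i j => -((q + q⁻¹) * q / (q - q⁻¹)) * ((x i)⁻¹ + (y j)⁻¹) := by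
  rw [h.f'_mul_f]
  exact add_sub_cancel_left ((q ^ 2)⁻¹ • (fOp q x y * f'Op q x y)) _

/-- Raising i replaces xᵢ by q²xᵢ and fixes yⱼ, so the eigenvalue of ψ changes by a multiple of xᵢ;
the other shift gives the same multiple of yⱼ. Hence bracketing with ψ raises the power in the
weights by one. -/
theorem bracket_raise : ∀ n : ℕ, ((diag fun i j => -((q + q⁻¹) / (q ^ 3 * (q - q⁻¹))) * (x i + y j)) *
    (raise (fun i j => x i ^ n * (x i - y j)⁻¹) fun i j => -(y j ^ n * (x i - y j)⁻¹))) -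
    (raise (fun i j => x i ^ n * (x i - y j)⁻¹) fun i j => -(y j ^ n * (x i - y j)⁻¹)) *
    (diag fun i j => -((q + q⁻¹) / (q ^ 3 * (q - q⁻¹))) * (x i + y j)) = (-((q + q⁻¹) / q ^ 2)) •
    raise (fun i j => x i ^ (n + 1) * (x i - y j)⁻¹) fun i j => -(y j ^ (n + 1) * (x i - y j)⁻¹) := by
  have hq := h.q_ne
  have hq' := h.q_sub_ne
  intro n
  rw [diag_mul_raise, raise_mul_diag, raise_sub, smul_raise]
  refine raise_congr ?_ ?_
  · intro i j
    simp only [h.x_succ]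
    have := h.x_ne i; have := h.y_ne j; have := h.ne i j; have := h.ne1 i j; have := h.ne2 i j
    have := h.ne3 i j; have := h.ne4 i j; have := h.ne5 i j
    have := h.ne6 i j; have := h.ne7 i j; have := h.ne8 i j; have := h.ne9 i j
    field_simp <;> ring
  · intro i j
    simp only [h.y_succ]
    have := h.x_ne i; have := h.y_ne j; have := h.ne i j; have := h.ne1 i j; have := h.ne2 i j
    have := h.ne3 i j; have := h.ne4 i j; have := h.ne5 i j
    have := h.ne6 i j; have := h.ne7 i j; have := h.ne8 i j; have := h.ne9 i j
    field_simp <;> ring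

theorem bracket_e' : e'Op q x y * (diag fun i j => -((q + q⁻¹) / (q ^ 3 * (q - q⁻¹))) * (x i + y j)) -
    (diag fun i j => -((q + q⁻¹) / (q ^ 3 * (q - q⁻¹))) * (x i + y j)) * e'Op q x y =
    (-((q + q⁻¹) / q ^ 4)) • lower (fun i j => x i * (lowerCoeff q (x i) (y j) / (q ^ 2 * y j)))
      fun i j => y j * (lowerCoeff q (y j) (x i) / (q ^ 2 * x i)) := by
  have hq := h.q_ne
  have hq' := h.q_sub_ne
  rw [e'Op, diag_mul_lower, lower_mul_diag, lower_sub, smul_lower]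
  refine lower_congr ?_ ?_
  · intro i j
    simp only [h.x_pred, lowerCoeff]
    have := h.x_ne i; have := h.y_ne j; have := h.ne i j; have := h.ne1 i j; have := h.ne2 i j
    have := h.ne3 i j; have := h.ne4 i j; have := h.ne5 i j
    have := h.ne6 i j; have := h.ne7 i j; have := h.ne8 i j; have := h.ne9 i j
    field_simp <;> ring
  · intro i j
    simp only [h.y_pred, lowerCoeff]
    have := h.x_ne i; have := h.y_ne j; have := h.ne i j; have := h.ne1 i j; have := h.ne2 i j
    have := h.ne3 i j; have := h.ne4 i j; have := h.ne5 i j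
    have := h.ne6 i j; have := h.ne7 i j; have := h.ne8 i j; have := h.ne9 i j
    field_simp <;> ring

theorem bracket_f : (diag fun i j => -((q + q⁻¹) * q / (q - q⁻¹)) * ((x i)⁻¹ + (y j)⁻¹)) * fOp q x y -
    fOp q x y * (diag fun i j => -((q + q⁻¹) * q / (q - q⁻¹)) * ((x i)⁻¹ + (y j)⁻¹)) =
    (-((q + q⁻¹) * q ^ 2)) • lower (fun i j => (x i)⁻¹ * lowerCoeff q (x i) (y j))
      fun i j => (y j)⁻¹ * lowerCoeff q (y j) (x i) := by
  have hq := h.q_ne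
  have hq' := h.q_sub_ne
  rw [fOp, diag_mul_lower, lower_mul_diag, lower_sub, smul_lower]
  refine lower_congr ?_ ?_
  · intro i j
    simp only [h.x_pred, lowerCoeff]
    have := h.x_ne i; have := h.y_ne j; have := h.ne i j; have := h.ne1 i j; have := h.ne2 i j
    have := h.ne3 i j; have := h.ne4 i j; have := h.ne5 i j
    have := h.ne6 i j; have := h.ne7 i j; have := h.ne8 i j; have := h.ne9 i j
    field_simp <;> ring
  · intro i j
    simp only [h.y_pred, lowerCoeff]
    have := h.x_ne i; have := h.y_ne j; have := h.ne i j; have := h.ne1 i j; have := h.ne2 i j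
    have := h.ne3 i j; have := h.ne4 i j; have := h.ne5 i j
    have := h.ne6 i j; have := h.ne7 i j; have := h.ne8 i j; have := h.ne9 i j
    field_simp <;> ring

theorem bracket_f' : f'Op q x y * (diag fun i j => -((q + q⁻¹) * q / (q - q⁻¹)) * ((x i)⁻¹ + (y j)⁻¹)) -
    (diag fun i j => -((q + q⁻¹) * q / (q - q⁻¹)) * ((x i)⁻¹ + (y j)⁻¹)) * f'Op q x y =
    (-((q + q⁻¹) * q ^ 2)) • raise (fun i j => y j * (x i - y j)⁻¹ * (x i)⁻¹)
      fun i j => -(x i * (x i - y j)⁻¹ * (y j)⁻¹) := by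
  have hq := h.q_ne
  have hq' := h.q_sub_ne
  rw [f'Op, diag_mul_raise, raise_mul_diag, raise_sub, smul_raise]
  refine raise_congr ?_ ?_
  · intro i j
    simp only [h.x_succ]
    have := h.x_ne i; have := h.y_ne j; have := h.ne i j; have := h.ne1 i j; have := h.ne2 i j
    have := h.ne3 i j; have := h.ne4 i j; have := h.ne5 i j
    have := h.ne6 i j; have := h.ne7 i j; have := h.ne8 i j; have := h.ne9 i j
    field_simp <;> ring
  · intro i j
    simp only [h.y_succ]
    have := h.x_ne i; have := h.y_ne j; have := h.ne i j; have := h.ne1 i j; have := h.ne2 i j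
    have := h.ne3 i j; have := h.ne4 i j; have := h.ne5 i j
    have := h.ne6 i j; have := h.ne7 i j; have := h.ne8 i j; have := h.ne9 i j
    field_simp <;> ring

theorem raise_one_mul_e : (raise (fun i j => x i ^ 1 * (x i - y j)⁻¹)
    fun i j => -(y j ^ 1 * (x i - y j)⁻¹)) * eOp x y = q ^ 2 • (eOp x y *
    raise (fun i j => x i ^ 1 * (x i - y j)⁻¹) fun i j => -(y j ^ 1 * (x i - y j)⁻¹)) := by
  have hq := h.q_ne
  have hq' := h.q_sub_ne
  refine raise_mul_raise_eq ?_ ?_ ?_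
  · intro i j
    simp only [h.x_succ, h.y_succ]
    have := h.x_ne i; have := h.y_ne j; have := h.ne i j; have := h.ne1 i j; have := h.ne2 i j
    have := h.ne3 i j; have := h.ne4 i j; have := h.ne5 i j
    have := h.ne6 i j; have := h.ne7 i j; have := h.ne8 i j; have := h.ne9 i j
    field_simp <;> ring
  · intro i j
    simp only [h.x_succ]
    have := h.x_ne i; have := h.y_ne j; have := h.ne i j; have := h.ne1 i j; have := h.ne2 i j
    have := h.ne3 i j; have := h.ne4 i j; have := h.ne5 i j
    have := h.ne6 i j; have := h.ne7 i j; have := h.ne8 i j; have := h.ne9 i j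
    field_simp
  · intro i j
    simp only [h.y_succ]
    have := h.x_ne i; have := h.y_ne j; have := h.ne i j; have := h.ne1 i j; have := h.ne2 i j
    have := h.ne3 i j; have := h.ne4 i j; have := h.ne5 i j
    have := h.ne6 i j; have := h.ne7 i j; have := h.ne8 i j; have := h.ne9 i j
    field_simp

theorem e'_mul_lower : e'Op q x y *
    (lower (fun i j => x i * (lowerCoeff q (x i) (y j) / (q ^ 2 * y j)))
      fun i j => y j * (lowerCoeff q (y j) (x i) / (q ^ 2 * x i))) = q ^ 2 •
    ((lower (fun i j => x i * (lowerCoeff q (x i) (y j) / (q ^ 2 * y j)))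
      fun i j => y j * (lowerCoeff q (y j) (x i) / (q ^ 2 * x i))) * e'Op q x y) := by
  have hq := h.q_ne
  have hq' := h.q_sub_ne
  refine lower_mul_lower_eq ?_ ?_ ?_
  · intro i j
    simp only [h.x_pred, h.y_pred, lowerCoeff]
    have := h.x_ne i; have := h.y_ne j; have := h.ne i j; have := h.ne1 i j; have := h.ne2 i j
    have := h.ne3 i j; have := h.ne4 i j; have := h.ne5 i j
    have := h.ne6 i j; have := h.ne7 i j; have := h.ne8 i j; have := h.ne9 i j
    field_simp <;> ring
  · intro i j
    simp only [h.x_pred, lowerCoeff]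
    have := h.x_ne i; have := h.y_ne j; have := h.ne i j; have := h.ne1 i j; have := h.ne2 i j
    have := h.ne3 i j; have := h.ne4 i j; have := h.ne5 i j
    have := h.ne6 i j; have := h.ne7 i j; have := h.ne8 i j; have := h.ne9 i j
    field_simp
  · intro i j
    simp only [h.y_pred, lowerCoeff]
    have := h.x_ne i; have := h.y_ne j; have := h.ne i j; have := h.ne1 i j; have := h.ne2 i j
    have := h.ne3 i j; have := h.ne4 i j; have := h.ne5 i j
    have := h.ne6 i j; have := h.ne7 i j; have := h.ne8 i j; have := h.ne9 i j
    field_simp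

theorem lower_mul_f : (lower (fun i j => (x i)⁻¹ * lowerCoeff q (x i) (y j))
      fun i j => (y j)⁻¹ * lowerCoeff q (y j) (x i)) * fOp q x y = q ^ 2 • (fOp q x y *
    lower (fun i j => (x i)⁻¹ * lowerCoeff q (x i) (y j))
      fun i j => (y j)⁻¹ * lowerCoeff q (y j) (x i)) := by
  have hq := h.q_ne
  have hq' := h.q_sub_ne
  refine lower_mul_lower_eq ?_ ?_ ?_
  · intro i j
    simp only [h.x_pred, h.y_pred, lowerCoeff]
    have := h.x_ne i; have := h.y_ne j; have := h.ne i j; have := h.ne1 i j; have := h.ne2 i j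
    have := h.ne3 i j; have := h.ne4 i j; have := h.ne5 i j
    have := h.ne6 i j; have := h.ne7 i j; have := h.ne8 i j; have := h.ne9 i j
    field_simp <;> ring
  · intro i j
    simp only [h.x_pred, lowerCoeff]
    have := h.x_ne i; have := h.y_ne j; have := h.ne i j; have := h.ne1 i j; have := h.ne2 i j
    have := h.ne3 i j; have := h.ne4 i j; have := h.ne5 i j
    have := h.ne6 i j; have := h.ne7 i j; have := h.ne8 i j; have := h.ne9 i j
    field_simp
  · intro i j
    simp only [h.y_pred, lowerCoeff]
    have := h.x_ne i; have := h.y_ne j; have := h.ne i j; have := h.ne1 i j; have := h.ne2 i j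
    have := h.ne3 i j; have := h.ne4 i j; have := h.ne5 i j
    have := h.ne6 i j; have := h.ne7 i j; have := h.ne8 i j; have := h.ne9 i j
    field_simp

theorem f'_mul_raise : f'Op q x y * (raise (fun i j => y j * (x i - y j)⁻¹ * (x i)⁻¹)
      fun i j => -(x i * (x i - y j)⁻¹ * (y j)⁻¹)) = q ^ 2 •
    ((raise (fun i j => y j * (x i - y j)⁻¹ * (x i)⁻¹)
      fun i j => -(x i * (x i - y j)⁻¹ * (y j)⁻¹)) * f'Op q x y) := by
  have hq := h.q_ne
  have hq' := h.q_sub_ne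
  refine raise_mul_raise_eq ?_ ?_ ?_
  · intro i j
    simp only [h.x_succ, h.y_succ]
    have := h.x_ne i; have := h.y_ne j; have := h.ne i j; have := h.ne1 i j; have := h.ne2 i j
    have := h.ne3 i j; have := h.ne4 i j; have := h.ne5 i j
    have := h.ne6 i j; have := h.ne7 i j; have := h.ne8 i j; have := h.ne9 i j
    field_simp <;> ring
  · intro i j
    simp only [h.x_succ]
    have := h.x_ne i; have := h.y_ne j; have := h.ne i j; have := h.ne1 i j; have := h.ne2 i j
    have := h.ne3 i j; have := h.ne4 i j; have := h.ne5 i j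
    have := h.ne6 i j; have := h.ne7 i j; have := h.ne8 i j; have := h.ne9 i j
    field_simp
  · intro i j
    simp only [h.y_succ]
    have := h.x_ne i; have := h.y_ne j; have := h.ne i j; have := h.ne1 i j; have := h.ne2 i j
    have := h.ne3 i j; have := h.ne4 i j; have := h.ne5 i j
    have := h.ne6 i j; have := h.ne7 i j; have := h.ne8 i j; have := h.ne9 i j
    field_simp

theorem eOp_eq : eOp x y = raise (fun i j => x i ^ 0 * (x i - y j)⁻¹)
    fun i j => -(y j ^ 0 * (x i - y j)⁻¹) := by
  simp only [pow_zero, one_mul]; rfl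

theorem serre_e : eOp x y ^ 3 * e'Op q x y - (q ^ 2 + 1 + (q ^ 2)⁻¹) •
      (eOp x y ^ 2 * e'Op q x y * eOp x y) + (q ^ 2 + 1 + (q ^ 2)⁻¹) •
      (eOp x y * e'Op q x y * eOp x y ^ 2) - e'Op q x y * eOp x y ^ 3 = 0 ∧
    e'Op q x y ^ 3 * eOp x y - (q ^ 2 + 1 + (q ^ 2)⁻¹) •
      (e'Op q x y ^ 2 * eOp x y * e'Op q x y) + (q ^ 2 + 1 + (q ^ 2)⁻¹) •
      (e'Op q x y * eOp x y * e'Op q x y ^ 2) - eOp x y * e'Op q x y ^ 3 = 0 := by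
  refine serre_of_bracket (R := Module.End k (boundedFunctions k)) h.q_ne h.e'_mul_e ?_ ?_
  · have := h.bracket_raise 0
    rw [← h.eOp_eq, zero_add] at this
    rw [this, smul_mul_assoc, h.raise_one_mul_e, mul_smul_comm, smul_comm]
  · rw [h.bracket_e', mul_smul_comm, h.e'_mul_lower, smul_mul_assoc, smul_comm]

theorem serre_f : fOp q x y ^ 3 * f'Op q x y - (q ^ 2 + 1 + (q ^ 2)⁻¹) •
      (fOp q x y ^ 2 * f'Op q x y * fOp q x y) + (q ^ 2 + 1 + (q ^ 2)⁻¹) •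
      (fOp q x y * f'Op q x y * fOp q x y ^ 2) - f'Op q x y * fOp q x y ^ 3 = 0 ∧
    f'Op q x y ^ 3 * fOp q x y - (q ^ 2 + 1 + (q ^ 2)⁻¹) •
      (f'Op q x y ^ 2 * fOp q x y * f'Op q x y) + (q ^ 2 + 1 + (q ^ 2)⁻¹) •
      (f'Op q x y * fOp q x y * f'Op q x y ^ 2) - fOp q x y * f'Op q x y ^ 3 = 0 := by
  refine serre_of_bracket (R := Module.End k (boundedFunctions k)) h.q_ne h.f'_mul_f_sub ?_ ?_
  · rw [h.bracket_f, smul_mul_assoc, h.lower_mul_f, mul_smul_comm, smul_comm]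
  · rw [h.bracket_f', mul_smul_comm, h.f'_mul_raise, smul_mul_assoc, smul_comm]

theorem diag_K_mul_inv : (diag fun i j => x i * y j) * (diag fun i j => (x i * y j)⁻¹) = 1 := by
  rw [diag_mul_diag, ← wshift_one]
  exact diag_congr fun i j => mul_inv_cancel₀ (mul_ne_zero (h.x_ne i) (h.y_ne j))

theorem diag_inv_mul_K : (diag fun i j => (x i * y j)⁻¹) * (diag fun i j => x i * y j) = 1 := by
  rw [diag_mul_diag, ← wshift_one]
  exact diag_congr fun i j => inv_mul_cancel₀ (mul_ne_zero (h.x_ne i) (h.y_ne j))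

theorem K_raise (a b : ℤ → ℤ → k) : (diag fun i j => x i * y j) * raise a b *
    (diag fun i j => (x i * y j)⁻¹) = q ^ 2 • raise a b := by
  rw [diag_mul_raise, raise_mul_diag, smul_raise]
  refine raise_congr ?_ ?_ <;> intro i j <;> have := h.x_ne i <;> have := h.y_ne j <;>
    simp only [h.x_succ, h.y_succ] <;> field_simp

theorem K_lower (a b : ℤ → ℤ → k) : (diag fun i j => x i * y j) * lower a b *
    (diag fun i j => (x i * y j)⁻¹) = (q ^ 2)⁻¹ • lower a b := by
  rw [diag_mul_lower, lower_mul_diag, smul_lower]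
  have := h.q_ne
  refine lower_congr ?_ ?_ <;> intro i j <;> have := h.x_ne i <;> have := h.y_ne j <;>
    simp only [h.x_pred, h.y_pred] <;> field_simp

theorem K'_raise (a b : ℤ → ℤ → k) : (diag fun i j => (x i * y j)⁻¹) * raise a b *
    (diag fun i j => x i * y j) = (q ^ 2)⁻¹ • raise a b := by
  rw [diag_mul_raise, raise_mul_diag, smul_raise]
  have := h.q_ne
  refine raise_congr ?_ ?_ <;> intro i j <;> have := h.x_ne i <;> have := h.y_ne j <;>
    simp only [h.x_succ, h.y_succ] <;> field_simp

theorem K'_lower (a b : ℤ → ℤ → k) : (diag fun i j => (x i * y j)⁻¹) * lower a b *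
    (diag fun i j => x i * y j) = q ^ 2 • lower a b := by
  rw [diag_mul_lower, lower_mul_diag, smul_lower]
  have := h.q_ne
  refine lower_congr ?_ ?_ <;> intro i j <;> have := h.x_ne i <;> have := h.y_ne j <;>
    simp only [h.x_pred, h.y_pred] <;> field_simp

/-- The quadratic element `u_{n+2}u_n - q²u_{n+1}²` acts as a weighted shift. -/
theorem quadratic (n : ℕ) (s : k) :
    (s ^ (n + 2) • raise (fun i j => x i ^ (n + 2) * (x i - y j)⁻¹)
      fun i j => -(y j ^ (n + 2) * (x i - y j)⁻¹)) *
    (s ^ n • raise (fun i j => x i ^ n * (x i - y j)⁻¹) fun i j => -(y j ^ n * (x i - y j)⁻¹)) =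
    q ^ 2 • ((s ^ (n + 1) • raise (fun i j => x i ^ (n + 1) * (x i - y j)⁻¹)
      fun i j => -(y j ^ (n + 1) * (x i - y j)⁻¹)) *
      (s ^ (n + 1) • raise (fun i j => x i ^ (n + 1) * (x i - y j)⁻¹)
      fun i j => -(y j ^ (n + 1) * (x i - y j)⁻¹))) +
    wshift 1 1 fun i j => -(s ^ (2 * n + 2) * (x i * y j) ^ n) := by
  have hq := h.q_ne
  simp only [smul_mul_assoc, mul_smul_comm, raise_mul_raise, smul_add, smul_wshift]
  rw [add_assoc, add_assoc, add_assoc]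
  congr 1
  · refine wshift_congr fun i j => ?_
    have := h.x_ne i; have := h.y_ne j; have := h.ne i j; have := h.ne1 i j
    have := h.ne6 i j
    simp only [h.x_succ]
    field_simp
    ring
  · rw [add_comm (wshift 0 2 _) (wshift 1 1 _), ← add_assoc, wshift_add]
    congr 1
    · refine wshift_congr fun i j => ?_
      simp only [h.x_succ, h.y_succ]
      have := h.x_ne i; have := h.y_ne j; have := h.ne i j; have := h.ne1 i j; have := h.ne2 i j
      have := h.ne3 i j; have := h.ne4 i j; have := h.ne5 i j
      have := h.ne6 i j; have := h.ne7 i j; have := h.ne8 i j; have := h.ne9 i j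
      field_simp
      ring
    · refine wshift_congr fun i j => ?_
      have := h.x_ne i; have := h.y_ne j; have := h.ne i j; have := h.ne2 i j
      have := h.ne7 i j
      simp only [h.y_succ]
      field_simp
      ring

end Progressions

/-! ### A representation of `U_q(𝔤)` -/

/-- The ratio is q² = v⁴, and the extra factor v keeps the two progressions disjoint. -/
theorem progressions : Progressions q (fun i => v ^ (4 * i)) (fun j => v ^ (4 * j + 1)) where
  q_ne := q_ne_zero
  q_sub_ne := sub_ne_zero.2 (q_pow_ne_one (by norm_num))
  x_ne i := zpow_ne_zero _ v_ne_zero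
  y_ne i := zpow_ne_zero _ v_ne_zero
  ne i j := sub_ne_zero.2 fun h => by
    have := v_zpow_injective h
    omega
  x_succ i := by
    rw [show q ^ 2 = v ^ (4 : ℤ) by rw [q, ← pow_mul]; rfl, ← zpow_add₀ v_ne_zero]
    congr 1; ring
  y_succ i := by
    rw [show q ^ 2 = v ^ (4 : ℤ) by rw [q, ← pow_mul]; rfl, ← zpow_add₀ v_ne_zero]
    congr 1; ring

/-- The ring of operators. -/
def OpRing : Type := Module.End 𝕂 (boundedFunctions 𝕂)

instance : Ring OpRing := inferInstanceAs (Ring (Module.End 𝕂 (boundedFunctions 𝕂)))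

instance : Algebra 𝕂 OpRing := inferInstanceAs (Algebra 𝕂 (Module.End 𝕂 (boundedFunctions 𝕂)))

/-- The action of the operators on functions. -/
def opAct (T : OpRing) : boundedFunctions 𝕂 →ₗ[𝕂] boundedFunctions 𝕂 := T

theorem opAct_mul (S T : OpRing) (f : boundedFunctions 𝕂) : opAct (S * T) f = opAct S (opAct T f) :=
  rfl

theorem commutator_of_eq {k R : Type*} [Field k] [Ring R] [Algebra k R] {a b c : R}
    (h : a * b = (1 : k) • (b * a) + c) : a * b - b * a = c := by
  rw [h, one_smul, add_sub_cancel_left]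

theorem commutator_of_eq' {k R : Type*} [Field k] [Ring R] [Algebra k R] {a b c : R}
    (h : a * b = (1 : k) • (b * a) + c) : b * a - a * b = -c := by
  rw [h, one_smul, sub_add_cancel_left]

/-- Diagonal operators. -/
def diagOp (g : ℤ → ℤ → 𝕂) : OpRing := diag g

theorem diag_diff (c : 𝕂) (g h : ℤ → ℤ → 𝕂) :
    diagOp (fun i j => c * (g i j - h i j)) = c • (diagOp g - diagOp h) := by
  have : diag (fun i j => c * (g i j - h i j)) = c • (diag g - diag h) := by
    rw [diag, diag, diag, wshift_sub, smul_wshift]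
  exact this

theorem diagOp_comm (f g : ℤ → ℤ → 𝕂) : diagOp f * diagOp g = diagOp g * diagOp f := by
  have : diag f * diag g = diag g * diag f := by
    rw [diag_mul_diag, diag_mul_diag]; exact diag_congr fun i j => mul_comm _ _
  exact this

theorem neg_smul_sub {k R : Type*} [Field k] [Ring R] [Algebra k R] (c : k) (a b : R) :
    -(c • (a - b)) = c • (b - a) := by
  rw [← smul_neg, neg_sub]

/-- The operators by which the generators act. -/
def genOp : Gen → OpRing
  | .e i => if i = 0 then eOp (fun i => v ^ (4 * i)) (fun j => v ^ (4 * j + 1))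
      else e'Op q (fun i => v ^ (4 * i)) (fun j => v ^ (4 * j + 1))
  | .f i => if i = 0 then fOp q (fun i => v ^ (4 * i)) (fun j => v ^ (4 * j + 1))
      else f'Op q (fun i => v ^ (4 * i)) (fun j => v ^ (4 * j + 1))
  | .k i => if i = 0 then diagOp fun i j => v ^ (4 * i) * v ^ (4 * j + 1)
      else diagOp fun i j => (v ^ (4 * i) * v ^ (4 * j + 1))⁻¹
  | .kinv i => if i = 0 then diagOp fun i j => (v ^ (4 * i) * v ^ (4 * j + 1))⁻¹
      else diagOp fun i j => v ^ (4 * i) * v ^ (4 * j + 1)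

/-- E₁ and F₂ raise, E₂ and F₁ lower, and K₂ acts as the inverse of K₁; this leaves four conjugation
rules and the bracket identities for the operators. -/
theorem lift_genOp_rel {s t : Free} (hst : Rel s t) :
    FreeAlgebra.lift 𝕂 genOp s = FreeAlgebra.lift 𝕂 genOp t := by
  have h := progressions
  have n1 : q ^ (-2 : ℤ) = (q ^ 2)⁻¹ := by rw [zpow_neg]; rfl
  have n2 : q ^ (2 : ℤ) = q ^ 2 := rfl
  cases hst with
  | k_comm i j =>
    fin_cases i <;> fin_cases j <;> simp [gen, genOp, diagOp_comm]
  | k_kinv i =>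
    rw [map_mul, map_one]
    simp only [gen, FreeAlgebra.lift_ι_apply]
    fin_cases i
    · exact h.diag_K_mul_inv
    · exact h.diag_inv_mul_K
  | kinv_k i =>
    rw [map_mul, map_one]
    simp only [gen, FreeAlgebra.lift_ι_apply]
    fin_cases i
    · exact h.diag_inv_mul_K
    · exact h.diag_K_mul_inv
  | k_e i j =>
    rw [map_mul, map_mul, map_smul]
    simp only [gen, FreeAlgebra.lift_ι_apply]
    fin_cases i <;> fin_cases j
    · exact h.K_raise _ _
    · exact (h.K_lower _ _).trans (by rw [← n1]; rfl)
    · exact (h.K'_raise _ _).trans (by rw [← n1]; rfl)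
    · exact h.K'_lower _ _
  | k_f i j =>
    rw [map_mul, map_mul, map_smul]
    simp only [gen, FreeAlgebra.lift_ι_apply]
    fin_cases i <;> fin_cases j
    · exact (h.K_lower _ _).trans (by rw [← n1]; rfl)
    · exact h.K_raise _ _
    · exact h.K'_lower _ _
    · exact (h.K'_raise _ _).trans (by rw [← n1]; rfl)
  | e_f i j =>
    rw [map_sub, map_mul, map_mul]
    split_ifs with hij
    · subst hij
      rw [map_smul, map_sub]
      simp only [gen, FreeAlgebra.lift_ι_apply]
      fin_cases i
      · refine (commutator_of_eq (R := OpRing) h.e_mul_f).trans ?_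
        exact diag_diff _ _ _
      · refine (commutator_of_eq' (R := OpRing) h.f'_mul_e').trans ?_
        exact (congrArg Neg.neg (diag_diff _ _ _)).trans (neg_smul_sub _ _ _)
    · rw [map_zero]
      simp only [gen, FreeAlgebra.lift_ι_apply]
      fin_cases i <;> fin_cases j
      · exact absurd rfl hij
      · exact commutator_of_eq (R := OpRing) (h.e_mul_f'.trans (add_zero (M := OpRing) _).symm)
      · exact commutator_of_eq (R := OpRing) (h.e'_mul_f.trans (add_zero (M := OpRing) _).symm)
      · exact absurd rfl hij
  | serre_e i j hij =>
    rw [serre_proj, map_zero]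
    simp only [gen, FreeAlgebra.lift_ι_apply]
    fin_cases i <;> fin_cases j
    · exact absurd rfl hij
    · exact h.serre_e.1
    · exact h.serre_e.2
    · exact absurd rfl hij
  | serre_f i j hij =>
    rw [serre_proj, map_zero]
    simp only [gen, FreeAlgebra.lift_ι_apply]
    fin_cases i <;> fin_cases j
    · exact absurd rfl hij
    · exact h.serre_f.1
    · exact h.serre_f.2
    · exact absurd rfl hij

/-- The representation of `U_q(𝔤)` by weighted shift operators. -/
def rep : Uq →ₐ[𝕂] OpRing := RingQuot.liftAlgHom 𝕂 ⟨FreeAlgebra.lift 𝕂 genOp, fun _ _ h => lift_genOp_rel h⟩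

theorem rep_gen (x : Gen) : rep (proj (gen x)) = genOp x := by
  rw [rep, proj, RingQuot.liftAlgHom_mkAlgHom_apply, gen, FreeAlgebra.lift_ι_apply]

/-- The operators `x⁺_n`. -/
def currentOp (n : ℕ) : OpRing :=
  raise (fun i j => (v ^ (4 * i)) ^ n * (v ^ (4 * i) - v ^ (4 * j + 1))⁻¹)
    fun i j => -((v ^ (4 * j + 1)) ^ n * (v ^ (4 * i) - v ^ (4 * j + 1))⁻¹)

/-- The scalar by which the string of `E₁` differs from the `x⁺_n`. -/
def currentScale : 𝕂 := -((q + q⁻¹) / q ^ 2)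

theorem rep_stringElt (n : ℕ) : rep (stringElt n) = currentScale ^ n • currentOp n := by
  have h := progressions
  induction n with
  | zero =>
    rw [pow_zero, one_smul, stringElt, rep_gen]
    exact h.eOp_eq
  | succ n ih =>
    rw [stringElt, map_sub, map_mul, map_mul, ih, pow_succ, mul_smul]
    have e : diagOp (fun i j => -((q + q⁻¹) / (q ^ 3 * (q - q⁻¹))) *
        (v ^ (4 * i) + v ^ (4 * j + 1))) * currentOp n - currentOp n *
        diagOp (fun i j => -((q + q⁻¹) / (q ^ 3 * (q - q⁻¹))) *
        (v ^ (4 * i) + v ^ (4 * j + 1))) = currentScale • currentOp (n + 1) := h.bracket_raise n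
    have e' : rep psi = diagOp fun i j => -((q + q⁻¹) / (q ^ 3 * (q - q⁻¹))) *
        (v ^ (4 * i) + v ^ (4 * j + 1)) := by
      rw [psi, map_sub, map_mul, map_smul, map_mul, rep_gen, rep_gen]
      exact h.e'_mul_e
    rw [← e'] at e
    rw [mul_smul_comm, smul_mul_assoc, ← smul_sub]
    rw [e]

/-- The restriction of the representation to `U_q^+(w)`. -/
def repPlus : Uplus →ₐ[𝕂] OpRing := rep.comp (Subalgebra.val _)

/-- The scalar `c` with `u_n ↦ cⁿ x⁺_n`. -/
def repScale : 𝕂 := stringScale * currentScale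

theorem repScale_ne : repScale ≠ 0 :=
  mul_ne_zero stringScale_ne (neg_ne_zero.2 (div_ne_zero q_add_inv_ne (pow_ne_zero _ q_ne_zero)))

theorem repPlus_u (i : Fin 4) : repPlus (u i) = repScale ^ (i : ℕ) • currentOp i := by
  have : repPlus (u i) = rep (u i : Uq) := rfl
  rw [this, coe_u, map_smul, rep_stringElt, smul_smul, repScale, mul_pow]

theorem currentOp_injective (n : ℕ) {f : boundedFunctions 𝕂} (hf : opAct (currentOp n) f = 0) : f = 0 := by
  have h := progressions
  refine raise_injective (fun i j => ?_) (fun i j => ?_) hf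
  · exact mul_ne_zero (pow_ne_zero _ (h.x_ne i)) (inv_ne_zero (h.ne i j))
  · exact neg_ne_zero.2 (mul_ne_zero (pow_ne_zero _ (h.y_ne j)) (inv_ne_zero (h.ne i j)))

theorem smul_op_eq_zero {c : 𝕂} (hc : c ≠ 0) {T : OpRing} {f : boundedFunctions 𝕂}
    (h : opAct (c • T) f = 0) : opAct T f = 0 :=
  (smul_eq_zero.1 (h : c • opAct T f = 0)).resolve_left hc

theorem repPlus_u_injective (i : Fin 4) {f : boundedFunctions 𝕂} (hf : opAct (repPlus (u i)) f = 0) :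
    f = 0 := by
  rw [repPlus_u] at hf
  exact currentOp_injective _ (smul_op_eq_zero (pow_ne_zero _ repScale_ne) hf)

/-- Weighted diagonal shifts. -/
def shiftOp (c : ℤ → ℤ → 𝕂) : OpRing := wshift 1 1 c

/-- In the quadratic combination the shifts by (2,0) and (0,2) cancel, leaving one shift by (1,1)
with nowhere vanishing weight. The cases n = 0 and n = 1 are Y₀ and Y₁. -/
theorem quadratic_injective (n : ℕ) {T : OpRing} (hT : T = (q⁻¹) ^ 2 •
    ((repScale ^ (n + 2) • currentOp (n + 2)) * (repScale ^ n • currentOp n) -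
      q ^ 2 • ((repScale ^ (n + 1) • currentOp (n + 1)) ^ 2)))
    {f : boundedFunctions 𝕂} (hf : opAct T f = 0) : f = 0 := by
  have h := progressions
  have e : (repScale ^ (n + 2) • currentOp (n + 2)) * (repScale ^ n • currentOp n) -
      q ^ 2 • ((repScale ^ (n + 1) • currentOp (n + 1)) ^ 2) = shiftOp fun i j =>
        -(repScale ^ (2 * n + 2) * (v ^ (4 * i) * v ^ (4 * j + 1)) ^ n) := by
    rw [sq (_ • _)]
    exact sub_eq_of_eq_add' (G := OpRing) (h.quadratic n repScale)
  rw [e] at hT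
  rw [hT] at hf
  have hf' := smul_op_eq_zero (pow_ne_zero 2 (inv_ne_zero q_ne_zero)) hf
  refine wshift_injective (m := 1) (n := 1) (c := fun i j =>
    -(repScale ^ (2 * n + 2) * (v ^ (4 * i) * v ^ (4 * j + 1)) ^ n)) (fun i j => ?_) hf'
  exact neg_ne_zero.2 (mul_ne_zero (pow_ne_zero _ repScale_ne)
    (pow_ne_zero _ (mul_ne_zero (h.x_ne i) (h.y_ne j))))

theorem map_quadratic {k A B : Type*} [Field k] [Ring A] [Algebra k A] [Ring B] [Algebra k B]
    (φ : A →ₐ[k] B) (x y z : A) (c d : k) :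
    φ (c • (x * y - d • z ^ 2)) = c • (φ x * φ y - d • φ z ^ 2) := by
  simp

theorem repPlus_Y₀_injective {f : boundedFunctions 𝕂} (hf : opAct (repPlus Y₀) f = 0) : f = 0 := by
  refine quadratic_injective 0 ?_ hf
  refine (map_quadratic repPlus (u 2) (u 0) (u 1) _ _).trans ?_
  rw [repPlus_u, repPlus_u, repPlus_u]
  rfl

theorem repPlus_Y₁_injective {f : boundedFunctions 𝕂} (hf : opAct (repPlus Y₁) f = 0) : f = 0 := by
  refine quadratic_injective 1 ?_ hf
  refine (map_quadratic repPlus (u 3) (u 1) (u 2) _ _).trans ?_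
  rw [repPlus_u, repPlus_u, repPlus_u]
  rfl

/-! ### Independence of monomials in quasi-commuting elements. -/

section QuasiCommuting

variable {k R : Type*} [Field k] [Ring R] [Algebra k R]

/-- Elements with pairwise different quasi-commutation weights are linearly independent. -/
theorem linearIndependent_of_quasiCommute {ι κ : Type*} (t : κ → R)
    (ht : ∀ i x, t i * x = 0 → x = 0) (m : ι → R) (hne : ∀ c, m c ≠ 0) (w : κ → ι → k)
    (hm : ∀ i c, m c * t i = w i c • (t i * m c)) (hsep : ∀ c c', (∀ i, w i c = w i c') → c = c') :
    LinearIndependent k m := by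
  classical
  rw [linearIndependent_iff']
  intro s
  induction s using Finset.induction_on with
  | empty => simp
  | insert a s has ih =>
    intro g hg
    -- As in Dedekind's independence of characters: multiplying the relation by t_i on the right and
    -- cancelling it on the left rescales each coefficient by its weight. Subtracting w_i(a) times
    -- the original relation then removes the term of a.
    have step : ∀ i, ∑ c ∈ insert a s, (g c * w i c) • m c = 0 := by
      intro i
      apply ht i
      rw [Finset.mul_sum]
      have := congrArg (· * t i) hg
      simp only [zero_mul, Finset.sum_mul] at this
      rw [← this]
      refine Finset.sum_congr rfl fun c _ => ?_
      rw [smul_mul_assoc, hm, smul_smul, mul_smul_comm]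
    have hs : ∀ c ∈ s, g c = 0 := by
      intro c hc
      have hca : c ≠ a := fun e => has (e ▸ hc)
      obtain ⟨i, hi⟩ := not_forall.1 fun e => hca (hsep c a e)
      have e1 : ∑ c ∈ s, (g c * (w i c - w i a)) • m c = 0 := by
        have e2 : ∑ c ∈ insert a s, (g c * (w i c - w i a)) • m c = 0 := by
          have e3 := step i
          have e4 := congrArg (w i a • ·) hg
          simp only [smul_zero, Finset.smul_sum, smul_smul] at e4
          refine Eq.trans ?_ ((congrArg₂ (· - ·) e3 e4).trans (sub_zero 0))
          rw [← Finset.sum_sub_distrib]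
          refine Finset.sum_congr rfl fun c _ => ?_
          rw [← sub_smul]; congr 1; ring
        rwa [Finset.sum_insert has, sub_self, mul_zero, zero_smul, zero_add] at e2
      exact (mul_eq_zero.1 (ih _ e1 c hc)).resolve_right (sub_ne_zero.2 hi)
    intro c hc
    rcases Finset.mem_insert.1 hc with rfl | hc
    · rw [Finset.sum_insert has, Finset.sum_eq_zero fun x hx => by rw [hs x hx, zero_smul],
        add_zero] at hg
      exact (smul_eq_zero.1 hg).resolve_right (hne c)
    · exact hs c hc

theorem commute_smul_pow {a x : R} {c : k} (hx : x * a = c • (a * x)) (n : ℕ) :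
    x ^ n * a = c ^ n • (a * x ^ n) := pow_mul_of_mul_eq_smul hx n

/-- Products of powers of quasi-commuting elements. -/
theorem commute_smul_prod {a x₃ x₂ x₁ x₀ : R} {q : k} (hq : q ≠ 0) {c₃ c₂ c₁ c₀ : ℤ}
    (h₃ : x₃ * a = q ^ c₃ • (a * x₃)) (h₂ : x₂ * a = q ^ c₂ • (a * x₂))
    (h₁ : x₁ * a = q ^ c₁ • (a * x₁)) (h₀ : x₀ * a = q ^ c₀ • (a * x₀)) (n₃ n₂ n₁ n₀ : ℕ) :
    (x₃ ^ n₃ * x₂ ^ n₂ * x₁ ^ n₁ * x₀ ^ n₀) * a =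
      q ^ (c₃ * n₃ + c₂ * n₂ + c₁ * n₁ + c₀ * n₀) • (a * (x₃ ^ n₃ * x₂ ^ n₂ * x₁ ^ n₁ * x₀ ^ n₀)) := by
  have := commute_smul_mul (commute_smul_mul (commute_smul_mul (commute_smul_pow h₃ n₃)
    (commute_smul_pow h₂ n₂)) (commute_smul_pow h₁ n₁)) (commute_smul_pow h₀ n₀)
  rw [this]
  congr 1
  simp only [← zpow_natCast, ← zpow_mul, ← zpow_add₀ hq]

theorem mul_pow_left_regular {t : R} (ht : ∀ x, t * x = 0 → x = 0) (n : ℕ) (x : R)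
    (h : t ^ n * x = 0) : x = 0 := by
  induction n with
  | zero => simpa using h
  | succ n ih =>
    rw [pow_succ', mul_assoc] at h
    exact ih (ht _ h)

/-- The product `Y₁^{d₃} Y₀^{d₂} u₁^{d₁} u₀^{d₀}`. -/
def torusMon (q : k) (u : Fin 4 → R) (d : Fin 4 → ℕ) : R :=
  y1 q u ^ d 3 * y0 q u ^ d 2 * u 1 ^ d 1 * u 0 ^ d 0

theorem Straightening.torusMon_linearIndependent [Nontrivial R] {q : k} {u : Fin 4 → R}
    (h : Straightening q u) (hqi : Function.Injective fun n : ℤ => q ^ n)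
    (hu0 : ∀ x, u 0 * x = 0 → x = 0) (hu1 : ∀ x, u 1 * x = 0 → x = 0)
    (hy0 : ∀ x, y0 q u * x = 0 → x = 0) (hy1 : ∀ x, y1 q u * x = 0 → x = 0) :
    LinearIndependent k (torusMon q u) := by
  have hq := h.q_ne
  have n2 : (q ^ 2)⁻¹ = q ^ (-2 : ℤ) := by rw [zpow_neg, zpow_ofNat]
  have n4 : (q ^ 4)⁻¹ = q ^ (-4 : ℤ) := by rw [zpow_neg, zpow_ofNat]
  have self : ∀ x : R, x * x = q ^ (0 : ℤ) • (x * x) := fun x => by rw [zpow_zero, one_smul]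
  have flip : ∀ {x y : R} {c : ℤ}, x * y = q ^ c • (y * x) → y * x = q ^ (-c) • (x * y) := by
    intro x y c e
    rw [zpow_neg]
    exact mul_comm_of_eq_smul (zpow_ne_zero _ hq) e
  have r10 : u 1 * u 0 = q ^ (2 : ℤ) • (u 0 * u 1) := by
    rw [zpow_ofNat]; exact h.rel10
  have a0 : u 0 * y0 q u = q ^ (-2 : ℤ) • (y0 q u * u 0) := n2 ▸ h.u0_y0
  have a1 : u 1 * y0 q u = q ^ (0 : ℤ) • (y0 q u * u 1) := by rw [zpow_zero]; exact h.u1_y0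
  have b0 : u 0 * y1 q u = q ^ (-4 : ℤ) • (y1 q u * u 0) := n4 ▸ h.u0_y1
  have b1 : u 1 * y1 q u = q ^ (-2 : ℤ) • (y1 q u * u 1) := n2 ▸ h.u1_y1
  have ab : y1 q u * y0 q u = q ^ (4 : ℤ) • (y0 q u * y1 q u) := by
    rw [zpow_ofNat]; exact h.y1_y0
  -- The rows of the exponent matrix record the cost of moving u₀, u₁, Y₀, Y₁ to the left through
  -- the monomial. The matrix is nondegenerate, so the four exponents determine d.
  refine linearIndependent_of_quasiCommute (κ := Fin 4) ![u 0, u 1, y0 q u, y1 q u] ?_ _ ?_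
    (fun i d => q ^ ((![4 * (d 3 : ℤ) + 2 * d 2 + 2 * d 1 + 0 * d 0,
      2 * (d 3 : ℤ) + 0 * d 2 + 0 * d 1 + -2 * d 0,
      4 * (d 3 : ℤ) + 0 * d 2 + 0 * d 1 + -2 * d 0,
      0 * (d 3 : ℤ) + -4 * d 2 + -2 * d 1 + -4 * d 0] : Fin 4 → ℤ) i)) ?_ ?_
  · intro i x
    fin_cases i
    · exact hu0 x
    · exact hu1 x
    · exact hy0 x
    · exact hy1 x
  · intro d hd
    rw [torusMon, mul_assoc, mul_assoc] at hd
    have := mul_pow_left_regular hu1 _ _ (mul_pow_left_regular hy0 _ _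
      (mul_pow_left_regular hy1 _ _ hd))
    rw [← mul_one (u 0 ^ d 0)] at this
    exact one_ne_zero (mul_pow_left_regular hu0 _ _ this)
  · intro i d
    fin_cases i
    · exact commute_smul_prod hq (flip b0) (flip a0) r10 (self _) _ _ _ _
    · exact commute_smul_prod hq (flip b1) (flip a1) (self _) (flip r10) _ _ _ _
    · exact commute_smul_prod hq ab (self _) a1 a0 _ _ _ _
    · exact commute_smul_prod hq (self _) (flip ab) b1 b0 _ _ _ _
  · intro d d' hdd
    have e0 := hqi (hdd 0)
    have e1 := hqi (hdd 1)
    have e2 := hqi (hdd 2)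
    have e3 := hqi (hdd 3)
    simp only [Matrix.cons_val] at e0 e1 e2 e3
    ext i
    fin_cases i <;> simp only [Fin.zero_eta, Fin.mk_one, Fin.reduceFinMk] <;> omega

end QuasiCommuting

theorem Y₀_eq : Y₀ = y0 q u := by
  rw [Y₀, y0, inv_pow, sq (u 1)]

theorem Y₁_eq : Y₁ = y1 q u := by
  rw [Y₁, y1, inv_pow, sq (u 2)]

theorem op_left_regular {T : OpRing} (hT : ∀ f, opAct T f = 0 → f = 0) (S : OpRing)
    (h : T * S = 0) : S = 0 := by
  have : opAct S = 0 := by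
    ext1 f
    apply hT
    rw [← opAct_mul, h]
    rfl
  exact this

theorem map_torusMon {k A B : Type*} [Field k] [Ring A] [Algebra k A] [Ring B] [Algebra k B]
    (φ : A →ₐ[k] B) (q : k) (w : Fin 4 → A) (d : Fin 4 → ℕ) :
    φ (torusMon q w d) = torusMon q (φ ∘ w) d := by
  simp [torusMon, y0, y1]

theorem Straightening.map {k A B : Type*} [Field k] [Ring A] [Algebra k A] [Ring B] [Algebra k B]
    {q : k} {w : Fin 4 → A} (h : Straightening q w) (φ : A →ₐ[k] B) : Straightening q (φ ∘ w) where
  q_ne := h.q_ne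
  rel10 := by simpa using congrArg φ h.rel10
  rel21 := by simpa using congrArg φ h.rel21
  rel32 := by simpa using congrArg φ h.rel32
  rel20 := by simpa using congrArg φ h.rel20
  rel31 := by simpa using congrArg φ h.rel31
  rel30 := by simpa using congrArg φ h.rel30

theorem map_y0 {k A B : Type*} [Field k] [Ring A] [Algebra k A] [Ring B] [Algebra k B]
    (φ : A →ₐ[k] B) (q : k) (w : Fin 4 → A) : φ (y0 q w) = y0 q (φ ∘ w) := by
  simp [y0]

theorem map_y1 {k A B : Type*} [Field k] [Ring A] [Algebra k A] [Ring B] [Algebra k B]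
    (φ : A →ₐ[k] B) (q : k) (w : Fin 4 → A) : φ (y1 q w) = y1 q (φ ∘ w) := by
  simp [y1]

instance : Nontrivial OpRing := by
  refine ⟨1, 0, fun h => ?_⟩
  let f : boundedFunctions 𝕂 := ⟨fun i _ => if 0 < i then 0 else 1, 0, fun i _ hi => if_pos hi⟩
  have e : opAct 1 f = opAct 0 f := by rw [h]
  have e' := congrFun (congrFun (congrArg Subtype.val e) 0) 0
  have : (1 : 𝕂) = 0 := e'
  exact one_ne_zero this

theorem torusMon_linearIndependent_of_rep {R : Type*} [Ring R] [Algebra 𝕂 R] {w : Fin 4 → R}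
    (h : Straightening q w) (φ : R →ₐ[𝕂] OpRing)
    (hu : ∀ i f, opAct (φ (w i)) f = 0 → f = 0) (hy0 : ∀ f, opAct (φ (y0 q w)) f = 0 → f = 0)
    (hy1 : ∀ f, opAct (φ (y1 q w)) f = 0 → f = 0) : LinearIndependent 𝕂 (torusMon q w) := by
  rw [map_y0] at hy0
  rw [map_y1] at hy1
  have h1 : LinearIndependent 𝕂 (torusMon q (φ ∘ w)) :=
    (h.map φ).torusMon_linearIndependent q_zpow_injective
      (op_left_regular fun f => hu 0 f) (op_left_regular fun f => hu 1 f)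
      (op_left_regular hy0) (op_left_regular hy1)
  refine LinearIndependent.of_comp φ.toLinearMap ?_
  have : (φ.toLinearMap ∘ torusMon q w) = torusMon q (φ ∘ w) := by
    funext d
    exact map_torusMon φ q w d
  rw [this]
  exact h1

theorem torusMon_linearIndependent : LinearIndependent 𝕂 (torusMon q u) :=
  torusMon_linearIndependent_of_rep straightening_u repPlus (fun i _ => repPlus_u_injective i)
    (by rw [← Y₀_eq]; exact fun _ => repPlus_Y₀_injective)
    (by rw [← Y₁_eq]; exact fun _ => repPlus_Y₁_injective)

/-! ### Linear independence of the ordered monomials. -/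

section PBW

variable {k R : Type*} [Field k] [Ring R] [Algebra k R]

/-- The span of the ordered monomials below `a`, including `a`. -/
def belowSpan (k : Type*) [Field k] [Algebra k R] (u : Fin 4 → R) (a : Fin 4 → ℕ) :
    Submodule k R := Submodule.span k {x | ∃ b, Below a b ∧ x = mon u b}

theorem mon_mem_belowSpan {u : Fin 4 → R} {a b : Fin 4 → ℕ} (h : Below a b) :
    mon u b ∈ belowSpan k u a := Submodule.subset_span ⟨b, h, rfl⟩

theorem lowerSpan_top_subset {u : Fin 4 → R} {a b : Fin 4 → ℕ} (h : Below a b) {x : R}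
    (hx : x ∈ lowerSpan (⊤ : Subalgebra k k) u b) : x ∈ belowSpan k u a := by
  induction hx using Submodule.span_induction with
  | mem x hx =>
    obtain ⟨c, hc, -, rfl⟩ := hx
    exact mon_mem_belowSpan (h.trans hc)
  | zero => exact zero_mem _
  | add x y _ _ hx hy => exact add_mem hx hy
  | smul c x _ hx => exact Submodule.smul_mem _ (c : k) hx

theorem Below.add {a b c d : Fin 4 → ℕ} (h : Below a b) (h' : Below c d) :
    Below (a + c) (b + d) := by
  refine (h.add_right c).trans ?_
  rw [add_comm b, add_comm b]
  exact h'.add_right b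

namespace Straightening

variable {q : k} {u : Fin 4 → R} (h : Straightening q u)
include h

theorem belowSpan_mul {a b : Fin 4 → ℕ} {x y : R} (hx : x ∈ belowSpan k u a)
    (hy : y ∈ belowSpan k u b) : x * y ∈ belowSpan k u (a + b) := by
  induction hx using Submodule.span_induction with
  | zero => simp
  | add x x' _ _ hx hx' => rw [add_mul]; exact add_mem hx hx'
  | smul c x _ hx => rw [smul_mul_assoc]; exact Submodule.smul_mem _ c hx
  | mem x hx =>
    obtain ⟨c, hc, rfl⟩ := hx
    induction hy using Submodule.span_induction with
    | zero => simp
    | add y y' _ _ hy hy' => rw [mul_add]; exact add_mem hy hy'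
    | smul c y _ hy => rw [mul_smul_comm]; exact Submodule.smul_mem _ c hy
    | mem y hy =>
      obtain ⟨d, hd, rfl⟩ := hy
      obtain ⟨n, hn⟩ := h.mon_mul_mon (S := (⊤ : Subalgebra k k)) trivial c d
      have hcd := hc.add hd
      rw [← sub_add_cancel (mon u c * mon u d) (((q ^ 2)⁻¹) ^ n • mon u (c + d))]
      exact add_mem (lowerSpan_top_subset hcd hn)
        (Submodule.smul_mem _ _ (mon_mem_belowSpan hcd))

theorem belowSpan_pow {a : Fin 4 → ℕ} {x : R} (hx : x ∈ belowSpan k u a) (n : ℕ) :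
    x ^ n ∈ belowSpan k u (n • a) := by
  induction n with
  | zero =>
    have : (1 : R) = mon u 0 := by simp [mon]
    rw [pow_zero, zero_smul, this]
    exact mon_mem_belowSpan (Below.refl _)
  | succ n ih => rw [pow_succ, succ_nsmul]; exact h.belowSpan_mul ih hx

theorem y0_mem_belowSpan : y0 q u ∈ belowSpan k u (vec 0 1 0 1) := by
  rw [y0]
  have e1 : u 2 * u 0 = mon u (vec 0 1 0 1) := by simp [mon_vec]
  have e2 : u 1 * u 1 = mon u (vec 0 0 2 0) := by simp [mon_vec, sq]
  rw [e1, e2]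
  exact Submodule.smul_mem _ _ (sub_mem (mon_mem_belowSpan (Below.refl _))
    (Submodule.smul_mem _ _ (mon_mem_belowSpan (below_vec.2 ⟨0, 1, by simp⟩))))

theorem y1_mem_belowSpan : y1 q u ∈ belowSpan k u (vec 1 0 1 0) := by
  rw [y1]
  have e1 : u 3 * u 1 = mon u (vec 1 0 1 0) := by simp [mon_vec]
  have e2 : u 2 * u 2 = mon u (vec 0 2 0 0) := by simp [mon_vec, sq]
  rw [e1, e2]
  exact Submodule.smul_mem _ _ (sub_mem (mon_mem_belowSpan (Below.refl _))
    (Submodule.smul_mem _ _ (mon_mem_belowSpan (below_vec.2 ⟨1, 0, by simp⟩))))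

/-- Y₁ contributes the exponents of u₃u₁ and Y₀ those of u₂u₀; their second terms lie lower. -/
theorem torusMon_mem_belowSpan (d : Fin 4 → ℕ) :
    torusMon q u d ∈ belowSpan k u (vec (d 3) (d 2) (d 1 + d 3) (d 0 + d 2)) := by
  have e1 : u 1 ∈ belowSpan k u (vec 0 0 1 0) := by
    have : u 1 = mon u (vec 0 0 1 0) := by simp [mon_vec]
    rw [this]; exact mon_mem_belowSpan (Below.refl _)
  have e0 : u 0 ∈ belowSpan k u (vec 0 0 0 1) := by
    have : u 0 = mon u (vec 0 0 0 1) := by simp [mon_vec]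
    rw [this]; exact mon_mem_belowSpan (Below.refl _)
  have := h.belowSpan_mul (h.belowSpan_mul (h.belowSpan_mul (h.belowSpan_pow h.y1_mem_belowSpan (d 3))
    (h.belowSpan_pow h.y0_mem_belowSpan (d 2))) (h.belowSpan_pow e1 (d 1))) (h.belowSpan_pow e0 (d 0))
  have e : vec (d 3) (d 2) (d 1 + d 3) (d 0 + d 2) = d 3 • vec 1 0 1 0 + d 2 • vec 0 1 0 1 +
      d 1 • vec 0 0 1 0 + d 0 • vec 0 0 0 1 := by
    ext i; fin_cases i <;> simp [vec, add_comm]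
  rw [e]
  exact this

/-- On the cone every vector is the leading exponent of a monomial in Y₁, Y₀, u₁, u₀, because c₁ -
c₃ and c₀ - c₂ are nonnegative. The sharper bound c₂ + 2c₃ ≤ c₀ makes the cone stable under passing
to lower vectors. Truncating by total degree, which the order preserves, leaves a finite-dimensional
comparison. -/
theorem mon_linearIndepOn_cone (hT : LinearIndependent k (torusMon q u)) :
    LinearIndepOn k (mon u) {c | c 3 ≤ c 1 ∧ c 2 + 2 * c 3 ≤ c 0} := by
  classical
  refine linearIndepOn_of_finite _ fun t ht hfin => ?_
  obtain ⟨N, hN⟩ : ∃ N, ∀ c ∈ t, ∑ i, c i ≤ N := by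
    obtain ⟨N, hN⟩ := (hfin.image fun c => ∑ i, c i).bddAbove
    exact ⟨N, fun c hc => hN ⟨c, hc, rfl⟩⟩
  let D : Finset (Fin 4 → ℕ) := (Finset.Iic fun _ => N).filter fun c =>
    ∑ i, c i ≤ N ∧ c 3 ≤ c 1 ∧ c 2 + 2 * c 3 ≤ c 0
  have memD : ∀ c, c ∈ D ↔ ∑ i, c i ≤ N ∧ c 3 ≤ c 1 ∧ c 2 + 2 * c 3 ≤ c 0 := by
    intro c
    simp only [D, Finset.mem_filter, Finset.mem_Iic, and_iff_right_iff_imp]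
    rintro ⟨h1, -⟩ i
    exact (Finset.single_le_sum (f := c) (fun _ _ => Nat.zero_le _) (Finset.mem_univ i)).trans h1
  have hD : LinearIndepOn k (mon u) (D : Set (Fin 4 → ℕ)) := by
    change LinearIndependent k fun c : D => mon u c
    have hT' : LinearIndependent k fun c : D =>
        torusMon q u (vec (c.1 3) (c.1 2) (c.1 1 - c.1 3) (c.1 0 - c.1 2)) := by
      refine hT.comp (fun c : D => vec (c.1 3) (c.1 2) (c.1 1 - c.1 3) (c.1 0 - c.1 2)) ?_
      rintro ⟨c, hc⟩ ⟨d, hd⟩ hcd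
      have hc := (memD c).1 hc
      have hd := (memD d).1 hd
      have hcd := vec_inj.1 hcd
      simp only at hcd
      rw [Subtype.mk.injEq, ← vec_eta c, ← vec_eta d, vec_inj]
      omega
    -- The |D| independent torus monomials lie in the span of the |D| ordered monomials, so the
    -- latter span a space of dimension at least |D| and are independent.
    rw [linearIndependent_iff_card_le_finrank_span]
    rw [linearIndependent_iff_card_eq_finrank_span] at hT'
    rw [hT', Set.finrank, Set.finrank]
    have := Module.Finite.span_of_finite k (Set.finite_range fun c : D => mon u c)
    refine Submodule.finrank_mono ?_
    rw [Submodule.span_le]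
    rintro _ ⟨⟨c, hc⟩, rfl⟩
    have hc' := (memD c).1 hc
    have e := h.torusMon_mem_belowSpan (vec (c 3) (c 2) (c 1 - c 3) (c 0 - c 2))
    refine Submodule.span_mono ?_ e
    rintro _ ⟨b, hb, rfl⟩
    refine ⟨⟨b, (memD b).2 ?_⟩, rfl⟩
    have hs := hb.sum_eq
    obtain ⟨s, r, h1, h2, h3, h4⟩ := hb
    simp only [vec, Matrix.cons_val, Fin.sum_univ_four] at h1 h2 h3 h4 hs hc' ⊢
    omega
  exact hD.mono fun c hc => (memD c).2 ⟨hN c hc, ht hc⟩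

theorem mon_mul_shift (a : Fin 4 → ℕ) (M N : ℕ) : mon u a * (u 1 ^ M * u 0 ^ N) =
    ((q ^ 2)⁻¹) ^ (a 0 * M) • mon u (a + vec 0 0 M N) := by
  have e := pow_mul_pow_of_mul_eq_smul h.swap01 (a 0) M
  rw [mon, mul_assoc, ← mul_assoc (u 0 ^ a 0), e, mon]
  simp only [smul_mul_assoc, mul_smul_comm, mul_assoc, pow_add, vec, Pi.add_apply, Matrix.cons_val,
    pow_zero, mul_one]

/-- Right multiplication by u₁^N u₀^{3N} only rescales and translates ordered monomials. If N bounds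
the degrees of a finite set, the translation moves this set into the cone. -/
theorem mon_linearIndependent (hT : LinearIndependent k (torusMon q u)) :
    LinearIndependent k (mon u) := by
  rw [← linearIndepOn_univ_iff]
  refine linearIndepOn_of_finite _ fun t _ hfin => ?_
  obtain ⟨N, hN⟩ : ∃ N, ∀ c ∈ t, ∑ i, c i ≤ N := by
    obtain ⟨N, hN⟩ := (hfin.image fun c => ∑ i, c i).bddAbove
    exact ⟨N, fun c hc => hN ⟨c, hc, rfl⟩⟩
  have h1 := (h.mon_linearIndepOn_cone hT)
  have h2 : LinearIndependent k fun c : t => mon u (c.1 + vec 0 0 N (3 * N)) := by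
    refine LinearIndependent.comp h1 (fun c : t => ⟨c.1 + vec 0 0 N (3 * N), ?_⟩) ?_
    · have := hN c.1 c.2
      simp only [Fin.sum_univ_four] at this
      simp only [Set.mem_ofPred_eq, Pi.add_apply, vec, Matrix.cons_val]
      omega
    · rintro ⟨c, hc⟩ ⟨d, hd⟩ hcd
      simpa using hcd
  have hq := h.q_ne
  have h3 := h2.units_smul fun c : t => Units.mk0 (((q ^ 2)⁻¹) ^ (c.1 0 * N))
    (pow_ne_zero _ (inv_ne_zero (pow_ne_zero _ hq)))
  refine LinearIndependent.of_comp (LinearMap.mulRight k (u 1 ^ N * u 0 ^ (3 * N))) ?_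
  have e : (LinearMap.mulRight k (u 1 ^ N * u 0 ^ (3 * N)) ∘ fun c : t => mon u c) =
      ((fun c : t => Units.mk0 (((q ^ 2)⁻¹) ^ (c.1 0 * N))
        (pow_ne_zero _ (inv_ne_zero (pow_ne_zero _ hq)))) •
        fun c : t => mon u (c.1 + vec 0 0 N (3 * N))) :=
    funext fun c => h.mon_mul_shift c.1 N (3 * N)
  exact e ▸ h3

end Straightening

end PBW

theorem uMon_linearIndependent : LinearIndependent 𝕂 uMon :=
  straightening_u.mon_linearIndependent torusMon_linearIndependent

/-! ### Absence of zero divisors. -/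

section Domain

variable {k R : Type*} [Field k] [Ring R] [Algebra k R]

/-- The exponents in the order in which they are compared lexicographically. -/
def lexKey (a : Fin 4 → ℕ) : Lex (Fin 4 → ℕ) := toLex ![a 3, a 0, a 2, a 1]

theorem lexKey_add (a b : Fin 4 → ℕ) : lexKey (a + b) = lexKey a + lexKey b := by
  apply toLex.symm.injective
  funext i
  fin_cases i <;> rfl

theorem lexKey_injective : Function.Injective lexKey := by
  intro a b h
  have h' := toLex.injective h
  have e0 := congrFun h' 0
  have e1 := congrFun h' 1
  have e2 := congrFun h' 2
  have e3 := congrFun h' 3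
  simp only [Matrix.cons_val] at e0 e1 e2 e3
  rw [← vec_eta a, ← vec_eta b, vec_inj]
  exact ⟨e0, e2, e3, e1⟩

/-- Going down lowers a₃ by s and a₀ by r, and (s, r) ≠ (0, 0). Comparing the coordinates 3 and 0
first therefore refines the partial order to a total order compatible with addition. -/
theorem Below.lexKey_lt {a b : Fin 4 → ℕ} (h : Below a b) (hne : b ≠ a) : lexKey b < lexKey a := by
  have hne' : ¬(b 3 = a 3 ∧ b 2 = a 2 ∧ b 1 = a 1 ∧ b 0 = a 0) := by
    rw [← vec_inj, vec_eta, vec_eta]; exact hne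
  obtain ⟨s, r, h1, h2, h3, h4⟩ := h
  by_cases hs : s = 0
  · refine ⟨1, fun j hj => ?_, ?_⟩
    · have : j = 0 := by omega
      subst this
      change b 3 = a 3
      omega
    · change b 0 < a 0
      omega
  · refine ⟨0, fun j hj => absurd hj (by omega), ?_⟩
    change b 3 < a 3
    omega

/-- The span of the monomials that are lexicographically smaller than `a`. -/
def lexSpan (k : Type*) [Field k] [Algebra k R] (u : Fin 4 → R) (a : Fin 4 → ℕ) :
    Submodule k R := Submodule.span k (mon u '' {b | lexKey b < lexKey a})

theorem lowerSpan_subset_lexSpan {u : Fin 4 → R} {a : Fin 4 → ℕ} {x : R}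
    (hx : x ∈ lowerSpan (⊤ : Subalgebra k k) u a) : x ∈ lexSpan k u a := by
  induction hx using Submodule.span_induction with
  | mem x hx =>
    obtain ⟨c, hc, hne, rfl⟩ := hx
    exact Submodule.subset_span ⟨c, hc.lexKey_lt hne, rfl⟩
  | zero => exact zero_mem _
  | add x y _ _ hx hy => exact add_mem hx hy
  | smul c x _ hx => exact Submodule.smul_mem _ (c : k) hx

theorem lexSpan_mono {u : Fin 4 → R} {a b : Fin 4 → ℕ} (h : lexKey a ≤ lexKey b) :
    lexSpan k u a ≤ lexSpan k u b :=
  Submodule.span_mono (Set.image_mono fun _ hc => lt_of_lt_of_le hc h)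

theorem exists_lead {u : Fin 4 → R} (htop : Submodule.span k (Set.range (mon u)) = ⊤) {x : R}
    (hx : x ≠ 0) : ∃ a, ∃ c : k, c ≠ 0 ∧ x - c • mon u a ∈ lexSpan k u a := by
  obtain ⟨f, rfl⟩ := Finsupp.mem_span_range_iff_exists_finsupp.1
    (htop ▸ Submodule.mem_top : x ∈ Submodule.span k (Set.range (mon u)))
  have hf : f.support.Nonempty := by
    rw [Finsupp.support_nonempty_iff]
    rintro rfl
    simp at hx
  obtain ⟨a, ha, hmax⟩ := f.support.exists_max_image lexKey hf
  refine ⟨a, f a, Finsupp.mem_support_iff.1 ha, ?_⟩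
  rw [Finsupp.sum, ← Finset.sum_erase_add _ _ ha, add_sub_cancel_right]
  refine Submodule.sum_mem _ fun b hb => Submodule.smul_mem _ _ (Submodule.subset_span ⟨b, ?_, rfl⟩)
  obtain ⟨hne, hb⟩ := Finset.mem_erase.1 hb
  exact lt_of_le_of_ne (hmax b hb) (lexKey_injective.ne hne)

theorem ne_zero_of_lead {u : Fin 4 → R} (hli : LinearIndependent k (mon u)) {x : R}
    {a : Fin 4 → ℕ} {c : k} (hc : c ≠ 0) (h : x - c • mon u a ∈ lexSpan k u a) : x ≠ 0 := by
  rintro rfl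
  rw [zero_sub, Submodule.neg_mem_iff, Submodule.smul_mem_iff _ hc] at h
  exact hli.notMem_span_image (s := {b | lexKey b < lexKey a}) (fun h' => lt_irrefl (lexKey a) h') h

namespace Straightening

variable {q : k} {u : Fin 4 → R} (h : Straightening q u)
include h

theorem mon_mul_mon_lex (a b : Fin 4 → ℕ) :
    ∃ c : k, c ≠ 0 ∧ mon u a * mon u b - c • mon u (a + b) ∈ lexSpan k u (a + b) := by
  obtain ⟨n, hn⟩ := h.mon_mul_mon (S := (⊤ : Subalgebra k k)) trivial a b
  exact ⟨_, pow_ne_zero _ (inv_ne_zero (pow_ne_zero _ h.q_ne)), lowerSpan_subset_lexSpan hn⟩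

theorem mon_mul_mon_mem {a b c : Fin 4 → ℕ} (hlt : lexKey (a + b) < lexKey c) :
    mon u a * mon u b ∈ lexSpan k u c := by
  obtain ⟨d, -, hn⟩ := h.mon_mul_mon_lex a b
  rw [← sub_add_cancel (mon u a * mon u b) (d • mon u (a + b))]
  exact add_mem (lexSpan_mono hlt.le hn)
    (Submodule.smul_mem _ _ (Submodule.subset_span ⟨_, hlt, rfl⟩))

theorem lexSpan_mul {a b c : Fin 4 → ℕ} {x y : R} (hx : x ∈ lexSpan k u a)
    (hy : ∃ s : Set (Fin 4 → ℕ), (∀ d ∈ s, lexKey d ≤ lexKey b) ∧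
      y ∈ Submodule.span k (mon u '' s)) (hc : c = a + b) : x * y ∈ lexSpan k u c := by
  obtain ⟨s, hs, hy⟩ := hy
  induction hx using Submodule.span_induction with
  | zero => simp
  | add x x' _ _ hx hx' => rw [add_mul]; exact add_mem hx hx'
  | smul c x _ hx => rw [smul_mul_assoc]; exact Submodule.smul_mem _ c hx
  | mem x hx =>
    obtain ⟨a', ha', rfl⟩ := hx
    induction hy using Submodule.span_induction with
    | zero => simp
    | add y y' _ _ hy hy' => rw [mul_add]; exact add_mem hy hy'
    | smul c y _ hy => rw [mul_smul_comm]; exact Submodule.smul_mem _ c hy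
    | mem y hy =>
      obtain ⟨d, hd, rfl⟩ := hy
      apply h.mon_mul_mon_mem
      rw [hc, lexKey_add, lexKey_add]
      exact add_lt_add_of_lt_of_le ha' (hs d hd)

theorem mul_lexSpan {a b : Fin 4 → ℕ} {y : R} (hy : y ∈ lexSpan k u b) :
    mon u a * y ∈ lexSpan k u (a + b) := by
  induction hy using Submodule.span_induction with
  | zero => simp
  | add y y' _ _ hy hy' => rw [mul_add]; exact add_mem hy hy'
  | smul c y _ hy => rw [mul_smul_comm]; exact Submodule.smul_mem _ c hy
  | mem y hy =>
    obtain ⟨d, hd, rfl⟩ := hy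
    apply h.mon_mul_mon_mem
    rw [lexKey_add, lexKey_add]
    exact add_lt_add_of_le_of_lt le_rfl hd

/-- For the lexicographic order, the leading monomial of a product is the product of the leading
monomials up to a nonzero scalar. -/
theorem noZeroDivisors (hli : LinearIndependent k (mon u))
    (htop : Submodule.span k (Set.range (mon u)) = ⊤) : NoZeroDivisors R where
  eq_zero_or_eq_zero_of_mul_eq_zero := by
    intro x y hxy
    by_contra hne
    rw [not_or] at hne
    obtain ⟨a, c, hc, hx⟩ := exists_lead htop hne.1
    obtain ⟨b, d, hd, hy⟩ := exists_lead htop hne.2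
    obtain ⟨e, he, hab⟩ := h.mon_mul_mon_lex a b
    refine ne_zero_of_lead hli (a := a + b) (c := c * d * e)
      (mul_ne_zero (mul_ne_zero hc hd) he) ?_ hxy
    have hy' : ∃ s : Set (Fin 4 → ℕ), (∀ d ∈ s, lexKey d ≤ lexKey b) ∧
        y ∈ Submodule.span k (mon u '' s) := by
      refine ⟨{d | lexKey d ≤ lexKey b}, fun _ h => h, ?_⟩
      rw [← sub_add_cancel y (d • mon u b)]
      have hb : mon u b ∈ Submodule.span k (mon u '' {d | lexKey d ≤ lexKey b}) :=
        Submodule.subset_span (Set.mem_image_of_mem _ (Set.mem_ofPred.2 (le_refl (lexKey b))))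
      have hsub : ({d | lexKey d < lexKey b} : Set (Fin 4 → ℕ)) ⊆ {d | lexKey d ≤ lexKey b} :=
        fun d hd => le_of_lt (Set.mem_ofPred.1 hd)
      exact add_mem (Submodule.span_mono (Set.image_mono hsub) hy) (Submodule.smul_mem _ _ hb)
    have e1 := h.lexSpan_mul hx hy' rfl
    have e2 := Submodule.smul_mem _ c (h.mul_lexSpan (a := a) hy)
    have e3 := Submodule.smul_mem _ (c * d) hab
    -- The three errors come from the lower part of x, the lower part of y, and the straightening of
    -- the product of the two leading monomials.
    have := add_mem (add_mem e1 e2) e3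
    convert this using 1
    simp only [sub_mul, mul_sub, smul_sub, smul_smul, smul_mul_assoc, mul_smul_comm]
    abel

end Straightening

end Domain

/-! ### Ore conditions from polynomial growth and the skew field of fractions. -/

section Ore

variable {k R : Type*} [Field k] [Ring R] [Algebra k R]

theorem exists_pow_lt_two_pow (d : ℕ) : ∃ n : ℕ, (n * d + 1) ^ 4 < 2 ^ n := by
  have h := isLittleO_pow_const_const_pow_of_one_lt (R := ℝ) 4 (r := 2) (by norm_num)
  have h2 := (h.def (c := 1 / ((d : ℝ) + 1) ^ 4 / 2) (by positivity)).and
    (Filter.eventually_ge_atTop 1)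
  obtain ⟨n, hn, hn1⟩ := h2.exists
  refine ⟨n, ?_⟩
  have e1 : ((n : ℝ) * d + 1) ^ 4 ≤ (n * (d + 1)) ^ 4 := by
    have : (1 : ℝ) ≤ n := by exact_mod_cast hn1
    gcongr
    nlinarith
  rw [Real.norm_of_nonneg (by positivity), Real.norm_of_nonneg (by positivity)] at hn
  have e2 : ((n : ℝ) * (d + 1)) ^ 4 ≤ 2 ^ n / 2 := by
    rw [mul_pow]
    calc (n : ℝ) ^ 4 * (d + 1) ^ 4 ≤ (1 / ((d : ℝ) + 1) ^ 4 / 2 * 2 ^ n) * (d + 1) ^ 4 := by gcongr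
      _ = 2 ^ n / 2 := by field_simp
  have e3 : ((n : ℝ) * d + 1) ^ 4 < 2 ^ n := by
    have : (0 : ℝ) < 2 ^ n := by positivity
    linarith
  exact_mod_cast e3

/-- Common multiples exist in a filtered space of polynomial growth. -/
theorem exists_common_multiple (V : ℕ → Submodule k R) [∀ n, FiniteDimensional k (V n)]
    (hV : ∀ n, Module.finrank k (V n) ≤ (n + 1) ^ 4) (h0 : 1 ≤ Module.finrank k (V 0))
    (f g : R →ₗ[k] R) (hf : Function.Injective f) (hg : Function.Injective g) (d : ℕ)
    (hfV : ∀ n, (V n).map f ≤ V (n + d)) (hgV : ∀ n, (V n).map g ≤ V (n + d)) :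
    ∃ x y, x ≠ 0 ∧ f x = g y := by
  by_contra hcon
  push Not at hcon
  -- Without common multiples the two images intersect trivially, so the dimension at least doubles
  -- in each step of length d. This contradicts the growth of degree four.
  have step : ∀ n, 2 * Module.finrank k (V n) ≤ Module.finrank k (V (n + d)) := by
    intro n
    have e := Submodule.finrank_sup_add_finrank_inf_eq ((V n).map f) ((V n).map g)
    have e1 : (V n).map f ⊓ (V n).map g = ⊥ := by
      rw [eq_bot_iff]
      rintro _ ⟨⟨x, -, rfl⟩, ⟨y, -, hy⟩⟩
      by_cases hx : x = 0
      · simp [hx]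
      · exact absurd hy.symm (hcon x y hx)
    rw [e1, finrank_bot, add_zero, ← (Submodule.equivMapOfInjective f hf (V n)).finrank_eq,
      ← (Submodule.equivMapOfInjective g hg (V n)).finrank_eq] at e
    rw [two_mul, ← e]
    exact Submodule.finrank_mono (sup_le (hfV n) (hgV n))
  have grow : ∀ n, 2 ^ n ≤ Module.finrank k (V (n * d)) := by
    intro n
    induction n with
    | zero => simpa using h0
    | succ n ih =>
      rw [pow_succ, Nat.succ_mul]
      have := step (n * d)
      omega
  obtain ⟨n, hn⟩ := exists_pow_lt_two_pow d
  exact absurd ((grow n).trans (hV _)) (not_le.2 hn)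

/-- The span of the monomials of degree at most `n`. -/
def degSpan (k : Type*) [Field k] [Algebra k R] (u : Fin 4 → R) (n : ℕ) : Submodule k R :=
  Submodule.span k (mon u '' {a | ∑ i, a i ≤ n})

theorem degree_subset (n : ℕ) : {a : Fin 4 → ℕ | ∑ i, a i ≤ n} ⊆
    (Fintype.piFinset fun _ : Fin 4 => Finset.range (n + 1) : Finset (Fin 4 → ℕ)) := by
  intro a ha
  rw [Finset.mem_coe, Fintype.mem_piFinset]
  intro i
  rw [Finset.mem_range, Nat.lt_succ_iff]
  exact (Finset.single_le_sum (f := a) (fun _ _ => Nat.zero_le _) (Finset.mem_univ i)).trans ha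

theorem finite_degree (u : Fin 4 → R) (n : ℕ) : (mon u '' {a | ∑ i, a i ≤ n}).Finite :=
  ((Finset.finite_toSet _).subset (degree_subset n)).image _

instance (u : Fin 4 → R) (n : ℕ) : FiniteDimensional k (degSpan k u n) :=
  FiniteDimensional.span_of_finite k (finite_degree u n)

theorem finrank_degSpan_le (u : Fin 4 → R) (n : ℕ) :
    Module.finrank k (degSpan k u n) ≤ (n + 1) ^ 4 := by
  classical
  have h1 : degSpan k u n ≤ Submodule.span k ((Fintype.piFinset fun _ : Fin 4 =>
      Finset.range (n + 1)).image (mon u) : Finset R) := by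
    refine Submodule.span_mono ?_
    rw [Finset.coe_image]
    exact Set.image_mono (degree_subset n)
  refine (Submodule.finrank_mono h1).trans ((finrank_span_finset_le_card _).trans
    (Finset.card_image_le.trans ?_))
  simp [Fintype.card_piFinset]

theorem exists_mem_degSpan {u : Fin 4 → R} (htop : Submodule.span k (Set.range (mon u)) = ⊤)
    (x : R) : ∃ n, x ∈ degSpan k u n := by
  obtain ⟨f, rfl⟩ := Finsupp.mem_span_range_iff_exists_finsupp.1
    (htop ▸ Submodule.mem_top : x ∈ Submodule.span k (Set.range (mon u)))
  refine ⟨∑ a ∈ f.support, ∑ i, a i, ?_⟩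
  refine Submodule.sum_mem _ fun a ha => Submodule.smul_mem _ _ (Submodule.subset_span ⟨a, ?_, rfl⟩)
  exact Finset.single_le_sum (f := fun a : Fin 4 → ℕ => ∑ i, a i) (fun _ _ => Nat.zero_le _) ha

theorem degSpan_mono {u : Fin 4 → R} {m n : ℕ} (h : m ≤ n) : degSpan k u m ≤ degSpan k u n :=
  Submodule.span_mono (Set.image_mono fun _ ha => le_trans ha h)

namespace Straightening

variable {q : k} {u : Fin 4 → R} (h : Straightening q u)
include h

theorem degSpan_mul {m n : ℕ} {x y : R} (hx : x ∈ degSpan k u m) (hy : y ∈ degSpan k u n) :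
    x * y ∈ degSpan k u (m + n) := by
  induction hx using Submodule.span_induction with
  | zero => simp
  | add x x' _ _ hx hx' => rw [add_mul]; exact add_mem hx hx'
  | smul c x _ hx => rw [smul_mul_assoc]; exact Submodule.smul_mem _ c hx
  | mem x hx =>
    obtain ⟨c, hc, rfl⟩ := hx
    induction hy using Submodule.span_induction with
    | zero => simp
    | add y y' _ _ hy hy' => rw [mul_add]; exact add_mem hy hy'
    | smul c y _ hy => rw [mul_smul_comm]; exact Submodule.smul_mem _ c hy
    | mem y hy =>
      obtain ⟨d, hd, rfl⟩ := hy
      have e := h.belowSpan_mul (mon_mem_belowSpan (Below.refl c)) (mon_mem_belowSpan (Below.refl d))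
      refine Submodule.span_mono ?_ e
      rintro _ ⟨b, hb, rfl⟩
      refine ⟨b, ?_, rfl⟩
      have := hb.sum_eq
      simp only [Set.mem_ofPred_eq, Pi.add_apply, Finset.sum_add_distrib] at this hc hd ⊢
      omega

variable (hli : LinearIndependent k (mon u)) (htop : Submodule.span k (Set.range (mon u)) = ⊤)
include hli htop

theorem one_le_finrank_degSpan : 1 ≤ Module.finrank k (degSpan k u 0) := by
  rw [Nat.one_le_iff_ne_zero, ne_eq, Submodule.finrank_eq_zero, ← ne_eq, Submodule.ne_bot_iff]
  exact ⟨mon u 0, Submodule.subset_span ⟨0, by simp, rfl⟩, hli.ne_zero 0⟩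

theorem left_ore (a b : R) (hb : b ≠ 0) : ∃ x y, x ≠ 0 ∧ x * a = y * b := by
  have := h.noZeroDivisors hli htop
  by_cases ha : a = 0
  · have : Nontrivial R := ⟨b, 0, hb⟩
    exact ⟨1, 0, one_ne_zero, by simp [ha]⟩
  obtain ⟨m, hm⟩ := exists_mem_degSpan htop a
  obtain ⟨n, hn⟩ := exists_mem_degSpan htop b
  refine exists_common_multiple (degSpan k u) (finrank_degSpan_le u)
    (h.one_le_finrank_degSpan hli htop) (LinearMap.mulRight k a) (LinearMap.mulRight k b)
    (fun _ _ => mul_right_cancel₀ ha) (fun _ _ => mul_right_cancel₀ hb) (max m n) ?_ ?_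
  · rintro i _ ⟨x, hx, rfl⟩
    exact h.degSpan_mul hx (degSpan_mono (le_max_left _ _) hm)
  · rintro i _ ⟨x, hx, rfl⟩
    exact h.degSpan_mul hx (degSpan_mono (le_max_right _ _) hn)

theorem right_ore (a b : R) (hb : b ≠ 0) : ∃ x y, x ≠ 0 ∧ a * x = b * y := by
  have := h.noZeroDivisors hli htop
  by_cases ha : a = 0
  · have : Nontrivial R := ⟨b, 0, hb⟩
    exact ⟨1, 0, one_ne_zero, by simp [ha]⟩
  obtain ⟨m, hm⟩ := exists_mem_degSpan htop a
  obtain ⟨n, hn⟩ := exists_mem_degSpan htop b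
  refine exists_common_multiple (degSpan k u) (finrank_degSpan_le u)
    (h.one_le_finrank_degSpan hli htop) (LinearMap.mulLeft k a) (LinearMap.mulLeft k b)
    (fun _ _ => mul_left_cancel₀ ha) (fun _ _ => mul_left_cancel₀ hb) (max m n) ?_ ?_
  · rintro i _ ⟨x, hx, rfl⟩
    rw [add_comm]
    exact h.degSpan_mul (degSpan_mono (le_max_left _ _) hm) hx
  · rintro i _ ⟨x, hx, rfl⟩
    rw [add_comm]
    exact h.degSpan_mul (degSpan_mono (le_max_right _ _) hn) hx

end Straightening

/-- A domain with the two-sided Ore property has a skew field of fractions. -/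
theorem exists_skewField {k R : Type} [Field k] [Ring R] [Algebra k R] [Nontrivial R]
    [NoZeroDivisors R]
    (hl : ∀ a b : R, b ≠ 0 → ∃ x y, x ≠ 0 ∧ x * a = y * b)
    (hr : ∀ a b : R, b ≠ 0 → ∃ x y, x ≠ 0 ∧ a * x = b * y) :
    ∃ (F : Type) (_ : DivisionRing F) (_ : Algebra k F) (ι : R →ₐ[k] F),
      Function.Injective ι ∧ ∀ f : F, ∃ a b : R, b ≠ 0 ∧ f = ι a * (ι b)⁻¹ := by
  classical
  obtain ⟨ho⟩ := (OreLocalization.nonempty_oreSet_iff_of_noZeroDivisors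
    (S := nonZeroDivisors R)).2 fun r s => by
      obtain ⟨x, y, hx, e⟩ := hl r s (nonZeroDivisors.ne_zero s.2)
      exact ⟨y, ⟨x, mem_nonZeroDivisors_of_ne_zero hx⟩, e⟩
  let ι : R →ₐ[k] OreLocalization (nonZeroDivisors R) R :=
    { OreLocalization.numeratorRingHom with commutes' := fun r => rfl }
  have hι : ∀ r, ι r = OreLocalization.numeratorHom r := fun r => rfl
  have hinj : Function.Injective ι :=
    OreLocalization.numeratorHom_inj fun _ hx => hx.1
  refine ⟨OreLocalization (nonZeroDivisors R) R, inferInstance, inferInstance, ι, hinj, fun f => ?_⟩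
  induction f using OreLocalization.ind with
  | _ r s =>
    have hs := nonZeroDivisors.ne_zero s.2
    -- The localization provides left fractions s⁻¹r; the right Ore condition rewrites them as right
    -- fractions.
    obtain ⟨x, y, hx, e⟩ := hr r s hs
    refine ⟨y, x, hx, ?_⟩
    have h1 : (r /ₒ s : OreLocalization (nonZeroDivisors R) R) = (ι s)⁻¹ * ι r := by
      have hs' : ι s ≠ 0 := fun h => hs (hinj (h.trans (map_zero ι).symm))
      rw [eq_inv_mul_iff_mul_eq₀ hs', hι, hι]
      exact OreLocalization.mul_cancel
    have hx' : ι x ≠ 0 := fun h => hx (hinj (h.trans (map_zero ι).symm))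
    have hs' : ι s ≠ 0 := fun h => hs (hinj (h.trans (map_zero ι).symm))
    rw [h1, eq_mul_inv_iff_mul_eq₀ hx', mul_assoc, ← map_mul, e, map_mul,
      inv_mul_cancel_left₀ hs']

end Ore

/-! ### The automorphism v ↦ v⁻¹ of the ground field. -/

open Polynomial in
theorem eval₂_inv_v_ne_zero {f : ℚ[X]} (hf : f ≠ 0) : f.eval₂ (algebraMap ℚ 𝕂) v⁻¹ ≠ 0 := by
  intro h
  letI : Invertible (v⁻¹ : 𝕂) := invertibleOfNonzero (inv_ne_zero v_ne_zero)
  -- A zero at v⁻¹ becomes a zero of the reversed polynomial at v, where v is the indeterminate.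
  have h1 := (Polynomial.eval₂_reverse_eq_zero_iff (algebraMap ℚ 𝕂) v⁻¹ f).2 h
  have h2 : (⅟(v⁻¹ : 𝕂)) = v := by rw [invOf_eq_inv, inv_inv]
  rw [h2] at h1
  have h3 : algebraMap ℚ[X] 𝕂 f.reverse = f.reverse.eval₂ (algebraMap ℚ 𝕂) v := by
    rw [v, ← RatFunc.algebraMap_X, ← Polynomial.aeval_def, Polynomial.aeval_algebraMap_apply]
    simp
  rw [← h3] at h1
  have h4 := RatFunc.algebraMap_injective ℚ (h1.trans (map_zero _).symm)
  exact hf (by simpa using h4)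

/-- The field automorphism `v ↦ v⁻¹`. -/
def bar : 𝕂 →+* 𝕂 := RatFunc.liftRingHom (Polynomial.eval₂RingHom (algebraMap ℚ 𝕂) v⁻¹) (by
  intro f hf
  rw [Submonoid.mem_comap]
  exact mem_nonZeroDivisors_of_ne_zero (eval₂_inv_v_ne_zero (nonZeroDivisors.ne_zero hf)))

theorem bar_algebraMap (f : Polynomial ℚ) :
    bar (algebraMap (Polynomial ℚ) 𝕂 f) = f.eval₂ (algebraMap ℚ 𝕂) v⁻¹ := by
  rw [bar, RatFunc.liftRingHom_apply]
  simp

theorem bar_v : bar v = v⁻¹ := by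
  rw [v, ← RatFunc.algebraMap_X, bar_algebraMap, Polynomial.eval₂_X, RatFunc.algebraMap_X, v]

theorem bar_q : bar q = q⁻¹ := by rw [q, map_pow, bar_v, inv_pow]

/-- The target need not be commutative, as it is applied to opposite algebras; agreement on inverses
is therefore deduced from the uniqueness of two-sided inverses. -/
theorem ringHom_ext_of_v {R : Type*} [Ring R] {f g : 𝕂 →+* R} (h : f v = g v) : f = g := by
  have hp : f.comp (algebraMap (Polynomial ℚ) 𝕂) = g.comp (algebraMap (Polynomial ℚ) 𝕂) := by
    refine Polynomial.ringHom_ext' (RingHom.ext_rat _ _) ?_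
    simpa [RatFunc.algebraMap_X, v] using h
  ext x
  induction x using RatFunc.induction_on with
  | f p r hr =>
    have hr' : algebraMap (Polynomial ℚ) 𝕂 r ≠ 0 := by
      intro h0
      exact hr (RatFunc.algebraMap_injective ℚ (h0.trans (map_zero _).symm))
    have e1 := RingHom.congr_fun hp p
    have e2 := RingHom.congr_fun hp r
    simp only [RingHom.comp_apply] at e1 e2
    have hu : g (algebraMap (Polynomial ℚ) 𝕂 r) * g (algebraMap (Polynomial ℚ) 𝕂 r)⁻¹ = 1 := by
      rw [← map_mul, mul_inv_cancel₀ hr', map_one]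
    have hu' : f (algebraMap (Polynomial ℚ) 𝕂 r)⁻¹ * f (algebraMap (Polynomial ℚ) 𝕂 r) = 1 := by
      rw [← map_mul, inv_mul_cancel₀ hr', map_one]
    rw [div_eq_mul_inv, map_mul, map_mul, e1]
    congr 1
    calc f (algebraMap (Polynomial ℚ) 𝕂 r)⁻¹
        = f (algebraMap (Polynomial ℚ) 𝕂 r)⁻¹ * (g (algebraMap (Polynomial ℚ) 𝕂 r) *
            g (algebraMap (Polynomial ℚ) 𝕂 r)⁻¹) := by rw [hu, mul_one]
      _ = g (algebraMap (Polynomial ℚ) 𝕂 r)⁻¹ := by rw [← mul_assoc, ← e2, hu', one_mul]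

theorem bar_bar (c : 𝕂) : bar (bar c) = c := by
  have : bar.comp bar = RingHom.id 𝕂 := ringHom_ext_of_v (by simp [bar_v, map_inv₀])
  exact RingHom.congr_fun this c

/-! ### The universal property -/

section Universal

variable {k : Type*} [Field k]

/-- The straightening relations. -/
inductive StraighteningRel (q : k) : FreeAlgebra k (Fin 4) → FreeAlgebra k (Fin 4) → Prop
  | rel10 : StraighteningRel q (FreeAlgebra.ι k 1 * FreeAlgebra.ι k 0)
      (q ^ 2 • (FreeAlgebra.ι k 0 * FreeAlgebra.ι k 1))
  | rel21 : StraighteningRel q (FreeAlgebra.ι k 2 * FreeAlgebra.ι k 1)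
      (q ^ 2 • (FreeAlgebra.ι k 1 * FreeAlgebra.ι k 2))
  | rel32 : StraighteningRel q (FreeAlgebra.ι k 3 * FreeAlgebra.ι k 2)
      (q ^ 2 • (FreeAlgebra.ι k 2 * FreeAlgebra.ι k 3))
  | rel20 : StraighteningRel q (FreeAlgebra.ι k 2 * FreeAlgebra.ι k 0)
      (q ^ 2 • (FreeAlgebra.ι k 0 * FreeAlgebra.ι k 2) +
        (q ^ 2 - 1) • (FreeAlgebra.ι k 1 * FreeAlgebra.ι k 1))
  | rel31 : StraighteningRel q (FreeAlgebra.ι k 3 * FreeAlgebra.ι k 1)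
      (q ^ 2 • (FreeAlgebra.ι k 1 * FreeAlgebra.ι k 3) +
        (q ^ 2 - 1) • (FreeAlgebra.ι k 2 * FreeAlgebra.ι k 2))
  | rel30 : StraighteningRel q (FreeAlgebra.ι k 3 * FreeAlgebra.ι k 0)
      (q ^ 2 • (FreeAlgebra.ι k 0 * FreeAlgebra.ι k 3) +
        (q ^ 2 - (q ^ 2)⁻¹) • (FreeAlgebra.ι k 2 * FreeAlgebra.ι k 1))

theorem Straightening.lift_rel {R : Type*} [Ring R] [Algebra k R] {q : k} {u : Fin 4 → R}
    (h : Straightening q u) ⦃x y : FreeAlgebra k (Fin 4)⦄ (hxy : StraighteningRel q x y) :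
    FreeAlgebra.lift k u x = FreeAlgebra.lift k u y := by
  cases hxy
  · simpa using h.rel10
  · simpa using h.rel21
  · simpa using h.rel32
  · simpa using h.rel20
  · simpa using h.rel31
  · simpa using h.rel30

theorem span_mon_eq_top {R : Type*} [Ring R] [Algebra k R] {q : k} {u : Fin 4 → R}
    (h : Straightening q u) (htop : Algebra.adjoin k (Set.range u) = ⊤) :
    Submodule.span k (Set.range (mon u)) = ⊤ := by
  have hgen : ∀ i, u i ∈ Submodule.span k (Set.range (mon u)) := by
    intro i
    refine Submodule.subset_span ⟨Pi.single i 1, ?_⟩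
    fin_cases i <;> simp [mon]
  have hmul : ∀ x y, x ∈ Submodule.span k (Set.range (mon u)) →
      y ∈ Submodule.span k (Set.range (mon u)) → x * y ∈ Submodule.span k (Set.range (mon u)) := by
    intro x y hx hy
    induction hx using Submodule.span_induction with
    | zero => simp
    | add x x' _ _ hx hx' => rw [add_mul]; exact add_mem hx hx'
    | smul c x _ hx => rw [smul_mul_assoc]; exact Submodule.smul_mem _ c hx
    | mem x hx =>
      obtain ⟨a, rfl⟩ := hx
      induction hy using Submodule.span_induction with
      | zero => simp
      | add y y' _ _ hy hy' => rw [mul_add]; exact add_mem hy hy'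
      | smul c y _ hy => rw [mul_smul_comm]; exact Submodule.smul_mem _ c hy
      | mem y hy =>
        obtain ⟨b, rfl⟩ := hy
        have := h.belowSpan_mul (mon_mem_belowSpan (Below.refl a)) (mon_mem_belowSpan (Below.refl b))
        refine Submodule.span_mono ?_ this
        rintro _ ⟨b, -, rfl⟩
        exact ⟨b, rfl⟩
  rw [eq_top_iff]
  rintro x -
  have hx : x ∈ Algebra.adjoin k (Set.range u) := htop ▸ Algebra.mem_top
  induction hx using Algebra.adjoin_induction with
  | mem x hx => obtain ⟨i, rfl⟩ := hx; exact hgen i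
  | algebraMap r =>
    rw [Algebra.algebraMap_eq_smul_one]
    exact Submodule.smul_mem _ _ (Submodule.subset_span ⟨0, by simp [mon]⟩)
  | add x y _ _ hx hy => exact add_mem hx hy
  | mul x y _ _ hx hy => exact hmul x y hx hy

theorem map_mon {A B : Type*} [Ring A] [Algebra k A] [Ring B] [Algebra k B] (φ : A →ₐ[k] B)
    (w : Fin 4 → A) (a : Fin 4 → ℕ) : φ (mon w a) = mon (φ ∘ w) a := by
  simp [mon]

/-- An algebra with a basis of ordered monomials is presented by the straightening relations. -/
theorem Straightening.exists_algHom {R B : Type*} [Ring R] [Algebra k R] [Ring B] [Algebra k B]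
    {q : k} {u : Fin 4 → R} {w : Fin 4 → B} (h : Straightening q u) (hw : Straightening q w)
    (hli : LinearIndependent k (mon u)) (htop : Submodule.span k (Set.range (mon u)) = ⊤) :
    ∃ φ : R →ₐ[k] B, ∀ i, φ (u i) = w i := by
  -- The algebra R is compared with the algebra presented by the relations, which maps both to R and
  -- to the target.
  let p : Fin 4 → RingQuot (StraighteningRel q) := fun i =>
    RingQuot.mkAlgHom k (StraighteningRel q) (FreeAlgebra.ι k i)
  have hp : Straightening q p := by
    refine ⟨h.q_ne, ?_, ?_, ?_, ?_, ?_, ?_⟩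
    · simpa [p] using RingQuot.mkAlgHom_rel k (StraighteningRel.rel10 (q := q))
    · simpa [p] using RingQuot.mkAlgHom_rel k (StraighteningRel.rel21 (q := q))
    · simpa [p] using RingQuot.mkAlgHom_rel k (StraighteningRel.rel32 (q := q))
    · simpa [p] using RingQuot.mkAlgHom_rel k (StraighteningRel.rel20 (q := q))
    · simpa [p] using RingQuot.mkAlgHom_rel k (StraighteningRel.rel31 (q := q))
    · simpa [p] using RingQuot.mkAlgHom_rel k (StraighteningRel.rel30 (q := q))
  have hptop : Algebra.adjoin k (Set.range p) = ⊤ := by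
    have e1 : Set.range p = RingQuot.mkAlgHom k (StraighteningRel q) ''
        Set.range (FreeAlgebra.ι k : Fin 4 → FreeAlgebra k (Fin 4)) := by
      rw [← Set.range_comp]; rfl
    rw [e1, ← AlgHom.map_adjoin, FreeAlgebra.adjoin_range_ι, Algebra.map_top,
      AlgHom.range_eq_top]
    exact RingQuot.mkAlgHom_surjective k _
  let π : RingQuot (StraighteningRel q) →ₐ[k] R :=
    RingQuot.liftAlgHom k ⟨FreeAlgebra.lift k u, h.lift_rel⟩
  let ρ : RingQuot (StraighteningRel q) →ₐ[k] B :=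
    RingQuot.liftAlgHom k ⟨FreeAlgebra.lift k w, hw.lift_rel⟩
  have hπ : ∀ i, π (p i) = u i := fun i => by simp [π, p]
  have hρ : ∀ i, ρ (p i) = w i := fun i => by simp [ρ, p]
  have hπm : ∀ a, π (mon p a) = mon u a := fun a => by
    rw [map_mon]; congr 1; funext i; exact hπ i
  -- The ordered monomials span the presented algebra and go to independent elements of R, so π has
  -- no kernel.
  have hinj : Function.Injective π := by
    rw [injective_iff_map_eq_zero]
    intro x hx
    obtain ⟨f, rfl⟩ := Finsupp.mem_span_range_iff_exists_finsupp.1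
      (span_mon_eq_top hp hptop ▸ Submodule.mem_top : x ∈ Submodule.span k (Set.range (mon p)))
    rw [Finsupp.sum, map_sum] at hx
    simp only [map_smul, hπm] at hx
    have hf : f = 0 := by
      ext a
      by_contra hne
      exact hne (linearIndependent_iff'.1 hli f.support f hx a (Finsupp.mem_support_iff.2 hne))
    simp [hf]
  have hsurj : Function.Surjective π := by
    intro x
    obtain ⟨f, rfl⟩ := Finsupp.mem_span_range_iff_exists_finsupp.1
      (htop ▸ Submodule.mem_top : x ∈ Submodule.span k (Set.range (mon u)))
    refine ⟨f.sum fun a c => c • mon p a, ?_⟩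
    rw [Finsupp.sum, map_sum]
    simp only [map_smul, hπm]
    rfl
  let e := AlgEquiv.ofBijective π ⟨hinj, hsurj⟩
  refine ⟨ρ.comp e.symm.toAlgHom, fun i => ?_⟩
  have : e.symm (u i) = p i := by rw [AlgEquiv.symm_apply_eq]; exact (hπ i).symm
  change ρ (e.symm (u i)) = w i
  rw [this, hρ]

end Universal

/-! ### The bar involution -/

/-- An anti-endomorphism, semilinear with respect to `β`, that multiplies the generator `u_i` by
`q^{e_i}`. -/
structure IsBarAnti {k R : Type*} [Field k] [Ring R] [Algebra k R] (β : k →+* k) (q : k)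
    (u : Fin 4 → R) (e : Fin 4 → ℤ) (s : R → R) : Prop where
  one : s 1 = 1
  add (x y : R) : s (x + y) = s x + s y
  mul (x y : R) : s (x * y) = s y * s x
  smul (c : k) (x : R) : s (c • x) = β c • s x
  gen (i : Fin 4) : s (u i) = q ^ e i • u i

/-- The opposite algebra, with scalars acting through the bar involution. -/
def TwistedOp (R : Type*) : Type _ := Rᵐᵒᵖ

instance (R : Type*) [Ring R] : Ring (TwistedOp R) := inferInstanceAs (Ring Rᵐᵒᵖ)

instance (R : Type*) [Ring R] [Algebra 𝕂 R] : Algebra 𝕂 (TwistedOp R) :=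
  RingHom.toAlgebra' (((algebraMap 𝕂 Rᵐᵒᵖ).comp bar : 𝕂 →+* Rᵐᵒᵖ) : 𝕂 →+* TwistedOp R)
    fun c x => Algebra.commutes (R := 𝕂) (A := Rᵐᵒᵖ) (bar c) x

/-- The identity map to the twisted opposite algebra. -/
def toTwisted {R : Type*} (x : R) : TwistedOp R := MulOpposite.op x

/-- The identity map from the twisted opposite algebra. -/
def ofTwisted {R : Type*} (x : TwistedOp R) : R := MulOpposite.unop x

section Twisted

variable {R : Type*} [Ring R] [Algebra 𝕂 R]

theorem ofTwisted_smul (c : 𝕂) (x : TwistedOp R) : ofTwisted (c • x) = bar c • ofTwisted x := by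
  have : c • x = algebraMap 𝕂 (TwistedOp R) c * x := Algebra.smul_def c x
  rw [this, Algebra.smul_def, Algebra.commutes]
  rfl

theorem ofTwisted_injective : Function.Injective (ofTwisted : TwistedOp R → R) :=
  MulOpposite.unop_injective

/-- These are the straightening relations with reversed products and q inverted. They are
homogeneous in the index, so the factors q^{2i} are harmless. -/
theorem Straightening.twisted_relations {k A : Type*} [Field k] [Ring A] [Algebra k A] {q : k}
    {u : Fin 4 → A} (h : Straightening q u) :
    let w : Fin 4 → A := fun i => q ^ (2 * (i : ℕ)) • u i
    w 0 * w 1 = (q ^ 2)⁻¹ • (w 1 * w 0) ∧ w 1 * w 2 = (q ^ 2)⁻¹ • (w 2 * w 1) ∧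
    w 2 * w 3 = (q ^ 2)⁻¹ • (w 3 * w 2) ∧
    w 0 * w 2 = (q ^ 2)⁻¹ • (w 2 * w 0) + ((q ^ 2)⁻¹ - 1) • (w 1 * w 1) ∧
    w 1 * w 3 = (q ^ 2)⁻¹ • (w 3 * w 1) + ((q ^ 2)⁻¹ - 1) • (w 2 * w 2) ∧
    w 0 * w 3 = (q ^ 2)⁻¹ • (w 3 * w 0) + ((q ^ 2)⁻¹ - q ^ 2) • (w 1 * w 2) := by
  have hq := h.q_ne
  intro w
  simp only [w, smul_mul_smul_comm, h.rel10, h.rel21, h.rel32, h.rel20, h.rel31, h.rel30]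
  refine ⟨?_, ?_, ?_, ?_, ?_, ?_⟩ <;> match_scalars <;> simp <;> field_simp <;> ring

theorem Straightening.twisted {u : Fin 4 → R} (h : Straightening q u) :
    Straightening q fun i : Fin 4 => (toTwisted (q ^ (2 * (i : ℕ)) • u i) : TwistedOp R) := by
  have hq := q_ne_zero
  have hb : bar (q ^ 2) = (q ^ 2)⁻¹ := by rw [map_pow, bar_q, inv_pow]
  have hm : ∀ x y : R, ofTwisted (toTwisted x * toTwisted y : TwistedOp R) = y * x := fun _ _ => rfl
  have ha : ∀ x y : TwistedOp R, ofTwisted (x + y) = ofTwisted x + ofTwisted y := fun _ _ => rfl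
  obtain ⟨e1, e2, e3, e4, e5, e6⟩ := h.twisted_relations
  refine ⟨hq, ?_, ?_, ?_, ?_, ?_, ?_⟩ <;> apply ofTwisted_injective <;>
    simp only [ha, ofTwisted_smul, hm, map_sub, map_inv₀, hb, map_one, inv_inv]
  exacts [e1, e2, e3, e4, e5, e6]

/-- The presentation yields a homomorphism to the twisted opposite algebra. Its square fixes the
generators, since the bar involution inverts the factors q^{2i}; it is therefore bijective. -/
theorem Straightening.exists_barAnti {u : Fin 4 → R} (h : Straightening q u)
    (hli : LinearIndependent 𝕂 (mon u)) (htop : Submodule.span 𝕂 (Set.range (mon u)) = ⊤) :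
    ∃ σ : R ≃+* Rᵐᵒᵖ, IsBarAnti bar q u (fun i => 2 * (i : ℕ)) fun x => (σ x).unop := by
  obtain ⟨φ, hφ⟩ := h.exists_algHom h.twisted hli htop
  have hadd : ∀ x y, ofTwisted (φ (x + y)) = ofTwisted (φ x) + ofTwisted (φ y) := fun x y => by
    rw [map_add]; rfl
  have hmul : ∀ x y, ofTwisted (φ (x * y)) = ofTwisted (φ y) * ofTwisted (φ x) := fun x y => by
    rw [map_mul]; rfl
  have hsmul : ∀ (c : 𝕂) x, ofTwisted (φ (c • x)) = bar c • ofTwisted (φ x) := fun c x => by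
    rw [map_smul, ofTwisted_smul]
  have hgen : ∀ i, ofTwisted (φ (u i)) = q ^ (2 * (i : ℕ)) • u i := fun i => by rw [hφ]; rfl
  have hpow : ∀ x n, ofTwisted (φ (x ^ n)) = ofTwisted (φ x) ^ n := fun x n => by
    rw [map_pow]; rfl
  have hinvgen : ∀ i, ofTwisted (φ (ofTwisted (φ (u i)))) = u i := by
    intro i
    rw [hgen, hsmul, hgen, map_pow, bar_q, smul_smul, ← mul_pow, inv_mul_cancel₀ q_ne_zero,
      one_pow, one_smul]
  have hinv : ∀ x, ofTwisted (φ (ofTwisted (φ x))) = x := by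
    intro x
    have hx : x ∈ Submodule.span 𝕂 (Set.range (mon u)) := htop ▸ Submodule.mem_top
    induction hx using Submodule.span_induction with
    | mem x hx =>
      obtain ⟨a, rfl⟩ := hx
      simp only [mon, hmul, hpow, hinvgen]
    | zero =>
      have : ofTwisted (φ 0) = (0 : R) := by rw [map_zero]; rfl
      rw [this, this]
    | add x y _ _ hx hy => rw [hadd, hadd, hx, hy]
    | smul c x _ hx => rw [hsmul, hsmul, bar_bar, hx]
  let σ : R ≃+* Rᵐᵒᵖ :=
    { toFun := fun x => φ x
      invFun := fun x => ofTwisted (φ x.unop)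
      left_inv := hinv
      right_inv := fun x => MulOpposite.unop_injective (hinv x.unop)
      map_mul' := fun x y => map_mul φ x y
      map_add' := fun x y => map_add φ x y }
  refine ⟨σ, congrArg MulOpposite.unop (map_one σ), hadd, hmul, hsmul, fun i => ?_⟩
  have : (σ (u i)).unop = q ^ (2 * (i : ℕ)) • u i := hgen i
  rw [this]
  norm_cast

end Twisted

/-! ### Eigenvectors of the bar anti-involution. -/

section Eigen

variable {k R : Type*} [Field k] [Ring R] [Algebra k R]

namespace Straightening

variable {q : k} {u : Fin 4 → R} (h : Straightening q u)
include h

/-- The same element with its products reversed and, up to a common power, q inverted: the form that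
an anti-involution inverting q produces from the definition. The companions below play the same role
in `sub_eigen`. -/
theorem y0_eq_swap : y0 q u = u 0 * u 2 - (q ^ 2)⁻¹ • (u 1 * u 1) := by
  have := h.q_ne
  rw [y0, h.swap02]
  match_scalars <;> field_simp <;> ring

theorem y1_eq_swap : y1 q u = u 1 * u 3 - (q ^ 2)⁻¹ • (u 2 * u 2) := by
  have := h.q_ne
  rw [y1, h.swap13]
  match_scalars <;> field_simp <;> ring

theorem zz_eq_swap : zz q u = u 0 * u 3 - (q ^ 2)⁻¹ • (u 1 * u 2) := by
  have := h.q_ne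
  rw [zz, h.swap03, h.swap12]
  match_scalars <;> field_simp <;> ring

theorem pos_two_eq_swap : pos q u 2 = q⁻¹ • (u 3 * zz q u) - q • (u 2 * y1 q u) := by
  have := h.q_ne
  rw [h.u2_y1, h.u3_zz]
  match_scalars <;> field_simp <;> ring

theorem pos_y1_y0 (n : ℕ) : pos q u (n + 1) * y1 q u * y0 q u =
    q ^ 10 • (y0 q u * (y1 q u * pos q u (n + 1))) := by
  have := h.pos_y0_y1 n 1
  rw [mul_one, mul_one] at this
  rw [mul_assoc, h.y1_y0, mul_smul_comm, this, smul_smul, ← pow_add]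

theorem pos_succ_eq_swap (n : ℕ) : pos q u (n + 3) = q⁻¹ • (pos q u (n + 2) * zz q u) -
    (q ^ 4)⁻¹ • (pos q u (n + 1) * y1 q u * y0 q u) := by
  have := h.q_ne
  rw [h.pos_y1_y0, h.pos_zz]
  match_scalars <;> field_simp <;> ring

end Straightening

namespace IsBarAnti

variable {β : k →+* k} {q : k} {u : Fin 4 → R} {e : Fin 4 → ℤ} {s : R → R}
  (hs : IsBarAnti β q u e s)
include hs

theorem zero : s 0 = 0 := by
  have := hs.add 0 0
  rw [add_zero] at this
  exact left_eq_add.1 this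

theorem sub (x y : R) : s (x - y) = s x - s y := by
  have := hs.add (x - y) y
  rw [sub_add_cancel] at this
  rw [this, add_sub_cancel_right]

theorem mul_eigen (hq : q ≠ 0) {x y x' y' : R} {m n : ℤ} (hx : s x = q ^ m • x')
    (hy : s y = q ^ n • y') : s (x * y) = q ^ (n + m) • (y' * x') := by
  rw [hs.mul, hx, hy, smul_mul_smul_comm, ← zpow_add₀ hq]

/-- A criterion for eigenvectors: z has two expansions, and s carries the terms of one to the terms
of the other up to powers of q. The conditions on exponents say that the two resulting factors
agree. -/
theorem sub_eigen (hq : q ≠ 0) (hβ : β q = q⁻¹) {x y x' y' z : R} (c d c' d' : ℤ) {m n l : ℤ}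
    (hx : s x = q ^ m • x') (hy : s y = q ^ n • y') (hz : z = q ^ c • x - q ^ d • y)
    (hz' : z = q ^ c' • x' - q ^ d' • y') (hc : m - l = c + c') (hd : n - l = d + d') :
    s z = q ^ l • z := by
  have e1 : q ^ m = q ^ l * (q ^ c * q ^ c') := by
    rw [← zpow_add₀ hq, ← zpow_add₀ hq]; congr 1; omega
  have e2 : q ^ n = q ^ l * (q ^ d * q ^ d') := by
    rw [← zpow_add₀ hq, ← zpow_add₀ hq]; congr 1; omega
  have hc0 := zpow_ne_zero c hq
  have hd0 := zpow_ne_zero d hq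
  nth_rw 1 [hz]
  rw [hs.sub, hs.smul, hs.smul, hx, hy, map_zpow₀, map_zpow₀, hβ, inv_zpow, inv_zpow, e1, e2, hz']
  match_scalars <;> field_simp

variable (h : Straightening q u) (hβ : β q = q⁻¹) (h02 : e 0 + e 2 = 2 * e 1)
  (h13 : e 1 + e 3 = 2 * e 2)
include h hβ

include h02 in
theorem eigen_y0 : s (y0 q u) = q ^ (2 * e 1 + 2) • y0 q u := by
  have hq := h.q_ne
  refine hs.sub_eigen hq hβ (-2) 0 0 (-2) (hs.mul_eigen hq (hs.gen 2) (hs.gen 0))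
    (hs.mul_eigen hq (hs.gen 1) (hs.gen 1)) ?_ ?_ (by omega) (by omega)
  · rw [y0, smul_sub, smul_smul, inv_mul_cancel₀ (pow_ne_zero 2 hq), zpow_neg, zpow_ofNat,
      zpow_zero]
  · rw [h.y0_eq_swap]; simp only [zpow_neg, zpow_ofNat, pow_zero, one_smul]

include h13 in
theorem eigen_y1 : s (y1 q u) = q ^ (2 * e 2 + 2) • y1 q u := by
  have hq := h.q_ne
  refine hs.sub_eigen hq hβ (-2) 0 0 (-2) (hs.mul_eigen hq (hs.gen 3) (hs.gen 1))
    (hs.mul_eigen hq (hs.gen 2) (hs.gen 2)) ?_ ?_ (by omega) (by omega)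
  · rw [y1, smul_sub, smul_smul, inv_mul_cancel₀ (pow_ne_zero 2 hq), zpow_neg, zpow_ofNat,
      zpow_zero]
  · rw [h.y1_eq_swap]; simp only [zpow_neg, zpow_ofNat, pow_zero, one_smul]

include h02 h13

theorem eigen_zz : s (zz q u) = q ^ (e 3 + e 0 + 2) • zz q u := by
  have hq := h.q_ne
  refine hs.sub_eigen hq hβ (-2) 0 0 (-2) (hs.mul_eigen hq (hs.gen 3) (hs.gen 0))
    (hs.mul_eigen hq (hs.gen 2) (hs.gen 1)) ?_ ?_ (by omega) (by omega)
  · rw [zz, smul_sub, smul_smul, inv_mul_cancel₀ (pow_ne_zero 2 hq), zpow_neg, zpow_ofNat,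
      zpow_zero]
  · rw [h.zz_eq_swap]; simp only [zpow_neg, zpow_ofNat, pow_zero, one_smul]

/-- The cluster variables are eigenvectors of the bar anti-involution. -/
theorem eigen_pos (n : ℕ) :
    s (pos q u (n + 1)) = q ^ (e 3 + n * (e 3 + e 0 + 2)) • pos q u (n + 1) := by
  have hq := h.q_ne
  induction n using Nat.strong_induction_on with
  | _ n ih =>
    match n with
    | 0 =>
      have := hs.gen 3
      simpa [pos] using this
    | 1 =>
      refine hs.sub_eigen hq hβ 1 (-1) (-1) 1
        (hs.mul_eigen hq (hs.eigen_zz h hβ h02 h13) (hs.gen 3))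
        (hs.mul_eigen hq (hs.eigen_y1 h hβ h13) (hs.gen 2)) ?_ ?_
        (by push_cast; omega) (by push_cast; omega)
      · rw [zpow_one, zpow_neg_one, h.pos_two]
      · rw [zpow_one, zpow_neg_one]; exact h.pos_two_eq_swap
    | m + 2 =>
      have i1 := ih (m + 1) (by omega)
      have i2 := ih m (by omega)
      refine hs.sub_eigen hq hβ 1 4 (-1) (-4)
        (hs.mul_eigen hq (hs.eigen_zz h hβ h02 h13) i1)
        (hs.mul_eigen hq (hs.eigen_y0 h hβ h02) (hs.mul_eigen hq (hs.eigen_y1 h hβ h13) i2)) ?_ ?_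
        (by push_cast; ring) (by push_cast; linear_combination -2 * (h02 + h13))
      · rw [zpow_one, zpow_ofNat]; exact h.pos_succ m
      · rw [zpow_neg_one, zpow_neg, zpow_ofNat]; exact h.pos_succ_eq_swap m

end IsBarAnti

end Eigen

/-! ### Chebyshev-type polynomials in the recursion element. -/

section Chebyshev

variable {k R : Type*} [Field k] [Ring R] [Algebra k R]

/-- The Chebyshev-type polynomials in the recursion element, shifted by one. -/
def cheb (q : k) (u : Fin 4 → R) : ℕ → R
  | 0 => 0
  | 1 => 1
  | n + 2 => zz q u * cheb q u (n + 1) - q ^ 2 • (y0 q u * (y1 q u * cheb q u n))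

namespace Straightening

variable {q : k} {u : Fin 4 → R} (h : Straightening q u)
include h

theorem cheb_succ (n : ℕ) : cheb q u (n + 2) =
    zz q u * cheb q u (n + 1) - q ^ 2 • (y0 q u * (y1 q u * cheb q u n)) := by rw [cheb]

/-- The polynomials commute with z because z commutes with Y₀Y₁, so z may be multiplied on either
side. -/
theorem cheb_succ_right (n : ℕ) : cheb q u (n + 2) =
    cheb q u (n + 1) * zz q u - q ^ 2 • (y0 q u * (y1 q u * cheb q u n)) := by
  have comm : ∀ n, cheb q u n * zz q u = zz q u * cheb q u n := by
    intro n
    induction n using Nat.strong_induction_on with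
    | _ n ih =>
      match n with
      | 0 => simp [cheb]
      | 1 => simp [cheb]
      | m + 2 =>
        rw [h.cheb_succ, sub_mul, smul_mul_assoc, mul_assoc, mul_assoc, mul_assoc,
          ih (m + 1) (by omega), ih m (by omega), mul_sub, mul_smul_comm, h.zz_y0_y1]
  rw [h.cheb_succ, comm]

/-- The cluster variables in terms of `u₃`, `Y₁u₂` and the Chebyshev polynomials. -/
theorem pos_eq_cheb (n : ℕ) : q ^ n • pos q u (n + 1) =
    u 3 * cheb q u (n + 1) - q ^ 2 • (y1 q u * (u 2 * cheb q u n)) := by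
  have hq := h.q_ne
  induction n using Nat.strong_induction_on with
  | _ n ih =>
    match n with
    | 0 => simp [cheb, pos]
    | 1 =>
      rw [h.cheb_succ]
      have e1 : pos q u 2 = q⁻¹ • (u 3 * zz q u) - q • (y1 q u * u 2) := by
        rw [h.pos_two_eq_swap, h.u2_y1, one_smul]
      simp only [Nat.reduceAdd, e1, cheb, mul_one, mul_zero, smul_zero, sub_zero]
      match_scalars <;> field_simp
    | m + 2 =>
      have i1 := ih (m + 1) (by omega)
      have i2 := ih m (by omega)
      have e0 : pos q u (m + 2 + 1) = q⁻¹ • (pos q u (m + 2) * zz q u) -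
          q ^ 6 • (y0 q u * (y1 q u * pos q u (m + 1))) := by
        rw [h.pos_zz]; match_scalars <;> field_simp <;> ring
      have e1 : q ^ (m + 2) • pos q u (m + 2 + 1) = (q ^ (m + 1) • pos q u (m + 2)) * zz q u -
          q ^ 8 • (y0 q u * (y1 q u * (q ^ m • pos q u (m + 1)))) := by
        rw [e0]
        simp only [smul_mul_assoc, mul_smul_comm]
        match_scalars <;> field_simp <;> ring
      have e3 := h.pos_y0_y1 0 (cheb q u (m + 1))
      simp only [pos] at e3
      have e2 : y1 q u * (u 2 * (y0 q u * (y1 q u * cheb q u m))) =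
          q ^ 6 • (y0 q u * (y1 q u * (y1 q u * (u 2 * cheb q u m)))) := by
        rw [← mul_assoc (u 2), h.u2_y0, smul_mul_assoc, mul_smul_comm, mul_assoc,
          ← mul_assoc (y1 q u), h.y1_y0, smul_mul_assoc, smul_smul, mul_assoc, ← mul_assoc (u 2),
          h.u2_y1, one_smul, mul_assoc, ← pow_add]
      rw [e1, i2, show m + 2 = m + 1 + 1 from rfl, i1, h.cheb_succ_right (m + 1),
        h.cheb_succ_right m]
      simp only [mul_sub, sub_mul, smul_mul_assoc, mul_smul_comm, mul_assoc, e2, e3]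
      match_scalars <;> field_simp

/-- The Chebyshev polynomials in terms of the cluster variables. -/
theorem cheb_eq_pos (n : ℕ) : q ^ (n + 3) • cheb q u (n + 3) =
    pos q u (n + 2) * u 0 - q ^ (2 * n + 5) • (y0 q u * (pos q u (n + 1) * u 1)) := by
  have hq := h.q_ne
  have hz : ∀ m, zz q u * pos q u (m + 2) = q⁻¹ • pos q u (m + 3) +
      q ^ 3 • (y0 q u * (y1 q u * pos q u (m + 1))) := by
    intro m
    rw [h.pos_succ]; match_scalars <;> field_simp <;> ring
  have hz1 : zz q u * u 3 = q⁻¹ • pos q u 2 + (q ^ 2)⁻¹ • (y1 q u * u 2) := by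
    rw [h.pos_two]; match_scalars <;> field_simp <;> ring
  have hzy : ∀ x, zz q u * (y0 q u * x) = q ^ 2 • (y0 q u * (zz q u * x)) := by
    intro x; rw [← mul_assoc, h.zz_y0, smul_mul_assoc, mul_assoc]
  have hyy : ∀ x, y1 q u * (y0 q u * x) = q ^ 4 • (y0 q u * (y1 q u * x)) := by
    intro x; rw [← mul_assoc, h.y1_y0, smul_mul_assoc, mul_assoc]
  have hzz : zz q u = (q ^ 2)⁻¹ • (u 3 * u 0) - u 2 * u 1 := by
    rw [zz]; match_scalars <;> field_simp
  -- Obtained from z² - q²Y₀Y₁ by expanding one factor z through u₃u₀ and u₂u₁ and applying the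
  -- recursion to zu₃ and zu₂.
  have base : q ^ 3 • cheb q u 3 = pos q u 2 * u 0 - q ^ 5 • (y0 q u * (u 3 * u 1)) := by
    have e0 : cheb q u 3 = zz q u * zz q u - q ^ 2 • (y0 q u * y1 q u) := by
      rw [h.cheb_succ 1, h.cheb_succ 0]; simp [cheb]
    have e1 : zz q u * zz q u = (q ^ 2)⁻¹ • (zz q u * u 3 * u 0) - zz q u * u 2 * u 1 := by
      nth_rw 2 [hzz]; rw [mul_sub, mul_smul_comm, mul_assoc, mul_assoc]
    have e2 : y1 q u * (u 2 * u 0) = q ^ 6 • (y0 q u * y1 q u) + q ^ 2 • (y1 q u * (u 1 * u 1)) := by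
      have : u 2 * u 0 = q ^ 2 • y0 q u + q ^ 2 • (u 1 * u 1) := by
        rw [y0]; match_scalars <;> field_simp <;> ring
      rw [this, mul_add, mul_smul_comm, mul_smul_comm, h.y1_y0, smul_smul, ← pow_add]
    rw [e0, e1, h.zz_u2, hz1]
    simp only [add_mul, smul_mul_assoc, mul_assoc, e2]
    match_scalars <;> field_simp <;> ring
  induction n using Nat.strong_induction_on with
  | _ n ih =>
    match n with
    | 0 => simpa [pos] using base
    | 1 =>
      have e1 : q ^ 4 • cheb q u 4 = q • (zz q u * (q ^ 3 • cheb q u 3)) -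
          q ^ 6 • (y0 q u * (y1 q u * zz q u)) := by
        rw [h.cheb_succ 2, h.cheb_succ 0]
        simp only [cheb, mul_one, mul_zero, smul_zero, sub_zero, mul_smul_comm]
        match_scalars <;> ring
      simp only [Nat.reduceAdd, Nat.reduceMul]
      have e2 : y0 q u * (y1 q u * zz q u) = (q ^ 2)⁻¹ • (y0 q u * (y1 q u * (u 3 * u 0))) -
          y0 q u * (y1 q u * (u 2 * u 1)) := by
        rw [hzz, mul_sub, mul_sub, mul_smul_comm, mul_smul_comm]
      have e3 := congrArg (· * u 0) (hz 0)
      have e4 := congrArg (· * u 1) hz1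
      simp only [add_mul, smul_mul_assoc, mul_assoc, zero_add, show pos q u 1 = u 3 from rfl]
        at e3 e4
      rw [e1, base, e2]
      simp only [mul_sub, mul_smul_comm, hzy, e3, e4, mul_add]
      match_scalars <;> field_simp <;> ring
    | m + 2 =>
      have i1 := ih (m + 1) (by omega)
      have i2 := ih m (by omega)
      have e1 : q ^ (m + 2 + 3) • cheb q u (m + 2 + 3) =
          q • (zz q u * (q ^ (m + 1 + 3) • cheb q u (m + 1 + 3))) -
          q ^ 4 • (y0 q u * (y1 q u * (q ^ (m + 3) • cheb q u (m + 3)))) := by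
        rw [show m + 2 + 3 = m + 3 + 2 from rfl, h.cheb_succ (m + 3)]
        simp only [mul_smul_comm, show m + 3 + 1 = m + 1 + 3 from rfl]
        match_scalars <;> ring
      have e2 := congrArg (· * u 0) (hz (m + 1))
      have e3 := congrArg (· * u 1) (hz m)
      simp only [add_mul, smul_mul_assoc, mul_assoc, add_assoc, Nat.reduceAdd] at e2 e3
      rw [e1, i1, i2]
      simp only [mul_sub, mul_smul_comm, hzy, add_assoc, Nat.reduceAdd, e2, e3, mul_add, hyy]
      match_scalars <;> field_simp <;> ring

end Straightening

end Chebyshev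

/-! ### Unitriangularity of the rescaled cluster variables over qℤ[q]. -/

section Lattice

variable {k R : Type*} [Field k] [Ring R] [Algebra k R]

/-- The dual PBW element. -/
def dualMon (q : k) (u : Fin 4 → R) (a : Fin 4 → ℕ) : R := q ^ (∑ i, (a i).choose 2) • mon u a

/-- The `q^n ℤ[q]`-span of the dual PBW elements strictly below `a`. -/
def dualLattice (q : k) (u : Fin 4 → R) (n : ℕ) (a : Fin 4 → ℕ) : AddSubgroup R :=
  AddSubgroup.closure {y : R | ∃ b : Fin 4 → ℕ, Below a b ∧ b ≠ a ∧
    ∃ m : ℕ, n ≤ m ∧ y = q ^ m • dualMon q u b}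

theorem dualMon_mem_dualLattice (q : k) (u : Fin 4 → R) {a b : Fin 4 → ℕ} (hb : Below a b)
    (hne : b ≠ a) {n m : ℕ} (h : n ≤ m) : q ^ m • dualMon q u b ∈ dualLattice q u n a :=
  AddSubgroup.subset_closure ⟨b, hb, hne, m, h, rfl⟩

theorem smul_mem_dualLattice {q : k} {u : Fin 4 → R} {a : Fin 4 → ℕ} {n m l : ℕ} {x : R}
    (hx : x ∈ dualLattice q u n a) (hl : l ≤ m + n) : q ^ m • x ∈ dualLattice q u l a := by
  induction hx using AddSubgroup.closure_induction with
  | mem x hx =>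
    obtain ⟨b, hb, hne, j, hj, rfl⟩ := hx
    rw [smul_smul, ← pow_add]
    exact dualMon_mem_dualLattice q u hb hne (by omega)
  | zero => rw [smul_zero]; exact zero_mem _
  | add x y _ _ hx hy => rw [smul_add]; exact add_mem hx hy
  | neg x _ hx => rw [smul_neg]; exact neg_mem hx

theorem map_mem_dualLattice {q : k} {u : Fin 4 → R} {a a' : Fin 4 → ℕ} (φ : R →ₗ[k] R)
    (hφ : ∀ b, Below a b → b ≠ a → φ (dualMon q u b) ∈ dualLattice q u 0 a') {x : R}
    (hx : x ∈ dualLattice q u 1 a) : φ x ∈ dualLattice q u 1 a' := by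
  induction hx using AddSubgroup.closure_induction with
  | mem x hx =>
    obtain ⟨b, hb, hne, j, hj, rfl⟩ := hx
    rw [map_smul]
    exact smul_mem_dualLattice (hφ b hb hne) (by omega)
  | zero => rw [map_zero]; exact zero_mem _
  | add x y _ _ hx hy => rw [map_add]; exact add_mem hx hy
  | neg x _ hx => rw [map_neg]; exact neg_mem hx

/-- For the main term of a recursion: φ carries the leading dual PBW element to the new one and does
not introduce negative powers of q elsewhere. -/
theorem map_sub_mem_dualLattice {q : k} {u : Fin 4 → R} {a a' : Fin 4 → ℕ} (φ : R →ₗ[k] R)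
    (hφ : ∀ b, Below a b → b ≠ a → φ (dualMon q u b) ∈ dualLattice q u 0 a')
    (ha : φ (dualMon q u a) = dualMon q u a') {x : R}
    (hx : x - dualMon q u a ∈ dualLattice q u 1 a) : φ x - dualMon q u a' ∈ dualLattice q u 1 a' := by
  rw [← ha, ← map_sub]
  exact map_mem_dualLattice φ hφ hx

theorem dualLattice_anti {q : k} {u : Fin 4 → R} {a : Fin 4 → ℕ} {n m : ℕ} (h : m ≤ n) :
    dualLattice q u n a ≤ dualLattice q u m a := by
  refine AddSubgroup.closure_mono ?_
  rintro _ ⟨b, hb, hne, j, hj, rfl⟩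
  exact ⟨b, hb, hne, j, h.trans hj, rfl⟩

/-- For the correction term of a recursion: φ sends everything, including the leading element, into
the lattice with coefficients in qℤ[q]. -/
theorem map_mem_dualLattice' {q : k} {u : Fin 4 → R} {a a' : Fin 4 → ℕ} (φ : R →ₗ[k] R)
    (hφ : ∀ b, Below a b → φ (dualMon q u b) ∈ dualLattice q u 1 a') {x : R}
    (hx : x - dualMon q u a ∈ dualLattice q u 1 a) : φ x ∈ dualLattice q u 1 a' := by
  have h1 := map_mem_dualLattice φ (fun b hb _ => dualLattice_anti zero_le_one (hφ b hb)) hx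
  have h2 := add_mem h1 (hφ a (Below.refl a))
  rwa [map_sub, sub_add_cancel] at h2

theorem dualMon_vec (q : k) (u : Fin 4 → R) (a b c d : ℕ) : dualMon q u (vec a b c d) =
    q ^ (a.choose 2 + b.choose 2 + c.choose 2 + d.choose 2) •
      (u 3 ^ a * (u 2 ^ b * (u 1 ^ c * u 0 ^ d))) := by
  rw [dualMon, mon_vec, Fin.sum_univ_four, mul_assoc, mul_assoc]
  congr 2
  simp only [vec, Matrix.cons_val]
  ring

theorem choose_two_succ (n : ℕ) : (n + 1).choose 2 = n.choose 2 + n := by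
  rw [Nat.choose_succ_succ' n 1, Nat.choose_one_right, add_comm]

theorem choose_two_add_three (n : ℕ) : (n + 3).choose 2 = n.choose 2 + 3 * n + 3 := by
  rw [choose_two_succ, choose_two_succ, choose_two_succ]; ring

namespace Straightening

variable {q : k} {u : Fin 4 → R} (h : Straightening q u)

theorem u3_mul_dualMon (a b c d : ℕ) :
    q ^ a • (u 3 * dualMon q u (vec a b c d)) = dualMon q u (vec (a + 1) b c d) := by
  rw [dualMon_vec, dualMon_vec, choose_two_succ, pow_succ', mul_smul_comm, mul_assoc (u 3)]
  match_scalars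
  ring

theorem dualMon_mul_u0 (a b c d : ℕ) :
    q ^ d • (dualMon q u (vec a b c d) * u 0) = dualMon q u (vec a b c (d + 1)) := by
  rw [dualMon_vec, dualMon_vec, choose_two_succ, pow_succ (u 0), smul_mul_assoc]
  simp only [mul_assoc]
  match_scalars
  ring

include h

/-- The correction operator of `pos_eq_cheb` takes a dual PBW element to a combination of only two,
and the power of q on the left is the one that makes the first coefficient equal to 1. -/
theorem y1_u2_mul_dualMon (a b c d : ℕ) :
    q ^ (5 * a + 3 * b + c + 4) • (y1 q u * (u 2 * dualMon q u (vec a b c d))) =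
      dualMon q u (vec (a + 1) (b + 1) (c + 1) d) -
        q ^ (a + c + 1) • dualMon q u (vec a (b + 3) c d) := by
  have hq := h.q_ne
  have f1 : ∀ x, y1 q u * (u 2 * (u 3 ^ a * x)) =
      (q ^ (4 * a))⁻¹ • (u 3 ^ a * (y1 q u * (u 2 * x))) := by
    intro x
    have e : u 3 * (y1 q u * u 2) = q ^ 4 • (y1 q u * u 2 * u 3) := by
      rw [← mul_assoc, h.u3_y1, smul_mul_assoc, mul_assoc, h.rel32, mul_smul_comm, smul_smul,
        ← pow_add, mul_assoc]
    have e2 := pow_mul_of_mul_eq_smul e a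
    rw [show u 3 ^ a * (y1 q u * (u 2 * x)) = u 3 ^ a * (y1 q u * u 2) * x by
      simp only [mul_assoc], e2, ← pow_mul, smul_mul_assoc, smul_smul,
      inv_mul_cancel₀ (pow_ne_zero _ hq), one_smul]
    simp only [mul_assoc]
  have f2 : ∀ x, y1 q u * (u 2 * x) = (q ^ 4)⁻¹ • (u 3 * (u 2 * (u 1 * x))) -
      u 2 * (u 2 * (u 2 * x)) := by
    intro x
    rw [y1, smul_mul_assoc, sub_mul, smul_mul_assoc]
    simp only [mul_assoc, h.swap12_assoc, mul_smul_comm]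
    match_scalars <;> field_simp
  have f3 : ∀ x, u 1 * (u 2 ^ b * x) = (q ^ (2 * b))⁻¹ • (u 2 ^ b * (u 1 * x)) := by
    intro x
    have e2 := pow_mul_of_mul_eq_smul h.rel21 b
    rw [← mul_assoc (u 2 ^ b), e2, ← pow_mul, smul_mul_assoc, smul_smul,
      inv_mul_cancel₀ (pow_ne_zero _ hq), one_smul, mul_assoc]
  have g2 : u 2 ^ (b + 3) = u 2 * (u 2 * (u 2 * u 2 ^ b)) := by
    simp only [pow_succ']
  rw [dualMon_vec, dualMon_vec, dualMon_vec, choose_two_add_three, choose_two_succ, choose_two_succ,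
    choose_two_succ, g2, pow_succ (u 3), pow_succ' (u 2), pow_succ' (u 1)]
  simp only [mul_smul_comm, mul_assoc, f1]
  rw [f2]
  simp only [f3, mul_smul_comm, mul_sub]
  match_scalars <;> field_simp <;> ring

theorem dualMon_mul_y0_u1 (a b c d : ℕ) :
    q ^ (5 * d + 3 * c + b + 4) • (dualMon q u (vec a b c d) * y0 q u * u 1) =
      dualMon q u (vec a (b + 1) (c + 1) (d + 1)) -
        q ^ (b + d + 1) • dualMon q u (vec a b (c + 3) d) := by
  have hq := h.q_ne
  have f1 : u 0 ^ d * (y0 q u * u 1) = (q ^ (4 * d))⁻¹ • (y0 q u * u 1 * u 0 ^ d) := by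
    have e : u 0 * (y0 q u * u 1) = (q ^ 4)⁻¹ • (y0 q u * u 1 * u 0) := by
      rw [← mul_assoc, h.u0_y0, smul_mul_assoc, mul_assoc, h.swap01, mul_smul_comm, smul_smul,
        mul_assoc]
      congr 1; field_simp
    rw [pow_mul_of_mul_eq_smul e d, inv_pow, ← pow_mul]
  have f2 : y0 q u * u 1 = (q ^ 4)⁻¹ • (u 2 * (u 1 * u 0)) - u 1 * (u 1 * u 1) := by
    rw [y0, smul_mul_assoc, sub_mul, smul_mul_assoc]
    simp only [mul_assoc, h.swap01, mul_smul_comm]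
    match_scalars <;> field_simp
  have f3 : ∀ x, u 1 ^ c * (u 2 * x) = (q ^ (2 * c))⁻¹ • (u 2 * (u 1 ^ c * x)) := by
    intro x
    rw [← mul_assoc, pow_mul_of_mul_eq_smul h.swap12 c, inv_pow, ← pow_mul, smul_mul_assoc,
      mul_assoc]
  have g1 : ∀ x, u 1 ^ (c + 3) * x = u 1 ^ c * (u 1 * (u 1 * (u 1 * x))) := by
    intro x; simp only [pow_succ, mul_assoc]
  rw [dualMon_vec, dualMon_vec, dualMon_vec, choose_two_add_three, choose_two_succ, choose_two_succ,
    choose_two_succ, g1, pow_succ (u 2), pow_succ (u 1), pow_succ' (u 0)]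
  simp only [smul_mul_assoc, mul_assoc]
  rw [f1, f2]
  simp only [sub_mul, smul_mul_assoc, mul_assoc, f3, mul_smul_comm, mul_sub]
  match_scalars <;> field_simp <;> ring

/-- A joint induction: `pos_eq_cheb` expresses the next cluster variable by two Chebyshev
polynomials, and `cheb_eq_pos` the next Chebyshev polynomial by two cluster variables. In each
formula one term carries the leading element, and the other contributes coefficients in qℤ[q] only.
-/
theorem pos_sub_mem_aux (K : ℕ) :
    (q ^ (2 * (K * (K + 1))) • pos q u (K + 1) - dualMon q u (vec (K + 1) 0 0 K) ∈
      dualLattice q u 1 (vec (K + 1) 0 0 K)) ∧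
    (q ^ (2 * K ^ 2) • cheb q u (K + 1) - dualMon q u (vec K 0 0 K) ∈
      dualLattice q u 1 (vec K 0 0 K)) ∧
    (q ^ (2 * (K + 1) ^ 2) • cheb q u (K + 2) - dualMon q u (vec (K + 1) 0 0 (K + 1)) ∈
      dualLattice q u 1 (vec (K + 1) 0 0 (K + 1))) := by
  have hq := h.q_ne
  have below_iff : ∀ {a d : ℕ} {b : Fin 4 → ℕ}, Below (vec a 0 0 d) b → ∃ s r b3 b2 b1 b0 : ℕ,
      b = vec b3 b2 b1 b0 ∧ b3 + s = a ∧ b2 + r = 2 * s ∧ b1 + s = 2 * r ∧ b0 + r = d := by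
    intro a d b hb
    rw [← vec_eta b, below_vec] at hb
    obtain ⟨s, r, h3, h2, h1, h0⟩ := hb
    exact ⟨s, r, b 3, b 2, b 1, b 0, (vec_eta b).symm, by omega, by omega, by omega, by omega⟩
  induction K with
  | zero =>
    refine ⟨?_, ?_, ?_⟩
    · have : dualMon q u (vec 1 0 0 0) = u 3 := by simp [dualMon_vec]
      simp only [zero_add, zero_mul, mul_zero, pow_zero, one_smul, this, pos, sub_self]
      exact zero_mem _
    · have : dualMon q u (vec 0 0 0 0) = 1 := by simp [dualMon_vec]
      simp [this, cheb]
    · have e1 : q ^ 2 • zz q u - dualMon q u (vec 1 0 0 1) =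
          -(q ^ 2 • dualMon q u (vec 0 1 1 0)) := by
        simp only [dualMon_vec, zz]
        simp only [pow_one, pow_zero, Nat.choose_succ_self, Nat.choose_zero_succ, add_zero, one_mul,
          mul_one]
        match_scalars <;> field_simp <;> ring
      simp only [zero_add, cheb, mul_one, mul_zero, smul_zero, sub_zero, one_pow, e1]
      exact neg_mem (dualMon_mem_dualLattice q u (below_vec.2 ⟨1, 1, by norm_num⟩)
        (by rw [ne_eq, vec_inj]; omega) (by norm_num))
  | succ K ih =>
    obtain ⟨iB, iT, iT'⟩ := ih
    have hB : q ^ (2 * ((K + 1) * (K + 1 + 1))) • pos q u (K + 1 + 1) =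
        q ^ (K + 1) • (u 3 * (q ^ (2 * (K + 1) ^ 2) • cheb q u (K + 2))) -
          q ^ (5 * (K + 1)) • (y1 q u * (u 2 * (q ^ (2 * K ^ 2) • cheb q u (K + 1)))) := by
      have e : pos q u (K + 1 + 1) = (q ^ (K + 1))⁻¹ • (u 3 * cheb q u (K + 2) -
          q ^ 2 • (y1 q u * (u 2 * cheb q u (K + 1)))) := by
        rw [← h.pos_eq_cheb (K + 1), smul_smul, inv_mul_cancel₀ (pow_ne_zero _ hq), one_smul]
      rw [e]
      simp only [mul_smul_comm]
      match_scalars <;> field_simp <;> ring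
    have sB : q ^ (2 * ((K + 1) * (K + 1 + 1))) • pos q u (K + 1 + 1) -
        dualMon q u (vec (K + 1 + 1) 0 0 (K + 1)) ∈
          dualLattice q u 1 (vec (K + 1 + 1) 0 0 (K + 1)) := by
      have m1 := map_sub_mem_dualLattice (a' := vec (K + 1 + 1) 0 0 (K + 1))
        (q ^ (K + 1) • LinearMap.mulLeft k (u 3)) (fun b hb hne => by
          obtain ⟨s, r, b3, b2, b1, b0, rfl, h3, h2, h1, h0⟩ := below_iff hb
          rw [LinearMap.smul_apply, LinearMap.mulLeft_apply, ← h3, add_comm b3, pow_add, mul_smul,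
            u3_mul_dualMon]
          refine dualMon_mem_dualLattice q u (below_vec.2 ⟨s, r, ?_, ?_, ?_, ?_⟩) ?_ (Nat.zero_le _)
          any_goals push_cast; omega
          rw [ne_eq, vec_inj] at hne ⊢
          omega) (u3_mul_dualMon _ _ _ _) iT'
      have m2 := map_mem_dualLattice' (a' := vec (K + 1 + 1) 0 0 (K + 1))
        (q ^ (5 * (K + 1)) • (LinearMap.mulLeft k (y1 q u) ∘ₗ LinearMap.mulLeft k (u 2)))
        (fun b hb => by
          obtain ⟨s, r, b3, b2, b1, b0, rfl, h3, h2, h1, h0⟩ := below_iff hb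
          rw [LinearMap.smul_apply, LinearMap.comp_apply, LinearMap.mulLeft_apply,
            LinearMap.mulLeft_apply,
            -- For b below (K,0,0,K), reached with multiplicities s and r, one has 5b₃ + 3b₂ + b₁ =
            -- 5K - r. The exponent thus leaves q^{r+1} to spare, which puts the correction in
            -- qℤ[q].
            show 5 * (K + 1) = (r + 1) + (5 * b3 + 3 * b2 + b1 + 4) by omega, pow_add, mul_smul,
            h.y1_u2_mul_dualMon, smul_sub, smul_smul, ← pow_add]
          refine sub_mem (dualMon_mem_dualLattice q u
              (below_vec.2 ⟨s + 1, r + 1, ?_, ?_, ?_, ?_⟩) ?_ (by omega))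
            (dualMon_mem_dualLattice q u (below_vec.2 ⟨s + 2, r + 1, ?_, ?_, ?_, ?_⟩) ?_ (by omega))
          all_goals first | (push_cast; omega) | (rw [ne_eq, vec_inj]; omega)) iT
      rw [hB, sub_right_comm]
      exact sub_mem m1 m2
    refine ⟨sB, iT', ?_⟩
    have hT : q ^ (2 * (K + 1 + 1) ^ 2) • cheb q u (K + 1 + 2) =
        q ^ (K + 1) • (q ^ (2 * ((K + 1) * (K + 1 + 1))) • pos q u (K + 1 + 1) * u 0) -
          q ^ (5 * K + 6) • ((q ^ (2 * (K * (K + 1))) • pos q u (K + 1)) * y0 q u * u 1) := by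
      have e : cheb q u (K + 1 + 2) = (q ^ (K + 3))⁻¹ • (pos q u (K + 2) * u 0 -
          q ^ (2 * K + 5) • (y0 q u * (pos q u (K + 1) * u 1))) := by
        rw [← h.cheb_eq_pos K, smul_smul, inv_mul_cancel₀ (pow_ne_zero _ hq), one_smul]
      rw [e]
      simp only [smul_mul_assoc, h.pos_y0, mul_assoc]
      match_scalars <;> field_simp <;> ring
    have m1 := map_sub_mem_dualLattice (a' := vec (K + 1 + 1) 0 0 (K + 1 + 1))
      (q ^ (K + 1) • LinearMap.mulRight k (u 0)) (fun b hb hne => by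
        obtain ⟨s, r, b3, b2, b1, b0, rfl, h3, h2, h1, h0⟩ := below_iff hb
        rw [LinearMap.smul_apply, LinearMap.mulRight_apply, ← h0, add_comm b0, pow_add, mul_smul,
          dualMon_mul_u0]
        refine dualMon_mem_dualLattice q u (below_vec.2 ⟨s, r, ?_, ?_, ?_, ?_⟩) ?_ (Nat.zero_le _)
        any_goals push_cast; omega
        rw [ne_eq, vec_inj] at hne ⊢
        omega) (dualMon_mul_u0 _ _ _ _) sB
    have m2 := map_mem_dualLattice' (a' := vec (K + 1 + 1) 0 0 (K + 1 + 1))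
      (q ^ (5 * K + 6) • (LinearMap.mulRight k (u 1) ∘ₗ LinearMap.mulRight k (y0 q u)))
      (fun b hb => by
        obtain ⟨s, r, b3, b2, b1, b0, rfl, h3, h2, h1, h0⟩ := below_iff hb
        rw [LinearMap.smul_apply, LinearMap.comp_apply, LinearMap.mulRight_apply,
          LinearMap.mulRight_apply,
          -- The mirror count below (K+1,0,0,K): here 5b₀ + 3b₁ + b₂ = 5K - s, so q^{s+2} is left
          -- over.
          show 5 * K + 6 = (s + 2) + (5 * b0 + 3 * b1 + b2 + 4) by omega, pow_add, mul_smul,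
          h.dualMon_mul_y0_u1, smul_sub, smul_smul, ← pow_add]
        refine sub_mem (dualMon_mem_dualLattice q u
            (below_vec.2 ⟨s + 1, r + 1, ?_, ?_, ?_, ?_⟩) ?_ (by omega))
          (dualMon_mem_dualLattice q u (below_vec.2 ⟨s + 1, r + 2, ?_, ?_, ?_, ?_⟩) ?_ (by omega))
        all_goals first | (push_cast; omega) | (rw [ne_eq, vec_inj]; omega)) iB
    rw [hT, sub_right_comm]
    exact sub_mem m1 m2

/-- The rescaled cluster variables have the triangularity property of dual canonical basis
elements. -/
theorem pos_sub_mem_dualLattice (K : ℕ) :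
    q ^ (2 * (K * (K + 1))) • pos q u (K + 1) - dualMon q u (vec (K + 1) 0 0 K) ∈
      dualLattice q u 1 (vec (K + 1) 0 0 K) := (h.pos_sub_mem_aux K).1

end Straightening

end Lattice

theorem algebraMap_polynomial_X : algebraMap (Polynomial ℚ) 𝕂 Polynomial.X = v :=
  RatFunc.algebraMap_X

/-- An element of vℚ[v] fixed by v ↦ v⁻¹ also lies in v⁻¹ℚ[v⁻¹]. In terms of degrees, invariance
makes the reversed polynomial equal to vⁿp with n = deg p ≥ 1, which exceeds the degree available to
it. -/
theorem algebraMap_eq_zero_of_bar {f : Polynomial ℚ}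
    (h : bar (algebraMap (Polynomial ℚ) 𝕂 (Polynomial.X * f)) =
      algebraMap (Polynomial ℚ) 𝕂 (Polynomial.X * f)) : f = 0 := by
  by_contra hf
  set p := Polynomial.X * f with hp
  have hp0 : p ≠ 0 := mul_ne_zero Polynomial.X_ne_zero hf
  have hdeg : 1 ≤ p.natDegree := by
    rw [hp, Polynomial.natDegree_X_mul hf]; omega
  rw [bar_algebraMap] at h
  letI : Invertible (v⁻¹ : 𝕂) := invertibleOfNonzero (inv_ne_zero v_ne_zero)
  have h2 := Polynomial.eval₂_reverse_mul_pow (algebraMap ℚ 𝕂) v⁻¹ p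
  rw [invOf_eq_inv, inv_inv, h] at h2
  have h3 : ∀ g : Polynomial ℚ, g.eval₂ (algebraMap ℚ 𝕂) v = algebraMap (Polynomial ℚ) 𝕂 g := by
    intro g
    rw [← algebraMap_polynomial_X, ← Polynomial.aeval_def, Polynomial.aeval_algebraMap_apply]
    simp
  have h4 : p.reverse = Polynomial.X ^ p.natDegree * p := by
    rw [h3, inv_pow] at h2
    apply RatFunc.algebraMap_injective ℚ
    rw [map_mul, map_pow, algebraMap_polynomial_X, ← h2, mul_comm,
      inv_mul_cancel_right₀ (pow_ne_zero _ v_ne_zero)]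
  have h5 := Polynomial.reverse_natDegree_le p
  rw [h4, Polynomial.natDegree_mul (pow_ne_zero _ Polynomial.X_ne_zero) hp0,
    Polynomial.natDegree_X_pow] at h5
  omega

theorem Straightening.reversed_mon_lex {k R : Type*} [Field k] [Ring R] [Algebra k R] {q : k}
    {u : Fin 4 → R} (h : Straightening q u) (a : Fin 4 → ℕ) :
    u 0 ^ a 0 * u 1 ^ a 1 * u 2 ^ a 2 * u 3 ^ a 3 -
      ((q ^ 2)⁻¹) ^ (a 1 * a 0 + a 2 * (a 0 + a 1) + a 3 * (a 0 + a 1 + a 2)) • mon u a ∈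
        lexSpan k u a :=
  lowerSpan_subset_lexSpan (h.reversed_mon (S := (⊤ : Subalgebra k k)) trivial a)

/-! ### Uniqueness of dual canonical basis elements. -/

section Uniqueness

variable {R : Type*} [Ring R] [Algebra 𝕂 R] {u : Fin 4 → R}

theorem IsBarAnti.ext {e : Fin 4 → ℤ} {s s' : R → R} (hs : IsBarAnti bar q u e s)
    (hs' : IsBarAnti bar q u e s') (htop : Submodule.span 𝕂 (Set.range (mon u)) = ⊤) : s = s' := by
  have hpow : ∀ {s : R → R}, IsBarAnti bar q u e s → ∀ x n, s (x ^ n) = s x ^ n := by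
    intro s hs x n
    induction n with
    | zero => rw [pow_zero, pow_zero, hs.one]
    | succ n ih => rw [pow_succ, hs.mul, ih, pow_succ']
  funext x
  have hx : x ∈ Submodule.span 𝕂 (Set.range (mon u)) := htop ▸ Submodule.mem_top
  induction hx using Submodule.span_induction with
  | mem x hx =>
    obtain ⟨a, rfl⟩ := hx
    simp only [mon, hs.mul, hs'.mul, hpow hs, hpow hs', hs.gen, hs'.gen]
  | zero => rw [hs.zero, hs'.zero]
  | add x y _ _ hx hy => rw [hs.add, hs'.add, hx, hy]
  | smul c x _ hx => rw [hs.smul, hs'.smul, hx]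

/-- The exponent of the leading coefficient of the bar anti-involution on a monomial. -/
def barExp (a : Fin 4 → ℕ) : ℤ :=
  2 * a 1 + 4 * a 2 + 6 * a 3 - 2 * (a 1 * a 0 + a 2 * (a 0 + a 1) + a 3 * (a 0 + a 1 + a 2))

theorem two_mul_choose_two (n : ℕ) : 2 * (n.choose 2 : ℤ) = n * (n - 1) := by
  induction n with
  | zero => simp
  | succ n ih => rw [choose_two_succ]; push_cast; linear_combination ih

/-- Since σ inverts the normalizing power of q in E[a], this says that the leading coefficient of σ
on E[a] is q^{-N(a)}, the eigenvalue prescribed for B[a]. -/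
theorem barExp_eq (a : Fin 4 → ℕ) :
    barExp a = -normN a + 2 * ((∑ i, (a i).choose 2 : ℕ) : ℤ) := by
  rw [Fin.sum_univ_four, barExp, normN]
  push_cast
  linear_combination -two_mul_choose_two (a 0) - two_mul_choose_two (a 1) -
    two_mul_choose_two (a 2) - two_mul_choose_two (a 3)

/-- Both generating vectors of the order preserve the total degree and the weight 7a₃ + 5a₂ + 3a₁ +
a₀. -/
theorem Below.normN_eq {a b : Fin 4 → ℕ} (h : Below a b) : normN b = normN a := by
  obtain ⟨s, r, h3, h2, h1, h0⟩ := h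
  rw [normN, normN, h3, h2, h1, h0]
  ring

theorem bar_mon {s : R → R} (hs : IsBarAnti bar q u (fun i => 2 * (i : ℕ)) s)
    (h : Straightening q u) (a : Fin 4 → ℕ) :
    s (mon u a) - q ^ barExp a • mon u a ∈ lexSpan 𝕂 u a := by
  have hq := q_ne_zero
  have hpow : ∀ (i : Fin 4) (n : ℕ), s (u i ^ n) = q ^ (2 * ((i : ℕ) : ℤ) * n) • u i ^ n := by
    intro i n
    induction n with
    | zero => simp [hs.one]
    | succ n ih =>
      rw [pow_succ, hs.mul, ih, hs.gen, smul_mul_smul_comm, ← zpow_add₀ hq, ← pow_succ', pow_succ]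
      congr 2
      push_cast; ring
  have e : s (mon u a) = q ^ (2 * (a 1 : ℤ) + 4 * a 2 + 6 * a 3) •
      (u 0 ^ a 0 * u 1 ^ a 1 * u 2 ^ a 2 * u 3 ^ a 3) := by
    rw [mon, hs.mul, hs.mul, hs.mul, hpow, hpow, hpow, hpow, smul_mul_smul_comm, smul_mul_smul_comm,
      smul_mul_smul_comm, ← zpow_add₀ hq, ← zpow_add₀ hq, ← zpow_add₀ hq]
    simp only [mul_assoc]
    congr 2
    simp
    ring
  have h1 := Submodule.smul_mem _ (q ^ (2 * (a 1 : ℤ) + 4 * a 2 + 6 * a 3))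
    (h.reversed_mon_lex a)
  rw [smul_sub, ← e, smul_smul] at h1
  convert h1 using 3
  rw [barExp, zpow_sub₀ hq, inv_pow, ← pow_mul, div_eq_mul_inv, ← zpow_natCast]
  push_cast
  rfl

theorem bar_lexSpan {s : R → R} (hs : IsBarAnti bar q u (fun i => 2 * (i : ℕ)) s)
    (h : Straightening q u) {a : Fin 4 → ℕ} {x : R} (hx : x ∈ lexSpan 𝕂 u a) :
    s x ∈ lexSpan 𝕂 u a := by
  induction hx using Submodule.span_induction with
  | mem x hx =>
    obtain ⟨b, hb, rfl⟩ := hx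
    rw [← sub_add_cancel (s (mon u b)) (q ^ barExp b • mon u b)]
    exact add_mem (lexSpan_mono hb.le (bar_mon hs h b))
      (Submodule.smul_mem _ _ (Submodule.subset_span ⟨b, hb, rfl⟩))
  | zero => rw [hs.zero]; exact zero_mem _
  | add x y _ _ hx hy => rw [hs.add]; exact add_mem hx hy
  | smul c x _ hx => rw [hs.smul]; exact Submodule.smul_mem _ _ hx

variable (hli : LinearIndependent 𝕂 (mon u)) (htop : Submodule.span 𝕂 (Set.range (mon u)) = ⊤)
include hli htop

/-- The coefficients with respect to the E[b] lie in qℤ[q]; membership in vℚ[v] is all that the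
uniqueness argument needs. A nonzero coefficient also places b below a. -/
theorem coeff_of_mem_dualLattice {a b : Fin 4 → ℕ} {x : R} (hx : x ∈ dualLattice q u 1 a) {c : 𝕂}
    (hc : c ≠ 0) (hlead : x - c • mon u b ∈ lexSpan 𝕂 u b) :
    Below a b ∧ ∃ f : Polynomial ℚ, c = q ^ (∑ i, (b i).choose 2) *
      algebraMap (Polynomial ℚ) 𝕂 (Polynomial.X * f) := by
  classical
  let B := Module.Basis.mk hli htop.ge
  have hB : ∀ d, B.repr (mon u d) = Finsupp.single d 1 := by
    intro d
    have := B.repr_self d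
    rwa [show B d = mon u d from Module.Basis.mk_apply _ _ _] at this
  have h0 : B.repr (x - c • mon u b) b = 0 := by
    generalize x - c • mon u b = y at hlead
    induction hlead using Submodule.span_induction with
    | mem x hx =>
      obtain ⟨d, hd, rfl⟩ := hx
      rw [hB, Finsupp.single_apply, if_neg]
      rintro rfl
      exact lt_irrefl (lexKey d) hd
    | zero => simp
    | add x y _ _ hx hy => rw [map_add, Finsupp.add_apply, hx, hy, add_zero]
    | smul c x _ hx => rw [map_smul, Finsupp.smul_apply, hx, smul_zero]
  have h1 : B.repr x b = c := by
    rw [map_sub, map_smul, hB, Finsupp.sub_apply, Finsupp.smul_apply, Finsupp.single_eq_same,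
      smul_eq_mul, mul_one] at h0
    exact sub_eq_zero.1 h0
  have key : (B.repr x b ≠ 0 → Below a b) ∧ ∃ f : Polynomial ℚ,
      B.repr x b = q ^ (∑ i, (b i).choose 2) *
        algebraMap (Polynomial ℚ) 𝕂 (Polynomial.X * f) := by
    clear h1 h0 hlead
    induction hx using AddSubgroup.closure_induction with
    | mem x hx =>
      obtain ⟨d, hd, -, m, hm, rfl⟩ := hx
      rw [dualMon, map_smul, map_smul, hB, Finsupp.smul_apply, Finsupp.smul_apply,
        Finsupp.single_apply]
      split_ifs with hdb
      · subst hdb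
        refine ⟨fun _ => hd, Polynomial.X ^ (2 * m - 1), ?_⟩
        rw [← pow_succ', show 2 * m - 1 + 1 = 2 * m by omega, map_pow, algebraMap_polynomial_X,
          smul_eq_mul, smul_eq_mul, mul_one, mul_comm, pow_mul, ← q]
      · exact ⟨fun h => (h (by simp)).elim, 0, by simp⟩
    | zero => exact ⟨fun h => (h (by simp)).elim, 0, by simp⟩
    | add x y _ _ hx hy =>
      obtain ⟨hx, f, ef⟩ := hx
      obtain ⟨hy, g, eg⟩ := hy
      refine ⟨fun h => ?_, f + g, ?_⟩
      · by_contra hn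
        rw [map_add, Finsupp.add_apply, not_not.1 fun h => hn (hx h), not_not.1 fun h => hn (hy h),
          add_zero] at h
        exact h rfl
      · rw [map_add, Finsupp.add_apply, ef, eg, mul_add, map_add, mul_add]
    | neg x _ hx =>
      obtain ⟨hx, f, ef⟩ := hx
      refine ⟨fun h => hx fun h' => h (by rw [map_neg, Finsupp.neg_apply, h', neg_zero]), -f, ?_⟩
      rw [map_neg, Finsupp.neg_apply, ef, mul_neg, map_neg, mul_neg]
  rw [h1] at key
  exact ⟨key.1 hc, key.2⟩

/-- Uniqueness of dual canonical basis elements. -/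
theorem eq_zero_of_mem_dualLattice {s : R → R}
    (hs : IsBarAnti bar q u (fun i => 2 * (i : ℕ)) s) (h : Straightening q u) {a : Fin 4 → ℕ}
    {x : R} (hx : x ∈ dualLattice q u 1 a) (hsx : s x = q ^ (-normN a) • x) : x = 0 := by
  by_contra hne
  have hq := q_ne_zero
  obtain ⟨b, c, hc, hlead⟩ := exists_lead htop hne
  obtain ⟨hab, f, hf⟩ := coeff_of_mem_dualLattice hli htop hx hc hlead
  set y := algebraMap (Polynomial ℚ) 𝕂 (Polynomial.X * f) with hy
  have h1 := bar_lexSpan hs h hlead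
  have h2 := Submodule.smul_mem _ (bar c) (bar_mon hs h b)
  have h3 := Submodule.smul_mem _ (q ^ (-normN a)) hlead
  rw [hs.sub, hs.smul, hsx] at h1
  have h4 : (q ^ (-normN a) * c - bar c * q ^ barExp b) • mon u b ∈ lexSpan 𝕂 u b := by
    convert sub_mem (add_mem h1 h2) h3 using 1
    rw [smul_sub, smul_sub, smul_smul, smul_smul, sub_smul]
    abel
  -- The coefficients of u[b] in s(x) and in q^{-N(a)}x must agree, for otherwise u[b] would lie in
  -- the span of smaller monomials.
  have h5 : q ^ (-normN a) * c - bar c * q ^ barExp b = 0 := by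
    by_contra h0
    rw [Submodule.smul_mem_iff _ h0] at h4
    exact hli.notMem_span_image (s := {d | lexKey d < lexKey b})
      (fun h' => lt_irrefl (lexKey b) h') h4
  rw [barExp_eq, hab.normN_eq, zpow_add₀ hq] at h5
  have h6 : c = bar c * q ^ (2 * ((∑ i, (b i).choose 2 : ℕ) : ℤ)) := by
    have := zpow_ne_zero (-normN a) hq
    apply mul_left_cancel₀ this
    linear_combination h5
  rw [hf, map_mul, map_pow, bar_q, zpow_mul, zpow_natCast, zpow_ofNat, ← pow_mul, two_mul,
    pow_add, inv_pow] at h6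
  have h7 := pow_ne_zero (∑ i, (b i).choose 2) hq
  -- As N(b) = N(a), the powers of q cancel: the coefficient y of E[b] is bar-invariant. It also
  -- lies in vℚ[v], hence vanishes.
  have h8 : bar y = y := by
    apply mul_left_cancel₀ h7
    rw [h6]
    field_simp
  rw [hy, algebraMap_eq_zero_of_bar h8, mul_zero, map_zero, mul_zero] at hf
  exact hc hf

end Uniqueness

/-- The reversed vector. -/
def rev (a : Fin 4 → ℕ) : Fin 4 → ℕ := vec (a 0) (a 1) (a 2) (a 3)

theorem rev_vec (a b c d : ℕ) : rev (vec a b c d) = vec d c b a := rfl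

theorem rev_rev (a : Fin 4 → ℕ) : rev (rev a) = a := vec_eta a

theorem Below.rev {a b : Fin 4 → ℕ} (h : Below a b) : Below (rev a) (rev b) := by
  obtain ⟨s, r, h3, h2, h1, h0⟩ := h
  exact below_vec.2 ⟨r, s, by omega, by omega, by omega, by omega⟩

/-! ### Reflection through the opposite algebra. -/

section Opposite

variable {k R : Type*} [Field k] [Ring R] [Algebra k R]

theorem unop_mon_opFamily (u : Fin 4 → R) (a : Fin 4 → ℕ) :
    (mon (opFamily u) a).unop = mon u (rev a) := by
  simp [mon, opFamily, rev, vec, mul_assoc]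

theorem unop_dualMon_opFamily (q : k) (u : Fin 4 → R) (a : Fin 4 → ℕ) :
    (dualMon q (opFamily u) a).unop = dualMon q u (rev a) := by
  rw [dualMon, MulOpposite.unop_smul, unop_mon_opFamily, dualMon, Fin.sum_univ_four,
    Fin.sum_univ_four]
  congr 2
  simp only [rev, vec, Matrix.cons_val]
  ring

theorem unop_mem_dualLattice {q : k} {u : Fin 4 → R} {n : ℕ} {a : Fin 4 → ℕ} {x : Rᵐᵒᵖ}
    (hx : x ∈ dualLattice q (opFamily u) n a) : x.unop ∈ dualLattice q u n (rev a) := by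
  induction hx using AddSubgroup.closure_induction with
  | mem x hx =>
    obtain ⟨b, hb, hne, m, hm, rfl⟩ := hx
    rw [MulOpposite.unop_smul, unop_dualMon_opFamily]
    refine dualMon_mem_dualLattice q u hb.rev (fun h => hne ?_) hm
    rw [← rev_rev b, h, rev_rev]
  | zero => exact zero_mem _
  | add x y _ _ hx hy => exact add_mem hx hy
  | neg x _ hx => exact neg_mem hx

/-- The cluster variables with index at most one, up to a common scalar. -/
def neg (q : k) (u : Fin 4 → R) (n : ℕ) : R := (pos q (opFamily u) n).unop

theorem Straightening.neg_sub_mem_dualLattice {q : k} {u : Fin 4 → R} (h : Straightening q u)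
    (K : ℕ) : q ^ (2 * (K * (K + 1))) • neg q u (K + 1) - dualMon q u (vec K 0 0 (K + 1)) ∈
      dualLattice q u 1 (vec K 0 0 (K + 1)) := by
  have := unop_mem_dualLattice (h.op.pos_sub_mem_dualLattice K)
  rwa [MulOpposite.unop_sub, MulOpposite.unop_smul, unop_dualMon_opFamily, rev_vec] at this

theorem IsBarAnti.op {β : k →+* k} {q : k} {u : Fin 4 → R} {e : Fin 4 → ℤ} {s : R → R}
    (hs : IsBarAnti β q u e s) : IsBarAnti β q (opFamily u) ![e 3, e 2, e 1, e 0]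
      (fun x => MulOpposite.op (s x.unop)) where
  one := congrArg MulOpposite.op hs.one
  add x y := congrArg MulOpposite.op (hs.add x.unop y.unop)
  mul x y := congrArg MulOpposite.op (hs.mul y.unop x.unop)
  smul c x := congrArg MulOpposite.op (hs.smul c x.unop)
  gen i := by
    fin_cases i
    · exact congrArg MulOpposite.op (hs.gen 3)
    · exact congrArg MulOpposite.op (hs.gen 2)
    · exact congrArg MulOpposite.op (hs.gen 1)
    · exact congrArg MulOpposite.op (hs.gen 0)

/-- The eigenvalue formula requires only that the exponents form an arithmetic progression, a
property preserved by reversal, so it applies in the opposite algebra. -/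
theorem IsBarAnti.eigen_neg {β : k →+* k} {q : k} {u : Fin 4 → R} {e : Fin 4 → ℤ} {s : R → R}
    (hs : IsBarAnti β q u e s) (h : Straightening q u) (hβ : β q = q⁻¹)
    (h02 : e 0 + e 2 = 2 * e 1) (h13 : e 1 + e 3 = 2 * e 2) (n : ℕ) :
    s (neg q u (n + 1)) = q ^ (e 0 + n * (e 0 + e 3 + 2)) • neg q u (n + 1) := by
  have := hs.op.eigen_pos h.op hβ (by simp only [Matrix.cons_val]; omega)
    (by simp only [Matrix.cons_val]; omega) n
  exact congrArg MulOpposite.unop this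

end Opposite

/-! ### The elements `X_n` -/

/-- The cluster variables, as elements of an algebra with straightening relations. -/
def clusterVar {R : Type*} [Ring R] [Algebra 𝕂 R] (w : Fin 4 → R) (n : ℤ) : R :=
  if 2 ≤ n then v⁻¹ • pos q w (n - 2).toNat else v⁻¹ • neg q w (1 - n).toNat

theorem clusterVar_pos {R : Type*} [Ring R] [Algebra 𝕂 R] (w : Fin 4 → R) (n : ℕ) :
    clusterVar w (n + 2) = v⁻¹ • pos q w n := by
  rw [clusterVar, if_pos (by omega)]
  congr 2
  omega

theorem clusterVar_neg {R : Type*} [Ring R] [Algebra 𝕂 R] (w : Fin 4 → R) (n : ℕ) :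
    clusterVar w (1 - n) = v⁻¹ • neg q w n := by
  rw [clusterVar, if_neg (by omega)]
  congr 2
  omega

theorem adjoin_range_u : Algebra.adjoin 𝕂 (Set.range u) = ⊤ := by
  have h1 : (1 - (q⁻¹) ^ 2 : 𝕂) ≠ 0 := by
    intro h0
    apply q_pow_ne_one (n := 2) (by norm_num)
    have := q_ne_zero
    field_simp at h0; linear_combination h0
  have h2 : ((↑) : Uplus → Uq) ⁻¹' Set.range rootVector ⊆
      (Algebra.adjoin 𝕂 (Set.range u) : Set Uplus) := by
    rintro x ⟨i, hi⟩
    have : x = ((1 - (q⁻¹) ^ 2) ^ (2 * (i : ℕ))) • u i := by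
      rw [u, smul_smul, mul_inv_cancel₀ (pow_ne_zero _ h1), one_smul]
      exact Subtype.ext hi.symm
    rw [this]
    exact Subalgebra.smul_mem _ (Algebra.subset_adjoin (Set.mem_range_self i)) _
  rw [eq_top_iff, ← Algebra.adjoin_adjoin_coe_preimage]
  exact Algebra.adjoin_le h2

theorem span_uMon : Submodule.span 𝕂 (Set.range uMon) = ⊤ :=
  span_mon_eq_top straightening_u adjoin_range_u

section Sigma

variable {R : Type*} [Ring R] [Algebra 𝕂 R] {w : Fin 4 → R}

/-- The value of σ is prescribed only at the scalar v; a ring homomorphism on 𝕂 is determined by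
this value, which gives semilinearity on all scalars. -/
theorem isBarAnti_of_ringEquiv {σ : R ≃+* Rᵐᵒᵖ}
    (hv : σ (algebraMap 𝕂 R v) = MulOpposite.op (algebraMap 𝕂 R v⁻¹))
    (hw : ∀ i : Fin 4, σ (w i) = MulOpposite.op (q ^ (2 * (i : ℕ)) • w i)) :
    IsBarAnti bar q w (fun i => 2 * (i : ℕ)) fun x => (σ x).unop where
  one := congrArg MulOpposite.unop (map_one σ)
  add x y := congrArg MulOpposite.unop (map_add σ x y)
  mul x y := congrArg MulOpposite.unop (map_mul σ x y)
  smul c x := by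
    have e : (σ : R →+* Rᵐᵒᵖ).comp (algebraMap 𝕂 R) = (algebraMap 𝕂 Rᵐᵒᵖ).comp bar := by
      apply ringHom_ext_of_v
      rw [RingHom.comp_apply, RingHom.comp_apply, bar_v]
      exact hv
    have e' : σ (algebraMap 𝕂 R c) = algebraMap 𝕂 Rᵐᵒᵖ (bar c) := RingHom.congr_fun e c
    rw [Algebra.smul_def, map_mul, e', ← Algebra.smul_def]
    rfl
  gen i := by
    rw [hw]
    exact_mod_cast rfl

theorem ringEquiv_of_isBarAnti {σ : R ≃+* Rᵐᵒᵖ}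
    (hσ : IsBarAnti bar q w (fun i => 2 * (i : ℕ)) fun x => (σ x).unop) :
    σ (algebraMap 𝕂 R v) = MulOpposite.op (algebraMap 𝕂 R v⁻¹) ∧
      ∀ i : Fin 4, σ (w i) = MulOpposite.op (q ^ (2 * (i : ℕ)) • w i) := by
  constructor
  · apply MulOpposite.unop_injective
    have := hσ.smul v 1
    rw [hσ.one, bar_v, ← Algebra.algebraMap_eq_smul_one, ← Algebra.algebraMap_eq_smul_one] at this
    exact this
  · intro i
    apply MulOpposite.unop_injective
    have := hσ.gen i
    rw [this]
    exact_mod_cast rfl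

variable (h : Straightening q w) (hli : LinearIndependent 𝕂 (mon w))
  (htop : Submodule.span 𝕂 (Set.range (mon w)) = ⊤)
include h hli htop

/-- Dual canonical basis elements are unique. -/
theorem dualCanonical_unique {a : Fin 4 → ℕ} {x y : R} {σ τ : R ≃+* Rᵐᵒᵖ}
    (hσ : IsBarAnti bar q w (fun i => 2 * (i : ℕ)) fun x => (σ x).unop)
    (hτ : IsBarAnti bar q w (fun i => 2 * (i : ℕ)) fun x => (τ x).unop)
    (hx : x - dualMon q w a ∈ dualLattice q w 1 a) (hy : y - dualMon q w a ∈ dualLattice q w 1 a)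
    (hσx : σ x = MulOpposite.op (q ^ (-normN a) • x))
    (hτy : τ y = MulOpposite.op (q ^ (-normN a) • y)) : x = y := by
  have e := congrFun (hσ.ext hτ htop) y
  rw [← sub_eq_zero]
  refine eq_zero_of_mem_dualLattice hli htop hσ h (a := a) ?_ ?_
  · have := sub_mem hx hy
    rwa [sub_sub_sub_cancel_right] at this
  · rw [hσ.sub, e, hσx, hτy, smul_sub]
    rfl

/-- The rescaling by q^{2K(K+1)} turns the eigenvalue of the recursion element into the prescribed
q^{-N(a)}, because σ inverts the scalar. -/
theorem exists_dualCanonical_pos : ∃ σ : R ≃+* Rᵐᵒᵖ,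
    IsBarAnti bar q w (fun i => 2 * (i : ℕ)) (fun x => (σ x).unop) ∧
    (∀ K : ℕ, σ (q ^ (2 * (K * (K + 1))) • pos q w (K + 1)) = MulOpposite.op
      (q ^ (-normN (vec (K + 1) 0 0 K)) • (q ^ (2 * (K * (K + 1))) • pos q w (K + 1)))) ∧
    (∀ K : ℕ, σ (q ^ (2 * (K * (K + 1))) • neg q w (K + 1)) = MulOpposite.op
      (q ^ (-normN (vec K 0 0 (K + 1))) • (q ^ (2 * (K * (K + 1))) • neg q w (K + 1)))) := by
  obtain ⟨σ, hσ⟩ := h.exists_barAnti hli htop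
  have hq := q_ne_zero
  refine ⟨σ, hσ, fun K => ?_, fun K => ?_⟩ <;> apply MulOpposite.unop_injective
  · refine (hσ.smul _ _).trans ?_
    rw [hσ.eigen_pos h bar_q rfl rfl, smul_smul, MulOpposite.unop_op, smul_smul, map_pow, bar_q,
      ← zpow_natCast, ← zpow_natCast, inv_zpow', ← zpow_add₀ hq, ← zpow_add₀ hq]
    congr 2
    simp only [normN, vec, Matrix.cons_val]
    push_cast
    simp
    ring
  · refine (hσ.smul _ _).trans ?_
    rw [hσ.eigen_neg h bar_q rfl rfl, smul_smul, MulOpposite.unop_op, smul_smul, map_pow, bar_q,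
      ← zpow_natCast, ← zpow_natCast, inv_zpow', ← zpow_add₀ hq, ← zpow_add₀ hq]
    congr 2
    simp only [normN, vec, Matrix.cons_val]
    push_cast
    simp
    ring

end Sigma

theorem isDualCanonical_unique {a : Fin 4 → ℕ} {x y : Uplus} (hx : IsDualCanonical a x)
    (hy : IsDualCanonical a y) : x = y := by
  obtain ⟨hx, σ, hσ, hσx⟩ := hx
  obtain ⟨hy, τ, hτ, hτy⟩ := hy
  exact dualCanonical_unique straightening_u uMon_linearIndependent span_uMon
    (isBarAnti_of_ringEquiv hσ.1 hσ.2) (isBarAnti_of_ringEquiv hτ.1 hτ.2) hx hy hσx hτy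

theorem isDualCanonical_pos (K : ℕ) :
    IsDualCanonical (vec (K + 1) 0 0 K) (q ^ (2 * (K * (K + 1))) • pos q u (K + 1)) := by
  obtain ⟨σ, hσ, hp, -⟩ := exists_dualCanonical_pos straightening_u uMon_linearIndependent span_uMon
  exact ⟨straightening_u.pos_sub_mem_dualLattice K, σ, ringEquiv_of_isBarAnti hσ, hp K⟩

theorem isDualCanonical_neg (K : ℕ) :
    IsDualCanonical (vec K 0 0 (K + 1)) (q ^ (2 * (K * (K + 1))) • neg q u (K + 1)) := by
  obtain ⟨σ, hσ, -, hn⟩ := exists_dualCanonical_pos straightening_u uMon_linearIndependent span_uMon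
  exact ⟨straightening_u.neg_sub_mem_dualLattice K, σ, ringEquiv_of_isBarAnti hσ, hn K⟩

/-- As (2K+1)² = 4K(K+1) + 1 and q = v², the normalization of X_n cancels that of the dual canonical
element and leaves the uniform factor q^{-1/2}. -/
theorem v_smul_q_smul {R : Type*} [Ring R] [Algebra 𝕂 R] (K : ℕ) (x : R) :
    v ^ (-(2 * (K : ℤ) + 1) ^ 2) • q ^ (2 * (K * (K + 1))) • x = v⁻¹ • x := by
  rw [smul_smul, q, ← pow_mul, ← zpow_natCast, ← zpow_add₀ v_ne_zero, ← zpow_neg_one]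
  congr 2
  push_cast; ring

/-- Existence comes from the recursion elements being dual canonical, and uniqueness of dual
canonical elements makes them the only choice. -/
theorem isX_iff (n : ℤ) (x : Uplus) : IsX n x ↔ x = clusterVar u n := by
  rw [IsX]
  split_ifs with h3 h0
  · obtain ⟨K, rfl⟩ : ∃ K : ℕ, n = K + 3 := ⟨(n - 3).toNat, by omega⟩
    have e1 : ((K : ℤ) + 3 - 2).toNat = K + 1 := by omega
    have e2 : ((K : ℤ) + 3 - 3).toNat = K := by omega
    have e3 : -(2 * ((K : ℤ) + 3) - 5) ^ 2 = -(2 * (K : ℤ) + 1) ^ 2 := by ring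
    have e4 : clusterVar u ((K : ℤ) + 3) = v⁻¹ • pos q u (K + 1) := by
      rw [← clusterVar_pos]; congr 1
    rw [e1, e2, e3, e4]
    constructor
    · rintro ⟨b, hb, rfl⟩
      rw [isDualCanonical_unique hb (isDualCanonical_pos K)]
      exact v_smul_q_smul K (pos q u (K + 1))
    · rintro rfl
      exact ⟨_, isDualCanonical_pos K, (v_smul_q_smul K (pos q u (K + 1))).symm⟩
  · obtain ⟨K, rfl⟩ : ∃ K : ℕ, n = -K := ⟨(-n).toNat, by omega⟩
    have e1 : (- -(K : ℤ)).toNat = K := by omega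
    have e2 : (1 - -(K : ℤ)).toNat = K + 1 := by omega
    have e3 : -(2 * -(K : ℤ) - 1) ^ 2 = -(2 * (K : ℤ) + 1) ^ 2 := by ring
    have e4 : clusterVar u (-(K : ℤ)) = v⁻¹ • neg q u (K + 1) := by
      rw [← clusterVar_neg]; congr 1; push_cast; ring
    rw [e1, e2, e3, e4]
    constructor
    · rintro ⟨b, hb, rfl⟩
      rw [isDualCanonical_unique hb (isDualCanonical_neg K)]
      exact v_smul_q_smul K (neg q u (K + 1))
    · rintro rfl
      exact ⟨_, isDualCanonical_neg K, (v_smul_q_smul K (neg q u (K + 1))).symm⟩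
  · have : n = 0 ∨ n = 1 ∨ n = 2 := by omega
    rcases this with rfl | rfl | rfl
    · exact Iff.rfl
    · exact Iff.rfl
    · exact Iff.rfl

/-! ### Laurent monomials and quantum tori in a skew field. -/

section QuasiCommutingPowers

variable {k F : Type*} [Field k] [DivisionRing F] [Algebra k F]

theorem smul_zpow' (c : k) (x : F) (n : ℤ) : (c • x) ^ n = c ^ n • x ^ n := by
  rw [Algebra.smul_def, Commute.mul_zpow (Algebra.commutes c x),
    ← map_zpow₀, ← Algebra.smul_def]

theorem mul_zpow_of_quasiCommute {x y : F} {c : k} (h : x * y = c • (y * x)) (n : ℤ) :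
    x * y ^ n = c ^ n • (y ^ n * x) := by
  have h1 : SemiconjBy x y (c • y) := by
    rw [SemiconjBy, h, smul_mul_assoc]
  have h2 := h1.zpow_right₀ n
  rwa [smul_zpow', SemiconjBy, smul_mul_assoc] at h2

theorem zpow_mul_of_quasiCommute {x y : F} {c : k} (hc : c ≠ 0) (h : x * y = c • (y * x)) (m : ℤ) :
    x ^ m * y = c ^ m • (y * x ^ m) := by
  have h1 := mul_zpow_of_quasiCommute (mul_comm_of_eq_smul hc h) m
  rw [h1, smul_smul, inv_zpow, mul_inv_cancel₀ (zpow_ne_zero _ hc), one_smul]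

theorem zpow_mul_zpow_of_quasiCommute {q : k} (hq : q ≠ 0) {x y : F} {l : ℤ}
    (h : x * y = q ^ l • (y * x)) (m n : ℤ) :
    x ^ m * y ^ n = q ^ (l * m * n) • (y ^ n * x ^ m) := by
  have h1 := zpow_mul_of_quasiCommute (zpow_ne_zero _ hq) h m
  have h2 := mul_zpow_of_quasiCommute h1 n
  rw [h2, ← zpow_mul, ← zpow_mul, mul_assoc]

/-- An ordered Laurent monomial. -/
def ordMon (x : Fin 4 → F) (c : Fin 4 → ℤ) : F := x 0 ^ c 0 * x 1 ^ c 1 * x 2 ^ c 2 * x 3 ^ c 3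

theorem ordMon_commute {q : k} (hq : q ≠ 0) {x : Fin 4 → F} {t : F} {l : Fin 4 → ℤ}
    (h : ∀ i, x i * t = q ^ l i • (t * x i)) (c : Fin 4 → ℤ) :
    ordMon x c * t = q ^ (∑ i, c i * l i) • (t * ordMon x c) := by
  have e : ∀ i, x i ^ c i * t = q ^ (c i * l i) • (t * x i ^ c i) := fun i => by
    rw [zpow_mul_of_quasiCommute (zpow_ne_zero _ hq) (h i), ← zpow_mul, mul_comm (l i)]
  rw [ordMon, commute_smul_mul (commute_smul_mul (commute_smul_mul (e 0) (e 1)) (e 2)) (e 3),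
    ← zpow_add₀ hq, ← zpow_add₀ hq, ← zpow_add₀ hq, Fin.sum_univ_four]

theorem ordMon_mul_zpow {q : k} (hq : q ≠ 0) {x : Fin 4 → F} (hx : ∀ i, x i ≠ 0)
    {Λ : Fin 4 → Fin 4 → ℤ} (h : ∀ i j, x i * x j = q ^ Λ i j • (x j * x i)) (c : Fin 4 → ℤ)
    (i : Fin 4) (n : ℤ) : ∃ s : k, ordMon x c * x i ^ n = s • ordMon x (c + Pi.single i n) := by
  have e : ∀ i j m n, x i ^ m * x j ^ n = q ^ (Λ i j * m * n) • (x j ^ n * x i ^ m) :=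
    fun i j m n => zpow_mul_zpow_of_quasiCommute hq (h i j) m n
  fin_cases i
  · have := commute_smul_mul (commute_smul_mul (e 1 0 (c 1) n) (e 2 0 (c 2) n)) (e 3 0 (c 3) n)
    refine ⟨q ^ (Λ 1 0 * c 1 * n) * q ^ (Λ 2 0 * c 2 * n) * q ^ (Λ 3 0 * c 3 * n), ?_⟩
    · calc ordMon x c * x 0 ^ n = x 0 ^ c 0 * (x 1 ^ c 1 * x 2 ^ c 2 * x 3 ^ c 3 * x 0 ^ n) := by
            simp only [ordMon, mul_assoc]
        _ = _ := by
            rw [this, mul_smul_comm]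
            simp only [ordMon, Pi.add_apply, Pi.single_apply]
            simp [zpow_add₀ (hx 0), mul_assoc]
  · have := commute_smul_mul (e 2 1 (c 2) n) (e 3 1 (c 3) n)
    refine ⟨q ^ (Λ 2 1 * c 2 * n) * q ^ (Λ 3 1 * c 3 * n), ?_⟩
    · calc ordMon x c * x 1 ^ n = x 0 ^ c 0 * x 1 ^ c 1 * (x 2 ^ c 2 * x 3 ^ c 3 * x 1 ^ n) := by
            simp only [ordMon, mul_assoc]
        _ = _ := by
            rw [this, mul_smul_comm]
            simp only [ordMon, Pi.add_apply, Pi.single_apply]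
            simp [zpow_add₀ (hx 1), mul_assoc]
  · have := e 3 2 (c 3) n
    refine ⟨q ^ (Λ 3 2 * c 3 * n), ?_⟩
    · calc ordMon x c * x 2 ^ n = x 0 ^ c 0 * x 1 ^ c 1 * x 2 ^ c 2 * (x 3 ^ c 3 * x 2 ^ n) := by
            simp only [ordMon, mul_assoc]
        _ = _ := by
            rw [this, mul_smul_comm]
            simp only [ordMon, Pi.add_apply, Pi.single_apply]
            simp [zpow_add₀ (hx 2), mul_assoc]
  · refine ⟨1, ?_⟩
    simp only [ordMon, Pi.add_apply, Pi.single_apply]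
    simp [zpow_add₀ (hx 3), mul_assoc]

theorem ordMon_mul_ordMon {q : k} (hq : q ≠ 0) {x : Fin 4 → F} (hx : ∀ i, x i ≠ 0)
    {Λ : Fin 4 → Fin 4 → ℤ} (h : ∀ i j, x i * x j = q ^ Λ i j • (x j * x i))
    (c d : Fin 4 → ℤ) : ∃ s : k, ordMon x c * ordMon x d = s • ordMon x (c + d) := by
  obtain ⟨s0, e0⟩ := ordMon_mul_zpow hq hx h c 0 (d 0)
  obtain ⟨s1, e1⟩ := ordMon_mul_zpow hq hx h (c + Pi.single 0 (d 0)) 1 (d 1)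
  obtain ⟨s2, e2⟩ := ordMon_mul_zpow hq hx h (c + Pi.single 0 (d 0) + Pi.single 1 (d 1)) 2 (d 2)
  obtain ⟨s3, e3⟩ := ordMon_mul_zpow hq hx h
    (c + Pi.single 0 (d 0) + Pi.single 1 (d 1) + Pi.single 2 (d 2)) 3 (d 3)
  have e : c + Pi.single 0 (d 0) + Pi.single 1 (d 1) + Pi.single 2 (d 2) + Pi.single 3 (d 3) =
      c + d := by
    funext i
    fin_cases i <;> simp
  refine ⟨s0 * (s1 * (s2 * s3)), ?_⟩
  rw [← e]
  calc ordMon x c * ordMon x d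
      = ordMon x c * x 0 ^ d 0 * x 1 ^ d 1 * x 2 ^ d 2 * x 3 ^ d 3 := by
        rw [ordMon, ordMon]; simp only [mul_assoc]
    _ = _ := by
        simp only [e0, e1, e2, e3, smul_mul_assoc, smul_smul, mul_assoc]

/-- The quantum torus spanned by the Laurent monomials in quasi-commuting elements. -/
def quantumTorus {q : k} (hq : q ≠ 0) {x : Fin 4 → F} (hx : ∀ i, x i ≠ 0)
    {Λ : Fin 4 → Fin 4 → ℤ} (h : ∀ i j, x i * x j = q ^ Λ i j • (x j * x i)) : Subalgebra k F :=
  (Submodule.span k (Set.range (ordMon x))).toSubalgebra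
    (Submodule.subset_span ⟨0, by simp [ordMon]⟩) (by
      intro f g hf hg
      induction hf using Submodule.span_induction with
      | zero => simp
      | add x x' _ _ hx hx' => rw [add_mul]; exact add_mem hx hx'
      | smul c x _ hx => rw [smul_mul_assoc]; exact Submodule.smul_mem _ c hx
      | mem f hf =>
        obtain ⟨c, rfl⟩ := hf
        induction hg using Submodule.span_induction with
        | zero => simp
        | add y y' _ _ hy hy' => rw [mul_add]; exact add_mem hy hy'
        | smul c y _ hy => rw [mul_smul_comm]; exact Submodule.smul_mem _ c hy
        | mem g hg =>
          obtain ⟨d, rfl⟩ := hg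
          obtain ⟨s, hs⟩ := ordMon_mul_ordMon hq hx h c d
          rw [hs]
          exact Submodule.smul_mem _ _ (Submodule.subset_span ⟨_, rfl⟩))

end QuasiCommutingPowers

/-! ### Toric frames and mutation under interchange of the two cluster variables. -/

namespace SeedData

variable {F : Type} [DivisionRing F] [Algebra 𝕂 F]

/-- The exponent of `v` in the toric frame. -/
def frameExp (Λ : Matrix (Fin 4) (Fin 4) ℤ) (c : Fin 4 → ℤ) : ℤ :=
  c 1 * c 0 * Λ 1 0 + (c 2 * c 0 * Λ 2 0 + c 2 * c 1 * Λ 2 1) +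
    (c 3 * c 0 * Λ 3 0 + c 3 * c 1 * Λ 3 1 + c 3 * c 2 * Λ 3 2)

theorem frame_eq (S : SeedData F 2 2) (c : Fin 4 → ℤ) :
    S.frame c = v ^ frameExp S.Λ c • ordMon S.x c := by
  have e1 : (∑ i : Fin 4, ∑ j : Fin 4, if j < i then c i * c j * S.Λ i j else 0) =
      frameExp S.Λ c := by
    simp [Fin.sum_univ_four, frameExp]
  have e2 : (List.ofFn fun i : Fin 4 => S.x i ^ c i).prod = ordMon S.x c := by
    simp [List.ofFn_succ, ordMon, mul_assoc]
  exact congrArg₂ (fun (n : ℤ) (x : F) => v ^ n • x) e1 e2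

theorem span_frame (S : SeedData F 2 2) :
    Submodule.span 𝕂 (Set.range S.frame) = Submodule.span 𝕂 (Set.range (ordMon S.x)) := by
  apply le_antisymm <;> rw [Submodule.span_le]
  · rintro _ ⟨c, rfl⟩
    rw [frame_eq]
    exact Submodule.smul_mem _ _ (Submodule.subset_span ⟨c, rfl⟩)
  · rintro _ ⟨c, rfl⟩
    have : ordMon S.x c = (v ^ frameExp S.Λ c)⁻¹ • S.frame c := by
      rw [frame_eq, smul_smul, inv_mul_cancel₀ (zpow_ne_zero _ v_ne_zero), one_smul]
    rw [this]
    exact Submodule.smul_mem _ _ (Submodule.subset_span ⟨c, rfl⟩)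

/-- The seed with the two exchangeable variables interchanged. -/
def swap (S : SeedData F 2 2) : SeedData F 2 2 where
  x := fun i => S.x (Equiv.swap (0 : Fin 4) 1 i)
  Λ := fun i j => S.Λ (Equiv.swap (0 : Fin 4) 1 i) (Equiv.swap (0 : Fin 4) 1 j)
  B := fun i j => S.B (Equiv.swap (0 : Fin 4) 1 i) (Equiv.swap (0 : Fin 2) 1 j)

theorem swap_swap (S : SeedData F 2 2) : S.swap.swap = S := by
  ext <;> simp [swap]

/-- The half-integral power of q in the toric frame compensates the reordering of the first two
factors, so the normalized monomial does not depend on their order. -/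
theorem frame_swap {S : SeedData F 2 2} (hq : ∀ i j, S.x i * S.x j = q ^ S.Λ i j • (S.x j * S.x i))
    (hΛ : S.Λ.transpose = -S.Λ) (c : Fin 4 → ℤ) :
    S.swap.frame (fun i => c (Equiv.swap (0 : Fin 4) 1 i)) = S.frame c := by
  have s0 : Equiv.swap (0 : Fin 4) 1 0 = 1 := rfl
  have s1 : Equiv.swap (0 : Fin 4) 1 1 = 0 := rfl
  have s2 : Equiv.swap (0 : Fin 4) 1 2 = 2 := rfl
  have s3 : Equiv.swap (0 : Fin 4) 1 3 = 3 := rfl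
  have hsk : S.Λ 0 1 = -S.Λ 1 0 := congrFun (congrFun hΛ 1) 0
  have e := zpow_mul_zpow_of_quasiCommute q_ne_zero (hq 1 0) (c 1) (c 0)
  rw [frame_eq, frame_eq, ordMon, ordMon]
  simp only [swap, s0, s1, s2, s3, frameExp]
  rw [e, smul_mul_assoc, smul_mul_assoc, smul_smul, q_zpow, ← zpow_add₀ v_ne_zero, hsk]
  congr 2
  ring

end SeedData

/-- The mutation rule for Λ in the first direction, with symbolic entries so that one computation
covers the seeds of all indices. -/
theorem transpose_mul_mul_zero (l p r p' r' m n : ℤ) :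
    !![-1, 0, 0, 0; 0, 1, 0, 0; m, 0, 1, 0; n, 0, 0, 1].transpose *
      !![0, l, 2 * p, 2 * r; -l, 0, 2 * p', 2 * r'; -(2 * p), -(2 * p'), 0, -4;
        -(2 * r), -(2 * r'), 4, 0] *
      !![-1, 0, 0, 0; 0, 1, 0, 0; m, 0, 1, 0; n, 0, 0, 1] =
    !![0, -(l + 2 * n * r' + 2 * p' * m), 2 * (-p + 2 * n), 2 * (-r - 2 * m);
      l + 2 * n * r' + 2 * p' * m, 0, 2 * p', 2 * r';
      -(2 * (-p + 2 * n)), -(2 * p'), 0, -4;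
      -(2 * (-r - 2 * m)), -(2 * r'), 4, 0] := by
  ext i k
  simp only [Matrix.mul_apply, Fin.sum_univ_four, Matrix.transpose_apply]
  fin_cases i <;> fin_cases k <;>
    simp only [Fin.zero_eta, Fin.mk_one, Fin.reduceFinMk, Matrix.of_apply, Matrix.cons_val] <;> ring

theorem transpose_mul_mul_one (l p r p' r' m n : ℤ) :
    !![1, 2, 0, 0; 0, -1, 0, 0; 0, m, 1, 0; 0, n, 0, 1].transpose *
      !![0, l, 2 * p, 2 * r; -l, 0, 2 * p', 2 * r'; -(2 * p), -(2 * p'), 0, -4;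
        -(2 * r), -(2 * r'), 4, 0] *
      !![1, 2, 0, 0; 0, -1, 0, 0; 0, m, 1, 0; 0, n, 0, 1] =
    !![0, -l + 2 * n * r + 2 * m * p, 2 * p, 2 * r;
      -(-l + 2 * n * r + 2 * m * p), 0, 2 * (2 * p - p' + 2 * n), 2 * (2 * r - r' - 2 * m);
      -(2 * p), -(2 * (2 * p - p' + 2 * n)), 0, -4;
      -(2 * r), -(2 * (2 * r - r' - 2 * m)), 4, 0] := by
  ext i k
  simp only [Matrix.mul_apply, Fin.sum_univ_four, Matrix.transpose_apply]
  fin_cases i <;> fin_cases k <;>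
    simp only [Fin.zero_eta, Fin.mk_one, Fin.reduceFinMk, Matrix.of_apply, Matrix.cons_val] <;> ring

namespace SeedData

variable {F : Type} [DivisionRing F] [Algebra 𝕂 F]

theorem swap_four_swap (i : Fin 4) : Equiv.swap (0 : Fin 4) 1 (Equiv.swap (0 : Fin 4) 1 i) = i :=
  Equiv.swap_apply_self _ _ i

theorem castAdd_swap (k : Fin 2) : Fin.castAdd 2 (Equiv.swap (0 : Fin 2) 1 k) =
    Equiv.swap (0 : Fin 4) 1 (Fin.castAdd 2 k) := by
  fin_cases k <;> rfl

theorem exchange_swap {S : SeedData F 2 2}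
    (hq : ∀ i j, S.x i * S.x j = q ^ S.Λ i j • (S.x j * S.x i))
    (hΛ : S.Λ.transpose = -S.Λ) (k : Fin 2) :
    S.swap.exchange (Equiv.swap (0 : Fin 2) 1 k) = S.exchange k := by
  rw [exchange, exchange, ← frame_swap hq hΛ, ← frame_swap hq hΛ]
  have e : ∀ i, S.swap.B i (Equiv.swap (0 : Fin 2) 1 k) = S.B (Equiv.swap (0 : Fin 4) 1 i) k := by
    intro i; simp [swap]
  have e' : ∀ i : Fin 4, (Pi.single (Fin.castAdd 2 (Equiv.swap (0 : Fin 2) 1 k)) 1 : Fin 4 → ℤ) i =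
      (Pi.single (Fin.castAdd 2 k) 1 : Fin 4 → ℤ) (Equiv.swap (0 : Fin 4) 1 i) := by
    intro i
    rw [castAdd_swap, Pi.single_apply, Pi.single_apply]
    congr 1
    rw [eq_iff_iff, Equiv.swap_apply_eq_iff]
  simp only [e]
  congr 2 <;> funext i <;> rw [e' i]

/-- Mutation is equivariant under relabelling. This is needed because mutating a seed of the
sequence returns the neighbouring seed with its two cluster variables interchanged. -/
theorem mutate_swap {S : SeedData F 2 2}
    (hq : ∀ i j, S.x i * S.x j = q ^ S.Λ i j • (S.x j * S.x i))
    (hΛ : S.Λ.transpose = -S.Λ) (k : Fin 2) :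
    S.swap.mutate (Equiv.swap (0 : Fin 2) 1 k) = (S.mutate k).swap := by
  have hE : ∀ i j, S.swap.mutE (Equiv.swap (0 : Fin 2) 1 k) i j =
      S.mutE k (Equiv.swap (0 : Fin 4) 1 i) (Equiv.swap (0 : Fin 4) 1 j) := by
    intro i j
    simp only [mutE, castAdd_swap, swap, Equiv.swap_apply_self, Equiv.swap_apply_eq_iff,
      EmbeddingLike.apply_eq_iff_eq]
  have hE' : ∀ i j, S.swap.mutE (Equiv.swap (0 : Fin 2) 1 k) (Equiv.swap (0 : Fin 4) 1 i) j =
      S.mutE k i (Equiv.swap (0 : Fin 4) 1 j) := by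
    intro i j
    rw [hE, swap_four_swap]
  ext i j
  · have := exchange_swap hq hΛ k
    simp only [mutate, swap, Function.update_apply, castAdd_swap, Equiv.swap_apply_eq_iff] at this ⊢
    rw [← this]
  · change ((S.swap.mutE _).transpose * S.swap.Λ * S.swap.mutE _) i j =
      ((S.mutE k).transpose * S.Λ * S.mutE k) _ _
    simp only [Matrix.mul_apply, Matrix.transpose_apply]
    rw [← Equiv.sum_comp (Equiv.swap (0 : Fin 4) 1)]
    refine Finset.sum_congr rfl fun l _ => ?_
    rw [hE', ← Equiv.sum_comp (Equiv.swap (0 : Fin 4) 1)]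
    congr 1
    refine Finset.sum_congr rfl fun m _ => ?_
    rw [hE']
    simp [swap]
  · simp only [mutate, swap, castAdd_swap, Equiv.swap_apply_self, Equiv.swap_apply_eq_iff]

theorem mutate_Λ (S : SeedData F 2 2) (k : Fin 2) :
    (S.mutate k).Λ = (S.mutE k).transpose * S.Λ * S.mutE k := rfl

theorem IsQuantumSeed.swap {S : SeedData F 2 2} (h : S.IsQuantumSeed) : S.swap.IsQuantumSeed where
  compatible := by
    obtain ⟨hΛ, d, hd, hB⟩ := h.compatible
    refine ⟨?_, fun j => d (Equiv.swap 0 1 j), fun j => hd _, fun j i => ?_⟩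
    · ext i j
      exact congrFun (congrFun hΛ (Equiv.swap (0 : Fin 4) 1 i)) (Equiv.swap (0 : Fin 4) 1 j)
    · have := hB (Equiv.swap 0 1 j) (Equiv.swap (0 : Fin 4) 1 i)
      rw [← Equiv.sum_comp (Equiv.swap (0 : Fin 4) 1)] at this
      refine this.trans ?_
      rw [castAdd_swap]
      simp only [EmbeddingLike.apply_eq_iff_eq]
  quasiComm i j := h.quasiComm _ _
  linearIndependent := by
    have e : S.frame = S.swap.frame ∘ fun c i => c (Equiv.swap (0 : Fin 4) 1 i) :=
      funext fun c => (frame_swap h.quasiComm h.compatible.1 c).symm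
    have hi := h.linearIndependent
    have e' : S.swap.frame = S.frame ∘ fun c i => c (Equiv.swap (0 : Fin 4) 1 i) := by
      rw [e]
      funext c
      simp
    rw [e']
    refine hi.comp _ fun c d hcd => ?_
    funext i
    have := congrFun hcd (Equiv.swap (0 : Fin 4) 1 i)
    simpa using this
  fractions := by
    have e : Set.range S.swap.frame = Set.range S.frame := by
      ext f
      constructor
      · rintro ⟨c, rfl⟩
        refine ⟨fun i => c (Equiv.swap (0 : Fin 4) 1 i), ?_⟩
        rw [← frame_swap h.quasiComm h.compatible.1]
        simp
      · rintro ⟨c, rfl⟩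
        exact ⟨_, frame_swap h.quasiComm h.compatible.1 c⟩
    rw [e]
    exact h.fractions

end SeedData

/-! ### Seeds from a bi-infinite sequence of cluster variables -/

/-- Half of the quasi-commutation exponent of the cluster variables with `Y₀`. -/
def pSeq (j : ℤ) : ℤ := |j| - 1

/-- Half of the quasi-commutation exponent of the cluster variables with `Y₁`. -/
def rSeq (j : ℤ) : ℤ := 1 - |j - 3|

/-- The quasi-commutation exponent of neighbouring cluster variables. -/
def lamSeq (j : ℤ) : ℤ := pSeq (j + 1) * rSeq j - pSeq j * rSeq (j + 1) - 1

/-- The tropical form of the exchange recursion. Together with the version for `rSeq` it is what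
makes the family of matrices closed under mutation. -/
theorem pSeq_succ (j : ℤ) : pSeq (j + 2) = -pSeq j + 2 * max (pSeq (j + 1)) 0 := by
  simp only [pSeq]; grind

theorem rSeq_succ (j : ℤ) : rSeq (j + 2) = -rSeq j - 2 * max (-rSeq (j + 1)) 0 := by
  simp only [rSeq]; grind

theorem max_sub_max_neg (t : ℤ) : max t 0 - max (-t) 0 = t := by omega

theorem lamSeq_succ (j : ℤ) : lamSeq (j + 1) = lamSeq j + 2 * max (pSeq (j + 1)) 0 * rSeq (j + 1) +
    2 * pSeq (j + 1) * max (-rSeq (j + 1)) 0 := by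
  rw [lamSeq, lamSeq, show j + 1 + 1 = j + 2 by ring, pSeq_succ, rSeq_succ]
  ring

/-- The exponent in the first term of the exchange relation. -/
def exchExp₁ (j : ℤ) : ℤ := 2 * lamSeq j + 2 * max (rSeq (j + 1)) 0 * pSeq j +
  2 * max (-pSeq (j + 1)) 0 * rSeq j - 4 * max (rSeq (j + 1)) 0 * pSeq (j + 1) -
  4 * max (-pSeq (j + 1)) 0 * rSeq (j + 1) + 4 * max (rSeq (j + 1)) 0 * max (-pSeq (j + 1)) 0

/-- The exponent in the second term of the exchange relation. -/
def exchExp₂ (j : ℤ) : ℤ := 2 * max (-rSeq (j + 1)) 0 * pSeq j +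
  2 * max (pSeq (j + 1)) 0 * rSeq j + 4 * max (-rSeq (j + 1)) 0 * max (pSeq (j + 1)) 0

/-- Relations between cluster variables `x_j` and frozen variables `a`, `b` in a skew field. -/
structure ClusterRelations {F : Type} [DivisionRing F] [Algebra 𝕂 F] (x : ℤ → F) (a b : F) :
    Prop where
  x_ne (j : ℤ) : x j ≠ 0
  a_ne : a ≠ 0
  b_ne : b ≠ 0
  comm_x (j : ℤ) : x j * x (j + 1) = q ^ lamSeq j • (x (j + 1) * x j)
  comm_a (j : ℤ) : x j * a = q ^ (2 * pSeq j) • (a * x j)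
  comm_b (j : ℤ) : x j * b = q ^ (2 * rSeq j) • (b * x j)
  comm_ab : a * b = q ^ (-4 : ℤ) • (b * a)
  exch (j : ℤ) : x j * x (j + 2) =
    v ^ exchExp₁ j • (x (j + 1) ^ 2 * a ^ max (rSeq (j + 1)) 0 * b ^ max (-pSeq (j + 1)) 0) +
      v ^ exchExp₂ j • (a ^ max (-rSeq (j + 1)) 0 * b ^ max (pSeq (j + 1)) 0)

/-- The seed with cluster `x_j, x_{j+1}`. -/
def clusterSeed {F : Type} (x : ℤ → F) (a b : F) (j : ℤ) : SeedData F 2 2 where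
  x := ![x j, x (j + 1), a, b]
  Λ := !![0, lamSeq j, 2 * pSeq j, 2 * rSeq j;
    -lamSeq j, 0, 2 * pSeq (j + 1), 2 * rSeq (j + 1);
    -(2 * pSeq j), -(2 * pSeq (j + 1)), 0, -4;
    -(2 * rSeq j), -(2 * rSeq (j + 1)), 4, 0]
  B := !![0, -2; 2, 0; rSeq (j + 1), -rSeq j; -pSeq (j + 1), pSeq j]

theorem clusterSeed_Λ {F : Type} (x : ℤ → F) (a b : F) (j : ℤ) : (clusterSeed x a b j).Λ =
    !![0, lamSeq j, 2 * pSeq j, 2 * rSeq j;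
    -lamSeq j, 0, 2 * pSeq (j + 1), 2 * rSeq (j + 1);
    -(2 * pSeq j), -(2 * pSeq (j + 1)), 0, -4;
    -(2 * rSeq j), -(2 * rSeq (j + 1)), 4, 0] := rfl

/-- The definition of `lamSeq` is such that both diagonal entries of the compatibility relation
equal 2. -/
theorem clusterSeed_compatible {F : Type} [DivisionRing F] [Algebra 𝕂 F] (x : ℤ → F) (a b : F)
    (j : ℤ) : (clusterSeed x a b j).IsCompatible := by
  refine ⟨?_, fun _ => 2, fun _ => two_pos, fun c i => ?_⟩
  · ext i k
    fin_cases i <;> fin_cases k <;> simp [clusterSeed]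
  · have hf := Fin.sum_univ_four fun k => (clusterSeed x a b j).B k c * (clusterSeed x a b j).Λ k i
    refine hf.trans ?_
    fin_cases c <;> fin_cases i <;> simp [clusterSeed, lamSeq] <;> ring

theorem seed_ext {F : Type} {S T : SeedData F 2 2} (hx : ∀ i : Fin 4, S.x i = T.x i)
    (hΛ : ∀ i j : Fin 4, S.Λ i j = T.Λ i j) (hB : ∀ (i : Fin 4) (j : Fin 2), S.B i j = T.B i j) :
    S = T :=
  SeedData.ext (funext hx) (Matrix.ext hΛ) (Matrix.ext hB)

theorem clusterSeed_mutE_zero {F : Type} (x : ℤ → F) (a b : F) (j : ℤ) : (clusterSeed x a b j).mutE 0 =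
    !![-1, 0, 0, 0; 0, 1, 0, 0; max (-rSeq (j + 1)) 0, 0, 1, 0; max (pSeq (j + 1)) 0, 0, 0, 1] := by
  ext i k
  fin_cases i <;> fin_cases k <;> simp [SeedData.mutE, clusterSeed]

theorem clusterSeed_mutE_one {F : Type} (x : ℤ → F) (a b : F) (j : ℤ) : (clusterSeed x a b (j + 1)).mutE 1 =
    !![1, 2, 0, 0; 0, -1, 0, 0; 0, max (rSeq (j + 1)) 0, 1, 0; 0, max (-pSeq (j + 1)) 0, 0, 1] := by
  ext i k
  fin_cases i <;> fin_cases k <;> simp [SeedData.mutE, clusterSeed]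

theorem clusterSeed_swap {F : Type} (x : ℤ → F) (a b : F) (j : ℤ) : (clusterSeed x a b j).swap =
    { x := ![x (j + 1), x j, a, b]
      Λ := !![0, -lamSeq j, 2 * pSeq (j + 1), 2 * rSeq (j + 1);
        lamSeq j, 0, 2 * pSeq j, 2 * rSeq j;
        -(2 * pSeq (j + 1)), -(2 * pSeq j), 0, -4;
        -(2 * rSeq (j + 1)), -(2 * rSeq j), 4, 0]
      B := !![0, 2; -2, 0; -rSeq j, rSeq (j + 1); pSeq j, -pSeq (j + 1)] } := by
  have s2 : Equiv.swap (0 : Fin 4) 1 2 = 2 := rfl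
  have s3 : Equiv.swap (0 : Fin 4) 1 3 = 3 := rfl
  refine seed_ext (fun i => ?_) (fun i k => ?_) fun i k => ?_
  · fin_cases i <;> simp [SeedData.swap, clusterSeed, s2, s3]
  · fin_cases i <;> fin_cases k <;> simp [SeedData.swap, clusterSeed, s2, s3]
  · fin_cases i <;> fin_cases k <;> simp [SeedData.swap, clusterSeed, s2, s3]

namespace ClusterRelations

variable {F : Type} [DivisionRing F] [Algebra 𝕂 F] {x : ℤ → F} {a b : F}
  (h : ClusterRelations x a b)
include h

theorem quasiComm (j : ℤ) (i k : Fin 4) : (clusterSeed x a b j).x i * (clusterSeed x a b j).x k =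
    q ^ (clusterSeed x a b j).Λ i k • ((clusterSeed x a b j).x k * (clusterSeed x a b j).x i) := by
  have flip : ∀ {x y : F} {c : ℤ}, x * y = q ^ c • (y * x) → y * x = q ^ (-c) • (x * y) := by
    intro x y c e
    rw [zpow_neg]
    exact mul_comm_of_eq_smul (zpow_ne_zero _ q_ne_zero) e
  have self : ∀ x : F, x * x = q ^ (0 : ℤ) • (x * x) := fun x => by rw [zpow_zero, one_smul]
  fin_cases i <;> fin_cases k
  · exact self _
  · exact h.comm_x j
  · exact h.comm_a j
  · exact h.comm_b j
  · exact flip (h.comm_x j)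
  · exact self _
  · exact h.comm_a (j + 1)
  · exact h.comm_b (j + 1)
  · exact flip (h.comm_a j)
  · exact flip (h.comm_a (j + 1))
  · exact self _
  · exact h.comm_ab
  · exact flip (h.comm_b j)
  · exact flip (h.comm_b (j + 1))
  · exact flip h.comm_ab
  · exact self _

theorem seed_ne_zero (j : ℤ) (i : Fin 4) : (clusterSeed x a b j).x i ≠ 0 := by
  fin_cases i
  · exact h.x_ne j
  · exact h.x_ne (j + 1)
  · exact h.a_ne
  · exact h.b_ne

theorem linearIndependent_frame (j : ℤ) : LinearIndependent 𝕂 (clusterSeed x a b j).frame := by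
  have hord := fun (i : Fin 4) (c : Fin 4 → ℤ) => ordMon_commute q_ne_zero
    (fun k => h.quasiComm j k i) c
  refine linearIndependent_of_quasiCommute (clusterSeed x a b j).x
    (fun i y hy => (mul_eq_zero.1 hy).resolve_left (h.seed_ne_zero j i)) _ (fun c => ?_)
    (fun i c => q ^ ∑ k, c k * (clusterSeed x a b j).Λ k i) (fun i c => ?_) fun c d hcd => ?_
  · rw [SeedData.frame_eq]
    refine smul_ne_zero (zpow_ne_zero _ v_ne_zero) ?_
    refine mul_ne_zero (mul_ne_zero (mul_ne_zero ?_ ?_) ?_) ?_ <;>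
      exact zpow_ne_zero _ (h.seed_ne_zero j _)
  · rw [SeedData.frame_eq, smul_mul_assoc, hord i c, smul_comm, mul_smul_comm]
  · have e : ∀ i : Fin 4, ∑ k : Fin 4, c k * (clusterSeed x a b j).Λ k i =
        ∑ k : Fin 4, d k * (clusterSeed x a b j).Λ k i := fun i => q_zpow_injective (hcd i)
    have e0 := e 0
    have e1 := e 1
    have e2 := e 2
    have e3 := e 3
    simp only [Fin.sum_univ_four, clusterSeed, Matrix.of_apply, Matrix.cons_val] at e0 e1 e2 e3
    have k0 : c 0 = d 0 := by
      -- Combining the equations with the entries of the first column of the exchange matrix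
      -- isolates this difference, by compatibility. The second column does the same for c₁, and the
      -- entries ±4 settle the frozen exponents.
      have : 2 * (c 0 - d 0) = 0 := by
        rw [lamSeq] at e0 e1
        linear_combination -2 * e1 - rSeq (j + 1) * e2 + pSeq (j + 1) * e3
      omega
    have k1 : c 1 = d 1 := by
      have : 2 * (c 1 - d 1) = 0 := by
        rw [lamSeq] at e0 e1
        linear_combination 2 * e0 + rSeq j * e2 - pSeq j * e3
      omega
    rw [k0, k1] at e2 e3
    funext i
    fin_cases i
    · exact k0
    · exact k1
    · change c 2 = d 2; omega
    · change c 3 = d 3; omega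

omit h in
theorem cluster_frame (j : ℤ) (c₀ c₁ c₂ c₃ : ℤ) : (clusterSeed x a b j).frame ![c₀, c₁, c₂, c₃] =
    v ^ (-(c₁ * c₀ * lamSeq j) - 2 * c₂ * c₀ * pSeq j - 2 * c₂ * c₁ * pSeq (j + 1) -
      2 * c₃ * c₀ * rSeq j - 2 * c₃ * c₁ * rSeq (j + 1) + 4 * c₃ * c₂) •
      (x j ^ c₀ * x (j + 1) ^ c₁ * a ^ c₂ * b ^ c₃) := by
  rw [SeedData.frame_eq]
  refine congrArg₂ (fun (n : ℤ) (y : F) => v ^ n • y) ?_ rfl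
  simp only [SeedData.frameExp, clusterSeed, Matrix.of_apply, Matrix.cons_val]
  ring

/-- The relation for x_j x_{j+2} multiplied on the left by the inverse of x_j; `exchExp₁` and
`exchExp₂` absorb the powers of v of the toric frame. -/
theorem exchange_zero (j : ℤ) : (clusterSeed x a b j).exchange 0 = x (j + 2) := by
  have e1 : (fun i => -(Pi.single (Fin.castAdd 2 0) 1 : Fin (2 + 2) → ℤ) i +
      max ((clusterSeed x a b j).B i 0) 0) =
      ![-1, 2, max (rSeq (j + 1)) 0, max (-pSeq (j + 1)) 0] := by
    funext i; fin_cases i <;> simp [clusterSeed]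
  have e2 : (fun i => -(Pi.single (Fin.castAdd 2 0) 1 : Fin (2 + 2) → ℤ) i +
      max (-(clusterSeed x a b j).B i 0) 0) =
      ![-1, 0, max (-rSeq (j + 1)) 0, max (pSeq (j + 1)) 0] := by
    funext i; fin_cases i <;> simp [clusterSeed]
  rw [SeedData.exchange, e1, e2, cluster_frame, cluster_frame]
  apply mul_left_cancel₀ (h.x_ne j)
  rw [h.exch, mul_add, mul_smul_comm, mul_smul_comm]
  simp only [zpow_neg_one, zpow_ofNat, pow_zero, mul_one, mul_assoc]
  rw [mul_inv_cancel_left₀ (h.x_ne j), mul_inv_cancel_left₀ (h.x_ne j)]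
  congr 3
  · rw [exchExp₁]; ring
  · rw [exchExp₂]; ring

theorem inv_mul_mul (j α β : ℤ) : (x j)⁻¹ * (a ^ α * (b ^ β * x j)) =
    v ^ (-(4 * α * pSeq j) - 4 * β * rSeq j) • (a ^ α * b ^ β) := by
  have e1 := mul_zpow_of_quasiCommute (h.comm_a j) α
  have e2 := mul_zpow_of_quasiCommute (h.comm_b j) β
  have e3 : x j * (a ^ α * b ^ β) =
      v ^ (4 * α * pSeq j + 4 * β * rSeq j) • (a ^ α * (b ^ β * x j)) := by
    rw [← mul_assoc, e1, smul_mul_assoc, mul_assoc, e2, mul_smul_comm, smul_smul,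
      ← zpow_mul, ← zpow_mul, q_zpow, q_zpow, ← zpow_add₀ v_ne_zero]
    congr 2; ring
  apply mul_left_cancel₀ (h.x_ne j)
  rw [mul_inv_cancel_left₀ (h.x_ne j), mul_smul_comm, e3, smul_smul, ← zpow_add₀ v_ne_zero,
    show -(4 * α * pSeq j) - 4 * β * rSeq j + (4 * α * pSeq j + 4 * β * rSeq j) = 0 by ring,
    zpow_zero, one_smul]

/-- The same relation solved for its left factor. The powers of v agree by the tropical recursions
for `pSeq`, `rSeq` and `lamSeq`, so mutation in the second direction undoes the forward step. -/
theorem exchange_one (j : ℤ) : (clusterSeed x a b (j + 1)).exchange 1 = x j := by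
  have e1 : (fun i => -(Pi.single (Fin.castAdd 2 1) 1 : Fin (2 + 2) → ℤ) i +
      max ((clusterSeed x a b (j + 1)).B i 1) 0) =
      ![0, -1, max (-rSeq (j + 1)) 0, max (pSeq (j + 1)) 0] := by
    funext i; fin_cases i <;> simp [clusterSeed]
  have e2 : (fun i => -(Pi.single (Fin.castAdd 2 1) 1 : Fin (2 + 2) → ℤ) i +
      max (-(clusterSeed x a b (j + 1)).B i 1) 0) =
      ![2, -1, max (rSeq (j + 1)) 0, max (-pSeq (j + 1)) 0] := by
    funext i; fin_cases i <;> simp [clusterSeed]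
  have hp := max_sub_max_neg (pSeq (j + 1))
  have hr := max_sub_max_neg (rSeq (j + 1))
  rw [SeedData.exchange, e1, e2, cluster_frame, cluster_frame, show j + 1 + 1 = j + 2 by ring]
  apply mul_right_cancel₀ (h.x_ne (j + 2))
  simp only [zpow_neg_one, zpow_ofNat, pow_zero, one_mul]
  rw [h.exch, add_mul, smul_mul_assoc, smul_mul_assoc, add_comm]
  simp only [mul_assoc]
  rw [h.inv_mul_mul, h.inv_mul_mul, mul_smul_comm, smul_smul, smul_smul,
    ← zpow_add₀ v_ne_zero, ← zpow_add₀ v_ne_zero]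
  congr 3
  · rw [exchExp₁, lamSeq_succ, pSeq_succ, rSeq_succ]
    linear_combination -4 * max (-rSeq (j + 1)) 0 * hp - 4 * max (pSeq (j + 1)) 0 * hr
  · rw [exchExp₂, pSeq_succ, rSeq_succ]
    ring

/-- The new variable x_{j+2} occupies the position of x_j, in front of x_{j+1}; hence the
interchange on the right side. -/
theorem mutate_zero (j : ℤ) :
    (clusterSeed x a b j).mutate 0 = (clusterSeed x a b (j + 1)).swap := by
  have e2 : j + 1 + 1 = j + 2 := by ring
  have hl := lamSeq_succ j
  have hp := pSeq_succ j
  have hr := rSeq_succ j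
  rw [clusterSeed_swap, e2]
  refine seed_ext (fun i => ?_) (fun i k => ?_) fun i k => ?_
  · have := h.exchange_zero j
    simp only [SeedData.mutate, this]
    fin_cases i <;> simp [clusterSeed]
  · have := transpose_mul_mul_zero (lamSeq j) (pSeq j) (rSeq j) (pSeq (j + 1)) (rSeq (j + 1))
      (max (-rSeq (j + 1)) 0) (max (pSeq (j + 1)) 0)
    rw [← hl, ← hp, ← hr] at this
    rw [SeedData.mutate_Λ, clusterSeed_mutE_zero, clusterSeed_Λ]
    exact congrFun (congrFun this i) k
  · fin_cases i <;> fin_cases k <;> simp [SeedData.mutate, clusterSeed, hp, hr] <;> ring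

theorem mutate_one (j : ℤ) :
    (clusterSeed x a b (j + 1)).mutate 1 = (clusterSeed x a b j).swap := by
  have e2 : j + 1 + 1 = j + 2 := by ring
  have hl := lamSeq_succ j
  have hp := pSeq_succ j
  have hr := rSeq_succ j
  have hp' := max_sub_max_neg (pSeq (j + 1))
  have hr' := max_sub_max_neg (rSeq (j + 1))
  rw [clusterSeed_swap]
  refine seed_ext (fun i => ?_) (fun i k => ?_) fun i k => ?_
  · have := h.exchange_one j
    simp only [SeedData.mutate, this]
    fin_cases i <;> simp [clusterSeed]
  · have := transpose_mul_mul_one (lamSeq (j + 1)) (pSeq (j + 1)) (rSeq (j + 1)) (pSeq (j + 2))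
      (rSeq (j + 2)) (max (rSeq (j + 1)) 0) (max (-pSeq (j + 1)) 0)
    have t1 : -lamSeq (j + 1) + 2 * max (-pSeq (j + 1)) 0 * rSeq (j + 1) +
        2 * max (rSeq (j + 1)) 0 * pSeq (j + 1) = -lamSeq j := by
      rw [hl]; linear_combination -2 * rSeq (j + 1) * hp' + 2 * pSeq (j + 1) * hr'
    have t2 : 2 * pSeq (j + 1) - pSeq (j + 2) + 2 * max (-pSeq (j + 1)) 0 = pSeq j := by
      rw [hp]; linear_combination -2 * hp'
    have t3 : 2 * rSeq (j + 1) - rSeq (j + 2) - 2 * max (rSeq (j + 1)) 0 = rSeq j := by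
      rw [hr]; linear_combination -2 * hr'
    rw [t1, t2, t3, neg_neg] at this
    rw [SeedData.mutate_Λ, clusterSeed_mutE_one, clusterSeed_Λ, e2]
    exact congrFun (congrFun this i) k
  · fin_cases i <;> fin_cases k <;> simp [SeedData.mutate, clusterSeed, e2, hp, hr] <;>
      linear_combination 0 * hp'

end ClusterRelations

/-! ### The relations between the elements `X_n` -/

section Relations

variable {D : Type*} [DivisionRing D] [Algebra 𝕂 D] {w : Fin 4 → D}

theorem clusterVar_eq_pos (w : Fin 4 → D) {j : ℤ} {n : ℕ} (hj : j = n + 2) :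
    clusterVar w j = v⁻¹ • pos q w n := by rw [hj, clusterVar_pos]

theorem clusterVar_eq_neg (w : Fin 4 → D) {j : ℤ} {n : ℕ} (hj : j = 1 - n) :
    clusterVar w j = v⁻¹ • neg q w n := by rw [hj, clusterVar_neg]

theorem clusterVar_one (w : Fin 4 → D) : clusterVar w 1 = v⁻¹ • w 1 :=
  clusterVar_eq_neg w (n := 0) rfl

theorem clusterVar_zero (w : Fin 4 → D) : clusterVar w 0 = v⁻¹ • w 0 :=
  clusterVar_eq_neg w (n := 1) rfl

/-- The reflection j ↦ 3 - j through the opposite algebra; it reduces statements on indices at most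
1 to indices at least 2. -/
theorem clusterVar_opFamily (w : Fin 4 → D) {j : ℤ} (hj : j ≤ 1) :
    clusterVar (opFamily w) (3 - j) = MulOpposite.op (clusterVar w j) := by
  obtain ⟨n, hn⟩ := Int.eq_ofNat_of_zero_le (sub_nonneg.2 hj)
  rw [clusterVar_eq_pos (opFamily w) (n := n) (by omega),
    clusterVar_eq_neg w (n := n) (by omega), MulOpposite.op_smul, neg, MulOpposite.op_unop]

theorem pSeq_of_nonneg {j : ℤ} (hj : 0 ≤ j) : pSeq j = j - 1 := by
  rw [pSeq, abs_of_nonneg hj]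

theorem rSeq_of_le {j : ℤ} (hj : 3 ≤ j) : rSeq j = 4 - j := by
  rw [rSeq, abs_of_nonneg (by omega)]; ring

theorem lamSeq_of_le {j : ℤ} (hj : 3 ≤ j) : lamSeq j = 2 := by
  rw [lamSeq, pSeq_of_nonneg (by omega), pSeq_of_nonneg (by omega), rSeq_of_le hj,
    rSeq_of_le (by omega)]
  ring

theorem smul_quasiCommute {x y : D} {c : 𝕂} (h : x * y = c • (y * x)) (s t : 𝕂) :
    (s • x) * (t • y) = c • ((t • y) * (s • x)) := by
  rw [smul_mul_smul_comm, smul_mul_smul_comm, h, smul_comm, mul_comm s]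

theorem smul_quasiCommute_left {x y : D} {c : 𝕂} (h : x * y = c • (y * x)) (s : 𝕂) :
    (s • x) * y = c • (y * (s • x)) := by
  rw [smul_mul_assoc, mul_smul_comm, h, smul_comm]

theorem Straightening.clusterVar_comm_of_le (h : Straightening q w) {j : ℤ} (hj : 2 ≤ j) :
    clusterVar w j * clusterVar w (j + 1) =
      q ^ lamSeq j • (clusterVar w (j + 1) * clusterVar w j) := by
  obtain ⟨n, hn⟩ := Int.eq_ofNat_of_zero_le (show 0 ≤ j - 2 by omega)
  rw [clusterVar_eq_pos w (n := n) (j := j) (by omega), clusterVar_eq_pos w (n := n + 1)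
    (j := j + 1) (by push_cast; omega)]
  refine smul_quasiCommute ?_ _ _
  rcases n with _ | n
  · obtain rfl : j = 2 := by omega
    rw [show lamSeq 2 = -2 from rfl, zpow_neg]
    exact h.swap23
  · rw [lamSeq_of_le (by omega)]
    exact h.pos_comm n

theorem Straightening.clusterVar_y0_of_le (h : Straightening q w) {j : ℤ} (hj : 2 ≤ j) :
    clusterVar w j * y0 q w = q ^ (2 * pSeq j) • (y0 q w * clusterVar w j) := by
  obtain ⟨n, hn⟩ := Int.eq_ofNat_of_zero_le (show 0 ≤ j - 2 by omega)
  rw [clusterVar_eq_pos w (n := n) (j := j) (by omega)]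
  refine smul_quasiCommute_left ?_ _
  rw [h.pos_y0, pSeq_of_nonneg (by omega), ← zpow_natCast]
  congr 2
  push_cast; omega

theorem Straightening.clusterVar_y1_of_le (h : Straightening q w) {j : ℤ} (hj : 2 ≤ j) :
    clusterVar w j * y1 q w = q ^ (2 * rSeq j) • (y1 q w * clusterVar w j) := by
  obtain ⟨n, hn⟩ := Int.eq_ofNat_of_zero_le (show 0 ≤ j - 2 by omega)
  rw [clusterVar_eq_pos w (n := n) (j := j) (by omega)]
  refine smul_quasiCommute_left ?_ _
  rcases n with _ | n
  · obtain rfl : j = 2 := by omega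
    rw [show 2 * rSeq 2 = 0 from rfl, zpow_zero]
    exact h.u2_y1
  · rw [h.pos_y1, rSeq_of_le (by omega), inv_pow, ← pow_mul, ← zpow_natCast, ← zpow_natCast,
      ← zpow_neg, ← zpow_add₀ q_ne_zero]
    congr 2
    push_cast; omega

theorem Straightening.clusterVar_exchange_of_le (h : Straightening q w) {j : ℤ} (hj : 2 ≤ j) :
    clusterVar w j * clusterVar w (j + 2) = v ^ exchExp₁ j • (clusterVar w (j + 1) ^ 2 *
      y0 q w ^ max (rSeq (j + 1)) 0 * y1 q w ^ max (-pSeq (j + 1)) 0) +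
      v ^ exchExp₂ j • (y0 q w ^ max (-rSeq (j + 1)) 0 * y1 q w ^ max (pSeq (j + 1)) 0) := by
  obtain ⟨n, hn⟩ := Int.eq_ofNat_of_zero_le (show 0 ≤ j - 2 by omega)
  rw [clusterVar_eq_pos w (n := n) (j := j) (by omega), clusterVar_eq_pos w (n := n + 1)
    (j := j + 1) (by push_cast; omega), clusterVar_eq_pos w (n := n + 2) (j := j + 2)
    (by push_cast; omega)]
  -- The index 2 is separate: there X₃² comes with Y₀, while for larger indices the squared term has
  -- no frozen factor.
  rcases n with _ | n
  · obtain rfl : j = 2 := by omega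
    have e := h.pos_y0 1
    have e' : pos q w 1 ^ 2 * y0 q w = (q ^ 4 * q ^ 4) • (y0 q w * pos q w 1 ^ 2) := by
      rw [pow_two]; exact commute_smul_mul e e
    rw [show exchExp₁ 2 = -10 from rfl, show exchExp₂ 2 = 0 from rfl,
      show max (rSeq (2 + 1)) 0 = 1 from rfl, show max (-pSeq (2 + 1)) 0 = 0 from rfl,
      show max (-rSeq (2 + 1)) 0 = 0 from rfl, show max (pSeq (2 + 1)) 0 = 2 from rfl]
    rw [smul_mul_smul_comm, smul_pow, zpow_one, zpow_zero, zpow_zero, zpow_zero, mul_one, one_mul,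
      one_smul, smul_mul_assoc, e', zpow_ofNat, smul_smul, smul_smul]
    refine (congrArg _ h.exchange_two).trans ?_
    rw [smul_add, smul_smul, smul_smul, pow_two (pos q w 1), pow_two (y1 q w)]
    have hv := v_ne_zero
    congr 1
    · refine congrArg (fun c : 𝕂 => c • _) ?_
      rw [q, show (-10 : ℤ) = -((10 : ℕ) : ℤ) from rfl, zpow_neg, zpow_natCast]
      field_simp
    · convert one_smul 𝕂 _ using 2
      rw [q]; field_simp
  · have t1 : max (rSeq (j + 1)) 0 = 0 := by rw [rSeq_of_le (by omega)]; omega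
    have t2 : max (-pSeq (j + 1)) 0 = 0 := by rw [pSeq_of_nonneg (by omega)]; omega
    have t3 : max (-rSeq (j + 1)) 0 = n := by rw [rSeq_of_le (by omega)]; push_cast at hn; omega
    have t4 : max (pSeq (j + 1)) 0 = (n + 3 : ℕ) := by
      rw [pSeq_of_nonneg (by omega)]; push_cast at hn ⊢; omega
    have t5 : exchExp₁ j = 4 := by rw [exchExp₁, t1, t2, lamSeq_of_le (by omega)]; ring
    have t6 : exchExp₂ j = 2 * (2 * ((n + 1) * (n + 2)) : ℕ) - 2 := by
      obtain rfl : j = n + 3 := by push_cast at hn; omega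
      rw [exchExp₂, t3, t4, pSeq_of_nonneg (by omega), rSeq_of_le (by omega)]; push_cast; ring
    have hv := v_ne_zero
    rw [t5, t6, t1, t2, t3, t4, zpow_zero, zpow_zero, mul_one, mul_one, zpow_natCast, zpow_natCast,
      smul_mul_smul_comm, h.exchange_pos, smul_add, smul_pow, pow_two (pos q w (n + 1 + 1)),
      smul_smul, smul_smul, smul_smul]
    congr 2
    · rw [q, zpow_ofNat]; field_simp
    · rw [zpow_sub₀ hv, ← q_zpow, zpow_natCast, zpow_ofNat]; field_simp

theorem y0_opFamily (w : Fin 4 → D) : y0 q (opFamily w) = MulOpposite.op (y1 q w) := rfl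

theorem y1_opFamily (w : Fin 4 → D) : y1 q (opFamily w) = MulOpposite.op (y0 q w) := rfl

theorem zz_opFamily (w : Fin 4 → D) : zz q (opFamily w) = MulOpposite.op (zz q w) := rfl

theorem pSeq_three_sub (j : ℤ) : pSeq (3 - j) = -rSeq j := by
  rw [pSeq, rSeq, abs_sub_comm]; ring

theorem rSeq_three_sub (j : ℤ) : rSeq (3 - j) = -pSeq j := by
  rw [pSeq, rSeq, show 3 - j - 3 = -j by ring, abs_neg]; ring

theorem lamSeq_two_sub (j : ℤ) : lamSeq (2 - j) = lamSeq j := by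
  rw [lamSeq, lamSeq, show 2 - j + 1 = 3 - j by ring, show 2 - j = 3 - (j + 1) by ring,
    pSeq_three_sub, pSeq_three_sub, rSeq_three_sub, rSeq_three_sub]
  ring

theorem exchExp₂_one_sub (j : ℤ) : exchExp₂ (1 - j) = exchExp₂ j := by
  rw [exchExp₂, exchExp₂, show 1 - j + 1 = 3 - (j + 1) by ring, show 1 - j = 3 - (j + 2) by ring,
    pSeq_three_sub, pSeq_three_sub, rSeq_three_sub, rSeq_three_sub, pSeq_succ, rSeq_succ]
  simp only [neg_neg]
  ring

/-- In the reflected relation the frozen factors stand on the other side of the square of the middle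
variable; the extra summand is the cost of moving them across. -/
theorem exchExp₁_one_sub (j : ℤ) : exchExp₁ (1 - j) = exchExp₁ j +
    8 * (pSeq (j + 1) * max (rSeq (j + 1)) 0 + rSeq (j + 1) * max (-pSeq (j + 1)) 0) := by
  have hp := max_sub_max_neg (pSeq (j + 1))
  have hr := max_sub_max_neg (rSeq (j + 1))
  rw [exchExp₁, exchExp₁, show 1 - j = 2 - (j + 1) by ring, lamSeq_two_sub, lamSeq_succ,
    show 2 - (j + 1) + 1 = 3 - (j + 1) by ring, show 2 - (j + 1) = 3 - (j + 2) by ring,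
    pSeq_three_sub, pSeq_three_sub, rSeq_three_sub, rSeq_three_sub, pSeq_succ, rSeq_succ, neg_neg]
  linear_combination -4 * max (-rSeq (j + 1)) 0 * hp - 4 * max (pSeq (j + 1)) 0 * hr

namespace Straightening

variable (h : Straightening q w)
include h

theorem clusterVar_comm (j : ℤ) : clusterVar w j * clusterVar w (j + 1) =
    q ^ lamSeq j • (clusterVar w (j + 1) * clusterVar w j) := by
  rcases lt_trichotomy j 1 with hj | rfl | hj
  · have := h.op.clusterVar_comm_of_le (j := 2 - j) (by omega)
    rw [show 2 - j + 1 = 3 - j by ring, show 2 - j = 3 - (j + 1) by ring,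
      clusterVar_opFamily w hj.le, clusterVar_opFamily w (show j + 1 ≤ 1 by omega),
      show 3 - (j + 1) = 2 - j by ring, lamSeq_two_sub] at this
    exact congrArg MulOpposite.unop this
  · have e2 : clusterVar w (1 + 1) = v⁻¹ • w 2 := clusterVar_eq_pos w (n := 0) rfl
    rw [e2, clusterVar_one]
    refine smul_quasiCommute ?_ _ _
    rw [show lamSeq 1 = -2 from rfl, zpow_neg]
    exact h.swap12
  · exact h.clusterVar_comm_of_le hj

theorem clusterVar_y0 (j : ℤ) :
    clusterVar w j * y0 q w = q ^ (2 * pSeq j) • (y0 q w * clusterVar w j) := by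
  rcases le_or_gt j 1 with hj | hj
  · have := h.op.clusterVar_y1_of_le (j := 3 - j) (by omega)
    rw [clusterVar_opFamily w hj, y1_opFamily, rSeq_three_sub] at this
    have := mul_comm_of_eq_smul (zpow_ne_zero _ q_ne_zero) (congrArg MulOpposite.unop this)
    rw [← zpow_neg, mul_neg, neg_neg] at this
    exact this
  · exact h.clusterVar_y0_of_le hj

theorem clusterVar_y1 (j : ℤ) :
    clusterVar w j * y1 q w = q ^ (2 * rSeq j) • (y1 q w * clusterVar w j) := by
  rcases le_or_gt j 1 with hj | hj
  · have := h.op.clusterVar_y0_of_le (j := 3 - j) (by omega)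
    rw [clusterVar_opFamily w hj, y0_opFamily, pSeq_three_sub] at this
    have := mul_comm_of_eq_smul (zpow_ne_zero _ q_ne_zero) (congrArg MulOpposite.unop this)
    rw [← zpow_neg, mul_neg, neg_neg] at this
    exact this
  · exact h.clusterVar_y1_of_le hj

/-- For j = 0 and j = 1 the relation restates the definitions of Y₀ and Y₁; larger indices come from
the recursion, smaller ones from the reflection. -/
theorem clusterVar_exchange (j : ℤ) :
    clusterVar w j * clusterVar w (j + 2) = v ^ exchExp₁ j • (clusterVar w (j + 1) ^ 2 *
      y0 q w ^ max (rSeq (j + 1)) 0 * y1 q w ^ max (-pSeq (j + 1)) 0) +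
      v ^ exchExp₂ j • (y0 q w ^ max (-rSeq (j + 1)) 0 * y1 q w ^ max (pSeq (j + 1)) 0) := by
  rcases le_or_gt 2 j with hj | hj
  · exact h.clusterVar_exchange_of_le hj
  have hv := v_ne_zero
  have x2 : clusterVar w 2 = v⁻¹ • w 2 := clusterVar_eq_pos w (n := 0) rfl
  have x3 : clusterVar w 3 = v⁻¹ • w 3 := clusterVar_eq_pos w (n := 1) rfl
  obtain rfl | rfl | hj : j = 1 ∨ j = 0 ∨ j ≤ -1 := by omega
  · rw [show exchExp₁ 1 = -4 from rfl, show exchExp₂ 1 = -2 from rfl,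
      show max (rSeq (1 + 1)) 0 = 0 from rfl, show max (-pSeq (1 + 1)) 0 = 0 from rfl,
      show max (-rSeq (1 + 1)) 0 = 0 from rfl, show max (pSeq (1 + 1)) 0 = 1 from rfl,
      show (1 : ℤ) + 2 = 3 from rfl, show (1 : ℤ) + 1 = 2 from rfl, zpow_one, zpow_zero, zpow_zero,
      mul_one, mul_one, one_mul, x2, x3, clusterVar_one, smul_mul_smul_comm, smul_pow, smul_smul,
      h.y1_eq_swap, smul_sub, smul_smul, pow_two (w 2)]
    rw [show v⁻¹ * v⁻¹ = v ^ (-2 : ℤ) by rw [zpow_neg, zpow_ofNat]; field_simp,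
      show v ^ (-4 : ℤ) * v⁻¹ ^ 2 = v ^ (-2 : ℤ) * (q ^ 2)⁻¹ by
        rw [q, zpow_neg, zpow_neg, zpow_ofNat, zpow_ofNat]; field_simp]
    abel
  · rw [show exchExp₁ 0 = -4 from rfl, show exchExp₂ 0 = -2 from rfl,
      show max (rSeq (0 + 1)) 0 = 0 from rfl, show max (-pSeq (0 + 1)) 0 = 0 from rfl,
      show max (-rSeq (0 + 1)) 0 = 1 from rfl, show max (pSeq (0 + 1)) 0 = 0 from rfl,
      show (0 : ℤ) + 2 = 2 from rfl, show (0 : ℤ) + 1 = 1 from rfl, zpow_one, zpow_zero, zpow_zero,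
      mul_one, mul_one, mul_one, x2, clusterVar_zero, clusterVar_one, smul_mul_smul_comm, smul_pow,
      smul_smul, h.y0_eq_swap, smul_sub, smul_smul, pow_two (w 1)]
    rw [show v⁻¹ * v⁻¹ = v ^ (-2 : ℤ) by rw [zpow_neg, zpow_ofNat]; field_simp,
      show v ^ (-4 : ℤ) * v⁻¹ ^ 2 = v ^ (-2 : ℤ) * (q ^ 2)⁻¹ by
        rw [q, zpow_neg, zpow_neg, zpow_ofNat, zpow_ofNat]; field_simp]
    abel
  · have := h.op.clusterVar_exchange_of_le (j := 1 - j) (by omega)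
    rw [show 1 - j + 2 = 3 - j by ring, show 1 - j + 1 = 3 - (j + 1) by ring,
      congrArg (clusterVar (opFamily w)) (show 1 - j = 3 - (j + 2) by ring),
      clusterVar_opFamily w (show j ≤ 1 by omega),
      clusterVar_opFamily w (show j + 1 ≤ 1 by omega),
      clusterVar_opFamily w (show j + 2 ≤ 1 by omega), pSeq_three_sub, rSeq_three_sub, neg_neg,
      neg_neg, exchExp₂_one_sub, exchExp₁_one_sub, y0_opFamily, y1_opFamily] at this
    refine (congrArg MulOpposite.unop this).trans ?_
    simp only [MulOpposite.unop_add, MulOpposite.unop_smul, MulOpposite.unop_mul,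
      MulOpposite.unop_pow, MulOpposite.unop_op, MulOpposite.unop_zpow]
    congr 1
    have ea := zpow_mul_zpow_of_quasiCommute q_ne_zero (h.clusterVar_y0 (j + 1)) 2
      (max (rSeq (j + 1)) 0)
    have eb := zpow_mul_zpow_of_quasiCommute q_ne_zero (h.clusterVar_y1 (j + 1)) 2
      (max (-pSeq (j + 1)) 0)
    rw [zpow_ofNat] at ea eb
    rw [ea, smul_mul_assoc, mul_assoc (y0 q w ^ _) (clusterVar w (j + 1) ^ 2), eb, mul_smul_comm,
      smul_smul, smul_smul, q_zpow, q_zpow,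
      ← zpow_add₀ hv, ← zpow_add₀ hv, mul_assoc]
    congr 2
    ring

theorem clusterVar_zz_of_le {j : ℤ} (hj : 3 ≤ j) : ∃ (m : ℕ) (c d : 𝕂), c ≠ 0 ∧ d ≠ 0 ∧
    zz q w * clusterVar w j =
      c • clusterVar w (j + 1) + d • (y0 q w ^ m * y1 q w * clusterVar w (j - 1)) := by
  have hq := q_ne_zero
  obtain ⟨n, hn⟩ := Int.eq_ofNat_of_zero_le (show 0 ≤ j - 3 by omega)
  rw [clusterVar_eq_pos w (n := n + 1) (j := j) (by push_cast; omega), clusterVar_eq_pos w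
    (n := n + 2) (j := j + 1) (by push_cast; omega), clusterVar_eq_pos w (n := n) (j := j - 1)
    (by omega)]
  have key : ∀ {x y z : D} {d : 𝕂}, z = q • x - d • y →
      v⁻¹ • x = q⁻¹ • (v⁻¹ • z) + (q⁻¹ * d) • (v⁻¹ • y) := by
    intro x y z d e
    have ex : x = q⁻¹ • z + (q⁻¹ * d) • y := by
      rw [e, mul_smul, ← smul_add, sub_add_cancel, smul_smul, inv_mul_cancel₀ hq, one_smul]
    rw [smul_comm q⁻¹, smul_comm (q⁻¹ * d), ← smul_add, ← ex]
  rcases n with _ | n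
  · refine ⟨0, q⁻¹, q⁻¹ * q⁻¹, by simp [hq], by simp [hq], ?_⟩
    rw [pow_zero, one_mul, mul_smul_comm, mul_smul_comm]
    exact key h.pos_two
  · refine ⟨1, q⁻¹, q⁻¹ * q ^ 4, by simp [hq], by simp [hq], ?_⟩
    rw [pow_one, mul_smul_comm, mul_smul_comm, mul_assoc]
    exact key (h.pos_succ n)

/-- All consequences come from the linear relation between z, x_j and the neighbours of x_j, whose
coefficients are units of T. Finding z requires the inverse of x_j, but moving from one neighbour to
the other does not. For j ≤ 0 the factor z stands on the right, by reflection. -/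
theorem mem_iff_mem_clusterVar (hx : ∀ j, clusterVar w j ≠ 0) (ha : y0 q w ≠ 0) (hb : y1 q w ≠ 0)
    (T : Subalgebra 𝕂 D) (ha₁ : y0 q w ∈ T) (ha₂ : (y0 q w)⁻¹ ∈ T) (hb₁ : y1 q w ∈ T)
    (hb₂ : (y1 q w)⁻¹ ∈ T) (j : ℤ) :
    (clusterVar w (j - 1) ∈ T → clusterVar w j ∈ T → (clusterVar w j)⁻¹ ∈ T →
      clusterVar w (j + 1) ∈ T → zz q w ∈ T) ∧
    (zz q w ∈ T → clusterVar w j ∈ T → (clusterVar w (j - 1) ∈ T ↔ clusterVar w (j + 1) ∈ T)) := by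
  have left : ∀ {x y z A B C : D}, x ≠ 0 → A ≠ 0 → A ∈ T → A⁻¹ ∈ T → B ≠ 0 → B ∈ T → B⁻¹ ∈ T →
      C * x = A * y + B * z → (z ∈ T → x ∈ T → x⁻¹ ∈ T → y ∈ T → C ∈ T) ∧
        (C ∈ T → x ∈ T → (z ∈ T ↔ y ∈ T)) := by
    intro x y z A B C hx hA hA₁ hA₂ hB hB₁ hB₂ e
    refine ⟨fun hz _ hx' hy => ?_, fun hC hx' => ⟨fun hz => ?_, fun hy => ?_⟩⟩
    · rw [(eq_mul_inv_iff_mul_eq₀ hx).2 e]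
      exact mul_mem (add_mem (mul_mem hA₁ hy) (mul_mem hB₁ hz)) hx'
    · rw [← inv_mul_cancel_left₀ hA y, ← sub_eq_iff_eq_add.2 e]
      exact mul_mem hA₂ (sub_mem (mul_mem hC hx') (mul_mem hB₁ hz))
    · rw [← inv_mul_cancel_left₀ hB z, ← sub_eq_iff_eq_add'.2 e]
      exact mul_mem hB₂ (sub_mem (mul_mem hC hx') (mul_mem hA₁ hy))
  have right : ∀ {x y z A B C : D}, x ≠ 0 → A ≠ 0 → A ∈ T → A⁻¹ ∈ T → B ≠ 0 → B ∈ T → B⁻¹ ∈ T →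
      x * C = y * A + z * B → (z ∈ T → x ∈ T → x⁻¹ ∈ T → y ∈ T → C ∈ T) ∧
        (C ∈ T → x ∈ T → (z ∈ T ↔ y ∈ T)) := by
    intro x y z A B C hx hA hA₁ hA₂ hB hB₁ hB₂ e
    refine ⟨fun hz _ hx' hy => ?_, fun hC hx' => ⟨fun hz => ?_, fun hy => ?_⟩⟩
    · rw [(eq_inv_mul_iff_mul_eq₀ hx).2 e]
      exact mul_mem hx' (add_mem (mul_mem hy hA₁) (mul_mem hz hB₁))
    · rw [← mul_inv_cancel_right₀ hA y, ← sub_eq_iff_eq_add.2 e]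
      exact mul_mem (sub_mem (mul_mem hx' hC) (mul_mem hz hB₁)) hA₂
    · rw [← mul_inv_cancel_right₀ hB z, ← sub_eq_iff_eq_add'.2 e]
      exact mul_mem (sub_mem (mul_mem hx' hC) (mul_mem hy hA₁)) hB₂
  have inv_smul : ∀ {c : 𝕂} {x : D}, x⁻¹ ∈ T → (c • x)⁻¹ ∈ T := by
    intro c x hx
    rw [smul_inv₀]
    exact T.smul_mem hx _
  have hq2 : q ^ 2 ≠ 0 := pow_ne_zero _ q_ne_zero
  have x2 : clusterVar w 2 = v⁻¹ • w 2 := clusterVar_eq_pos w (n := 0) rfl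
  have x3 : clusterVar w 3 = v⁻¹ • w 3 := clusterVar_eq_pos w (n := 1) rfl
  have mid : ∀ {x y z : D}, zz q w * x = q ^ 2 • (y0 q w * y) + (q ^ 2)⁻¹ • (y1 q w * z) →
      zz q w * (v⁻¹ • x) = (q ^ 2 • y0 q w) * (v⁻¹ • y) + ((q ^ 2)⁻¹ • y1 q w) * (v⁻¹ • z) := by
    intro x y z e
    rw [mul_smul_comm, e, smul_add, smul_mul_assoc, smul_mul_assoc, mul_smul_comm, mul_smul_comm,
      smul_comm v⁻¹, smul_comm v⁻¹]
  have units : q ^ 2 • y0 q w ≠ 0 ∧ q ^ 2 • y0 q w ∈ T ∧ (q ^ 2 • y0 q w)⁻¹ ∈ T ∧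
      (q ^ 2)⁻¹ • y1 q w ≠ 0 ∧ (q ^ 2)⁻¹ • y1 q w ∈ T ∧ ((q ^ 2)⁻¹ • y1 q w)⁻¹ ∈ T :=
    ⟨smul_ne_zero hq2 ha, T.smul_mem ha₁ _, inv_smul ha₂, smul_ne_zero (inv_ne_zero hq2) hb,
      T.smul_mem hb₁ _, inv_smul hb₂⟩
  obtain ⟨A₁, A₂, A₃, B₁, B₂, B₃⟩ := units
  obtain hj | rfl | rfl | hj : 3 ≤ j ∨ j = 2 ∨ j = 1 ∨ j ≤ 0 := by omega
  · obtain ⟨m, c, d, hc, hd, e⟩ := h.clusterVar_zz_of_le hj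
    refine left (hx j) (A := algebraMap 𝕂 D c) (B := d • (y0 q w ^ m * y1 q w)) (by simpa)
      (T.algebraMap_mem c) ?_ (smul_ne_zero hd (mul_ne_zero (pow_ne_zero _ ha) hb))
      (T.smul_mem (mul_mem (pow_mem ha₁ _) hb₁) _) (inv_smul ?_) ?_
    · rw [← map_inv₀]; exact T.algebraMap_mem _
    · rw [mul_inv_rev, ← inv_pow]; exact mul_mem hb₂ (pow_mem ha₂ _)
    · rw [e, Algebra.smul_def, smul_mul_assoc]
  · refine left (hx 2) A₁ A₂ A₃ B₁ B₂ B₃ ?_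
    rw [show (2 : ℤ) + 1 = 3 from rfl, show (2 : ℤ) - 1 = 1 from rfl, x2, x3, clusterVar_one]
    exact mid h.zz_u2
  · refine left (hx 1) A₁ A₂ A₃ B₁ B₂ B₃ ?_
    rw [show (1 : ℤ) + 1 = 2 from rfl, show (1 : ℤ) - 1 = 0 from rfl, x2, clusterVar_zero,
      clusterVar_one]
    exact mid h.zz_u1
  · obtain ⟨m, c, d, hc, hd, e⟩ := h.op.clusterVar_zz_of_le (j := 3 - j) (by omega)
    rw [show 3 - j + 1 = 3 - (j - 1) by ring, show 3 - j - 1 = 3 - (j + 1) by ring,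
      clusterVar_opFamily w (show j ≤ 1 by omega), clusterVar_opFamily w (show j - 1 ≤ 1 by omega),
      clusterVar_opFamily w (show j + 1 ≤ 1 by omega), y0_opFamily, y1_opFamily, zz_opFamily] at e
    have e := congrArg MulOpposite.unop e
    simp only [MulOpposite.unop_add, MulOpposite.unop_smul, MulOpposite.unop_mul,
      MulOpposite.unop_pow, MulOpposite.unop_op] at e
    refine right (hx j) (y := clusterVar w (j + 1)) (z := clusterVar w (j - 1)) (A := d • (y0 q w * y1 q w ^ m)) (B := algebraMap 𝕂 D c)
      (smul_ne_zero hd (mul_ne_zero ha (pow_ne_zero _ hb)))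
      (T.smul_mem (mul_mem ha₁ (pow_mem hb₁ _)) _) (inv_smul ?_) (by simpa) (T.algebraMap_mem c) ?_
      (e.trans ?_)
    · rw [mul_inv_rev, ← inv_pow]; exact mul_mem (pow_mem hb₂ _) ha₂
    · rw [← map_inv₀]; exact T.algebraMap_mem _
    · rw [add_comm, Algebra.smul_def c, Algebra.commutes c, mul_smul_comm]

end Straightening

theorem Straightening.clusterRelations {F : Type} [DivisionRing F] [Algebra 𝕂 F] {w : Fin 4 → F}
    (h : Straightening q w) (hx : ∀ j, clusterVar w j ≠ 0) (ha : y0 q w ≠ 0) (hb : y1 q w ≠ 0) :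
    ClusterRelations (clusterVar w) (y0 q w) (y1 q w) where
  x_ne := hx
  a_ne := ha
  b_ne := hb
  comm_x := h.clusterVar_comm
  comm_a := h.clusterVar_y0
  comm_b := h.clusterVar_y1
  comm_ab := by
    rw [zpow_neg]
    exact mul_comm_of_eq_smul (pow_ne_zero _ q_ne_zero) h.y1_y0
  exch := h.clusterVar_exchange

end Relations

namespace ClusterRelations

variable {F : Type} [DivisionRing F] [Algebra 𝕂 F] {x : ℤ → F} {a b : F}
  (h : ClusterRelations x a b)
include h

/-- The weights with respect to the two frozen variables give |j| and |j - 3|, which together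
determine j. -/
theorem injective : Function.Injective x := by
  have key : ∀ {i j : ℤ} {c : F} {m n : ℤ}, c ≠ 0 → x i = x j → x i * c = q ^ m • (c * x i) →
      x j * c = q ^ n • (c * x j) → m = n := by
    intro i j c m n hc e h1 h2
    rw [e, h2] at h1
    exact (q_zpow_injective
      (smul_left_injective 𝕂 (mul_ne_zero hc (h.x_ne j)) h1)).symm
  intro i j e
  have h1 := key h.a_ne e (h.comm_a i) (h.comm_a j)
  have h2 := key h.b_ne e (h.comm_b i) (h.comm_b j)
  rw [pSeq, pSeq] at h1
  rw [rSeq, rSeq] at h2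
  grind

/-- The quantum torus of the seed with cluster `x_j, x_{j+1}`. -/
def torus (j : ℤ) : Subalgebra 𝕂 F :=
  quantumTorus q_ne_zero (h.seed_ne_zero j) (h.quasiComm j)

theorem mem_torus {j : ℤ} {f : F} : f ∈ h.torus j ↔
    f ∈ Submodule.span 𝕂 (Set.range (clusterSeed x a b j).frame) := by
  rw [SeedData.span_frame]; rfl

theorem zpow_mem_torus (j : ℤ) (i : Fin 4) (n : ℤ) : (clusterSeed x a b j).x i ^ n ∈ h.torus j := by
  have : ordMon (clusterSeed x a b j).x (Pi.single i n) = (clusterSeed x a b j).x i ^ n := by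
    rw [ordMon]
    fin_cases i <;> simp
  rw [← this]
  exact Submodule.subset_span ⟨_, rfl⟩

theorem inv_mem_torus (j : ℤ) (i : Fin 4) : ((clusterSeed x a b j).x i)⁻¹ ∈ h.torus j := by
  rw [← zpow_neg_one]; exact h.zpow_mem_torus j i _

theorem mem_torus_self (j : ℤ) (i : Fin 4) : (clusterSeed x a b j).x i ∈ h.torus j := by
  have := h.zpow_mem_torus j i 1
  rwa [zpow_one] at this

theorem pred_mem_torus (j : ℤ) : x (j - 1) ∈ h.torus j := by
  have e := h.exch (j - 1)
  rw [show j - 1 + 2 = j + 1 by ring, show j - 1 + 1 = j by ring] at e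
  rw [(eq_mul_inv_iff_mul_eq₀ (h.x_ne (j + 1))).2 e]
  refine mul_mem (add_mem (Subalgebra.smul_mem _ (mul_mem (mul_mem (pow_mem ?_ _) ?_) ?_) _)
    (Subalgebra.smul_mem _ (mul_mem ?_ ?_) _)) (h.inv_mem_torus j 1)
  · exact h.mem_torus_self j 0
  · exact h.zpow_mem_torus j 2 _
  · exact h.zpow_mem_torus j 3 _
  · exact h.zpow_mem_torus j 2 _
  · exact h.zpow_mem_torus j 3 _

variable {z : F} (hz : ∀ T : Subalgebra 𝕂 F, a ∈ T → a⁻¹ ∈ T → b ∈ T → b⁻¹ ∈ T → ∀ j : ℤ,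
    (x (j - 1) ∈ T → x j ∈ T → (x j)⁻¹ ∈ T → x (j + 1) ∈ T → z ∈ T) ∧
    (z ∈ T → x j ∈ T → (x (j - 1) ∈ T ↔ x (j + 1) ∈ T)))
include hz

/-- The Laurent property. The torus contains x_{j-1}, x_j^{±1} and x_{j+1}, hence z; from there the
linear recursion reaches every index with division by frozen variables only. -/
theorem mem_torus_all (j i : ℤ) : x i ∈ h.torus j := by
  have H := hz (h.torus j) (h.mem_torus_self j 2) (h.inv_mem_torus j 2) (h.mem_torus_self j 3)
    (h.inv_mem_torus j 3)
  have hx : x j ∈ h.torus j := h.mem_torus_self j 0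
  have hx' : x (j + 1) ∈ h.torus j := h.mem_torus_self j 1
  have hZ := (H j).1 (h.pred_mem_torus j) hx (h.inv_mem_torus j 0) hx'
  suffices x i ∈ h.torus j ∧ x (i + 1) ∈ h.torus j from this.1
  induction i using Int.inductionOn' (b := j) with
  | zero => exact ⟨hx, hx'⟩
  | succ k _ ih =>
    refine ⟨ih.2, ?_⟩
    have := (H (k + 1)).2 hZ ih.2
    rw [show k + 1 - 1 = k by ring] at this
    exact this.1 ih.1
  | pred k _ ih =>
    rw [show k - 1 + 1 = k by ring]
    exact ⟨((H k).2 hZ ih.1).2 ih.2, ih.1⟩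

variable (hF : ∀ f : F, ∃ g ∈ Algebra.adjoin 𝕂 (Set.range x), ∃ g' ∈ Algebra.adjoin 𝕂 (Set.range x),
  g' ≠ 0 ∧ f = g * g'⁻¹)
include hF

theorem isQuantumSeed (j : ℤ) : (clusterSeed x a b j).IsQuantumSeed where
  compatible := clusterSeed_compatible x a b j
  quasiComm := h.quasiComm j
  linearIndependent := h.linearIndependent_frame j
  fractions f := by
    have hle : Algebra.adjoin 𝕂 (Set.range x) ≤ h.torus j := by
      refine Algebra.adjoin_le ?_
      rintro _ ⟨i, rfl⟩
      exact h.mem_torus_all hz j i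
    obtain ⟨g, hg, g', hg', hne, e⟩ := hF f
    exact ⟨g, h.mem_torus.1 (hle hg), g', h.mem_torus.1 (hle hg'), hne, e⟩

omit hz hF

theorem mutate_eq (j : ℤ) (k : Fin 2) : ∃ i, (clusterSeed x a b j).mutate k =
    (clusterSeed x a b i).swap := by
  fin_cases k
  · exact ⟨j + 1, h.mutate_zero j⟩
  · refine ⟨j - 1, ?_⟩
    have := h.mutate_one (j - 1)
    rwa [sub_add_cancel] at this

theorem swap_mutate (j : ℤ) (k : Fin 2) : (clusterSeed x a b j).swap.mutate k =
    ((clusterSeed x a b j).mutate (Equiv.swap 0 1 k)).swap := by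
  rw [← SeedData.mutate_swap (h.quasiComm j) (clusterSeed_compatible x a b j).1,
    Equiv.swap_apply_self]

/-- Each mutation shifts the index by one and interchanges the two positions, so up to ordering the
mutation class consists of seeds of the sequence. -/
theorem eq_of_reaches {n : ℤ} {S : SeedData F 2 2} (hS : (clusterSeed x a b n).Reaches S) :
    ∃ j, S = clusterSeed x a b j ∨ S = (clusterSeed x a b j).swap := by
  induction hS with
  | refl => exact ⟨n, Or.inl rfl⟩
  | tail _ hk ih =>
    obtain ⟨k, rfl⟩ := hk
    obtain ⟨j, rfl | rfl⟩ := ih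
    · obtain ⟨i, hi⟩ := h.mutate_eq j k
      exact ⟨i, Or.inr hi⟩
    · obtain ⟨i, hi⟩ := h.mutate_eq j (Equiv.swap 0 1 k)
      refine ⟨i, Or.inl ?_⟩
      rw [h.swap_mutate, hi, SeedData.swap_swap]

theorem exists_reaches (n j : ℤ) : ∃ S : SeedData F 2 2, (clusterSeed x a b n).Reaches S ∧
    (S = clusterSeed x a b j ∨ S = (clusterSeed x a b j).swap) := by
  have up : ∀ k : ℤ, (clusterSeed x a b k).mutate 0 = (clusterSeed x a b (k + 1)).swap :=
    h.mutate_zero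
  have down : ∀ k : ℤ, (clusterSeed x a b k).mutate 1 = (clusterSeed x a b (k - 1)).swap :=
    fun k => by
      have := h.mutate_one (k - 1)
      rwa [sub_add_cancel] at this
  induction j using Int.inductionOn' (b := n) with
  | zero => exact ⟨_, Relation.ReflTransGen.refl, Or.inl rfl⟩
  | succ k _ ih =>
    obtain ⟨S, hS, rfl | rfl⟩ := ih
    · exact ⟨_, hS.tail ⟨0, rfl⟩, Or.inr (up k)⟩
    · refine ⟨_, hS.tail ⟨1, rfl⟩, Or.inl ?_⟩
      rw [h.swap_mutate, Equiv.swap_apply_right, up, SeedData.swap_swap]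
  | pred k _ ih =>
    obtain ⟨S, hS, rfl | rfl⟩ := ih
    · exact ⟨_, hS.tail ⟨1, rfl⟩, Or.inr (down k)⟩
    · refine ⟨_, hS.tail ⟨0, rfl⟩, Or.inl ?_⟩
      rw [h.swap_mutate, Equiv.swap_apply_left, down, SeedData.swap_swap]

omit h in
theorem clusterSeed_x (j : ℤ) : (clusterSeed x a b j).x = ![x j, x (j + 1), a, b] := rfl

omit h in
theorem clusterSeed_swap_x (j : ℤ) : (clusterSeed x a b j).swap.x = ![x (j + 1), x j, a, b] := by
  rw [clusterSeed_swap]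

/-- Only the variables of S are prescribed, not its matrices. Since the x_j are distinct, the
cluster identifies the index and the ordering, and with them the seed. -/
theorem exchange_of_reaches {n : ℤ} {S : SeedData F 2 2}
    (hS : (clusterSeed x a b n).Reaches S) (j : ℤ) :
    (S.x = ![x j, x (j + 1), a, b] →
      S.exchange 0 = x (j + 2) ∧ S.exchange 1 = x (j - 1)) ∧
    (S.x = ![x (j + 1), x j, a, b] →
      S.exchange 1 = x (j + 2) ∧ S.exchange 0 = x (j - 1)) := by
  have h1 : (clusterSeed x a b j).exchange 1 = x (j - 1) := by
    have := h.exchange_one (j - 1)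
    rwa [sub_add_cancel] at this
  obtain ⟨i, rfl | rfl⟩ := h.eq_of_reaches hS
  · rw [clusterSeed_x]
    constructor
    · intro e
      obtain rfl : i = j := h.injective (congrFun e 0)
      exact ⟨h.exchange_zero i, h1⟩
    · intro e
      have e0 := h.injective (congrFun e 0)
      have e1 := h.injective (congrFun e 1)
      omega
  · rw [clusterSeed_swap_x]
    constructor
    · intro e
      have e0 := h.injective (congrFun e 0)
      have e1 := h.injective (congrFun e 1)
      omega
    · intro e
      obtain rfl : i = j := h.injective (congrFun e 1)
      have E := SeedData.exchange_swap (h.quasiComm i) (clusterSeed_compatible x a b i).1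
      exact ⟨(E 0).trans (h.exchange_zero i), (E 1).trans h1⟩

theorem setOf_reaches (n : ℤ) : {y : F | ∃ T : SeedData F 2 2,
    (clusterSeed x a b n).Reaches T ∧ ∃ i, y = T.x i} = Set.range x ∪ {a, b} := by
  ext y
  constructor
  · rintro ⟨T, hT, i, rfl⟩
    obtain ⟨j, rfl | rfl⟩ := h.eq_of_reaches hT
    · rw [clusterSeed_x]
      fin_cases i
      · exact Or.inl ⟨j, rfl⟩
      · exact Or.inl ⟨j + 1, rfl⟩
      · exact Or.inr (Or.inl rfl)
      · exact Or.inr (Or.inr rfl)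
    · rw [clusterSeed_swap_x]
      fin_cases i
      · exact Or.inl ⟨j + 1, rfl⟩
      · exact Or.inl ⟨j, rfl⟩
      · exact Or.inr (Or.inl rfl)
      · exact Or.inr (Or.inr rfl)
  · rintro (⟨j, rfl⟩ | rfl | rfl)
    · obtain ⟨S, hS, rfl | rfl⟩ := h.exists_reaches n j
      · exact ⟨_, hS, 0, rfl⟩
      · refine ⟨_, hS, 1, ?_⟩
        rw [clusterSeed_swap_x]; rfl
    · exact ⟨_, Relation.ReflTransGen.refl, 2, rfl⟩
    · exact ⟨_, Relation.ReflTransGen.refl, 3, rfl⟩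

end ClusterRelations

/-! ### The integral form -/

section Map

variable {k R S : Type*} [Field k] [Ring R] [Ring S] [Algebra k R] [Algebra k S]

theorem map_zz (φ : R →ₐ[k] S) (q : k)
    (w : Fin 4 → R) : φ (zz q w) = zz q (fun i => φ (w i)) := by
  simp only [zz, map_smul, map_sub, map_mul]

theorem map_pos (φ : R →ₐ[k] S) (q : k)
    (w : Fin 4 → R) : ∀ n, φ (pos q w n) = pos q (fun i => φ (w i)) n
  | 0 => rfl
  | 1 => rfl
  | 2 => by simp only [pos, map_smul, map_sub, map_mul, map_zz, map_y1, Function.comp_def]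
  | n + 3 => by
    simp only [pos, map_smul, map_sub, map_mul, map_zz, map_y0, map_y1, map_pos φ q w (n + 2),
      map_pos φ q w (n + 1), Function.comp_def]

theorem map_neg' (φ : R →ₐ[k] S) (q : k)
    (w : Fin 4 → R) (n : ℕ) : φ (neg q w n) = neg q (fun i => φ (w i)) n := by
  have := map_pos (AlgHom.op φ) q (opFamily w) n
  have e : (fun i => AlgHom.op φ (opFamily w i)) = opFamily fun i => φ (w i) := by
    funext i; fin_cases i <;> rfl
  rw [e] at this
  exact congrArg MulOpposite.unop this

theorem map_clusterVar [Algebra 𝕂 R] [Algebra 𝕂 S] (φ : R →ₐ[𝕂] S) (w : Fin 4 → R) (j : ℤ) :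
    φ (clusterVar w j) = clusterVar (fun i => φ (w i)) j := by
  rw [clusterVar, clusterVar]
  split_ifs
  · rw [map_smul, map_pos]
  · rw [map_smul, map_neg']

end Map

section Mem

variable {k R : Type*} [Field k] [Ring R] [Algebra k R] {q : k} {w : Fin 4 → R} {B : Subring R}

/-- The elements Y₀, Y₁, z and the recursion involve no denominators other than powers of q. This is
the source of integrality of the cluster variables. -/
theorem pos_mem (hq : ∀ x ∈ B, q • x ∈ B) (hq' : ∀ x ∈ B, q⁻¹ • x ∈ B) (hw : ∀ i, w i ∈ B)
    (n : ℕ) : pos q w n ∈ B ∧ y0 q w ∈ B ∧ y1 q w ∈ B := by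
  have hp : ∀ (m : ℕ) (x : R), x ∈ B → q ^ m • x ∈ B := by
    intro m x hx
    induction m with
    | zero => simpa
    | succ m ih => rw [pow_succ', mul_smul]; exact hq _ ih
  have hp' : ∀ x ∈ B, (q ^ 2)⁻¹ • x ∈ B := by
    intro x hx
    rw [pow_two, mul_inv, mul_smul]
    exact hq' _ (hq' _ hx)
  have h0 : y0 q w ∈ B := hp' _ (sub_mem (mul_mem (hw _) (hw _)) (hp _ _ (mul_mem (hw _) (hw _))))
  have h1 : y1 q w ∈ B := hp' _ (sub_mem (mul_mem (hw _) (hw _)) (hp _ _ (mul_mem (hw _) (hw _))))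
  have hz : zz q w ∈ B := hp' _ (sub_mem (mul_mem (hw _) (hw _)) (hp _ _ (mul_mem (hw _) (hw _))))
  refine ⟨?_, h0, h1⟩
  induction n using Nat.strong_induction_on with
  | _ n ih =>
    match n with
    | 0 => exact hw 2
    | 1 => exact hw 3
    | 2 => exact sub_mem (hq _ (mul_mem hz (hw 3))) (hq' _ (mul_mem h1 (hw 2)))
    | n + 3 =>
      exact sub_mem (hq _ (mul_mem hz (ih (n + 2) (by omega))))
        (hp _ _ (mul_mem h0 (mul_mem h1 (ih (n + 1) (by omega)))))

theorem neg_mem' (hq : ∀ x ∈ B, q • x ∈ B) (hq' : ∀ x ∈ B, q⁻¹ • x ∈ B) (hw : ∀ i, w i ∈ B)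
    (n : ℕ) : neg q w n ∈ B := by
  have := (pos_mem (B := B.op) (w := opFamily w) (q := q) (fun x hx => hq _ hx) (fun x hx => hq' _ hx)
    (fun i => ?_) n).1
  · exact this
  · fin_cases i
    · exact hw 3
    · exact hw 2
    · exact hw 1
    · exact hw 0

end Mem

theorem v_mem_Zv : v ∈ Zv := Algebra.subset_adjoin (Or.inl rfl)

theorem v_inv_mem_Zv : v⁻¹ ∈ Zv := Algebra.subset_adjoin (Or.inr rfl)

theorem q_mem_Zv : q ∈ Zv := pow_mem v_mem_Zv 2

theorem q_inv_mem_Zv : q⁻¹ ∈ Zv := by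
  rw [q, ← inv_pow]; exact pow_mem v_inv_mem_Zv 2

section IntegralForm

variable {R : Type*} [Ring R] [Algebra 𝕂 R] {w : Fin 4 → R}

/-- The `ℤ[q^{±1/2}]`-subalgebra spanned by the ordered monomials. -/
def Straightening.integralSubalgebra (h : Straightening q w) : Subalgebra Zv R :=
  (Submodule.span Zv (Set.range (mon w))).toSubalgebra
    (Submodule.subset_span ⟨0, by simp [mon]⟩)
    (fun _ _ hx hy => h.span_mul_mem (by
      rw [← inv_pow]; exact pow_mem q_inv_mem_Zv 2) hx hy)

theorem smul_mem_of_mem_Zv (B : Subalgebra Zv R) {c : 𝕂} (hc : c ∈ Zv) {x : R} (hx : x ∈ B) :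
    c • x ∈ B :=
  B.smul_mem hx (⟨c, hc⟩ : Zv)

theorem clusterVar_mem (B : Subalgebra Zv R) (hw : ∀ i, w i ∈ B) (j : ℤ) :
    clusterVar w j ∈ B := by
  have hq : ∀ x ∈ B.toSubring, q • x ∈ B.toSubring := fun x hx => smul_mem_of_mem_Zv B q_mem_Zv hx
  have hq' : ∀ x ∈ B.toSubring, q⁻¹ • x ∈ B.toSubring :=
    fun x hx => smul_mem_of_mem_Zv B q_inv_mem_Zv hx
  rw [clusterVar]
  split_ifs
  · exact smul_mem_of_mem_Zv B v_inv_mem_Zv (pos_mem (B := B.toSubring) hq hq' hw _).1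
  · exact smul_mem_of_mem_Zv B v_inv_mem_Zv (neg_mem' (B := B.toSubring) hq hq' hw _)

theorem y0_mem (B : Subalgebra Zv R) (hw : ∀ i, w i ∈ B) : y0 q w ∈ B :=
  (pos_mem (B := B.toSubring) (fun _ hx => smul_mem_of_mem_Zv B q_mem_Zv hx)
    (fun _ hx => smul_mem_of_mem_Zv B q_inv_mem_Zv hx) hw 0).2.1

theorem y1_mem (B : Subalgebra Zv R) (hw : ∀ i, w i ∈ B) : y1 q w ∈ B :=
  (pos_mem (B := B.toSubring) (fun _ hx => smul_mem_of_mem_Zv B q_mem_Zv hx)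
    (fun _ hx => smul_mem_of_mem_Zv B q_inv_mem_Zv hx) hw 0).2.2

theorem clusterVar_fin (w : Fin 4 → R) (i : Fin 4) : clusterVar w (i : ℕ) = v⁻¹ • w i := by
  fin_cases i
  · exact clusterVar_neg w 1
  · exact clusterVar_neg w 0
  · exact clusterVar_pos w 0
  · exact clusterVar_pos w 1

theorem eq_v_smul_clusterVar (w : Fin 4 → R) (i : Fin 4) : w i = v • clusterVar w (i : ℕ) := by
  rw [clusterVar_fin, smul_smul, mul_inv_cancel₀ v_ne_zero, one_smul]

theorem mon_mem (B : Subalgebra Zv R) (hw : ∀ i, w i ∈ B) (a : Fin 4 → ℕ) : mon w a ∈ B :=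
  mul_mem (mul_mem (mul_mem (pow_mem (hw 3) _) (pow_mem (hw 2) _)) (pow_mem (hw 1) _))
    (pow_mem (hw 0) _)

namespace Straightening

variable (h : Straightening q w)
include h

theorem gen_mem_integralSubalgebra (i : Fin 4) : w i ∈ h.integralSubalgebra := by
  have : mon w (Pi.single i 1) = w i := by
    fin_cases i <;> simp [mon]
  rw [← this]
  exact Submodule.subset_span ⟨_, rfl⟩

theorem integralSubalgebra_le (B : Subalgebra Zv R) (hw : ∀ i, w i ∈ B) :
    h.integralSubalgebra ≤ B := by
  have : Submodule.span Zv (Set.range (mon w)) ≤ Subalgebra.toSubmodule B := by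
    rw [Submodule.span_le]
    rintro _ ⟨a, rfl⟩
    exact mon_mem B hw a
  exact this

theorem integralSubalgebra_eq_adjoin : h.integralSubalgebra =
    Algebra.adjoin Zv {clusterVar w 0, clusterVar w 1, clusterVar w 2, clusterVar w 3} := by
  apply le_antisymm
  · refine h.integralSubalgebra_le _ fun i => ?_
    rw [eq_v_smul_clusterVar w i]
    refine smul_mem_of_mem_Zv _ v_mem_Zv (Algebra.subset_adjoin ?_)
    fin_cases i
    · exact Or.inl rfl
    · exact Or.inr (Or.inl rfl)
    · exact Or.inr (Or.inr (Or.inl rfl))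
    · exact Or.inr (Or.inr (Or.inr rfl))
  · refine Algebra.adjoin_le ?_
    rintro _ (rfl | rfl | rfl | rfl) <;> exact clusterVar_mem _ h.gen_mem_integralSubalgebra _

theorem integralSubalgebra_eq_adjoin_range : h.integralSubalgebra =
    Algebra.adjoin Zv (Set.range (clusterVar w)) := by
  apply le_antisymm
  · refine h.integralSubalgebra_le _ fun i => ?_
    rw [eq_v_smul_clusterVar w i]
    exact smul_mem_of_mem_Zv _ v_mem_Zv (Algebra.subset_adjoin ⟨_, rfl⟩)
  · refine Algebra.adjoin_le ?_
    rintro _ ⟨j, rfl⟩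
    exact clusterVar_mem _ h.gen_mem_integralSubalgebra _

variable (hli : LinearIndependent 𝕂 (mon w)) (htop : Submodule.span 𝕂 (Set.range (mon w)) = ⊤)
include hli htop

/-- Its coefficient would be 1, which is not in vℚ[v]. Consequently elements with a unitriangular
expansion, in particular the cluster variables, are nonzero. -/
theorem dualMon_notMem_dualLattice (a : Fin 4 → ℕ) : dualMon q w a ∉ dualLattice q w 1 a := by
  intro hmem
  have hq := pow_ne_zero (∑ i, (a i).choose 2) q_ne_zero
  obtain ⟨-, f, hf⟩ := coeff_of_mem_dualLattice hli htop hmem hq (b := a) (by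
    rw [dualMon, sub_self]; exact zero_mem _)
  rw [eq_comm, mul_eq_left₀ hq, ← map_one (algebraMap (Polynomial ℚ) 𝕂)] at hf
  have := congrArg (Polynomial.eval 0) (IsFractionRing.injective (Polynomial ℚ) 𝕂 hf)
  simp at this

theorem clusterVar_ne_zero (j : ℤ) : clusterVar w j ≠ 0 := by
  have key : ∀ {x : R} {a : Fin 4 → ℕ} {c : 𝕂}, c • x - dualMon q w a ∈ dualLattice q w 1 a →
      x ≠ 0 := by
    rintro x a c hx rfl
    rw [smul_zero, zero_sub, neg_mem_iff] at hx
    exact h.dualMon_notMem_dualLattice hli htop a hx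
  have hw : ∀ i, w i ≠ 0 := by
    intro i
    have : mon w (Pi.single i 1) = w i := by
      fin_cases i <;> simp [mon]
    rw [← this]
    exact hli.ne_zero _
  have hv := inv_ne_zero v_ne_zero
  rw [clusterVar]
  split_ifs
  · refine smul_ne_zero hv ?_
    rcases (j - 2).toNat with _ | n
    · exact hw 2
    · exact key (h.pos_sub_mem_dualLattice n)
  · refine smul_ne_zero hv ?_
    rcases (1 - j).toNat with _ | n
    · exact hw 1
    · exact key (h.neg_sub_mem_dualLattice n)

end Straightening

end IntegralForm

/-! ### The seeds of the theorem -/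

/-- For n ≥ 3 the absolute values resolve to p = n - 1 and r = 4 - n, and neighbouring cluster
variables have commutation exponent 2. -/
theorem seed_eq_clusterSeed {F : Type} [DivisionRing F] [Algebra 𝕂 F] (ι : Uplus →ₐ[𝕂] F)
    (X : ℤ → Uplus) {n : ℤ} (hn : 3 ≤ n) :
    seed ι X n = clusterSeed (fun j => ι (X j)) (ι Y₀) (ι Y₁) n := by
  have p0 := pSeq_of_nonneg (show 0 ≤ n by omega)
  have p1 := pSeq_of_nonneg (show 0 ≤ n + 1 by omega)
  have r0 := rSeq_of_le hn
  have r1 := rSeq_of_le (show 3 ≤ n + 1 by omega)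
  have l := lamSeq_of_le hn
  refine seed_ext (fun i => rfl) (fun i k => ?_) fun i k => ?_
  · change L n i k = (clusterSeed (fun j => ι (X j)) (ι Y₀) (ι Y₁) n).Λ i k
    rw [clusterSeed_Λ, p0, p1, r0, r1, l]
    fin_cases i <;> fin_cases k <;>
      simp only [L, Fin.zero_eta, Fin.mk_one, Fin.reduceFinMk, Matrix.of_apply, Matrix.cons_val] <;>
      ring
  · change -(exchangeMatrix n i k) = (!![0, -2; 2, 0; rSeq (n + 1), -rSeq n;
      -pSeq (n + 1), pSeq n] : Matrix (Fin 4) (Fin 2) ℤ) i k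
    rw [p0, p1, r0, r1]
    fin_cases i <;> fin_cases k <;>
      simp only [exchangeMatrix, Fin.zero_eta, Fin.mk_one, Fin.reduceFinMk, Matrix.of_apply,
        Matrix.cons_val] <;> ring

theorem y0_u_ne_zero : y0 q u ≠ 0 := by
  have := torusMon_linearIndependent.ne_zero (Pi.single 2 1)
  simpa [torusMon, Pi.single_apply] using this

theorem y1_u_ne_zero : y1 q u ≠ 0 := by
  have := torusMon_linearIndependent.ne_zero (Pi.single 3 1)
  simpa [torusMon, Pi.single_apply] using this

theorem clusterVar_u_ne_zero (j : ℤ) : clusterVar u j ≠ 0 :=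
  straightening_u.clusterVar_ne_zero uMon_linearIndependent span_uMon j

section Injective

variable {F : Type} [DivisionRing F] [Algebra 𝕂 F] {ι : Uplus →ₐ[𝕂] F} (hι : Function.Injective ι)
include hι

omit hι in
theorem map_Y₀ : ι Y₀ = y0 q (ι ∘ u) := by
  rw [Y₀_eq]; exact map_y0 ι q u

omit hι in
theorem map_Y₁ : ι Y₁ = y1 q (ι ∘ u) := by
  rw [Y₁_eq]; exact map_y1 ι q u

omit hι in
theorem map_clusterVar_u (j : ℤ) : ι (clusterVar u j) = clusterVar (ι ∘ u) j :=
  map_clusterVar ι u j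

omit hι in
theorem map_zz_u : ι (zz q u) = zz q (ι ∘ u) := map_zz ι q u

theorem clusterRelations_comp : ClusterRelations (clusterVar (ι ∘ u)) (y0 q (ι ∘ u))
    (y1 q (ι ∘ u)) := by
  refine (straightening_u.map ι).clusterRelations (fun j => ?_) ?_ ?_
  · rw [← map_clusterVar_u]
    exact (map_ne_zero_iff ι hι).2 (clusterVar_u_ne_zero j)
  · rw [← map_Y₀, Y₀_eq]; exact (map_ne_zero_iff ι hι).2 y0_u_ne_zero
  · rw [← map_Y₁, Y₁_eq]; exact (map_ne_zero_iff ι hι).2 y1_u_ne_zero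

theorem clusterRelations_u : ClusterRelations (fun j => ι (clusterVar u j)) (ι Y₀) (ι Y₁) := by
  rw [map_Y₀, map_Y₁, funext (map_clusterVar_u (ι := ι))]
  exact clusterRelations_comp hι

theorem mem_iff_mem_u (T : Subalgebra 𝕂 F) (ha : ι Y₀ ∈ T) (ha' : (ι Y₀)⁻¹ ∈ T)
    (hb : ι Y₁ ∈ T) (hb' : (ι Y₁)⁻¹ ∈ T) (j : ℤ) :
    (ι (clusterVar u (j - 1)) ∈ T → ι (clusterVar u j) ∈ T → (ι (clusterVar u j))⁻¹ ∈ T →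
      ι (clusterVar u (j + 1)) ∈ T → ι (zz q u) ∈ T) ∧
    (ι (zz q u) ∈ T → ι (clusterVar u j) ∈ T →
      (ι (clusterVar u (j - 1)) ∈ T ↔ ι (clusterVar u (j + 1)) ∈ T)) := by
  have h := clusterRelations_comp hι
  rw [map_Y₀] at ha ha'
  rw [map_Y₁] at hb hb'
  rw [map_clusterVar_u, map_clusterVar_u, map_clusterVar_u, map_zz_u]
  exact (straightening_u.map ι).mem_iff_mem_clusterVar h.x_ne h.a_ne h.b_ne T ha ha' hb hb' j

/-- The generators u_i are scalar multiples of X₀, …, X₃, so the cluster variables generate the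
whole algebra over 𝕂. -/
theorem exists_fraction (hF : ∀ f : F, ∃ a b : Uplus, b ≠ 0 ∧ f = ι a * (ι b)⁻¹) (f : F) :
    ∃ g ∈ Algebra.adjoin 𝕂 (Set.range fun j => ι (clusterVar u j)),
      ∃ g' ∈ Algebra.adjoin 𝕂 (Set.range fun j => ι (clusterVar u j)), g' ≠ 0 ∧ f = g * g'⁻¹ := by
  have htop : Algebra.adjoin 𝕂 (Set.range (clusterVar u)) = ⊤ := by
    rw [eq_top_iff, ← adjoin_range_u]
    refine Algebra.adjoin_le ?_
    rintro _ ⟨i, rfl⟩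
    rw [eq_v_smul_clusterVar u i]
    exact Subalgebra.smul_mem _ (Algebra.subset_adjoin (Set.mem_range_self _)) _
  have hmem : ∀ a, ι a ∈ Algebra.adjoin 𝕂 (Set.range fun j => ι (clusterVar u j)) := by
    intro a
    have : a ∈ Algebra.adjoin 𝕂 (Set.range (clusterVar u)) := htop ▸ Algebra.mem_top
    have : ι a ∈ (Algebra.adjoin 𝕂 (Set.range (clusterVar u))).map ι := ⟨a, this, rfl⟩
    rw [AlgHom.map_adjoin, ← Set.range_comp] at this
    exact this
  obtain ⟨a, b, hb, e⟩ := hF f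
  exact ⟨_, hmem a, _, hmem b, fun h0 => hb (hι (h0.trans (map_zero ι).symm)), e⟩

theorem isQuantumSeed_u (hF : ∀ f : F, ∃ a b : Uplus, b ≠ 0 ∧ f = ι a * (ι b)⁻¹) (j : ℤ) :
    (clusterSeed (fun j => ι (clusterVar u j)) (ι Y₀) (ι Y₁) j).IsQuantumSeed :=
  (clusterRelations_u hι).isQuantumSeed (mem_iff_mem_u hι) (exists_fraction hι hF) j

theorem exchange_relation {n : ℤ} (hn : 3 ≤ n) : ι (clusterVar u (n + 2)) =
    (seed ι (clusterVar u) n).frame ![-1, 2, 0, 0] +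
      (seed ι (clusterVar u) n).frame ![-1, 0, n - 3, n] := by
  have h := (clusterRelations_u hι).exchange_zero n
  rw [SeedData.exchange, ← seed_eq_clusterSeed ι _ hn] at h
  refine h.symm.trans ?_
  congr 2 <;> funext i <;> fin_cases i <;> simp [seed, exchangeMatrix] <;> omega

/-- The generators are the X_j, Y₀ and Y₁. All are integral polynomials in the u_i up to powers of
v, and conversely the X_j already generate the integral form. -/
theorem quantumClusterAlgebra_eq {n : ℤ} (hn : 3 ≤ n) :
    (seed ι (clusterVar u) n).quantumClusterAlgebra =
      straightening_u.integralSubalgebra.map (ι.restrictScalars Zv) := by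
  rw [SeedData.quantumClusterAlgebra, seed_eq_clusterSeed ι _ hn,
    (clusterRelations_u hι).setOf_reaches]
  apply le_antisymm
  · refine Algebra.adjoin_le ?_
    have hmem := straightening_u.gen_mem_integralSubalgebra
    rintro _ (⟨j, rfl⟩ | rfl | rfl)
    · exact ⟨_, clusterVar_mem _ hmem j, rfl⟩
    · exact ⟨Y₀, Y₀_eq ▸ y0_mem _ hmem, rfl⟩
    · exact ⟨Y₁, Y₁_eq ▸ y1_mem _ hmem, rfl⟩
  · rw [straightening_u.integralSubalgebra_eq_adjoin_range, AlgHom.map_adjoin, ← Set.range_comp]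
    exact Algebra.adjoin_mono Set.subset_union_left

theorem localizedQuantumClusterAlgebra_eq {n : ℤ} (hn : 3 ≤ n) :
    (seed ι (clusterVar u) n).localizedQuantumClusterAlgebra = Algebra.adjoin Zv
      ((straightening_u.integralSubalgebra.map (ι.restrictScalars Zv) : Set F) ∪
        {(ι Y₀)⁻¹, (ι Y₁)⁻¹}) := by
  have e : {y : F | ∃ i : Fin 2, y = ((seed ι (clusterVar u) n).x (Fin.natAdd 2 i))⁻¹} =
      {(ι Y₀)⁻¹, (ι Y₁)⁻¹} := by
    ext y
    constructor
    · rintro ⟨i, rfl⟩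
      fin_cases i
      · exact Or.inl rfl
      · exact Or.inr rfl
    · rintro (rfl | rfl)
      · exact ⟨0, rfl⟩
      · exact ⟨1, rfl⟩
  rw [SeedData.localizedQuantumClusterAlgebra, e, ← quantumClusterAlgebra_eq hι hn,
    SeedData.quantumClusterAlgebra, Algebra.adjoin_union, Algebra.adjoin_union, Algebra.adjoin_eq]

end Injective

end QuantumKronecker

end

theorem mainTheorem6 :
    -- the monomials `u[a]` form a basis, and their `ℤ[q^{±1/2}]`-span is an algebra `A`
    LinearIndependent 𝕂 uMon ∧ Submodule.span 𝕂 (Set.range uMon) = ⊤ ∧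
    ∃ A : Subalgebra Zv Uplus, Subalgebra.toSubmodule A = integralForm ∧
    -- the elements `X_n` are well defined
    ∃ X : ℤ → Uplus, (∀ (n : ℤ) (x : Uplus), IsX n x ↔ x = X n) ∧
    A = Algebra.adjoin Zv {X 0, X 1, X 2, X 3} ∧
    A = Algebra.adjoin Zv (Set.range X) ∧
    -- the skew field of fractions `F` of `U_q^+(w)`
    ∃ (F : Type) (_ : DivisionRing F) (_ : Algebra 𝕂 F) (ι : Uplus →ₐ[𝕂] F),
      Function.Injective ι ∧
      (∀ f : F, ∃ a b : Uplus, b ≠ 0 ∧ f = ι a * (ι b)⁻¹) ∧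
      ∀ n : ℤ, 3 ≤ n →
        (seed ι X n).IsQuantumSeed ∧
        -- the exchange relation
        ι (X (n + 2)) =
          (seed ι X n).frame ![-1, 2, 0, 0] + (seed ι X n).frame ![-1, 0, n - 3, n] ∧
        -- the mutation class of the seed
        (∀ S : SeedData F 2 2, (seed ι X n).Reaches S → S.IsQuantumSeed ∧
          ∃ j : ℤ, S.x = ![ι (X j), ι (X (j + 1)), ι Y₀, ι Y₁] ∨
            S.x = ![ι (X (j + 1)), ι (X j), ι Y₀, ι Y₁]) ∧
        (∀ j : ℤ, ∃ S : SeedData F 2 2, (seed ι X n).Reaches S ∧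
          (S.x = ![ι (X j), ι (X (j + 1)), ι Y₀, ι Y₁] ∨
            S.x = ![ι (X (j + 1)), ι (X j), ι Y₀, ι Y₁])) ∧
        (∀ (S : SeedData F 2 2) (j : ℤ), (seed ι X n).Reaches S →
          (S.x = ![ι (X j), ι (X (j + 1)), ι Y₀, ι Y₁] →
            S.exchange 0 = ι (X (j + 2)) ∧ S.exchange 1 = ι (X (j - 1))) ∧
          (S.x = ![ι (X (j + 1)), ι (X j), ι Y₀, ι Y₁] →
            S.exchange 1 = ι (X (j + 2)) ∧ S.exchange 0 = ι (X (j - 1)))) ∧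
        -- the quantum cluster algebra is `A`
        (seed ι X n).quantumClusterAlgebra = A.map (ι.restrictScalars Zv) ∧
        (seed ι X n).localizedQuantumClusterAlgebra =
          Algebra.adjoin Zv ((A.map (ι.restrictScalars Zv) : Set F) ∪
            {(ι Y₀)⁻¹, (ι Y₁)⁻¹}) := by
  refine ⟨uMon_linearIndependent, span_uMon, straightening_u.integralSubalgebra, rfl,
    clusterVar u, isX_iff, straightening_u.integralSubalgebra_eq_adjoin,
    straightening_u.integralSubalgebra_eq_adjoin_range, ?_⟩
  have := straightening_u.noZeroDivisors uMon_linearIndependent span_uMon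
  have : Nontrivial Uplus := ⟨_, _, clusterVar_u_ne_zero 0⟩
  obtain ⟨F, _, _, ι, hι, hF⟩ := exists_skewField (k := 𝕂) (R := Uplus)
    (straightening_u.left_ore uMon_linearIndependent span_uMon)
    (straightening_u.right_ore uMon_linearIndependent span_uMon)
  have h := clusterRelations_u hι
  have hseed := isQuantumSeed_u hι hF
  refine ⟨F, _, _, ι, hι, hF, fun n hn => ⟨?_, exchange_relation hι hn, ?_, ?_, ?_,
    quantumClusterAlgebra_eq hι hn, localizedQuantumClusterAlgebra_eq hι hn⟩⟩
  · rw [seed_eq_clusterSeed ι _ hn]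
    exact hseed n
  · intro S hS
    rw [seed_eq_clusterSeed ι _ hn] at hS
    obtain ⟨j, rfl | rfl⟩ := h.eq_of_reaches hS
    · exact ⟨hseed j, j, Or.inl rfl⟩
    · exact ⟨(hseed j).swap, j, Or.inr (ClusterRelations.clusterSeed_swap_x j)⟩
  · intro j
    obtain ⟨S, hS, hSj⟩ := h.exists_reaches n j
    rw [← seed_eq_clusterSeed ι _ hn] at hS
    refine ⟨S, hS, ?_⟩
    obtain rfl | rfl := hSj
    · exact Or.inl rfl
    · exact Or.inr (ClusterRelations.clusterSeed_swap_x j)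
  · intro S j hS
    rw [seed_eq_clusterSeed ι _ hn] at hS
    exact h.exchange_of_reaches hS j
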